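/- **Setting.** Let $V$ be a simple (irreducible) finite-dimensional Euclidean Jordan algebra with unit $e$, multiplication operators $L(x)y=xy$, and symmetric cone $W=\operatorname{int}\{x^2 : x\in V\}$. Let $G=\mathrm{Aut}_0(W)\subseteq GL(V)$ be the identity component of the automorphism group of $W$, $\mathfrak g$ its Lie algebra, $\mathfrak g^1=[\mathfrak g,\mathfrak g]$, and $G^1$ the analytic subgroup of $G$ with Lie algebra $\mathfrak g^1$. Let $c_1,\dots,c_l$ be a Jordan frame of $V$, $\mathfrak a=\bigoplus_j\mathbb R L(c_j)$, $\Sigma$ the set of restricted roots of $(\mathfrak g,\mathfrak a)$, $$\Omega=\{X\in\mathfrak a : |\alpha(X)|<\tfrac{\pi}{2}\ \text{for all }\alpha\in\Sigma\},\qquad \Omega^1=\Omega\cap\mathfrak g^1 .$$ Let $V_{\mathbb C}=V\oplus iV$ be the complexified Jordan algebra, $z\mapsto\bar z$ the conjugation with respect to $V$, $\det$ the Jordan algebra determinant of $V_{\mathbb C}$, and $P(z,w)=L(z)L(w)+L(w)L(z)-L(zw)$. Realising $G_{\mathbb C}/K_{\mathbb C}$ in $V_{\mathbb C}$ through the orbit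 map $gK_{\mathbb C}\mapsto g(e)$, the commutator square root domain is $$\Xi^{1,1/2}=G^1\exp\!\big(\tfrac i2\Omega^1\big)(e)\subseteq V_{\mathbb C}.$$ For $Z\in V_{\mathbb C}$ put $(\delta_Zf)(z)=\frac{d}{dt}\big|_{t=0}f(z+tZ)$, $\partial_Z=\frac12(\delta_Z-i\delta_{iZ})$ and $\bar\partial_Z=\frac12(\delta_Z+i\delta_{iZ})$. **Theorem.** The set $\Xi^{1,1/2}$ is a relatively open subset of $\{z\in V_{\mathbb C} : \det z=1\}$, and the complex differential of $\det$ vanishes at no point of $\Xi^{1,1/2}$; so $\Xi^{1,1/2}$ is a complex submanifold of $V_{\mathbb C}$ of codimension one with $T_z\Xi^{1,1/2}=\ker d(\det)_z$. For $z\in\Xi^{1,1/2}$ the determinant of the complex linear operator $P(z,\bar z)$ is a positive real number. The function $\varphi^1:\Xi^{1,1/2}\to\mathbb R$, $\varphi^1(z)=\log\det P(z,\bar z)^{-1}$, is smooth and strictly plurisubharmonic. The forms $$h_z(Z_1,Z_2)=(\partial_{Z_1}\bar\partial_{Z_2}\varphi^1)(z)\qquad(z\in\Xi^{1,1/2},\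 Z_1,Z_2\in T_z\Xi^{1,1/2})$$ (computed with the extension of $\varphi^1$ to a neighbourhood in $V_{\mathbb C}$ given by the same formula; on tangent vectors the result does not depend on the extension) define a positive Kähler structure on $\Xi^{1,1/2}$: each $h_z$ is a positive definite Hermitian form on $T_z\Xi^{1,1/2}$, and the fundamental two-form $\operatorname{Im}h$ is smooth and closed. The group $G^1$ maps $\Xi^{1,1/2}$ to itself, and $h$ is $G^1$-invariant: $h_{gz}(gZ_1,gZ_2)=h_z(Z_1,Z_2)$ for $g\in G^1$. The Riemannian metric $\operatorname{Re}h$ on $\Xi^{1,1/2}$ is complete. -/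

import Mathlib

open Set Filter Topology
open scoped ENNReal ContDiff

set_option linter.unusedSectionVars false

noncomputable section

/-! ### Euclidean Jordan algebras -/

/-- A Euclidean Jordan algebra: a real inner product space with a bilinear commutative product with
unit satisfying the Jordan identity `(x * y) * x² = x * (y * x²)` (this is `IsCommJordan`), whose
inner product is associative. (Finite dimension is assumed separately.) -/
class EuclideanJordanAlgebra (V : Type*) [NormedAddCommGroup V] [InnerProductSpace ℝ V]
    extends CommMagma V, One V, IsCommJordan V where
  one_mul' : ∀ x : V, 1 * x = x
  mul_add' : ∀ x y z : V, x * (y + z) = x * y + x * z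
  mul_smul' : ∀ (a : ℝ) (x y : V), x * (a • y) = a • (x * y)
  inner_mul_left' : ∀ x u v : V, inner ℝ (x * u) v = inner ℝ u (x * v)

section RealAlgebra

/-- A Jordan algebra is simple if it is nonzero and its only ideals are `0` and the whole algebra.
(Simple Euclidean Jordan algebras are also called irreducible.) -/
def IsSimpleJordan (V : Type*) [NormedAddCommGroup V] [InnerProductSpace ℝ V]
    [EuclideanJordanAlgebra V] : Prop :=
  Nontrivial V ∧ ∀ I : Submodule ℝ V, (∀ x y : V, y ∈ I → x * y ∈ I) → I = ⊥ ∨ I = ⊤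

variable {V : Type*} [NormedAddCommGroup V] [InnerProductSpace ℝ V] [EuclideanJordanAlgebra V]

/-- A primitive idempotent: a nonzero idempotent that is not the sum of two nonzero (necessarily
orthogonal) idempotents. -/
def IsPrimitiveIdempotent (c : V) : Prop :=
  c * c = c ∧ c ≠ 0 ∧ ∀ a b : V, a * a = a → b * b = b → a + b = c → a = 0 ∨ b = 0

/-- A Jordan frame: a complete system of mutually orthogonal primitive idempotents. -/
def IsJordanFrame {l : ℕ} (c : Fin l → V) : Prop :=
  (∀ i, IsPrimitiveIdempotent (c i)) ∧ (∀ i j, i ≠ j → c i * c j = 0) ∧ ∑ i, c i = 1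

variable (V) in
/-- The symmetric cone `W`, the interior of the set of squares. -/
def symmetricCone : Set V := interior (range fun x : V => x * x)

variable (V) in
/-- The automorphism group `Aut(W) = {g ∈ GL(V) : g W = W}` of the symmetric cone. -/
def coneAut : Subgroup (V →L[ℝ] V)ˣ where
  carrier := {g | ∀ x : V, (g : V →L[ℝ] V) x ∈ symmetricCone V ↔ x ∈ symmetricCone V}
  one_mem' := fun x => by simp
  mul_mem' := fun {a b} ha hb x => by
    have : ((a * b : (V →L[ℝ] V)ˣ) : V →L[ℝ] V) x = (a : V →L[ℝ] V) ((b : V →L[ℝ] V) x) := by simp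
    rw [this, ha, hb]
  inv_mem' := fun {a} ha x => by
    have : (a : V →L[ℝ] V) (((a⁻¹ : (V →L[ℝ] V)ˣ) : V →L[ℝ] V) x) = x := by
      exact congrArg (fun T : V →L[ℝ] V => T x) a.mul_inv
    rw [← ha, this]

variable (V) in
/-- `G`, the identity component of `Aut(W)`. -/
def groupG : Subgroup (V →L[ℝ] V)ˣ :=
  (Subgroup.connectedComponentOfOne (coneAut V)).map (coneAut V).subtype

variable (V) in
/-- The Lie algebra `𝔤` of the closed linear group `G`: all `X` with `exp(tX) ∈ G` for all real
`t`. -/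
def lieG : Set (V →L[ℝ] V) :=
  {X | ∀ t : ℝ, ∃ g ∈ groupG V, (g : V →L[ℝ] V) = NormedSpace.exp (t • X)}

variable (V) in
/-- The commutator algebra `𝔤¹ = [𝔤, 𝔤]`, the span of all brackets `[X, Y] = XY - YX`. -/
def lieG1 : Submodule ℝ (V →L[ℝ] V) :=
  Submodule.span ℝ {Z | ∃ X ∈ lieG V, ∃ Y ∈ lieG V, Z = X * Y - Y * X}

variable (V) in
/-- `G¹`, the analytic subgroup of `G` with Lie algebra `𝔤¹`, i.e. the subgroup generated by
`exp(𝔤¹)`. -/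
def groupG1 : Subgroup (V →L[ℝ] V)ˣ :=
  Subgroup.closure {g | ∃ X ∈ lieG1 V, (g : V →L[ℝ] V) = NormedSpace.exp X}

variable [FiniteDimensional ℝ V]

/-- The multiplication operator `L(x) y = x * y`. -/
def jordanL (x : V) : V →L[ℝ] V :=
  LinearMap.toContinuousLinearMap
    { toFun := fun y => x * y
      map_add' := EuclideanJordanAlgebra.mul_add' x
      map_smul' := fun a y => EuclideanJordanAlgebra.mul_smul' a x y }

variable {l : ℕ} (c : Fin l → V)

/-- The maximal abelian subspace `𝔞 = ⨁ ℝ L(c_j)` attached to a Jordan frame. -/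
def cartanA : Submodule ℝ (V →L[ℝ] V) := Submodule.span ℝ (range fun j => jordanL (c j))

/-- The restricted roots `Σ(𝔤, 𝔞)`: the nonzero linear forms `α` on `𝔞` whose root space
`{Y ∈ 𝔤 : [H, Y] = α(H) Y for all H ∈ 𝔞}` is nonzero. -/
def IsRestrictedRoot (α : cartanA c →ₗ[ℝ] ℝ) : Prop :=
  α ≠ 0 ∧ ∃ Y ∈ lieG V, Y ≠ 0 ∧
    ∀ H : cartanA c, (H : V →L[ℝ] V) * Y - Y * (H : V →L[ℝ] V) = α H • Y

/-- `Ω = {X ∈ 𝔞 : |α(X)| < π/2 for every restricted root α}`. -/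
def crownOmega : Set (V →L[ℝ] V) :=
  {X | ∃ hX : X ∈ cartanA c, ∀ α : cartanA c →ₗ[ℝ] ℝ, IsRestrictedRoot c α →
    |α ⟨X, hX⟩| < Real.pi / 2}

/-- `Ω¹ = Ω ∩ 𝔤¹`. -/
def crownOmega1 : Set (V →L[ℝ] V) := crownOmega c ∩ (lieG1 V : Set (V →L[ℝ] V))

end RealAlgebra

/-! ### The complexification `V_ℂ = V ⊕ iV` -/

/-- The complexification `V_ℂ = V ⊕ iV` of a real inner product space; the pair `(x, y)` is `x + iy`
and the norm is `‖x + iy‖² = ‖x‖² + ‖y‖²`. -/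
def Cplx (V : Type*) : Type _ := WithLp 2 (V × V)

namespace Cplx

section Linear

variable {V : Type*} [NormedAddCommGroup V] [InnerProductSpace ℝ V]

instance : NormedAddCommGroup (Cplx V) := inferInstanceAs (NormedAddCommGroup (WithLp 2 (V × V)))

/-- The element `x + iy`. -/
def mk (x y : V) : Cplx V := WithLp.toLp 2 (x, y)

/-- The real part of `x + iy`. -/
def re (z : Cplx V) : V := WithLp.fst z

/-- The imaginary part of `x + iy`. -/
def im (z : Cplx V) : V := WithLp.snd z

@[simp] theorem re_mk (x y : V) : (mk x y).re = x := rfl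
@[simp] theorem im_mk (x y : V) : (mk x y).im = y := rfl
@[simp] theorem re_add (z w : Cplx V) : (z + w).re = z.re + w.re := rfl
@[simp] theorem im_add (z w : Cplx V) : (z + w).im = z.im + w.im := rfl

@[ext] theorem ext {z w : Cplx V} (h₁ : z.re = w.re) (h₂ : z.im = w.im) : z = w :=
  WithLp.ofLp_injective 2 (Prod.ext h₁ h₂)

/-- Complex scalars act by `(a + ib)(x + iy) = (ax - by) + i(ay + bx)`. -/
instance : SMul ℂ (Cplx V) :=
  ⟨fun a z => mk (a.re • z.re - a.im • z.im) (a.re • z.im + a.im • z.re)⟩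

@[simp] theorem re_smul (a : ℂ) (z : Cplx V) : (a • z).re = a.re • z.re - a.im • z.im := rfl
@[simp] theorem im_smul (a : ℂ) (z : Cplx V) : (a • z).im = a.re • z.im + a.im • z.re := rfl

instance : Module ℂ (Cplx V) where
  one_smul z := by ext <;> simp
  mul_smul a b z := by
    ext <;> simp [sub_smul, add_smul, mul_smul, smul_sub, smul_add] <;> abel
  smul_zero a := by
    have h1 : (0 : Cplx V).re = 0 := rfl
    have h2 : (0 : Cplx V).im = 0 := rfl
    ext <;> simp [h1, h2]
  smul_add a z w := by ext <;> simp <;> abel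
  add_smul a b z := by ext <;> simp [add_smul] <;> abel
  zero_smul z := by
    have h1 : (0 : Cplx V).re = 0 := rfl
    have h2 : (0 : Cplx V).im = 0 := rfl
    ext <;> simp [h1, h2]

theorem norm_sq (z : Cplx V) : ‖z‖ ^ 2 = ‖z.re‖ ^ 2 + ‖z.im‖ ^ 2 :=
  WithLp.prod_norm_sq_eq_of_L2 (α := V) (β := V) z

instance : NormedSpace ℂ (Cplx V) where
  norm_smul_le a z := by
    refine le_of_eq ?_
    have h : ‖a • z‖ ^ 2 = (‖a‖ * ‖z‖) ^ 2 := by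
      rw [mul_pow, norm_sq, norm_sq, re_smul, im_smul, norm_sub_sq_real, norm_add_sq_real,
        ← Complex.normSq_eq_norm_sq, Complex.normSq_apply]
      simp only [norm_smul, inner_smul_left, inner_smul_right, mul_pow, Real.norm_eq_abs, sq_abs,
        RCLike.conj_to_real, real_inner_comm z.re z.im]
      ring
    exact (sq_eq_sq₀ (norm_nonneg _) (by positivity)).1 h

/-- The inclusion `V → V_ℂ`. -/
def ofReal (x : V) : Cplx V := mk x 0

/-- Complex conjugation `x + iy ↦ x - iy` with respect to `V`. -/
def conj (z : Cplx V) : Cplx V := mk z.re (-z.im)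

/-- The complex linear extension `x + iy ↦ T x + i T y` of a real operator. -/
def extend (T : V →L[ℝ] V) : Cplx V →L[ℂ] Cplx V where
  toFun z := mk (T z.re) (T z.im)
  map_add' z w := by ext <;> simp
  map_smul' a z := by ext <;> simp
  cont := by
    have h1 : Continuous fun z : Cplx V => z.re :=
      continuous_fst.comp (WithLp.prod_continuous_ofLp 2 V V)
    have h2 : Continuous fun z : Cplx V => z.im :=
      continuous_snd.comp (WithLp.prod_continuous_ofLp 2 V V)
    exact (WithLp.prod_continuous_toLp 2 V V).comp
      ((T.continuous.comp h1).prodMk (T.continuous.comp h2))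

end Linear

section Jordan

variable {V : Type*} [NormedAddCommGroup V] [InnerProductSpace ℝ V] [EuclideanJordanAlgebra V]

/-- The complex bilinear extension of the Jordan product. -/
instance : Mul (Cplx V) :=
  ⟨fun z w => mk (z.re * w.re - z.im * w.im) (z.re * w.im + z.im * w.re)⟩

/-- The unit `e` of `V`, which is the unit of `V_ℂ`. -/
instance : One (Cplx V) := ⟨ofReal 1⟩

@[simp] theorem re_mul (z w : Cplx V) : (z * w).re = z.re * w.re - z.im * w.im := rfl
@[simp] theorem im_mul (z w : Cplx V) : (z * w).im = z.re * w.im + z.im * w.re := rfl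

theorem mul_sub_real (x y z : V) : x * (y - z) = x * y - x * z := by
  have h := EuclideanJordanAlgebra.mul_add' x y ((-1 : ℝ) • z)
  rw [EuclideanJordanAlgebra.mul_smul'] at h
  simpa [sub_eq_add_neg] using h

/-- The multiplication operator `L(z) w = z * w` on `V_ℂ`. -/
def L (z : Cplx V) : Cplx V →ₗ[ℂ] Cplx V where
  toFun w := z * w
  map_add' u v := by ext <;> simp [EuclideanJordanAlgebra.mul_add'] <;> abel
  map_smul' a u := by
    ext <;> simp [EuclideanJordanAlgebra.mul_add', mul_sub_real, EuclideanJordanAlgebra.mul_smul',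
      smul_sub, smul_add] <;> abel

/-- The polarized quadratic representation `P(z, w) = L(z)L(w) + L(w)L(z) - L(zw)`. -/
def P (z w : Cplx V) : Cplx V →ₗ[ℂ] Cplx V := L z ∘ₗ L w + L w ∘ₗ L z - L (z * w)

/-- Jordan powers `z⁰ = e`, `zᵏ⁺¹ = z * zᵏ`. -/
def jpow (z : Cplx V) : ℕ → Cplx V
  | 0 => 1
  | k + 1 => z * jpow z k

/-- The value `p(z) = ∑ aₖ zᵏ` of a polynomial at `z ∈ V_ℂ`. -/
def jeval (p : Polynomial ℂ) (z : Cplx V) : Cplx V :=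
  ∑ k ∈ Finset.range (p.natDegree + 1), p.coeff k • jpow z k

/-- The degree of the minimal polynomial of `z`, i.e. the dimension of `ℂ[z] = span {e, z, z², …}`. -/
def degree (z : Cplx V) : ℕ := Module.finrank ℂ (Submodule.span ℂ (range (jpow z)))

/-- `z` is regular if the degree of its minimal polynomial is maximal (equal to the rank). -/
def IsRegular (z : Cplx V) : Prop := ∀ w : Cplx V, degree w ≤ degree z

/-- `Δ` is the determinant of the Jordan algebra `V_ℂ`: the polynomial function whose value at a
regular element `z` with minimal polynomial `λʳ - a₁ λʳ⁻¹ + ⋯ + (-1)ʳ aᵣ` is `aᵣ`. Regular elements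
are dense, so there is at most one such function. -/
def IsJordanDet (Δ : Cplx V → ℂ) : Prop :=
  (∃ (n : ℕ) (f : Fin n → Cplx V →ₗ[ℂ] ℂ) (p : MvPolynomial (Fin n) ℂ),
      ∀ z, Δ z = MvPolynomial.eval (fun i => f i z) p) ∧
    ∀ z, IsRegular z → ∀ p : Polynomial ℂ, p.Monic → p.natDegree = degree z → jeval p z = 0 →
      Δ z = (-1) ^ p.natDegree * p.coeff 0

/-- The potential `φ(z) = log (det P(z, z̄))⁻¹`, where `det` is the determinant of a complex linear
operator. (For every `z`, `P(z, z̄) = P(x) + P(y)` is the extension of a real operator, so this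
determinant is real.) -/
def potential (z : Cplx V) : ℝ := Real.log ((LinearMap.det (P z (conj z))).re)⁻¹

variable [FiniteDimensional ℝ V]

/-- The commutator square root domain `G¹ exp(i ½ Ω¹) K_ℂ / K_ℂ`, realised in `V_ℂ` through the
orbit map `g K_ℂ ↦ g(e)`; elements of `G¹ ⊆ GL(V)` act on `V_ℂ` by complex linear extension. -/
def Xi {l : ℕ} (c : Fin l → V) : Set (Cplx V) :=
  {z | ∃ g ∈ groupG1 V, ∃ X ∈ crownOmega1 c,
    z = extend (g : V →L[ℝ] V) (NormedSpace.exp ((Complex.I / 2) • extend X) 1)}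

end Jordan

end Cplx

/-! ### Levi form, Kähler structures, completeness -/

section Complex

variable {E : Type*} [NormedAddCommGroup E] [NormedSpace ℂ E]

/-- `δ_Z f (z) = d/dt f(z + tZ)` at `t = 0` (`t` real). -/
def dirDeriv (Z : E) (f : E → ℂ) (z : E) : ℂ := deriv (fun t : ℝ => f (z + (t : ℂ) • Z)) 0

/-- `∂_Z = ½(δ_Z - i δ_{iZ})`. -/
def delZ (Z : E) (f : E → ℂ) (z : E) : ℂ :=
  (1 / 2 : ℂ) * (dirDeriv Z f z - Complex.I * dirDeriv (Complex.I • Z) f z)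

/-- `∂̄_Z = ½(δ_Z + i δ_{iZ})`. -/
def delbarZ (Z : E) (f : E → ℂ) (z : E) : ℂ :=
  (1 / 2 : ℂ) * (dirDeriv Z f z + Complex.I * dirDeriv (Complex.I • Z) f z)

/-- The form `(Z₁, Z₂) ↦ (∂_{Z₁} ∂̄_{Z₂} f)(z)`. If `f` is defined near a complex submanifold, then
the values of this form on tangent vectors of the submanifold depend only on the restriction of `f`
to it. -/
def leviForm (f : E → ℝ) (z Z₁ Z₂ : E) : ℂ := delZ Z₁ (delbarZ Z₂ fun w => (f w : ℂ)) z

/-- The holomorphic tangent space at `z` of a level set of `Δ`: the kernel of the complex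
differential of `Δ`. -/
def levelTangent (Δ : E → ℂ) (z : E) : Submodule ℂ E := LinearMap.ker (fderiv ℂ Δ z : E →ₗ[ℂ] ℂ)

/-- `S` is a complex submanifold of codimension one which is a relatively open subset of the level
set `{Δ = 1}`, at whose points `Δ` is holomorphic with nonvanishing differential. -/
def IsOpenInHypersurface (S : Set E) (Δ : E → ℂ) : Prop :=
  Differentiable ℂ Δ ∧ (∃ O : Set E, IsOpen O ∧ S = O ∩ {z | Δ z = 1}) ∧
    ∀ z ∈ S, fderiv ℂ Δ z ≠ 0

/-- The function `f`, defined near the complex submanifold `S` with tangent spaces `T`, restricts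
to a (smooth) strictly plurisubharmonic function on `S`: its Levi form is positive definite on
each tangent space. -/
def IsStrictlyPlurisubharmonicOn (S : Set E) (T : E → Submodule ℂ E) (f : E → ℝ) : Prop :=
  (∃ O : Set E, IsOpen O ∧ S ⊆ O ∧ ContDiffOn ℝ ∞ f O) ∧
    ∀ z ∈ S, ∀ Z ∈ T z, Z ≠ 0 → (leviForm f z Z Z).im = 0 ∧ 0 < (leviForm f z Z Z).re

/-- `h` is a positive Kähler structure on the complex submanifold `S` with tangent spaces `T`: each
`h z` is a positive definite Hermitian form on `T z`, and the fundamental form `Im h` is a smooth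
closed two-form on `S`. A form on an embedded submanifold is smooth and closed exactly if it is the
restriction to the tangent spaces of a smooth closed form `η` on an open neighbourhood of `S`.
(`Re h (u, v) = Im h (iu, v)`, so that all of `h` is smooth then.) -/
structure IsKahlerStructure (S : Set E) (T : E → Submodule ℂ E) (h : E → E → E → ℂ) : Prop where
  add_left : ∀ z ∈ S, ∀ u ∈ T z, ∀ v ∈ T z, ∀ w ∈ T z, h z (u + v) w = h z u w + h z v w
  smul_left : ∀ z ∈ S, ∀ a : ℂ, ∀ u ∈ T z, ∀ w ∈ T z, h z (a • u) w = a * h z u w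
  hermitian : ∀ z ∈ S, ∀ u ∈ T z, ∀ v ∈ T z, h z v u = (starRingEnd ℂ) (h z u v)
  pos : ∀ z ∈ S, ∀ u ∈ T z, u ≠ 0 → 0 < (h z u u).re
  closed : ∃ (O : Set E) (η : E → E [⋀^Fin 2]→L[ℝ] ℝ), IsOpen O ∧ S ⊆ O ∧ ContDiffOn ℝ ∞ η O ∧
    (∀ z ∈ O, extDeriv η z = 0) ∧
    ∀ z ∈ S, ∀ u ∈ T z, ∀ v ∈ T z, η z ![u, v] = (h z u v).im

/-- The length `∫₀¹ √(g(γ', γ')) dt` of a curve for the Riemannian metric `g = Re h`. -/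
def curveLength (h : E → E → E → ℂ) (γ : ℝ → E) : ℝ≥0∞ :=
  ∫⁻ t in Icc (0 : ℝ) 1, ENNReal.ofReal (Real.sqrt (h (γ t) (deriv γ t) (deriv γ t)).re)

/-- The Riemannian distance on `S` for `g = Re h`: the infimum of the lengths of the `C¹` curves in
`S` from `p` to `q`. -/
def riemannDist (S : Set E) (h : E → E → E → ℂ) (p q : E) : ℝ≥0∞ :=
  sInf {ℓ | ∃ γ : ℝ → E, ContDiffOn ℝ 1 γ (Icc 0 1) ∧ (∀ t ∈ Icc (0 : ℝ) 1, γ t ∈ S) ∧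
    γ 0 = p ∧ γ 1 = q ∧ ℓ = curveLength h γ}

/-- The Riemannian metric `g = Re h` on `S` is complete: every Cauchy sequence for the Riemannian
distance converges in `S`. -/
def IsCompleteRiemannian (S : Set E) (h : E → E → E → ℂ) : Prop :=
  ∀ x : ℕ → E, (∀ n, x n ∈ S) →
    (∀ ε : ℝ≥0∞, 0 < ε → ∃ N, ∀ m ≥ N, ∀ n ≥ N, riemannDist S h (x m) (x n) < ε) →
    ∃ y ∈ S, Tendsto (fun n => riemannDist S h (x n) y) atTop (𝓝 0)

end Complex

end

set_option maxSynthPendingDepth 3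

noncomputable section

/-! ### Jordan identities -/

section Identities

variable {V : Type*} [NormedAddCommGroup V] [InnerProductSpace ℝ V] [EuclideanJordanAlgebra V]

/-! The proof reduces everything to a diagonal torus. The automorphism Lie algebra of the cone is
L(V) + Der(V) (`IsJordanFrame.mem_lieG_iff`). On 𝔞 the forms (x_j - x_k)/2 with j ≠ k are roots, and
every root vector has one of these values, so Ω¹ is the set of L(∑ x_j c_j) with |x_j - x_k| < π and
∑ x_j = 0 (`IsJordanFrame.mem_crownOmega1_iff`). Hence the domain consists of the points g·∑
exp(iθ_j) c_j with g in G¹, |θ_j - θ_k| < π/2 and ∑ θ_j = 0 (`Cplx.mem_Xi_iff`).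

P(z, z̄) is the complexification of the real operator P(x,x) + P(y,y), z = x + iy. It transforms by
T ↦ g T g* under G¹, and det g = 1, so the potential is G¹-invariant; at a torus point it acts on
the Peirce space V_jk as cos(θ_j - θ_k). The Jordan determinant is constructed as a polynomial from
power sums by Newton's identities. It is G¹-invariant because det P(x)^l = det(x)^{2n}, n = dim V,
determines it on the cone, where it is positive. Pointwise statements then only need proof on the
torus.

Openness: a point of the tube over the cone can be moved by G¹ and a positive scalar to ∑ exp(i
arctan t_j) c_j. Positivity of P(z, z̄) bounds the differences of angles by π/2, and an open
condition that follows the argument of det along the segment from Re z to z singles out the branch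
with angle sum zero (`Cplx.mem_Xi_of_mem_tubeNhd`). Euler's identity dΔ_z(z) = lΔ(z) shows that the
differential does not vanish.

Positivity: with S = P(z, z̄)⁻¹, the Levi form is tr((SA)²) + tr((SA')²) - tr(S P(Z, Z̄)), where 2A
and 2A' are the derivatives of P(z, z̄) along Z and iZ. The symmetries 1 - 8L(c_i) + 8L(c_i)² change
signs of Peirce components, so the form splits into diagonal and off-diagonal blocks. Off-diagonal
blocks are bounded below by `Cplx.leviForm_offdiag_ge`; the diagonal block is the sum of squares in
`Cplx.leviForm_diagVec`, whose kernel on diagonal vectors consists of constant coefficient families,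
not tangent unless zero. Closedness holds because Im h is the exterior derivative of ¼ dφ(i·).

Completeness: |dφ|² ≤ 4n Re h on tangent vectors, so φ stays bounded along a Cauchy sequence. Modulo
G¹ its sublevel sets are compact (`Cplx.isCompact_torusPt_potential_le`). As G¹ acts by isometries,
one translation brings the tail of the sequence into a compact subset, where the Riemannian and
Euclidean distances are locally comparable. -/

instance EuclideanJordanAlgebra.toRing : NonUnitalNonAssocCommRing V :=
  { (inferInstance : AddCommGroup V) with
    mul := fun x y => x * y
    left_distrib := fun x y z => EuclideanJordanAlgebra.mul_add' x y z
    right_distrib := fun x y z => by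
      rw [mul_comm, EuclideanJordanAlgebra.mul_add', mul_comm z x, mul_comm z y]
    zero_mul := fun x => by
      have h := EuclideanJordanAlgebra.mul_smul' (0 : ℝ) x x
      rw [mul_comm]
      simpa using h
    mul_zero := fun x => by
      have h := EuclideanJordanAlgebra.mul_smul' (0 : ℝ) x x
      simpa using h
    mul_comm := fun x y => mul_comm x y }

instance EuclideanJordanAlgebra.smulComm : SMulCommClass ℝ V V :=
  ⟨fun a x y => (EuclideanJordanAlgebra.mul_smul' a x y).symm⟩

instance EuclideanJordanAlgebra.scalarTower : IsScalarTower ℝ V V :=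
  ⟨fun a x y => by
    change (a • x) * y = a • (x * y)
    rw [mul_comm, EuclideanJordanAlgebra.mul_smul', mul_comm y x]⟩

theorem jone_mul (x : V) : 1 * x = x := EuclideanJordanAlgebra.one_mul' x
theorem jmul_one (x : V) : x * 1 = x := by rw [mul_comm, jone_mul]

theorem inner_jmul_left (x u v : V) : inner ℝ (x * u) v = inner ℝ u (x * v) :=
  EuclideanJordanAlgebra.inner_mul_left' x u v

/-- The fully linearized Jordan identity. -/
theorem jordan_linearized (a b c d : V) :
    a * ((b * c) * d) - (b * c) * (a * d) + (b * ((c * a) * d) - (c * a) * (b * d)) +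
      (c * ((a * b) * d) - (a * b) * (c * d)) = 0 := by
  have h := two_nsmul_lie_lmul_lmul_add_add_eq_zero a b c
  have h3 : (2 : ℝ) • (a * ((b * c) * d) - (b * c) * (a * d) +
      (b * ((c * a) * d) - (c * a) * (b * d)) +
      (c * ((a * b) * d) - (a * b) * (c * d))) = 0 := by
    rw [two_smul, ← two_nsmul]; exact DFunLike.congr_fun h d
  exact (smul_eq_zero.1 h3).resolve_left two_ne_zero

variable [FiniteDimensional ℝ V]

theorem clm_add (f g : V →L[ℝ] V) (x : V) : (f + g) x = f x + g x := rfl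
theorem clm_sub (f g : V →L[ℝ] V) (x : V) : (f - g) x = f x - g x := rfl
theorem clm_mul (f g : V →L[ℝ] V) (x : V) : (f * g) x = f (g x) := rfl
theorem clm_smul (a : ℝ) (f : V →L[ℝ] V) (x : V) : (a • f) x = a • f x := rfl
theorem clm_neg (f : V →L[ℝ] V) (x : V) : (-f) x = -f x := rfl
theorem clm_one (x : V) : (1 : V →L[ℝ] V) x = x := rfl

@[simp] theorem jordanL_apply (x y : V) : jordanL x y = x * y := rfl

theorem jordanL_add (x y : V) : jordanL (x + y) = jordanL x + jordanL y := by
  ext z; simp [add_mul]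
theorem jordanL_sub (x y : V) : jordanL (x - y) = jordanL x - jordanL y := by
  ext z; simp [sub_mul]
theorem jordanL_neg (x : V) : jordanL (-x) = -jordanL x := by
  ext z; simp
theorem jordanL_smul (a : ℝ) (x : V) : jordanL (a • x) = a • jordanL x := by
  ext z; simp [smul_mul_assoc]
@[simp] theorem jordanL_zero : jordanL (0 : V) = 0 := by
  ext z; simp
theorem jordanL_one : jordanL (1 : V) = 1 := by
  ext z; simp [jone_mul]

/-- `L` as a linear map. -/
def jordanLm : V →ₗ[ℝ] (V →L[ℝ] V) where
  toFun := jordanL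
  map_add' := jordanL_add
  map_smul' := jordanL_smul

@[simp] theorem jordanLm_apply (x : V) : jordanLm x = jordanL x := rfl

theorem jordanL_sum {ι : Type*} (s : Finset ι) (f : ι → V) :
    jordanL (∑ i ∈ s, f i) = ∑ i ∈ s, jordanL (f i) := map_sum jordanLm f s

theorem continuous_jordanL : Continuous (jordanL : V → V →L[ℝ] V) :=
  (jordanLm (V := V)).continuous_of_finiteDimensional

theorem jordanL_comm_cyclic (a b c : V) :
    (jordanL a * jordanL (b * c) - jordanL (b * c) * jordanL a) +
    (jordanL b * jordanL (c * a) - jordanL (c * a) * jordanL b) +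
    (jordanL c * jordanL (a * b) - jordanL (a * b) * jordanL c) = 0 := by
  ext d; simpa using jordan_linearized a b c d

/-- The linearized Jordan identity is read as an identity of operators applied to its second
variable `b`. It turns the multiplication by a triple product into a polynomial in multiplications.
-/
theorem jordanL_triple (a c d : V) :
    jordanL ((c * a) * d) = jordanL (a * d) * jordanL c + jordanL (c * a) * jordanL d +
      jordanL (c * d) * jordanL a - jordanL a * jordanL d * jordanL c -
      jordanL c * jordanL d * jordanL a := by
  ext b
  have h := jordan_linearized a b c d
  simp only [clm_add, clm_sub, clm_mul, jordanL_apply] at *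
  rw [mul_comm b c, mul_comm (c * b) d, mul_comm (c * b) (a * d), mul_comm b (c * a * d),
    mul_comm b d, mul_comm (a * b) d, mul_comm (a * b) (c * d)] at h
  rw [← sub_eq_zero, ← h]; abel

/-- The inner derivation `[L(a), L(b)]`. -/
def innerDer (a b : V) : V →L[ℝ] V := jordanL a * jordanL b - jordanL b * jordanL a

theorem innerDer_apply (a b x : V) : innerDer a b x = a * (b * x) - b * (a * x) := rfl

/-- The polarized quadratic representation on `V`. -/
def quadP (x y : V) : V →L[ℝ] V := jordanL x * jordanL y + jordanL y * jordanL x - jordanL (x * y)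

theorem quadP_apply (x y z : V) : quadP x y z = x * (y * z) + y * (x * z) - (x * y) * z := rfl

theorem quadP_comm (x y : V) : quadP x y = quadP y x := by
  unfold quadP; rw [mul_comm x y, add_comm]

/-- This is P(gx, gy) = g P(x, y) g* differentiated along g = exp(tL(a)), where L(a) is its own
adjoint. -/
theorem jordanL_quadP (a x y : V) :
    jordanL a * quadP x y + quadP x y * jordanL a = quadP (a * x) y + quadP x (a * y) := by
  unfold quadP
  have h1 := jordanL_triple x a y
  have h2 := jordanL_triple y a x
  have h3 := jordanL_comm_cyclic a x y
  rw [mul_comm x (a * y), h1, h2]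
  rw [mul_comm y a] at h3
  rw [mul_comm y x, eq_comm, ← sub_eq_zero, ← h3]
  noncomm_ring

/-- `T` is a derivation of the Jordan product. -/
def IsDer (T : V →L[ℝ] V) : Prop := ∀ x y : V, T (x * y) = T x * y + x * T y

/-- Two instances of `jordanL_triple`, with a and b exchanged, differ exactly by the Leibniz defect.
-/
theorem isDer_innerDer (a b : V) : IsDer (innerDer a b) := by
  intro x y
  have h1 := DFunLike.congr_fun (jordanL_triple b x a) y
  have h2 := DFunLike.congr_fun (jordanL_triple a x b) y
  simp only [clm_add, clm_sub, clm_mul, jordanL_apply] at h1 h2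
  simp only [innerDer_apply, sub_mul, mul_sub]
  rw [mul_comm a (b * x), mul_comm b (a * x), mul_comm b x, mul_comm a x, h1, h2, mul_comm b a]
  abel

theorem innerDer_skew (a b x y : V) :
    inner ℝ (innerDer a b x) y = - inner ℝ x (innerDer a b y) := by
  simp only [innerDer_apply, inner_sub_left, inner_sub_right, inner_jmul_left]
  ring

theorem IsDer.map_one {T : V →L[ℝ] V} (hT : IsDer T) : T 1 = 0 := by
  have h := hT 1 1
  rw [jone_mul, jone_mul, jmul_one] at h
  simpa using h

theorem IsDer.comm_jordanL {T : V →L[ℝ] V} (hT : IsDer T) (x : V) :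
    T * jordanL x - jordanL x * T = jordanL (T x) := by
  ext y; simp [hT x y]

theorem IsDer.quadP {T : V →L[ℝ] V} (hT : IsDer T) (x y : V) :
    T * quadP x y - quadP x y * T = quadP (T x) y + quadP x (T y) := by
  ext z
  simp only [clm_sub, clm_mul, clm_add, quadP_apply, map_add, map_sub, hT _ _, mul_add, add_mul]
  abel

end Identities
end

noncomputable section

/-! ### Idempotents and the Peirce decomposition -/

section Idempotents

variable {V : Type*} [NormedAddCommGroup V] [InnerProductSpace ℝ V] [EuclideanJordanAlgebra V]

/-- All the Peirce multiplication rules used below come from this and `idem_mul_half`. The factor 2λ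
- 1 is the reason why λ = 1/2 needs separate treatment. -/
theorem idem_mul_eigen {e x y : V} {lam mu : ℝ} (he : e * e = e) (hx : e * x = lam • x)
    (hy : e * y = mu • y) :
    (2 * lam - 1) • (e * (x * y)) = ((2 * lam - 1) * mu) • (x * y) := by
  have h := jordan_linearized e e x y
  rw [he, mul_comm x e, hx, hy] at h
  simp only [smul_mul_assoc, mul_smul_comm, smul_smul] at h
  rw [← sub_eq_zero, ← h]
  module

theorem idem_mul_of_ne {e x y : V} {lam mu : ℝ} (he : e * e = e) (hx : e * x = lam • x)
    (hy : e * y = mu • y) (hl : lam ≠ 1 / 2) : e * (x * y) = mu • (x * y) := by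
  have h := idem_mul_eigen he hx hy
  rw [mul_smul] at h
  exact smul_right_injective V (r := 2 * lam - 1) (by intro h0; apply hl; linarith) h

theorem idem_mul_half {e x y : V} (he : e * e = e) (hx : e * x = (1 / 2 : ℝ) • x)
    (hy : e * y = (1 / 2 : ℝ) • y) : e * (e * (x * y)) = e * (x * y) := by
  have h := jordan_linearized e x y e
  rw [he, mul_comm y e, hy, mul_comm x e, hx] at h
  simp only [smul_mul_assoc, mul_smul_comm, hx, hy, smul_smul, mul_comm y x, mul_comm x e,
    mul_comm y e, mul_comm (x * y) e] at h
  rw [← sub_eq_zero, ← h]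
  module

/-- L(e) is a root of 2t³ - 3t² + t = t(2t - 1)(t - 1), so its only possible eigenvalues are 0, 1/2
and 1. -/
theorem idem_cubic {e : V} (he : e * e = e) (x : V) :
    (2 : ℝ) • (e * (e * (e * x))) = (3 : ℝ) • (e * (e * x)) - e * x := by
  have h := jordan_linearized e x e e
  simp only [he, mul_comm x e, mul_comm (e * x) e] at h
  rw [← sub_eq_zero, ← h]
  module

/-- The symmetry `1 - 8 L(e) + 8 L(e)²`. -/
def paritySymm [FiniteDimensional ℝ V] (e : V) : V →L[ℝ] V :=
  1 - (8 : ℝ) • jordanL e + (8 : ℝ) • (jordanL e * jordanL e)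

variable [FiniteDimensional ℝ V]

theorem paritySymm_apply (e x : V) :
    paritySymm e x = x - (8 : ℝ) • (e * x) + (8 : ℝ) • (e * (e * x)) := rfl

theorem paritySymm_of_zero {e x : V} (hx : e * (e * x) = e * x) : paritySymm e x = x := by
  rw [paritySymm_apply, hx]; abel

theorem paritySymm_of_half {e x : V} (hx : e * x = (1 / 2 : ℝ) • x) : paritySymm e x = -x := by
  rw [paritySymm_apply, hx, mul_smul_comm, hx]; module

/-- The components are the Lagrange interpolation polynomials at 0, 1/2 and 1, evaluated at L(e): 1
- 3t + 2t², 4t - 4t² and 2t² - t. -/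
theorem exists_even_odd {e : V} (he : e * e = e) (x : V) :
    ∃ x0 x1 x2 : V, x = x0 + x1 + x2 ∧ e * x0 = (0 : ℝ) • x0 ∧ e * x1 = (1 / 2 : ℝ) • x1 ∧
      e * x2 = (1 : ℝ) • x2 := by
  have h := idem_cubic he x
  refine ⟨x - (3 : ℝ) • (e * x) + (2 : ℝ) • (e * (e * x)),
    (4 : ℝ) • (e * x) - (4 : ℝ) • (e * (e * x)), (2 : ℝ) • (e * (e * x)) - e * x, ?_, ?_, ?_, ?_⟩
  · module
  · simp only [mul_add, mul_sub, mul_smul_comm, h]; module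
  · have h2 : (4 : ℝ) • (e * (e * (e * x))) = (2 : ℝ) • ((2 : ℝ) • (e * (e * (e * x)))) := by module
    simp only [mul_sub, mul_smul_comm, h2, h]; module
  · simp only [mul_sub, mul_smul_comm, h]; module

/-- The polynomial 1 - 8t + 8t² takes the values 1, -1, 1 at 0, 1/2, 1. Thus the map is the sign of
the ℤ/2-grading with odd part V_{1/2}(e), and the Peirce rules say that the product respects this
grading. -/
theorem paritySymm_mul {e : V} (he : e * e = e) (x y : V) :
    paritySymm e (x * y) = paritySymm e x * paritySymm e y := by
  obtain ⟨x0, x1, x2, rfl, hx0, hx1, hx2⟩ := exists_even_odd he x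
  obtain ⟨y0, y1, y2, rfl, hy0, hy1, hy2⟩ := exists_even_odd he y
  have n0 : (0 : ℝ) ≠ 1 / 2 := by norm_num
  have n2 : (1 : ℝ) ≠ 1 / 2 := by norm_num
  have ev0 : ∀ {z : V}, e * z = (0 : ℝ) • z → paritySymm e z = z := fun {z} h =>
    paritySymm_of_zero (by rw [h]; simp)
  have ev2 : ∀ {z : V}, e * z = (1 : ℝ) • z → paritySymm e z = z := fun {z} h =>
    paritySymm_of_zero (by rw [h]; simp [h])
  simp only [map_add, mul_add, add_mul]
  rw [ev0 hx0, ev0 hy0, ev2 hx2, ev2 hy2, paritySymm_of_half hx1, paritySymm_of_half hy1,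
    ev0 (idem_mul_of_ne he hx0 hy0 n0), ev2 (idem_mul_of_ne he hx0 hy2 n0),
    ev0 (idem_mul_of_ne he hx2 hy0 n2), ev2 (idem_mul_of_ne he hx2 hy2 n2),
    paritySymm_of_half (idem_mul_of_ne he hx0 hy1 n0),
    paritySymm_of_half (idem_mul_of_ne he hx2 hy1 n2),
    mul_comm x1 y0, mul_comm x1 y2,
    paritySymm_of_half (idem_mul_of_ne he hy0 hx1 n0),
    paritySymm_of_half (idem_mul_of_ne he hy2 hx1 n2),
    paritySymm_of_zero (idem_mul_half he hx1 hy1)]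
  simp only [mul_neg, neg_mul, neg_neg, mul_comm x1 y0, mul_comm x1 y2]

theorem paritySymm_self {e : V} (he : e * e = e) (x : V) :
    paritySymm e (paritySymm e x) = x := by
  obtain ⟨x0, x1, x2, rfl, hx0, hx1, hx2⟩ := exists_even_odd he x
  have e0 : paritySymm e x0 = x0 := paritySymm_of_zero (by rw [hx0]; simp)
  have e2 : paritySymm e x2 = x2 := paritySymm_of_zero (by rw [hx2]; simp [hx2])
  simp [map_add, e0, e2, paritySymm_of_half hx1]

theorem inner_cubic (p y : V) (a b : ℝ) :
    inner ℝ ((a • p + b • y) * (a • p + b • y)) (a • p + b • y) =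
      a ^ 3 * inner ℝ (p * p) p + 3 * a ^ 2 * b * inner ℝ (p * p) y +
      3 * a * b ^ 2 * inner ℝ (y * y) p + b ^ 3 * inner ℝ (y * y) y := by
  have h1 : inner ℝ (p * y) p = inner ℝ (p * p) y := by
    rw [inner_jmul_left, real_inner_comm]
  have h2 : inner ℝ (p * y) y = inner ℝ (y * y) p := by
    rw [mul_comm p y, inner_jmul_left, real_inner_comm]
  simp only [mul_add, add_mul, smul_mul_assoc, mul_smul_comm, inner_add_left, inner_add_right,
    inner_smul_left, inner_smul_right, mul_comm y p, h1, h2, RCLike.conj_to_real]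
  ring

/-- The Peirce `1`-space of a primitive idempotent is a line. -/
theorem IsPrimitiveIdempotent.eq_smul {e : V} (he : IsPrimitiveIdempotent e) {x : V}
    (hx : e * x = x) : ∃ a : ℝ, x = a • e := by
  obtain ⟨he1, he0, hprim⟩ := he
  by_contra hcon
  push Not at hcon
  have hen : 0 < ‖e‖ := norm_pos_iff.2 he0
  -- The cubic form ⟪x², x⟫ is maximized on the unit sphere of the Peirce 1-space. A maximizer `p`
  -- turns out to be a multiple of an idempotent, hence of `e`, and a second direction would allow a
  -- larger value.
  set S : Set V := {x | e * x = x} ∩ Metric.sphere 0 1 with hS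
  have hcl : IsClosed {x : V | e * x = x} :=
    isClosed_eq (jordanL e).continuous continuous_id
  have hcomp : IsCompact S := (isCompact_sphere (0 : V) 1).inter_left hcl
  have heS : (‖e‖⁻¹) • e ∈ S := by
    refine ⟨?_, ?_⟩
    · simp [he1, mul_smul_comm]
    · simp [norm_smul, hen.ne']
  have hcont : ContinuousOn (fun x : V => inner ℝ (x * x) x) S := by
    have h1 : Continuous fun x : V => jordanL x x := by
      exact (continuous_jordanL.clm_apply continuous_id)
    exact (h1.inner continuous_id).continuousOn
  obtain ⟨p, ⟨hpA, hp1⟩, hmax⟩ := hcomp.exists_isMaxOn ⟨_, heS⟩ hcont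
  simp only [mem_ofPred_eq] at hpA
  have hpn : ‖p‖ = 1 := by simpa using hp1
  have hmem : ∀ (y : V) (a b : ℝ), e * y = y → ‖y‖ = 1 → inner ℝ p y = 0 → a ^ 2 + b ^ 2 = 1 →
      a • p + b • y ∈ S := by
    intro y a b hy hy1 hpy hab
    refine ⟨?_, ?_⟩
    · simp [mul_add, mul_smul_comm, hpA, hy]
    · have : ‖a • p + b • y‖ ^ 2 = 1 := by
        rw [norm_add_sq_real, inner_smul_left, inner_smul_right, hpy, norm_smul, norm_smul, hpn,
          hy1]
        simpa using hab
      have h2 := (pow_eq_one_iff_of_nonneg (norm_nonneg (a • p + b • y)) two_ne_zero).1 this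
      simpa using h2
  have hcrit : ∀ y : V, e * y = y → ‖y‖ = 1 → inner ℝ p y = 0 → inner ℝ (p * p) y = 0 := by
    intro y hy hy1 hpy
    -- The cubic form along the great circle cos t · p + sin t · y; its derivative at 0 is 3⟪p², y⟫.
    set g : ℝ → ℝ := fun t => Real.cos t ^ 3 * inner ℝ (p * p) p +
      3 * Real.cos t ^ 2 * Real.sin t * inner ℝ (p * p) y +
      3 * Real.cos t * Real.sin t ^ 2 * inner ℝ (y * y) p + Real.sin t ^ 3 * inner ℝ (y * y) y
      with hg
    have hloc : IsLocalMax g 0 := by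
      refine Filter.Eventually.of_forall fun t => ?_
      have h1 := hmax (hmem y (Real.cos t) (Real.sin t) hy hy1 hpy (Real.cos_sq_add_sin_sq t))
      simp only [mem_ofPred_eq] at h1
      rw [inner_cubic] at h1
      simpa [hg] using h1
    have hc := Real.hasDerivAt_cos 0
    have hs := Real.hasDerivAt_sin 0
    have hd := ((((hc.pow 3).mul_const (inner ℝ (p * p) p)).add
      ((((hc.pow 2).const_mul 3).mul hs).mul_const (inner ℝ (p * p) y))).add
      ((((hc.const_mul 3).mul (hs.pow 2))).mul_const (inner ℝ (y * y) p))).add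
      ((hs.pow 3).mul_const (inner ℝ (y * y) y))
    have h0 := hloc.hasDerivAt_eq_zero hd
    simpa using h0
  have hpp : e * (p * p) = p * p := by
    have := idem_mul_of_ne he1 (x := p) (y := p) (lam := 1) (mu := 1) (by simpa using hpA)
      (by simpa using hpA) (by norm_num)
    simpa using this
  set lam : ℝ := inner ℝ (p * p) p with hlam
  have hsq : p * p = lam • p := by
    by_contra hne
    set y := p * p - lam • p with hy
    have hy0 : y ≠ 0 := sub_ne_zero.2 hne
    have hyn : 0 < ‖y‖ := norm_pos_iff.2 hy0
    have hey : e * y = y := by simp [hy, mul_sub, hpp, mul_smul_comm, hpA]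
    have hpy : inner ℝ p y = 0 := by
      rw [hy, inner_sub_right, inner_smul_right, real_inner_self_eq_norm_sq, hpn, hlam,
        real_inner_comm]; ring
    have h1 := hcrit (‖y‖⁻¹ • y) (by simp [mul_smul_comm, hey]) (by simp [norm_smul, hyn.ne'])
      (by rw [inner_smul_right, hpy, mul_zero])
    rw [inner_smul_right] at h1
    have h2 : inner ℝ (p * p) y = 0 := by
      rcases mul_eq_zero.1 h1 with h | h
      · exact absurd h (inv_ne_zero hyn.ne')
      · exact h
    have h3 : inner ℝ y y = 0 := by
      conv_lhs => rw [hy]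
      rw [inner_sub_left, inner_smul_left, h2, hpy]; simp
    exact hy0 (inner_self_eq_zero.1 h3)
  -- The competitor e/‖e‖ already has the positive value 1/‖e‖.
  have hlpos : 0 < lam := by
    have h1 := hmax heS
    simp only [mem_ofPred_eq, smul_mul_assoc, mul_smul_comm, he1, inner_smul_left,
      inner_smul_right, real_inner_self_eq_norm_sq, RCLike.conj_to_real] at h1
    refine lt_of_lt_of_le ?_ h1
    positivity
  have hq : (lam⁻¹ • p) * (lam⁻¹ • p) = lam⁻¹ • p := by
    rw [smul_mul_assoc, mul_smul_comm, hsq, smul_smul lam⁻¹ lam, inv_mul_cancel₀ hlpos.ne', one_smul]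
  have heq : e * (lam⁻¹ • p) = lam⁻¹ • p := by rw [mul_smul_comm, hpA]
  have hqe : lam⁻¹ • p = e := by
    rcases hprim (lam⁻¹ • p) (e - lam⁻¹ • p) hq
      (by rw [mul_sub, sub_mul, sub_mul, he1, heq, hq, mul_comm, heq]; abel) (by abel) with h | h
    · exfalso
      rcases smul_eq_zero.1 h with h | h
      · exact inv_ne_zero hlpos.ne' h
      · rw [h] at hpn; simp at hpn
    · exact (sub_eq_zero.1 h).symm
  have hpe : p = lam • e := by rw [← hqe, smul_smul, mul_inv_cancel₀ hlpos.ne', one_smul]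
  -- a second direction contradicts maximality
  set y := x - (inner ℝ p x : ℝ) • p with hy
  have hey : e * y = y := by simp [hy, mul_sub, hx, mul_smul_comm, hpA]
  have hy0 : y ≠ 0 := by
    intro h0
    apply hcon (inner ℝ p x * lam)
    rw [mul_smul, ← hpe]
    exact sub_eq_zero.1 h0
  have hyn : 0 < ‖y‖ := norm_pos_iff.2 hy0
  have hpy : inner ℝ p y = 0 := by
    rw [hy, inner_sub_right, inner_smul_right, real_inner_self_eq_norm_sq, hpn]; ring
  set u := ‖y‖⁻¹ • y with hu
  have heu : e * u = u := by simp [hu, mul_smul_comm, hey]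
  have hun : ‖u‖ = 1 := by simp [hu, norm_smul, hyn.ne']
  have hpu : inner ℝ p u = 0 := by rw [hu, inner_smul_right, hpy, mul_zero]
  -- Averaging the values at (4/5)p ± (3/5)u removes the terms odd in u and leaves ((4/5)³ +
  -- 3(4/5)(3/5)²)λ = (172/125)λ, which exceeds the maximum λ.
  have h1 := hmax (hmem u (4 / 5) (3 / 5) heu hun hpu (by norm_num))
  have h2 := hmax (hmem u (4 / 5) (-(3 / 5)) heu hun hpu (by norm_num))
  simp only [mem_ofPred_eq] at h1 h2
  rw [inner_cubic] at h1 h2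
  have h3 : inner ℝ (u * u) p = lam := by
    rw [inner_jmul_left, hpe, mul_smul_comm, mul_comm u e, heu, inner_smul_right,
      real_inner_self_eq_norm_sq, hun]; ring
  rw [h3, ← hlam] at h1 h2
  nlinarith

end Idempotents
end

noncomputable section

/-! ### Jordan frames -/

section Frames

variable {V : Type*} [NormedAddCommGroup V] [InnerProductSpace ℝ V] [EuclideanJordanAlgebra V]
  [FiniteDimensional ℝ V] {l : ℕ} {c : Fin l → V}

/-- The eigenvalue of `L(c_k)` on the Peirce space `V_ij`. -/
def peirceCoeff (i j k : Fin l) : ℝ := (if k = i then 1 / 2 else 0) + (if k = j then 1 / 2 else 0)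

theorem peirceCoeff_comm (i j k : Fin l) : peirceCoeff i j k = peirceCoeff j i k := by
  unfold peirceCoeff; ring

theorem sum_mul_peirceCoeff (i j : Fin l) (a : Fin l → ℝ) :
    ∑ k, a k * peirceCoeff i j k = (a i + a j) / 2 := by
  simp only [peirceCoeff, mul_add, Finset.sum_add_distrib, mul_ite, mul_zero, Finset.sum_ite_eq',
    Finset.mem_univ, if_true]
  ring

variable (c) in
/-- The Peirce space `V_ij` of a family of idempotents. -/
def peirceSpace (i j : Fin l) : Submodule ℝ V where
  carrier := {x | ∀ k, c k * x = peirceCoeff i j k • x}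
  add_mem' := fun {x y} hx hy k => by rw [mul_add, hx k, hy k, smul_add]
  zero_mem' := fun k => by simp
  smul_mem' := fun a x hx k => by rw [mul_smul_comm, hx k, smul_comm]

theorem mem_peirce {i j : Fin l} {x : V} :
    x ∈ peirceSpace c i j ↔ ∀ k, c k * x = peirceCoeff i j k • x := Iff.rfl

theorem peirceSpace_comm (i j : Fin l) : peirceSpace c i j = peirceSpace c j i := by
  ext x; simp only [mem_peirce, peirceCoeff_comm i j]

theorem frame_sum_mul (a : Fin l → ℝ) {i j : Fin l} {x : V} (hx : x ∈ peirceSpace c i j) :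
    (∑ k, a k • c k) * x = ((a i + a j) / 2) • x := by
  rw [Finset.sum_mul, ← sum_mul_peirceCoeff, Finset.sum_smul]
  exact Finset.sum_congr rfl fun k _ => by rw [smul_mul_assoc, hx k, smul_smul]

namespace IsJordanFrame

variable (hc : IsJordanFrame c)
include hc

theorem idem (i : Fin l) : c i * c i = c i := (hc.1 i).1
theorem ne_zero (i : Fin l) : c i ≠ 0 := (hc.1 i).2.1
theorem orth {i j : Fin l} (h : i ≠ j) : c i * c j = 0 := hc.2.1 i j h
theorem sum_eq : ∑ i, c i = 1 := hc.2.2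

theorem mul_eq (i j : Fin l) : c i * c j = if i = j then c i else 0 := by
  split_ifs with h
  · rw [← h, hc.idem]
  · exact hc.orth h

theorem self_mem (i : Fin l) : c i ∈ peirceSpace c i i := by
  intro k
  rw [hc.mul_eq, peirceCoeff]
  split_ifs with h
  · rw [h]; norm_num
  · simp

theorem mul_left_comm' (i j : Fin l) (x : V) : c i * (c j * x) = c j * (c i * x) := by
  by_cases h : i = j
  · rw [h]
  have h1 := jordan_linearized (c i) (c j) (c j) x
  rw [hc.idem, hc.orth h, hc.orth (Ne.symm h)] at h1
  simp only [zero_mul, mul_zero, sub_zero, add_zero, mul_comm (c j) (c i * x)] at h1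
  rw [← sub_eq_zero, ← h1, mul_comm (c j) (c i * x)]

/-- On joint eigenvectors this says 2λ_i²λ_j = λ_iλ_j: if c_j acts nontrivially, then c_i can act
only by 0 or 1/2. Together with `mul_three` it limits the joint eigenvalues to those of the Peirce
spaces V_ij. -/
theorem two_smul_mul {i j : Fin l} (h : i ≠ j) (x : V) :
    (2 : ℝ) • (c i * (c i * (c j * x))) = c i * (c j * x) := by
  have h1 := DFunLike.congr_fun (jordanL_triple (c j) (c i) (c i)) x
  simp only [clm_add, clm_sub, clm_mul, jordanL_apply, hc.orth h, hc.orth (Ne.symm h), hc.idem,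
    zero_mul] at h1
  rw [hc.mul_left_comm' j i (c i * x), hc.mul_left_comm' j i x] at h1
  rw [← sub_eq_zero, ← neg_eq_zero, eq_comm, h1]
  module

theorem mul_three {i j k : Fin l} (hij : i ≠ j) (hjk : j ≠ k) (hik : i ≠ k) (x : V) :
    c i * (c j * (c k * x)) = 0 := by
  have h1 := DFunLike.congr_fun (jordanL_triple (c j) (c i) (c k)) x
  simp only [clm_add, clm_sub, clm_mul, jordanL_apply, hc.orth hij, hc.orth hik, hc.orth hjk,
    zero_mul] at h1
  rw [hc.mul_left_comm' j k, hc.mul_left_comm' j i, hc.mul_left_comm' k i,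
    hc.mul_left_comm' k j] at h1
  have h2 : (2 : ℝ) • (c i * (c j * (c k * x))) = 0 := by
    rw [← neg_eq_zero, eq_comm, h1]; module
  exact (smul_eq_zero.1 h2).resolve_left two_ne_zero

/-- P(c_i, c_i) is the Peirce projection onto V_ii, and P(c_i, c_j) for i ≠ j is half the projection
onto V_ij. The double sum over ordered pairs is therefore the identity, which is P(e, e) = 1. -/
theorem quadP_mem (i j : Fin l) (x : V) : quadP (c i) (c j) x ∈ peirceSpace c i j := by
  intro k
  rw [quadP_apply]
  by_cases hij : i = j
  · subst hij
    rw [hc.idem]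
    by_cases hk : k = i
    · subst hk
      have h := idem_cubic (hc.idem k) x
      have h2 : peirceCoeff k k k = 1 := by simp [peirceCoeff]; norm_num
      rw [h2]
      simp only [mul_add, mul_sub]
      rw [← sub_eq_zero, ← sub_eq_zero.2 h]
      module
    · have h := hc.two_smul_mul (Ne.symm hk) x
      have h2 : peirceCoeff i i k = 0 := by simp [peirceCoeff, hk]
      rw [h2]
      simp only [mul_add, mul_sub]
      rw [hc.mul_left_comm' k i (c i * x), hc.mul_left_comm' k i x]
      rw [← sub_eq_zero, ← sub_eq_zero.2 h]
      module
  · rw [hc.orth hij, zero_mul, sub_zero, hc.mul_left_comm' j i]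
    by_cases hki : k = i
    · subst hki
      have h := hc.two_smul_mul hij x
      have h2 : peirceCoeff k j k = 1 / 2 := by simp [peirceCoeff, hij]
      rw [h2, ← two_smul ℝ (c k * (c j * x)), mul_smul_comm, h]
      module
    · by_cases hkj : k = j
      · subst hkj
        have h := hc.two_smul_mul (Ne.symm hij) x
        have h2 : peirceCoeff i k k = 1 / 2 := by simp [peirceCoeff, Ne.symm hij]
        rw [h2, hc.mul_left_comm' i k, mul_add, ← two_smul ℝ (c k * (c k * (c i * x))), h]
        module
      · rw [mul_add, hc.mul_three hki hij hkj]
        simp [peirceCoeff, hki, hkj]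

omit hc in
theorem quadP_add_left (x y z : V) : quadP (x + y) z = quadP x z + quadP y z := by
  unfold quadP; rw [add_mul x y z, jordanL_add, jordanL_add]; noncomm_ring

theorem sum_quadP (x : V) : ∑ i, ∑ j, quadP (c i) (c j) x = x := by
  have h1 : ∀ y : V, ∑ j, c j * y = y := fun y => by
    rw [← Finset.sum_mul, hc.sum_eq, jone_mul]
  simp only [quadP_apply, Finset.sum_sub_distrib, Finset.sum_add_distrib, ← Finset.mul_sum, h1,
    ← Finset.sum_mul, hc.sum_eq, jmul_one]
  abel

theorem inner_eq_zero_of_coeff {i j k m : Fin l} {x y : V} (hx : x ∈ peirceSpace c i j)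
    (hy : y ∈ peirceSpace c k m) {r : Fin l} (h : peirceCoeff i j r ≠ peirceCoeff k m r) :
    inner ℝ x y = 0 := by
  have h1 := inner_jmul_left (c r) x y
  rw [hx r, hy r, inner_smul_left, inner_smul_right, RCLike.conj_to_real, ← sub_eq_zero,
    ← sub_mul] at h1
  exact (mul_eq_zero.1 h1).resolve_left (sub_ne_zero.2 h)

theorem eq_smul_of_mem_diag {i : Fin l} {x : V} (hx : x ∈ peirceSpace c i i) : ∃ a : ℝ, x = a • c i := by
  refine (hc.1 i).eq_smul ?_
  have := hx i
  rw [this, peirceCoeff]; norm_num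

theorem inner_frame {i j : Fin l} (h : i ≠ j) : inner ℝ (c i) (c j) = 0 :=
  hc.inner_eq_zero_of_coeff (hc.self_mem i) (hc.self_mem j) (r := i) (by
    simp [peirceCoeff, h])

theorem inner_frame_one (i : Fin l) : inner ℝ (c i) 1 = ‖c i‖ ^ 2 := by
  have h := inner_jmul_left (c i) (c i) 1
  rwa [hc.idem, jmul_one, real_inner_self_eq_norm_sq] at h

end IsJordanFrame

theorem pow_three_add_lt {i j m : ℕ} (hi : i < m) (hj : j < m) : 3 ^ i + 3 ^ j < 3 ^ m := by
  obtain ⟨m, rfl⟩ : ∃ k, m = k + 1 := ⟨m - 1, by omega⟩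
  have h1 : 3 ^ i ≤ 3 ^ m := Nat.pow_le_pow_right (by norm_num) (by omega)
  have h2 : 3 ^ j ≤ 3 ^ m := Nat.pow_le_pow_right (by norm_num) (by omega)
  have h3 : 0 < 3 ^ m := by positivity
  rw [pow_succ]; omega

/-- The weights 3^k in `genericElt` are chosen for this: L(`genericElt`) acts on V_ij by (3^i +
3^j)/2, so its eigenvalue determines the unordered pair. -/
theorem pow_three_sidon {i j k m : ℕ} (h : 3 ^ i + 3 ^ j = 3 ^ k + 3 ^ m) :
    (i = k ∧ j = m) ∨ (i = m ∧ j = k) := by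
  have inj : ∀ {a b : ℕ}, 3 ^ a = 3 ^ b → a = b := fun h => Nat.pow_right_injective (by norm_num) h
  have p1 : 0 < 3 ^ i := by positivity
  have p2 : 0 < 3 ^ j := by positivity
  have p3 : 0 < 3 ^ k := by positivity
  have p4 : 0 < 3 ^ m := by positivity
  have a1 : ¬ (i < m ∧ j < m) := fun ⟨h1, h2⟩ => by have := pow_three_add_lt h1 h2; omega
  have a2 : ¬ (i < k ∧ j < k) := fun ⟨h1, h2⟩ => by have := pow_three_add_lt h1 h2; omega
  have a3 : ¬ (k < i ∧ m < i) := fun ⟨h1, h2⟩ => by have := pow_three_add_lt h1 h2; omega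
  have a4 : ¬ (k < j ∧ m < j) := fun ⟨h1, h2⟩ => by have := pow_three_add_lt h1 h2; omega
  have : i = m ∨ i = k ∨ j = k ∨ j = m := by omega
  rcases this with rfl | rfl | rfl | rfl
  · exact Or.inr ⟨rfl, inj (by omega)⟩
  · exact Or.inl ⟨rfl, inj (by omega)⟩
  · exact Or.inr ⟨inj (by omega), rfl⟩
  · exact Or.inl ⟨inj (by omega), rfl⟩

variable (c) in
/-- An orthonormal basis consisting of elements of the Peirce spaces. -/
structure PeirceBasis where
  b : OrthonormalBasis (Fin (Module.finrank ℝ V)) ℝ V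
  p : Fin (Module.finrank ℝ V) → Fin l
  q : Fin (Module.finrank ℝ V) → Fin l
  mem : ∀ a, b a ∈ peirceSpace c (p a) (q a)

theorem jordanL_isSymmetric (x : V) : (jordanL x : V →ₗ[ℝ] V).IsSymmetric :=
  fun u v => inner_jmul_left x u v

variable (c) in
/-- A generic element of the span of a frame. -/
def genericElt : V := ∑ k : Fin l, ((3 : ℝ) ^ (k : ℕ)) • c k

theorem IsJordanFrame.generic_mul_quadP (hc : IsJordanFrame c) (r s : Fin l) {v : V} :
    genericElt c * quadP (c r) (c s) v = quadP (c r) (c s) (genericElt c * v) := by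
  have h1 : ∀ t y, genericElt c * (c t * y) = c t * (genericElt c * y) := by
    intro t y
    simp only [genericElt, Finset.sum_mul, Finset.mul_sum, smul_mul_assoc, mul_smul_comm]
    exact Finset.sum_congr rfl fun k _ => by rw [hc.mul_left_comm']
  rw [quadP_apply, quadP_apply, mul_sub, mul_add, h1, h1, h1, h1, hc.mul_eq]
  split_ifs
  · rw [h1]
  · simp

/-- The Peirce projections commute with L(`genericElt`), so every nonzero component of v has the
same eigenvalue and must belong to V_ij. -/
theorem IsJordanFrame.mem_peirce_of_generic (hc : IsJordanFrame c) {i j : Fin l} {v : V}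
    (hv : genericElt c * v = (((3 : ℝ) ^ (i : ℕ) + 3 ^ (j : ℕ)) / 2) • v) : v ∈ peirceSpace c i j := by
  have hcomm := hc.generic_mul_quadP (v := v)
  have key : ∀ r s, quadP (c r) (c s) v ∈ peirceSpace c i j := by
    intro r s
    by_cases h0 : quadP (c r) (c s) v = 0
    · rw [h0]; exact zero_mem _
    have h1 := hcomm r s
    rw [hv, map_smul, genericElt, frame_sum_mul _ (hc.quadP_mem r s v), ← sub_eq_zero, ← sub_smul] at h1
    have h2 := (smul_eq_zero.1 h1).resolve_right h0
    have h3 : (3 : ℝ) ^ (r : ℕ) + 3 ^ (s : ℕ) = 3 ^ (i : ℕ) + 3 ^ (j : ℕ) := by linarith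
    have h4 : 3 ^ (r : ℕ) + 3 ^ (s : ℕ) = 3 ^ (i : ℕ) + 3 ^ (j : ℕ) := by exact_mod_cast h3
    rcases pow_three_sidon h4 with ⟨h, h'⟩ | ⟨h, h'⟩
    · rw [← Fin.ext h, ← Fin.ext h']; exact hc.quadP_mem r s v
    · rw [← Fin.ext h, ← Fin.ext h', peirceSpace_comm]; exact hc.quadP_mem r s v
  rw [← hc.sum_quadP v]
  exact Submodule.sum_mem _ fun r _ => Submodule.sum_mem _ fun s _ => key r s

/-- An orthonormal eigenbasis of the symmetric operator L(`genericElt`) is adapted to all Peirce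
spaces at once. -/
theorem IsJordanFrame.nonempty_peirceBasis (hc : IsJordanFrame c) : Nonempty (PeirceBasis c) := by
  have hT := jordanL_isSymmetric (genericElt c)
  have key : ∀ a, ∃ i j, hT.eigenvectorBasis rfl a ∈ peirceSpace c i j := by
    intro a
    set v := hT.eigenvectorBasis rfl a with hv
    have hv0 : v ≠ 0 := (hT.eigenvectorBasis rfl).orthonormal.ne_zero a
    obtain ⟨mu, hev⟩ : ∃ mu : ℝ, genericElt c * v = mu • v :=
      ⟨_, hT.apply_eigenvectorBasis rfl a⟩
    obtain ⟨r, s, hrs⟩ : ∃ r s, quadP (c r) (c s) v ≠ 0 := by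
      by_contra hcon
      push Not at hcon
      apply hv0
      rw [← hc.sum_quadP v]
      simp [hcon]
    refine ⟨r, s, hc.mem_peirce_of_generic ?_⟩
    have hcomm := hc.generic_mul_quadP r s (v := v)
    rw [hev, map_smul] at hcomm
    unfold genericElt at hcomm
    rw [frame_sum_mul _ (hc.quadP_mem r s v), ← sub_eq_zero, ← sub_smul] at hcomm
    have h2 := (smul_eq_zero.1 hcomm).resolve_right hrs
    rw [hev, sub_eq_zero.1 h2]
  choose p q h using key
  exact ⟨⟨hT.eigenvectorBasis rfl, p, q, h⟩⟩

end Frames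
end

noncomputable section

/-! ### Traces of operators -/

section OperatorTrace

variable {V : Type*} [NormedAddCommGroup V] [InnerProductSpace ℝ V] [FiniteDimensional ℝ V]

/-- The trace of an operator. -/
def opTr : (V →L[ℝ] V) →ₗ[ℝ] ℝ :=
  (LinearMap.trace ℝ V).comp (ContinuousLinearMap.coeLM ℝ)

theorem opTr_mul_comm (S T : V →L[ℝ] V) : opTr (S * T) = opTr (T * S) :=
  LinearMap.trace_mul_comm ℝ (S : V →ₗ[ℝ] V) (T : V →ₗ[ℝ] V)

theorem opTr_eq_sum {ι : Type*} [Fintype ι] (b : OrthonormalBasis ι ℝ V) (T : V →L[ℝ] V) :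
    opTr T = ∑ i, inner ℝ (b i) (T (b i)) :=
  LinearMap.trace_eq_sum_inner (T : V →ₗ[ℝ] V) b

theorem opTr_one : opTr (1 : V →L[ℝ] V) = Module.finrank ℝ V :=
  LinearMap.trace_one ℝ V

end OperatorTrace

/-! ### Peirce multiplication and simplicity -/

section PeirceMul

variable {V : Type*} [NormedAddCommGroup V] [InnerProductSpace ℝ V] [EuclideanJordanAlgebra V]
  [FiniteDimensional ℝ V] {l : ℕ} {c : Fin l → V}

namespace IsJordanFrame

theorem peirceCoeff_left {i j : Fin l} (h : i ≠ j) : peirceCoeff i j i = 1 / 2 := by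
  simp [peirceCoeff, h]
theorem peirceCoeff_right {i j : Fin l} (h : i ≠ j) : peirceCoeff i j j = 1 / 2 := by
  simp [peirceCoeff, h.symm]
theorem peirceCoeff_other {i j k : Fin l} (h : k ≠ i) (h' : k ≠ j) : peirceCoeff i j k = 0 := by
  simp [peirceCoeff, h, h']
theorem peirceCoeff_diag (i : Fin l) : peirceCoeff i i i = 1 := by
  simp [peirceCoeff]; norm_num

variable (hc : IsJordanFrame c)
include hc

/-- The product of two elements of `V_ij` with `i ≠ j`. -/
theorem mul_mem_offdiag {i j : Fin l} (h : i ≠ j) {a b : V} (ha : a ∈ peirceSpace c i j)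
    (hb : b ∈ peirceSpace c i j) :
    a * b = (inner ℝ a b / (2 * ‖c i‖ ^ 2)) • c i + (inner ℝ a b / (2 * ‖c j‖ ^ 2)) • c j := by
  have hz : ∀ k, k ≠ i → k ≠ j → c k * (a * b) = 0 := by
    intro k h1 h2
    have hak := ha k
    have hbk := hb k
    rw [peirceCoeff_other h1 h2] at hak hbk
    simpa using idem_mul_of_ne (hc.idem k) hak hbk (by norm_num)
  have hi : c i * (c i * (a * b)) = c i * (a * b) :=
    idem_mul_half (hc.idem i) (by rw [ha i, peirceCoeff_left h]) (by rw [hb i, peirceCoeff_left h])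
  have hj : c j * (c j * (a * b)) = c j * (a * b) :=
    idem_mul_half (hc.idem j) (by rw [ha j, peirceCoeff_right h])
      (by rw [hb j, peirceCoeff_right h])
  have hs : a * b = c i * (a * b) + c j * (a * b) := by
    conv_lhs => rw [← jone_mul (a * b), ← hc.sum_eq, Finset.sum_mul]
    rw [← Finset.sum_pair (f := fun k => c k * (a * b)) h]
    exact (Finset.sum_subset (Finset.subset_univ _) fun k _ hk => by
      simp only [Finset.mem_insert, Finset.mem_singleton, not_or] at hk
      exact hz k hk.1 hk.2).symm
  have hji : c j * (c i * (a * b)) = 0 := by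
    have : c i * (a * b) = a * b - c j * (a * b) := by
      rw [eq_sub_iff_add_eq]; exact hs.symm
    rw [this, mul_sub, hj, sub_self]
  have hij : c i * (c j * (a * b)) = 0 := by rw [hc.mul_left_comm', hji]
  have mi : c i * (a * b) ∈ peirceSpace c i i := by
    intro k
    by_cases hk : k = i
    · rw [hk, hi, peirceCoeff_diag, one_smul]
    · rw [peirceCoeff_other hk hk, zero_smul]
      by_cases hk2 : k = j
      · rw [hk2, hji]
      · rw [hc.mul_left_comm', hz k hk hk2, mul_zero]
  have mj : c j * (a * b) ∈ peirceSpace c j j := by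
    intro k
    by_cases hk : k = j
    · rw [hk, hj, peirceCoeff_diag, one_smul]
    · rw [peirceCoeff_other hk hk, zero_smul]
      by_cases hk2 : k = i
      · rw [hk2, hij]
      · rw [hc.mul_left_comm', hz k hk2 hk, mul_zero]
  -- The diagonal Peirce space is the line through c_k, and the coefficient is found by pairing with
  -- c_k and moving L(c_k) and L(a) across the inner product.
  have aux : ∀ k, (c k * a = (1 / 2 : ℝ) • a) → c k * (a * b) ∈ peirceSpace c k k →
      c k * (a * b) = (inner ℝ a b / (2 * ‖c k‖ ^ 2)) • c k := by
    intro k hka hm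
    obtain ⟨r, hr⟩ := hc.eq_smul_of_mem_diag hm
    have hn : ‖c k‖ ^ 2 ≠ 0 := pow_ne_zero 2 (norm_ne_zero_iff.2 (hc.ne_zero k))
    have h1 : inner ℝ (c k * (a * b)) (c k) = 1 / 2 * inner ℝ a b := by
      rw [inner_jmul_left, hc.idem, inner_jmul_left, mul_comm a, hka, inner_smul_right,
        real_inner_comm]
    rw [hr, inner_smul_left, RCLike.conj_to_real, real_inner_self_eq_norm_sq] at h1
    rw [hr]
    congr 1
    rw [eq_div_iff (mul_ne_zero two_ne_zero hn)]
    linarith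
  rw [← aux i (by rw [ha i, peirceCoeff_left h]) mi, ← aux j (by rw [ha j, peirceCoeff_right h]) mj]
  exact hs

/-- Write a² = r c_i + s c_j. The Jordan identity gives (a²)² = a(a·a²) = ((r + s)/2) a², and the
coefficient of c_i yields r² = r(r + s)/2, so r = s. -/
theorem norm_eq_of_mem {i j : Fin l} (h : i ≠ j) {a : V} (ha : a ∈ peirceSpace c i j)
    (h0 : a ≠ 0) : ‖c i‖ ^ 2 = ‖c j‖ ^ 2 := by
  have hni : ‖c i‖ ^ 2 ≠ 0 := pow_ne_zero 2 (norm_ne_zero_iff.2 (hc.ne_zero i))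
  have hnj : ‖c j‖ ^ 2 ≠ 0 := pow_ne_zero 2 (norm_ne_zero_iff.2 (hc.ne_zero j))
  have hna : ‖a‖ ^ 2 ≠ 0 := pow_ne_zero 2 (norm_ne_zero_iff.2 h0)
  have h1 := hc.mul_mem_offdiag h ha ha
  rw [real_inner_self_eq_norm_sq] at h1
  set r := ‖a‖ ^ 2 / (2 * ‖c i‖ ^ 2) with hr
  set s := ‖a‖ ^ 2 / (2 * ‖c j‖ ^ 2) with hs
  have hra : a * (a * a) = ((r + s) / 2) • a := by
    rw [h1, mul_add, mul_smul_comm, mul_smul_comm, mul_comm a, mul_comm a, ha i, ha j,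
      peirceCoeff_left h, peirceCoeff_right h]
    module
  have hj := IsCommJordan.lmul_comm_rmul_rmul a a
  rw [hra, mul_smul_comm, h1] at hj
  have h2 := congrArg (fun x => c i * x) hj
  simp only [mul_add, add_mul, mul_smul_comm, smul_mul_assoc, hc.idem, hc.orth h,
    hc.orth h.symm, smul_zero, add_zero, zero_add] at h2
  rw [smul_smul, smul_smul, ← sub_eq_zero, ← sub_smul] at h2
  have h3 := (smul_eq_zero.1 h2).resolve_right (hc.ne_zero i)
  have hr0 : r ≠ 0 := by rw [hr]; positivity
  have h4 : r = s := by
    have : r * (r - s) = 0 := by nlinarith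
    rcases mul_eq_zero.1 this with h | h
    · exact absurd h hr0
    · linarith
  rw [hr, hs] at h4
  rw [div_eq_div_iff (mul_ne_zero two_ne_zero hni) (mul_ne_zero two_ne_zero hnj)] at h4
  have := mul_left_cancel₀ hna h4
  linarith

/-- The idempotents other than c_j act by the one-idempotent Peirce rules. The action of c_j is
forced to be zero because the frame sums to e and the halves from c_i and c_k already add up to one.
-/
theorem mul_mem_chain {i j k : Fin l} (hij : i ≠ j) (hjk : j ≠ k) (hik : i ≠ k) {a b : V}
    (ha : a ∈ peirceSpace c i j) (hb : b ∈ peirceSpace c j k) : a * b ∈ peirceSpace c i k := by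
  have hi : c i * (a * b) = (1 / 2 : ℝ) • (a * b) := by
    rw [mul_comm a b]
    exact idem_mul_of_ne (hc.idem i) (by rw [hb i, peirceCoeff_other hij hik])
      (by rw [ha i, peirceCoeff_left hij]) (by norm_num)
  have hk : c k * (a * b) = (1 / 2 : ℝ) • (a * b) :=
    idem_mul_of_ne (hc.idem k) (by rw [ha k, peirceCoeff_other hik.symm hjk.symm])
      (by rw [hb k, peirceCoeff_right hjk]) (by norm_num)
  have ho : ∀ m, m ≠ i → m ≠ j → m ≠ k → c m * (a * b) = 0 := by
    intro m h1 h2 h3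
    simpa using idem_mul_of_ne (hc.idem m) (x := a) (y := b) (lam := 0) (mu := 0)
      (by rw [ha m, peirceCoeff_other h1 h2]) (by rw [hb m, peirceCoeff_other h2 h3]) (by norm_num)
  have hj : c j * (a * b) = 0 := by
    have h1 : (∑ m, c m) * (a * b) = a * b := by rw [hc.sum_eq, jone_mul]
    rw [Finset.sum_mul, ← Finset.sum_subset (Finset.subset_univ {i, j, k}) (fun m _ hm => by
      simp only [Finset.mem_insert, Finset.mem_singleton, not_or] at hm
      exact ho m hm.1 hm.2.1 hm.2.2),
      Finset.sum_insert (by simp [hij, hik]), Finset.sum_pair hjk, hi, hk] at h1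
    linear_combination (norm := module) (1 : ℝ) • h1
  intro m
  by_cases h1 : m = i
  · rw [h1, hi, peirceCoeff_left hik]
  by_cases h3 : m = k
  · rw [h3, hk, peirceCoeff_right hik]
  rw [peirceCoeff_other h1 h3, zero_smul]
  by_cases h2 : m = j
  · rw [h2, hj]
  · exact ho m h1 h2 h3

theorem two_mul_mul_chain {i j k : Fin l} (hij : i ≠ j) (hjk : j ≠ k) (hik : i ≠ k) {a b : V}
    (ha : a ∈ peirceSpace c i j) (hb : b ∈ peirceSpace c j k) :
    (2 : ℝ) • (a * (a * b)) = (a * a) * b := by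
  have hab := hc.mul_mem_chain hij hjk hik ha hb
  have ha' : a ∈ peirceSpace c j i := by rwa [peirceSpace_comm]
  have haab := hc.mul_mem_chain hij.symm hik hjk ha' hab
  have h := jordan_linearized a (c i) b a
  have e1 : c i * b = 0 := by rw [hb i, peirceCoeff_other hij hik, zero_smul]
  have e2 : c i * a = (1 / 2 : ℝ) • a := by rw [ha i, peirceCoeff_left hij]
  have e3 : c i * (a * (a * b)) = 0 := by
    rw [haab i, peirceCoeff_other hij hik, zero_smul]
  rw [e1, mul_comm b a, mul_comm (a * b) a, e3, mul_comm a (c i), e2] at h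
  simp only [smul_mul_assoc, mul_smul_comm, zero_mul, mul_zero,
    mul_comm (a * b) a, mul_comm b (a * a)] at h
  linear_combination (norm := module) (-2 : ℝ) • h

/-- By `two_mul_mul_chain`, 2a(ab) = a²b, and a² acts on V_jk as the positive scalar ‖a‖²/(4‖c_j‖²).
Hence the relation V_ij ≠ 0 between indices is transitive. -/
theorem chain_ne_zero {i j k : Fin l} (hij : i ≠ j) (hjk : j ≠ k) (hik : i ≠ k) {a b : V}
    (ha : a ∈ peirceSpace c i j) (hb : b ∈ peirceSpace c j k) (ha0 : a ≠ 0) (hb0 : b ≠ 0) :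
    a * b ≠ 0 := by
  intro h0
  have h := hc.two_mul_mul_chain hij hjk hik ha hb
  rw [h0, mul_zero, smul_zero, hc.mul_mem_offdiag hij ha ha, add_mul, smul_mul_assoc,
    smul_mul_assoc, hb i, hb j, peirceCoeff_other hij hik, peirceCoeff_left hjk, zero_smul,
    smul_zero, zero_add, smul_smul] at h
  rcases smul_eq_zero.1 h.symm with h | h
  · have : ‖c j‖ ≠ 0 := norm_ne_zero_iff.2 (hc.ne_zero j)
    have h2 : ‖a‖ ≠ 0 := norm_ne_zero_iff.2 ha0
    rw [real_inner_self_eq_norm_sq] at h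
    have : ‖a‖ ^ 2 / (2 * ‖c j‖ ^ 2) * (1 / 2) ≠ 0 := by positivity
    exact this h
  · exact hb0 h

/-- Otherwise the indices connected to i by nonzero Peirce spaces form a set K that omits j. The sum
u of the c_k with k in K then acts only by 0 and 1, and its 1-space is an ideal containing c_i but
not c_j. -/
theorem exists_peirce_ne_zero (hV : IsSimpleJordan V) {i j : Fin l} (hij : i ≠ j) :
    ∃ a ∈ peirceSpace c i j, a ≠ 0 := by
  classical
  by_contra hcon
  push Not at hcon
  set K : Finset (Fin l) := {k | k = i ∨ ∃ a ∈ peirceSpace c i k, a ≠ 0} with hK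
  have hiK : i ∈ K := by simp [hK]
  have hjK : j ∉ K := by
    simp only [hK, Finset.mem_filter, Finset.mem_univ, true_and, not_or]
    exact ⟨hij.symm, fun ⟨a, ha, h0⟩ => h0 (hcon a ha)⟩
  set ind : Fin l → ℝ := fun k => if k ∈ K then 1 else 0 with hind
  set u : V := ∑ k, ind k • c k with hu
  have huc : ∀ k, u * c k = ind k • c k := by
    intro k
    rw [hu, frame_sum_mul _ (hc.self_mem k)]
    congr 1; ring
  have hz : ∀ r s x, x ∈ peirceSpace c r s → u * (u * x) = u * x := by
    have hsep : ∀ r s x, x ∈ peirceSpace c r s → r ∈ K → s ∉ K → x = 0 := by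
      intro r s x hx hr hs
      by_contra hx0
      apply hs
      simp only [hK, Finset.mem_filter, Finset.mem_univ, true_and] at hr hs ⊢
      push Not at hs
      rcases hr with rfl | ⟨a, ha, ha0⟩
      · exact Or.inr ⟨x, hx, hx0⟩
      by_cases hri : r = i
      · subst hri; exact Or.inr ⟨x, hx, hx0⟩
      have hrs : r ≠ s := by
        rintro rfl
        exact ha0 (hs.2 a ha)
      exact Or.inr ⟨a * x, hc.mul_mem_chain (Ne.symm hri) hrs (Ne.symm hs.1) ha hx,
        hc.chain_ne_zero (Ne.symm hri) hrs (Ne.symm hs.1) ha hx ha0 hx0⟩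
    intro r s x hx
    by_cases hr : r ∈ K <;> by_cases hs : s ∈ K
    · have : u * x = x := by rw [hu, frame_sum_mul _ hx]; simp [hind, hr, hs]
      rw [this, this]
    · rw [hsep r s x hx hr hs]; simp
    · rw [hsep s r x (by rwa [peirceSpace_comm]) hs hr]; simp
    · have : u * x = 0 := by rw [hu, frame_sum_mul _ hx]; simp [hind, hr, hs]
      rw [this]; simp
  have hall : ∀ x, u * (u * x) = u * x := by
    intro x
    rw [← hc.sum_quadP x]
    simp only [Finset.mul_sum]
    exact Finset.sum_congr rfl fun r _ => Finset.sum_congr rfl fun s _ =>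
      hz r s _ (hc.quadP_mem r s x)
  have huu : u * u = u := by simpa [jmul_one] using hall 1
  let I : Submodule ℝ V :=
    { carrier := {y | u * y = y}
      add_mem' := fun {x y} hx hy => by
        change u * (x + y) = x + y
        rw [mul_add, hx, hy]
      zero_mem' := by change u * 0 = 0; simp
      smul_mem' := fun a x hx => by
        change u * (a • x) = a • x
        rw [mul_smul_comm, hx] }
  have hI : ∀ x y : V, y ∈ I → x * y ∈ I := by
    intro x y hy
    have hy' : u * y = (1 : ℝ) • y := by rw [one_smul]; exact hy
    have h1 := idem_mul_of_ne huu (x := u * x) (y := y) (lam := 1) (mu := 1)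
      (by rw [hall, one_smul]) hy' (by norm_num)
    have h2 := idem_mul_of_ne huu (x := x - u * x) (y := y) (lam := 0) (mu := 1)
      (by rw [mul_sub, hall]; simp) hy' (by norm_num)
    change u * (x * y) = x * y
    have h3 : x * y = (u * x) * y + (x - u * x) * y := by rw [← add_mul]; congr 1; abel
    rw [h3, mul_add, h1, h2, one_smul, one_smul]
  rcases hV.2 I hI with h | h
  · have : c i ∈ I := by
      change u * c i = c i
      rw [huc]; simp [hind, hiK]
    rw [h] at this
    exact hc.ne_zero i this
  · have : c j ∈ I := by rw [h]; trivial
    have h1 : u * c j = c j := this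
    rw [huc] at h1
    simp only [hind, hjK, if_false, zero_smul] at h1
    exact hc.ne_zero j h1.symm

theorem norm_sq_eq (hV : IsSimpleJordan V) (i j : Fin l) : ‖c i‖ ^ 2 = ‖c j‖ ^ 2 := by
  by_cases h : i = j
  · rw [h]
  · obtain ⟨a, ha, h0⟩ := hc.exists_peirce_ne_zero hV h
    exact hc.norm_eq_of_mem h ha h0

end IsJordanFrame

/-- An element all of whose multiplications commute with `L(b)` is a multiple of the unit. -/
theorem IsSimpleJordan.eq_smul_one (hV : IsSimpleJordan V) {a : V}
    (ha : ∀ x y : V, a * (x * y) = x * (a * y)) : ∃ r : ℝ, a = r • (1 : V) := by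
  have := hV.1
  obtain ⟨r, hr⟩ : ∃ r : ℝ, Module.End.HasEigenvalue (jordanL a : V →ₗ[ℝ] V) r :=
    ⟨_, (jordanL_isSymmetric a).hasEigenvalue_iSup_of_finiteDimensional⟩
  obtain ⟨v, hv⟩ := hr.exists_hasEigenvector
  -- Commutation with all multiplications makes an eigenspace of L(a) an ideal; being nonzero it is
  -- everything.
  have hI := hV.2 (Module.End.eigenspace (jordanL a : V →ₗ[ℝ] V) r) (by
    intro x y hy
    rw [Module.End.mem_eigenspace_iff] at hy ⊢
    change a * (x * y) = r • (x * y)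
    change a * y = r • y at hy
    rw [ha, hy, mul_smul_comm])
  rcases hI with h | h
  · have hm : v ∈ Module.End.eigenspace (jordanL a : V →ₗ[ℝ] V) r :=
      Module.End.mem_eigenspace_iff.2 hv.apply_eq_smul
    exact absurd ((Submodule.mem_bot ℝ).1 (h.le hm)) hv.2
  · refine ⟨r, ?_⟩
    have : (1 : V) ∈ Module.End.eigenspace (jordanL a : V →ₗ[ℝ] V) r := by rw [h]; trivial
    rw [Module.End.mem_eigenspace_iff] at this
    change a * 1 = r • (1 : V) at this
    rwa [jmul_one] at this

/-- The orthogonal complement of the unit is spanned by values of inner derivations. -/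
theorem IsSimpleJordan.mem_span_innerDer (hV : IsSimpleJordan V) {a : V} (ha : inner ℝ a 1 = 0) :
    a ∈ Submodule.span ℝ {z : V | ∃ x y b : V, z = innerDer x y b} := by
  set S := Submodule.span ℝ {z : V | ∃ x y b : V, z = innerDer x y b} with hS
  -- An element w orthogonal to every [L(x), L(y)]b satisfies w(by) = b(wy) for all b and y.
  -- Simplicity makes such an element a multiple of e.
  have key : Sᗮ ≤ Submodule.span ℝ {(1 : V)} := by
    intro w hw
    rw [Submodule.mem_orthogonal] at hw
    obtain ⟨r, hr⟩ := hV.eq_smul_one (a := w) (by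
      intro b y
      rw [← sub_eq_zero]
      refine ext_inner_right ℝ fun x => ?_
      have h := hw _ (Submodule.subset_span ⟨x, y, b, rfl⟩)
      rw [innerDer_apply, inner_sub_left, inner_jmul_left, inner_jmul_left] at h
      rw [inner_zero_left, inner_sub_left, inner_jmul_left, inner_jmul_left, inner_jmul_left]
      have e1 : inner ℝ b (y * (x * w)) = inner ℝ y (b * (w * x)) := by
        rw [← inner_jmul_left, mul_comm y b, inner_jmul_left, mul_comm x w]
      have e2 : inner ℝ (y * (x * b)) w = inner ℝ (w * y) (b * x) := by
        rw [inner_jmul_left, real_inner_comm, mul_comm y w, mul_comm x b]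
      rw [← e1, ← e2]
      exact h)
    rw [hr]
    exact Submodule.smul_mem _ _ (Submodule.mem_span_singleton_self _)
  have h2 : a ∈ Sᗮᗮ := by
    rw [Submodule.mem_orthogonal]
    intro w hw
    obtain ⟨r, rfl⟩ := Submodule.mem_span_singleton.1 (key hw)
    rw [inner_smul_left, real_inner_comm, ha, mul_zero]
  rwa [Submodule.orthogonal_orthogonal] at h2

theorem IsSimpleJordan.opTr_jordanL_eq_zero (hV : IsSimpleJordan V) {a : V}
    (ha : inner ℝ a 1 = 0) : opTr (jordanL a) = 0 := by
  have h := hV.mem_span_innerDer ha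
  clear ha
  induction h using Submodule.span_induction with
  | mem z hz =>
    obtain ⟨x, y, b, rfl⟩ := hz
    rw [← (isDer_innerDer x y).comm_jordanL b, map_sub, opTr_mul_comm, sub_self]
  | zero => simp
  | add x y _ _ hx hy => rw [jordanL_add, map_add, hx, hy, add_zero]
  | smul r x _ hx => rw [jordanL_smul, map_smul, hx, smul_zero]

theorem IsSimpleJordan.one_ne_zero (hV : IsSimpleJordan V) : (1 : V) ≠ 0 := by
  have := hV.1
  intro h
  obtain ⟨x, hx⟩ := exists_ne (0 : V)
  apply hx
  rw [← jone_mul x, h, zero_mul]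

/-- The trace of L vanishes on e^⊥, because L(Db) = [D, L(b)] is a commutator and e^⊥ is spanned by
such elements. So x ↦ tr L(x) is proportional to ⟪x, e⟫, and x = e fixes the factor. -/
theorem IsSimpleJordan.opTr_jordanL (hV : IsSimpleJordan V) (x : V) :
    opTr (jordanL x) * ‖(1 : V)‖ ^ 2 = Module.finrank ℝ V * inner ℝ x 1 := by
  have h1 : ‖(1 : V)‖ ≠ 0 := norm_ne_zero_iff.2 hV.one_ne_zero
  set r : ℝ := inner ℝ x 1 / ‖(1 : V)‖ ^ 2 with hr
  have h2 := hV.opTr_jordanL_eq_zero (a := x - r • (1 : V)) (by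
    rw [inner_sub_left, inner_smul_left, real_inner_self_eq_norm_sq, hr]
    simp only [RCLike.conj_to_real]
    field_simp
    simp)
  rw [jordanL_sub, jordanL_smul, jordanL_one, map_sub, map_smul, opTr_one, sub_eq_zero] at h2
  rw [h2, smul_eq_mul, hr]
  field_simp

end PeirceMul
end

noncomputable section

/-! ### One-parameter groups -/

section Exponential

variable {E : Type*} [NormedAddCommGroup E] [NormedSpace ℝ E] [CompleteSpace E]

theorem hasDerivAt_exp_smul (A : E →L[ℝ] E) (t : ℝ) :
    HasDerivAt (fun s : ℝ => NormedSpace.exp (s • A)) (A * NormedSpace.exp (t • A)) t :=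
  hasDerivAt_exp_smul_const' (𝕂 := ℝ) A t

theorem hasDerivAt_exp_smul_apply (A : E →L[ℝ] E) (v : E) (t : ℝ) :
    HasDerivAt (fun s : ℝ => NormedSpace.exp (s • A) v) (A (NormedSpace.exp (t • A) v)) t :=
  (hasDerivAt_exp_smul A t).clm_apply (hasDerivAt_const t v) |>.congr_deriv (by simp)

theorem exp_neg_mul_exp (A : E →L[ℝ] E) : NormedSpace.exp (-A) * NormedSpace.exp A = 1 := by
  let _ : NormedAlgebra ℚ (E →L[ℝ] E) := NormedAlgebra.restrictScalars ℚ ℝ _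
  rw [← NormedSpace.exp_add_of_commute (Commute.neg_left (Commute.refl A)), neg_add_cancel,
    NormedSpace.exp_zero]

theorem exp_mul_exp_neg (A : E →L[ℝ] E) : NormedSpace.exp A * NormedSpace.exp (-A) = 1 := by
  let _ : NormedAlgebra ℚ (E →L[ℝ] E) := NormedAlgebra.restrictScalars ℚ ℝ _
  rw [← NormedSpace.exp_add_of_commute (Commute.neg_right (Commute.refl A)), add_neg_cancel,
    NormedSpace.exp_zero]

/-- The exponential as an invertible operator. -/
def expUnit (A : E →L[ℝ] E) : (E →L[ℝ] E)ˣ :=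
  ⟨NormedSpace.exp A, NormedSpace.exp (-A), exp_mul_exp_neg A, exp_neg_mul_exp A⟩

@[simp] theorem coe_expUnit (A : E →L[ℝ] E) : (expUnit A : E →L[ℝ] E) = NormedSpace.exp A := rfl

/-- Solutions of linear differential equations with constant coefficients. -/
theorem eq_exp_smul_apply {A : E →L[ℝ] E} {w : ℝ → E} (hw : ∀ t, HasDerivAt w (A (w t)) t) (t : ℝ) :
    w t = NormedSpace.exp (t • A) (w 0) := by
  have h1 : ∀ s, HasDerivAt (fun s : ℝ => NormedSpace.exp (s • (-A)) (w s)) 0 s := by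
    intro s
    refine ((hasDerivAt_exp_smul (-A) s).clm_apply (hw s)).congr_deriv ?_
    have hc : Commute (-A) (NormedSpace.exp (s • (-A))) :=
      ((Commute.refl (-A)).smul_right s).exp_right
    rw [hc.eq]
    simp
  have h2 := is_const_of_deriv_eq_zero (fun s => (h1 s).differentiableAt) (fun s => (h1 s).deriv) t 0
  simp only [zero_smul, NormedSpace.exp_zero] at h2
  have h3 := congrArg (fun v => NormedSpace.exp (t • A) v) h2
  have h4 : NormedSpace.exp (t • A) * NormedSpace.exp (t • -A) = 1 := by
    rw [smul_neg, exp_mul_exp_neg]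
  have h5 := DFunLike.congr_fun h4 (w t)
  exact h5.symm.trans h3

theorem linear_ode_unique {A : E →L[ℝ] E} {w u : ℝ → E} (hw : ∀ t, HasDerivAt w (A (w t)) t)
    (hu : ∀ t, HasDerivAt u (A (u t)) t) (h0 : w 0 = u 0) (t : ℝ) : w t = u t := by
  rw [eq_exp_smul_apply hw, eq_exp_smul_apply hu, h0]

/-- If ‖exp(tA) - 1‖ ≤ 1/2 on [0, 1], the curve exp(tA)v - tAv moves by at most ½‖Av‖. When exp(A)v
= v it moves by exactly ‖Av‖. The bound on A does not depend on v. -/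
theorem exists_forall_exp_fixed (E : Type*) [NormedAddCommGroup E] [NormedSpace ℝ E]
    [CompleteSpace E] :
    ∃ δ > 0, ∀ A : E →L[ℝ] E, ‖A‖ < δ → ∀ v, NormedSpace.exp A v = v → A v = 0 := by
  let _ : NormedAlgebra ℚ (E →L[ℝ] E) := NormedAlgebra.restrictScalars ℚ ℝ _
  have hc : ContinuousAt (NormedSpace.exp : (E →L[ℝ] E) → (E →L[ℝ] E)) 0 :=
    (NormedSpace.exp_continuous).continuousAt
  obtain ⟨δ, hδ, hd⟩ := Metric.continuousAt_iff.1 hc (1 / 2) (by norm_num)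
  refine ⟨δ, hδ, fun A hA v hv => ?_⟩
  have hder : ∀ t ∈ Icc (0 : ℝ) 1, HasDerivWithinAt
      (fun s : ℝ => NormedSpace.exp (s • A) v - s • A v)
      (A (NormedSpace.exp (t • A) v) - A v) (Icc 0 1) t := fun t _ =>
    ((hasDerivAt_exp_smul_apply A v t).sub
      (((hasDerivAt_id t).smul_const (A v)).congr_deriv (one_smul ℝ _))).hasDerivWithinAt
  have hb : ∀ t ∈ Ico (0 : ℝ) 1, ‖A (NormedSpace.exp (t • A) v) - A v‖ ≤ 1 / 2 * ‖A v‖ := by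
    intro t ht
    have hcm : Commute A (NormedSpace.exp (t • A)) := ((Commute.refl A).smul_right t).exp_right
    have h1 : A (NormedSpace.exp (t • A) v) - A v = (NormedSpace.exp (t • A) - 1) (A v) := by
      have := DFunLike.congr_fun hcm.eq v
      change A (NormedSpace.exp (t • A) v) = NormedSpace.exp (t • A) (A v) at this
      rw [this]; simp
    rw [h1]
    refine (ContinuousLinearMap.le_opNorm _ _).trans ?_
    gcongr
    have h2 : dist (t • A) 0 < δ := by
      rw [dist_zero_right, norm_smul, Real.norm_eq_abs, abs_of_nonneg ht.1]
      nlinarith [norm_nonneg A, ht.2, ht.1]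
    have h3 := hd h2
    rw [NormedSpace.exp_zero, dist_eq_norm] at h3
    exact h3.le
  have h := norm_image_sub_le_of_norm_deriv_le_segment_01' hder hb
  simp only [one_smul, hv, zero_smul, NormedSpace.exp_zero] at h
  have h2 : ‖A v‖ ≤ 1 / 2 * ‖A v‖ := by
    refine le_trans (le_of_eq ?_) h
    rw [← norm_neg]; congr 1; simp
  exact norm_eq_zero.1 (by linarith [norm_nonneg (A v)])

end Exponential

theorem exp_apply_of_eigen {𝕂 E : Type*} [RCLike 𝕂] [NormedAddCommGroup E] [NormedSpace 𝕂 E]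
    [CompleteSpace E] {A : E →L[𝕂] E} {v : E} {r : 𝕂} (h : A v = r • v) :
    NormedSpace.exp A v = NormedSpace.exp r • v := by
  have h1 := (NormedSpace.exp_series_hasSum_exp' (𝕂 := 𝕂) A).mapL
    (ContinuousLinearMap.apply 𝕂 E v)
  have h2 := (NormedSpace.exp_series_hasSum_exp' (𝕂 := 𝕂) r).smul_const v
  refine h1.unique ?_
  convert h2 using 2 with n
  have hp : ∀ n : ℕ, (A ^ n) v = r ^ n • v := by
    intro n
    induction n with
    | zero => simp
    | succ n ih => 
      rw [pow_succ', pow_succ', mul_smul]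
      change A ((A ^ n) v) = r • r ^ n • v
      rw [ih, map_smul, h, smul_comm]
  simp [hp, smul_smul]

/-! ### Derivations and inner automorphisms -/

section Derivations

variable {V : Type*} [NormedAddCommGroup V] [InnerProductSpace ℝ V] [EuclideanJordanAlgebra V]
  [FiniteDimensional ℝ V] {l : ℕ} {c : Fin l → V}

instance : CompleteSpace V := FiniteDimensional.complete ℝ V

theorem HasDerivAt.jmul {u v : ℝ → V} {u' v' : V} {t : ℝ} (hu : HasDerivAt u u' t)
    (hv : HasDerivAt v v' t) : HasDerivAt (fun s => u s * v s) (u' * v t + u t * v') t := by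
  have h1 : HasDerivAt (fun s => jordanL (u s)) (jordanL u') t :=
    ((jordanLm (V := V)).toContinuousLinearMap.hasFDerivAt.comp_hasDerivAt t hu)
  exact h1.clm_apply hv

theorem IsDer.exp_mul {D : V →L[ℝ] V} (hD : IsDer D) (x y : V) :
    NormedSpace.exp D (x * y) = NormedSpace.exp D x * NormedSpace.exp D y := by
  have h := linear_ode_unique (A := D) (w := fun t => NormedSpace.exp (t • D) (x * y))
    (u := fun t => NormedSpace.exp (t • D) x * NormedSpace.exp (t • D) y)
    (hasDerivAt_exp_smul_apply D _) (fun t => by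
      rw [hD]
      exact (hasDerivAt_exp_smul_apply D x t).jmul (hasDerivAt_exp_smul_apply D y t)) (by simp) 1
  simpa using h

/-- The infinitesimal action of an operator on bilinear products. -/
def derivAction : (V →L[ℝ] V) →L[ℝ] ((V →L[ℝ] V →L[ℝ] V) →L[ℝ] (V →L[ℝ] V →L[ℝ] V)) :=
  (ContinuousLinearMap.compL ℝ V (V →L[ℝ] V) (V →L[ℝ] V)).comp (ContinuousLinearMap.compL ℝ V V V) -
    (ContinuousLinearMap.compL ℝ V V (V →L[ℝ] V)).flip -
    (ContinuousLinearMap.compL ℝ V (V →L[ℝ] V) (V →L[ℝ] V)).comp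
      (ContinuousLinearMap.compL ℝ V V V).flip

theorem derivAction_apply (D : V →L[ℝ] V) (m : V →L[ℝ] V →L[ℝ] V) (x y : V) :
    derivAction D m x y = D (m x y) - m (D x) y - m x (D y) := rfl

/-- exp of the infinitesimal action on bilinear products is transport of structure by exp(D); both
sides solve the same linear differential equation. -/
theorem exp_derivAction (D : V →L[ℝ] V) (m : V →L[ℝ] V →L[ℝ] V) (x y : V) :
    NormedSpace.exp (derivAction D) m (NormedSpace.exp D x) (NormedSpace.exp D y) =
      NormedSpace.exp D (m x y) := by
  have h := linear_ode_unique (A := D)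
    (w := fun t => NormedSpace.exp (t • derivAction D) m (NormedSpace.exp (t • D) x)
      (NormedSpace.exp (t • D) y))
    (u := fun t => NormedSpace.exp (t • D) (m x y)) (fun t => by
      have h1 := ((hasDerivAt_exp_smul_apply (derivAction D) m t).clm_apply
        (hasDerivAt_exp_smul_apply D x t)).clm_apply (hasDerivAt_exp_smul_apply D y t)
      refine h1.congr_deriv ?_
      simp only [_root_.add_apply, derivAction_apply]
      abel) (hasDerivAt_exp_smul_apply D _) (by simp) 1
  simpa using h

variable (V) in
-- The exponential map is open near 0, so g = exp(D) with D small. That g preserves the product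
-- means that exp(`derivAction D`) fixes it, and `exists_forall_exp_fixed` upgrades this to
-- `derivAction D` annihilating it.
theorem exists_log_automorphism : ∃ δ > 0, ∀ g : V →L[ℝ] V, (∀ x y, g (x * y) = g x * g y) →
    ‖g - 1‖ < δ → ∃ D, IsDer D ∧ g = NormedSpace.exp D := by
  obtain ⟨δ, hδ, hd⟩ := exists_forall_exp_fixed (V →L[ℝ] V →L[ℝ] V)
  have hcont : Continuous fun D : V →L[ℝ] V => ‖derivAction (V := V) D‖ :=
    (derivAction (V := V)).continuous.norm
  have hU : {D : V →L[ℝ] V | ‖derivAction D‖ < δ} ∈ 𝓝 (0 : V →L[ℝ] V) :=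
    (isOpen_lt hcont continuous_const).mem_nhds (by simpa using hδ)
  have hmap : Filter.map (NormedSpace.exp : (V →L[ℝ] V) → (V →L[ℝ] V)) (𝓝 0) = 𝓝 1 := by
    have h := hasStrictFDerivAt_exp_zero (𝕂 := ℝ) (𝔸 := V →L[ℝ] V)
    have h2 : HasStrictFDerivAt (NormedSpace.exp : (V →L[ℝ] V) → (V →L[ℝ] V))
        ((ContinuousLinearEquiv.refl ℝ (V →L[ℝ] V) : (V →L[ℝ] V) ≃L[ℝ] (V →L[ℝ] V)) :
          (V →L[ℝ] V) →L[ℝ] (V →L[ℝ] V)) 0 := h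
    have := h2.map_nhds_eq_of_equiv
    rwa [NormedSpace.exp_zero] at this
  have himg := Filter.image_mem_map (m := (NormedSpace.exp : (V →L[ℝ] V) → (V →L[ℝ] V))) hU
  rw [hmap] at himg
  obtain ⟨r, hr, hball⟩ := Metric.mem_nhds_iff.1 himg
  refine ⟨r, hr, fun g hg hgr => ?_⟩
  obtain ⟨D, hD, rfl⟩ := hball (show g ∈ Metric.ball 1 r by rwa [mem_ball_iff_norm])
  refine ⟨D, ?_, rfl⟩
  let m : V →L[ℝ] V →L[ℝ] V := (jordanLm (V := V)).toContinuousLinearMap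
  have hm : NormedSpace.exp (derivAction D) m = m := by
    ext x y
    have h := exp_derivAction D m (NormedSpace.exp (-D) x) (NormedSpace.exp (-D) y)
    have e : ∀ z, NormedSpace.exp D (NormedSpace.exp (-D) z) = z := fun z =>
      DFunLike.congr_fun (exp_mul_exp_neg D) z
    rw [e, e] at h
    rw [h]
    change NormedSpace.exp D (NormedSpace.exp (-D) x * NormedSpace.exp (-D) y) = x * y
    rw [hg, e, e]
  have h0 := hd _ hD m hm
  intro x y
  have := DFunLike.congr_fun (DFunLike.congr_fun h0 x) y
  rw [derivAction_apply] at this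
  change D (x * y) - D x * y - x * D y = 0 at this
  rw [← sub_eq_zero, ← this]; abel

variable (V) in
/-- The space of inner derivations. -/
def innDer : Submodule ℝ (V →L[ℝ] V) := Submodule.span ℝ {D | ∃ a b : V, D = innerDer a b}

theorem innerDer_mem (a b : V) : innerDer a b ∈ innDer V := Submodule.subset_span ⟨a, b, rfl⟩

theorem isDer_of_mem_innDer {D : V →L[ℝ] V} (hD : D ∈ innDer V) : IsDer D := by
  induction hD using Submodule.span_induction with
  | mem z hz => obtain ⟨a, b, rfl⟩ := hz; exact isDer_innerDer a b
  | zero => intro x y; simp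
  | add S T _ _ hS hT => intro x y; simp only [clm_add, hS x y, hT x y, add_mul, mul_add]; abel
  | smul r S _ hS => intro x y; simp only [clm_smul, hS x y, smul_add, smul_mul_assoc, mul_smul_comm]

theorem skew_of_mem_innDer {D : V →L[ℝ] V} (hD : D ∈ innDer V) (x y : V) :
    inner ℝ (D x) y = - inner ℝ x (D y) := by
  induction hD using Submodule.span_induction with
  | mem z hz => obtain ⟨a, b, rfl⟩ := hz; exact innerDer_skew a b x y
  | zero => simp
  | add S T _ _ hS hT => simp only [clm_add, inner_add_left, inner_add_right, hS, hT]; ring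
  | smul r S _ hS =>
    simp only [clm_smul, inner_smul_left, inner_smul_right, hS, RCLike.conj_to_real]; ring

theorem opTr_mul_self_eq_zero_symm {T : V →L[ℝ] V} (hT : ∀ x y, inner ℝ (T x) y = inner ℝ x (T y))
    (h : opTr (T * T) = 0) : T = 0 := by
  set b := stdOrthonormalBasis ℝ V
  rw [opTr_eq_sum b] at h
  have h1 : ∀ i, inner ℝ (b i) ((T * T) (b i)) = ‖T (b i)‖ ^ 2 := fun i => by
    rw [clm_mul, ← hT, real_inner_self_eq_norm_sq]
  simp only [h1] at h
  have h2 := (Finset.sum_eq_zero_iff_of_nonneg fun i _ => by positivity).1 h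
  refine ContinuousLinearMap.coe_injective (b.toBasis.ext fun i => ?_)
  have := h2 i (Finset.mem_univ i)
  simpa using this

theorem opTr_mul_self_eq_zero_skew {T : V →L[ℝ] V} (hT : ∀ x y, inner ℝ (T x) y = - inner ℝ x (T y))
    (h : opTr (T * T) = 0) : T = 0 := by
  set b := stdOrthonormalBasis ℝ V
  rw [opTr_eq_sum b] at h
  have h1 : ∀ i, inner ℝ (b i) ((T * T) (b i)) = - ‖T (b i)‖ ^ 2 := fun i => by
    rw [clm_mul, ← neg_neg (inner ℝ (b i) (T (T (b i)))), ← hT, real_inner_self_eq_norm_sq]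
  simp only [h1, Finset.sum_neg_distrib, neg_eq_zero] at h
  have h2 := (Finset.sum_eq_zero_iff_of_nonneg fun i _ => by positivity).1 h
  refine ContinuousLinearMap.coe_injective (b.toBasis.ext fun i => ?_)
  have := h2 i (Finset.mem_univ i)
  simpa using this

/-- Derivations of a Euclidean Jordan algebra are inner. -/
theorem IsDer.mem_innDer {D : V →L[ℝ] V} (hD : IsDer D) : D ∈ innDer V := by
  let B : innDer V →ₗ[ℝ] Module.Dual ℝ (innDer V) :=
    LinearMap.mk₂ ℝ (fun S T : innDer V => opTr ((S : V →L[ℝ] V) * (T : V →L[ℝ] V)))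
      (fun S S' T => by simp [add_mul]) (fun r S T => by simp)
      (fun S T T' => by simp [mul_add]) (fun r S T => by simp)
  -- Inner derivations are skew, so the trace form is negative definite on them. Hence some inner
  -- derivation `D0` has the same trace pairings with inner derivations as `D`.
  have hinj : Function.Injective B := by
    rw [injective_iff_map_eq_zero]
    intro S hS
    have h := DFunLike.congr_fun hS S
    exact Subtype.ext (opTr_mul_self_eq_zero_skew (skew_of_mem_innDer S.2) h)
  have hsurj : Function.Surjective B :=
    (LinearMap.injective_iff_surjective_of_finrank_eq_finrank
      (Subspace.dual_finrank_eq (K := ℝ) (V := innDer V)).symm).1 hinj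
  let f : Module.Dual ℝ (innDer V) :=
    { toFun := fun T => opTr (D * (T : V →L[ℝ] V))
      map_add' := fun S T => by simp [mul_add]
      map_smul' := fun r S => by simp }
  obtain ⟨D0, hD0⟩ := hsurj f
  have hd : IsDer (D - (D0 : V →L[ℝ] V)) := by
    intro x y
    have := isDer_of_mem_innDer D0.2 x y
    simp only [clm_sub, hD x y, this, sub_mul, mul_sub]; abel
  have htr : ∀ a b, opTr ((D - (D0 : V →L[ℝ] V)) * innerDer a b) = 0 := by
    intro a b
    have h := DFunLike.congr_fun hD0 ⟨innerDer a b, innerDer_mem a b⟩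
    change opTr ((D0 : V →L[ℝ] V) * innerDer a b) = opTr (D * innerDer a b) at h
    rw [sub_mul, map_sub, h, sub_self]
  have hz : D - (D0 : V →L[ℝ] V) = 0 := by
    ext a
    set T := D - (D0 : V →L[ℝ] V)
    -- With T = D - D0, tr(L(Ta)²) = tr([T, L(a)] L(Ta)) = tr(T [L(a), L(Ta)]), which vanishes by
    -- the choice of `D0`. Definiteness on symmetric operators gives L(Ta) = 0, hence Ta = 0.
    have h1 : opTr (jordanL (T a) * jordanL (T a)) = 0 := by
      have e : opTr (jordanL (T a) * jordanL (T a)) =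
          opTr ((T * jordanL a - jordanL a * T) * jordanL (T a)) := by rw [hd.comm_jordanL a]
      have e2 := htr a (T a)
      rw [innerDer, mul_sub, map_sub, ← mul_assoc, ← mul_assoc,
        opTr_mul_comm (T * jordanL (T a)), ← mul_assoc] at e2
      rw [e, sub_mul, map_sub, e2]
    have h2 := opTr_mul_self_eq_zero_symm (T := jordanL (T a)) (inner_jmul_left _) h1
    have h3 := DFunLike.congr_fun h2 1
    simpa [jmul_one] using h3
  rw [sub_eq_zero.1 hz]
  exact D0.2

end Derivations
end

noncomputable section

/-! ### Inner automorphisms and diagonalization -/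

section Diagonalization

variable {V : Type*} [NormedAddCommGroup V] [InnerProductSpace ℝ V] [EuclideanJordanAlgebra V]
  [FiniteDimensional ℝ V] {l : ℕ} {c : Fin l → V}

/-- `g` is multiplicative and preserves the inner product. -/
def IsOrthAut (g : V →L[ℝ] V) : Prop :=
  (∀ x y, g (x * y) = g x * g y) ∧ ∀ x y, inner ℝ (g x) (g y) = inner ℝ x y

variable (V) in
/-- The group generated by the exponentials of inner derivations. -/
def innGroup : Subgroup (V →L[ℝ] V)ˣ :=
  Subgroup.closure {g | ∃ D ∈ innDer V, (g : V →L[ℝ] V) = NormedSpace.exp D}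

theorem units_apply_inv (g : (V →L[ℝ] V)ˣ) (x : V) :
    (g : V →L[ℝ] V) (((g⁻¹ : (V →L[ℝ] V)ˣ) : V →L[ℝ] V) x) = x :=
  DFunLike.congr_fun g.mul_inv x

theorem units_inv_apply (g : (V →L[ℝ] V)ˣ) (x : V) :
    ((g⁻¹ : (V →L[ℝ] V)ˣ) : V →L[ℝ] V) ((g : V →L[ℝ] V) x) = x :=
  DFunLike.congr_fun g.inv_mul x

theorem inner_exp_of_skew {D : V →L[ℝ] V} (hD : ∀ x y, inner ℝ (D x) y = - inner ℝ x (D y))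
    (x y : V) : inner ℝ (NormedSpace.exp D x) (NormedSpace.exp D y) = inner ℝ x y := by
  have h : ∀ t : ℝ, HasDerivAt (fun t : ℝ => inner ℝ (NormedSpace.exp (t • D) x)
      (NormedSpace.exp (t • D) y)) 0 t := by
    intro t
    refine ((hasDerivAt_exp_smul_apply D x t).inner ℝ
      (hasDerivAt_exp_smul_apply D y t)).congr_deriv ?_
    rw [hD]; ring
  have := is_const_of_deriv_eq_zero (fun s => (h s).differentiableAt) (fun s => (h s).deriv) 1 0
  simpa using this

theorem isOrthAut_exp {D : V →L[ℝ] V} (hD : D ∈ innDer V) : IsOrthAut (NormedSpace.exp D) :=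
  ⟨fun x y => (isDer_of_mem_innDer hD).exp_mul x y, inner_exp_of_skew (skew_of_mem_innDer hD)⟩

theorem IsOrthAut.inv {g : (V →L[ℝ] V)ˣ} (hg : IsOrthAut (g : V →L[ℝ] V)) :
    IsOrthAut ((g⁻¹ : (V →L[ℝ] V)ˣ) : V →L[ℝ] V) := by
  refine ⟨fun x y => ?_, fun x y => ?_⟩
  · conv_lhs => rw [← units_apply_inv g x, ← units_apply_inv g y]
    rw [← hg.1, units_inv_apply]
  · conv_rhs => rw [← units_apply_inv g x, ← units_apply_inv g y]
    rw [hg.2]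

theorem isOrthAut_of_mem_innGroup {g : (V →L[ℝ] V)ˣ} (hg : g ∈ innGroup V) :
    IsOrthAut (g : V →L[ℝ] V) := by
  induction hg using Subgroup.closure_induction with
  | mem x hx => obtain ⟨D, hD, h⟩ := hx; rw [h]; exact isOrthAut_exp hD
  | one => exact ⟨fun x y => rfl, fun x y => rfl⟩
  | mul x y _ _ hx hy =>
    refine ⟨fun u v => ?_, fun u v => ?_⟩
    · rw [Units.val_mul, clm_mul, clm_mul, clm_mul, hy.1, hx.1]
    · rw [Units.val_mul, clm_mul, clm_mul, hx.2, hy.2]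
  | inv x _ hx => exact hx.inv

theorem expUnit_mem_innGroup {D : V →L[ℝ] V} (hD : D ∈ innDer V) : expUnit D ∈ innGroup V :=
  Subgroup.subset_closure ⟨D, hD, rfl⟩

theorem IsOrthAut.norm_map {g : V →L[ℝ] V} (hg : IsOrthAut g) (x : V) : ‖g x‖ = ‖x‖ := by
  have h := hg.2 x x
  rw [real_inner_self_eq_norm_sq, real_inner_self_eq_norm_sq] at h
  exact (sq_eq_sq₀ (norm_nonneg _) (norm_nonneg _)).1 h

theorem IsOrthAut.opNorm_le {g : V →L[ℝ] V} (hg : IsOrthAut g) : ‖g‖ ≤ 1 :=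
  g.opNorm_le_bound zero_le_one fun x => by rw [hg.norm_map, one_mul]

theorem isClosed_isOrthAut : IsClosed {g : V →L[ℝ] V | IsOrthAut g} := by
  have h1 : {g : V →L[ℝ] V | IsOrthAut g} =
      (⋂ x, ⋂ y, {g : V →L[ℝ] V | g (x * y) = g x * g y}) ∩
      ⋂ x, ⋂ y, {g : V →L[ℝ] V | inner ℝ (g x) (g y) = inner ℝ x y} := by
    ext g; simp [IsOrthAut]
  rw [h1]
  have ha : ∀ x : V, Continuous fun g : V →L[ℝ] V => g x := fun x =>
    (ContinuousLinearMap.apply ℝ V x).continuous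
  refine IsClosed.inter (isClosed_iInter fun x => isClosed_iInter fun y => ?_)
    (isClosed_iInter fun x => isClosed_iInter fun y => ?_)
  · exact isClosed_eq (ha _) ((continuous_jordanL.comp (ha x)).clm_apply (ha y))
  · exact isClosed_eq ((ha x).inner (ha y)) continuous_const

/-- Elements of the closure of the inner automorphism group belong to it. -/
theorem exists_mem_innGroup_of_closure {k : V →L[ℝ] V}
    (hk : k ∈ closure ((fun g : (V →L[ℝ] V)ˣ => (g : V →L[ℝ] V)) '' (innGroup V))) :
    ∃ g ∈ innGroup V, (g : V →L[ℝ] V) = k := by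
  obtain ⟨δ, hδ, hd⟩ := exists_log_automorphism V
  have hko : IsOrthAut k := by
    refine (isClosed_isOrthAut.closure_subset_iff.2 ?_) hk
    rintro _ ⟨g, hg, rfl⟩
    exact isOrthAut_of_mem_innGroup hg
  obtain ⟨_, ⟨g, hg, rfl⟩, hgk⟩ := Metric.mem_closure_iff.1 hk δ hδ
  set gi : V →L[ℝ] V := ((g⁻¹ : (V →L[ℝ] V)ˣ) : V →L[ℝ] V) with hgi
  have hgo := isOrthAut_of_mem_innGroup (inv_mem hg)
  -- Since g⁻¹ is orthogonal, k g⁻¹ is as close to 1 as k is to g, so it is the exponential of a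
  -- derivation, which is inner.
  obtain ⟨D, hD, hkD⟩ := hd (k * gi) (fun x y => by
      rw [clm_mul, clm_mul, clm_mul, hgo.1, hko.1]) (by
    have h1 : k * gi - 1 = (k - g) * gi := by rw [sub_mul, hgi, g.mul_inv]
    rw [h1]
    calc ‖(k - g) * gi‖ ≤ ‖k - g‖ * ‖gi‖ := norm_mul_le _ _
      _ ≤ ‖k - g‖ * 1 := by gcongr; exact hgo.opNorm_le
      _ < δ := by rw [mul_one, ← dist_eq_norm]; exact hgk)
  refine ⟨expUnit D * g, mul_mem (expUnit_mem_innGroup hD.mem_innDer) hg, ?_⟩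
  rw [Units.val_mul, coe_expUnit, ← hkD, mul_assoc, hgi, g.inv_mul, mul_one]

/-- L(u) preserves the eigenspaces of L(`genericElt`), so u c_i lies in V_ii = ℝ c_i; summing over i
recovers u. -/
theorem IsJordanFrame.mem_span_of_commute (hc : IsJordanFrame c) {u : V}
    (hu : ∀ a, u * (genericElt c * a) = genericElt c * (u * a)) :
    ∃ t : Fin l → ℝ, u = ∑ j, t j • c j := by
  have h1 : ∀ i, ∃ t : ℝ, u * c i = t • c i := by
    intro i
    refine hc.eq_smul_of_mem_diag (hc.mem_peirce_of_generic ?_)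
    rw [← hu]
    unfold genericElt
    rw [frame_sum_mul _ (hc.self_mem i), mul_smul_comm]
  choose t ht using h1
  refine ⟨t, ?_⟩
  conv_lhs => rw [← jmul_one u, ← hc.sum_eq, Finset.mul_sum]
  exact Finset.sum_congr rfl fun i _ => ht i

/-- Every element is conjugate under the inner automorphism group to an element of the span of a
given Jordan frame. -/
theorem IsJordanFrame.exists_diag (hc : IsJordanFrame c) (x : V) :
    ∃ k ∈ innGroup V, ∃ t : Fin l → ℝ, (k : V →L[ℝ] V) x = ∑ j, t j • c j := by
  set S : Set (V →L[ℝ] V) := (fun g : (V →L[ℝ] V)ˣ => (g : V →L[ℝ] V)) '' (innGroup V) with hS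
  have hbd : Bornology.IsBounded S := by
    refine (Metric.isBounded_closedBall (x := (0 : V →L[ℝ] V)) (r := 1)).subset ?_
    rintro _ ⟨g, hg, rfl⟩
    simpa using (isOrthAut_of_mem_innGroup hg).opNorm_le
  have : ProperSpace (V →L[ℝ] V) := FiniteDimensional.proper ℝ _
  have hcomp : IsCompact (closure S) := hbd.isCompact_closure
  have hcont : Continuous fun g : V →L[ℝ] V => inner ℝ (g x) (genericElt c) :=
    ((ContinuousLinearMap.apply ℝ V x).continuous).inner continuous_const
  obtain ⟨k, hk, hmax⟩ := hcomp.exists_isMaxOn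
    ⟨1, subset_closure ⟨1, one_mem _, rfl⟩⟩ hcont.continuousOn
  -- The maximizer of k ↦ ⟪kx, `genericElt`⟫ over the compact closure is critical along every
  -- exp(t[L(a), L(b)]). By associativity of the inner product this says that L(kx) and
  -- L(`genericElt`) commute, so kx is diagonal.
  have hcrit : ∀ a b, inner ℝ (innerDer a b (k x)) (genericElt c) = 0 := by
    intro a b
    have hloc : IsLocalMax (fun t : ℝ => inner ℝ (NormedSpace.exp (t • innerDer a b) (k x))
        (genericElt c)) 0 := by
      refine Filter.Eventually.of_forall fun t => ?_
      have hmem : NormedSpace.exp (t • innerDer a b) * k ∈ closure S := by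
        refine map_mem_closure (f := fun g => NormedSpace.exp (t • innerDer a b) * g)
          (continuous_const.mul continuous_id) hk ?_
        rintro _ ⟨g, hg, rfl⟩
        exact ⟨expUnit (t • innerDer a b) * g, mul_mem (expUnit_mem_innGroup
          (Submodule.smul_mem _ _ (innerDer_mem a b))) hg, rfl⟩
      have := hmax hmem
      simpa using this
    have h0 := hloc.hasDerivAt_eq_zero ((hasDerivAt_exp_smul_apply (innerDer a b) (k x) 0).inner ℝ
      (hasDerivAt_const 0 (genericElt c)))
    simpa using h0
  obtain ⟨t, ht⟩ := hc.mem_span_of_commute (u := k x) (by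
    intro a
    rw [← sub_eq_zero]
    refine ext_inner_right ℝ fun b => ?_
    have h := hcrit a b
    rw [innerDer_apply, inner_sub_left, inner_jmul_left a, inner_jmul_left b (a * k x)] at h
    set u := k x
    set g := genericElt c
    rw [inner_zero_left, inner_sub_left, real_inner_comm, real_inner_comm b (g * (u * a))]
    have e1 : inner ℝ b (u * (g * a)) = inner ℝ (b * u) (a * g) := by
      rw [← inner_jmul_left, mul_comm u b, mul_comm g a]
    have e2 : inner ℝ b (g * (u * a)) = inner ℝ (a * u) (b * g) := by
      rw [← inner_jmul_left, mul_comm g b, mul_comm u a, real_inner_comm]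
    rw [e1, e2]; exact h)
  obtain ⟨g, hg, rfl⟩ := exists_mem_innGroup_of_closure hk
  exact ⟨g, hg, t, ht⟩

theorem IsOrthAut.map_one {g : (V →L[ℝ] V)ˣ} (hg : IsOrthAut (g : V →L[ℝ] V)) :
    (g : V →L[ℝ] V) (1 : V) = 1 := by
  have h := hg.1 1 (((g⁻¹ : (V →L[ℝ] V)ˣ) : V →L[ℝ] V) 1)
  rw [jone_mul, units_apply_inv, jmul_one] at h
  exact h.symm

theorem IsJordanFrame.map (hc : IsJordanFrame c) {g : (V →L[ℝ] V)ˣ}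
    (hg : IsOrthAut (g : V →L[ℝ] V)) : IsJordanFrame fun i => (g : V →L[ℝ] V) (c i) := by
  have hgi := hg.inv
  have h1 := hg.map_one
  have h2 : ∀ x, (g : V →L[ℝ] V) x = 0 → x = 0 := fun x hx => by
    rw [← units_inv_apply g x, hx, map_zero]
  refine ⟨fun i => ⟨?_, ?_, ?_⟩, fun i j hij => ?_, ?_⟩
  · rw [← hg.1, hc.idem]
  · exact fun h => hc.ne_zero i (h2 _ h)
  · intro a b ha hb hab
    have h3 := congrArg ((g⁻¹ : (V →L[ℝ] V)ˣ) : V →L[ℝ] V) hab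
    rw [map_add, units_inv_apply] at h3
    rcases (hc.1 i).2.2 _ _ (by rw [← hgi.1, ha]) (by rw [← hgi.1, hb]) h3 with h | h
    · left; rw [← units_apply_inv g a, h, map_zero]
    · right; rw [← units_apply_inv g b, h, map_zero]
  · rw [← hg.1, hc.orth hij, map_zero]
  · rw [← map_sum, hc.sum_eq, h1]

/-- The spectral theorem: every element is diagonal in a Jordan frame conjugate to a given one. -/
theorem IsJordanFrame.exists_spectral (hc : IsJordanFrame c) (x : V) :
    ∃ k ∈ innGroup V, ∃ t : Fin l → ℝ, IsJordanFrame (fun i => (k : V →L[ℝ] V) (c i)) ∧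
      x = ∑ j, t j • (k : V →L[ℝ] V) (c j) := by
  obtain ⟨k, hk, t, h⟩ := hc.exists_diag x
  refine ⟨k⁻¹, inv_mem hk, t, hc.map (isOrthAut_of_mem_innGroup (inv_mem hk)), ?_⟩
  rw [← units_inv_apply k x, h, map_sum]
  simp

end Diagonalization
end

noncomputable section

/-! ### The symmetric cone -/

section Cone

variable {V : Type*} [NormedAddCommGroup V] [InnerProductSpace ℝ V] [EuclideanJordanAlgebra V]
  [FiniteDimensional ℝ V] {l : ℕ} {c : Fin l → V}

theorem PeirceBasis.sum_mul (B : PeirceBasis c) (s : Fin l → ℝ) (a) :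
    (∑ j, s j • c j) * B.b a = ((s (B.p a) + s (B.q a)) / 2) • B.b a :=
  frame_sum_mul s (B.mem a)

theorem PeirceBasis.inner_sum_mul (B : PeirceBasis c) (s : Fin l → ℝ) (u : V) :
    inner ℝ ((∑ j, s j • c j) * u) u =
      ∑ a, (s (B.p a) + s (B.q a)) / 2 * inner ℝ (B.b a) u ^ 2 := by
  have h : (∑ j, s j • c j) * u =
      ∑ a, (∑ j, s j • c j) * ((inner ℝ (B.b a) u : ℝ) • B.b a) := by
    rw [← Finset.mul_sum, B.b.sum_repr' u]
  rw [h, sum_inner]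
  refine Finset.sum_congr rfl fun a _ => ?_
  rw [mul_smul_comm, B.sum_mul, inner_smul_left, inner_smul_left]
  simp only [RCLike.conj_to_real]; ring

namespace IsJordanFrame
variable (hc : IsJordanFrame c)
include hc

theorem sum_mul_sum (s t : Fin l → ℝ) :
    (∑ j, s j • c j) * (∑ j, t j • c j) = ∑ j, (s j * t j) • c j := by
  rw [Finset.mul_sum]
  refine Finset.sum_congr rfl fun j _ => ?_
  rw [mul_smul_comm, frame_sum_mul s (hc.self_mem j), smul_smul]
  congr 1; ring

theorem inner_sum_frame (s : Fin l → ℝ) (j : Fin l) :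
    inner ℝ ((∑ i, s i • c i) * c j) (c j) = s j * ‖c j‖ ^ 2 := by
  rw [frame_sum_mul s (hc.self_mem j), inner_smul_left, real_inner_self_eq_norm_sq]
  simp

end IsJordanFrame

theorem inner_mul_self_nonneg {c : Fin l → V} (hc : IsJordanFrame c) (y u : V) :
    0 ≤ inner ℝ ((y * y) * u) u := by
  obtain ⟨k, -, t, hf, rfl⟩ := hc.exists_spectral y
  obtain ⟨B⟩ := hf.nonempty_peirceBasis
  rw [hf.sum_mul_sum, B.inner_sum_mul]
  exact Finset.sum_nonneg fun a _ => by
    have := mul_self_nonneg (t (B.p a))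
    have := mul_self_nonneg (t (B.q a))
    positivity

/-- The spectral theorem identifies squares with the elements all of whose eigenvalues are
nonnegative, that is, L(x) ≥ 0. Its interior version `mem_cone_iff` replaces this by L(x) ≥ δ for
some δ > 0. -/
theorem IsJordanFrame.mem_squares_iff (hc : IsJordanFrame c) {x : V} :
    x ∈ range (fun x : V => x * x) ↔ ∀ u, 0 ≤ inner ℝ (x * u) u := by
  constructor
  · rintro ⟨y, rfl⟩ u
    exact inner_mul_self_nonneg hc y u
  · intro h
    obtain ⟨k, -, t, hf, rfl⟩ := hc.exists_spectral x
    have ht : ∀ j, 0 ≤ t j := by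
      intro j
      have h1 := h ((k : V →L[ℝ] V) (c j))
      rw [hf.inner_sum_frame] at h1
      have h2 : 0 < ‖(k : V →L[ℝ] V) (c j)‖ ^ 2 := by
        have := norm_pos_iff.2 (hf.ne_zero j)
        positivity
      exact nonneg_of_mul_nonneg_left h1 h2
    refine ⟨∑ j, Real.sqrt (t j) • (k : V →L[ℝ] V) (c j), ?_⟩
    simp only [hf.sum_mul_sum, Real.mul_self_sqrt (ht _)]

theorem IsJordanFrame.mem_cone_iff (hc : IsJordanFrame c) {x : V} :
    x ∈ symmetricCone V ↔ ∃ δ > 0, ∀ u, δ * ‖u‖ ^ 2 ≤ inner ℝ (x * u) u := by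
  constructor
  · intro hx
    have hcont : Continuous fun ε : ℝ => x - ε • (1 : V) := by fun_prop
    have hU : (fun ε : ℝ => x - ε • (1 : V)) ⁻¹' (range fun x : V => x * x) ∈ 𝓝 (0 : ℝ) :=
      hcont.continuousAt.preimage_mem_nhds (by simpa using mem_interior_iff_mem_nhds.1 hx)
    obtain ⟨r, hr, hball⟩ := Metric.mem_nhds_iff.1 hU
    refine ⟨r / 2, by positivity, fun u => ?_⟩
    have h1 := hball (show r / 2 ∈ Metric.ball (0 : ℝ) r by
      rw [Metric.mem_ball, dist_zero_right, Real.norm_eq_abs, abs_of_pos (by positivity)]; linarith)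
    have h2 := hc.mem_squares_iff.1 h1 u
    rw [sub_mul, smul_mul_assoc, jone_mul, inner_sub_left, inner_smul_left,
      real_inner_self_eq_norm_sq] at h2
    simp only [RCLike.conj_to_real] at h2
    linarith
  · rintro ⟨δ, hδ, h⟩
    rw [symmetricCone, mem_interior_iff_mem_nhds]
    have hcont : Continuous fun y : V => ‖jordanL (y - x)‖ :=
      (continuous_jordanL.comp (continuous_id.sub continuous_const)).norm
    have hU : {y : V | ‖jordanL (y - x)‖ < δ} ∈ 𝓝 x :=
      (isOpen_lt hcont continuous_const).mem_nhds (by simpa using hδ)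
    refine Filter.mem_of_superset hU fun y hy => hc.mem_squares_iff.2 fun u => ?_
    have h1 := h u
    have h2 : |inner ℝ ((y - x) * u) u| ≤ δ * ‖u‖ ^ 2 := by
      refine (abs_real_inner_le_norm _ _).trans ?_
      have h3 := (jordanL (y - x)).le_opNorm u
      rw [jordanL_apply] at h3
      have h4 : ‖jordanL (y - x)‖ ≤ δ := le_of_lt hy
      nlinarith [norm_nonneg u, mul_le_mul_of_nonneg_right h4 (norm_nonneg u)]
    have h5 : inner ℝ (y * u) u = inner ℝ (x * u) u + inner ℝ ((y - x) * u) u := by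
      rw [← inner_add_left, ← add_mul]; congr 2; abel
    rw [h5]
    linarith [neg_le_of_abs_le h2]

theorem IsJordanFrame.sum_mem_cone_iff (hc : IsJordanFrame c) (s : Fin l → ℝ) :
    ∑ j, s j • c j ∈ symmetricCone V ↔ ∀ j, 0 < s j := by
  constructor
  · intro h j
    obtain ⟨δ, hδ, h⟩ := hc.mem_cone_iff.1 h
    have h1 := h (c j)
    rw [hc.inner_sum_frame] at h1
    have h2 : 0 < ‖c j‖ ^ 2 := by
      have := norm_pos_iff.2 (hc.ne_zero j)
      positivity
    have : δ ≤ s j := le_of_mul_le_mul_right h1 h2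
    linarith
  · intro h
    obtain ⟨B⟩ := hc.nonempty_peirceBasis
    by_cases hl : Nonempty (Fin l)
    · obtain ⟨j0, hj0⟩ := Finite.exists_min s
      refine hc.mem_cone_iff.2 ⟨s j0, h j0, fun u => ?_⟩
      rw [B.inner_sum_mul, ← B.b.sum_sq_inner_right u, Finset.mul_sum]
      refine Finset.sum_le_sum fun a _ => ?_
      have h1 := hj0 (B.p a)
      have h2 := hj0 (B.q a)
      gcongr
      linarith
    · refine hc.mem_cone_iff.2 ⟨1, one_pos, fun u => ?_⟩
      have : (1 : V) = 0 := by
        rw [← hc.sum_eq]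
        exact Finset.sum_eq_zero fun i _ => absurd ⟨i⟩ hl
      have hu : u = 0 := by rw [← jone_mul u, this, zero_mul]
      simp [hu]

theorem IsJordanFrame.closure_cone_subset (hc : IsJordanFrame c) :
    closure (symmetricCone V) ⊆ {x : V | ∀ u, 0 ≤ inner ℝ (x * u) u} := by
  refine closure_minimal (fun x hx u => ?_) ?_
  · exact hc.mem_squares_iff.1 (interior_subset hx) u
  · have : {x : V | ∀ u, 0 ≤ inner ℝ (x * u) u} = ⋂ u, {x : V | 0 ≤ inner ℝ (x * u) u} := by
      ext; simp
    rw [this]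
    refine isClosed_iInter fun u => isClosed_le continuous_const ?_
    have h1 : Continuous fun x : V => jordanL x u :=
      continuous_jordanL.clm_apply continuous_const
    exact h1.inner continuous_const

theorem IsJordanFrame.one_mem_cone (hc : IsJordanFrame c) : (1 : V) ∈ symmetricCone V := by
  have := (hc.sum_mem_cone_iff fun _ => 1).2 fun _ => one_pos
  simpa [hc.sum_eq] using this

theorem IsJordanFrame.quadP_sum_frame (hc : IsJordanFrame c) (s : Fin l → ℝ) (j : Fin l) :
    quadP (∑ i, s i • c i) (∑ i, s i • c i) (c j) = (s j ^ 2) • c j := by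
  rw [quadP_apply, hc.sum_mul_sum]
  simp only [frame_sum_mul _ (hc.self_mem j), mul_smul_comm, smul_smul, ← sub_smul, ← add_smul]
  congr 1; ring

/-- A path of elements with injective quadratic representation that starts in the cone stays in
the cone. -/
theorem IsJordanFrame.path_mem_cone (hc : IsJordanFrame c) {γ : ℝ → V} (hγ : Continuous γ)
    (h0 : γ 0 ∈ symmetricCone V) (hP : ∀ t, Function.Injective (quadP (γ t) (γ t))) (t : ℝ) :
    γ t ∈ symmetricCone V := by
  have hpre : IsPreconnected (range γ) := isPreconnected_range hγ
  refine hpre.subset_of_closure_inter_subset isOpen_interior ⟨γ 0, ⟨0, rfl⟩, h0⟩ ?_ ⟨t, rfl⟩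
  rintro _ ⟨hx, s, rfl⟩
  have hx2 := hc.closure_cone_subset hx
  have hinj := hP s
  obtain ⟨k, -, r, hf, hr⟩ := hc.exists_spectral (γ s)
  change γ s ∈ symmetricCone V
  rw [hr] at hx2 hinj ⊢
  rw [hf.sum_mem_cone_iff]
  intro j
  have h1 := hx2 ((k : V →L[ℝ] V) (c j))
  rw [hf.inner_sum_frame] at h1
  have h2 : 0 < ‖(k : V →L[ℝ] V) (c j)‖ ^ 2 := by
    have := norm_pos_iff.2 (hf.ne_zero j)
    positivity
  -- A point in the closure of the cone has nonnegative eigenvalues; a zero eigenvalue r_j would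
  -- make the quadratic representation kill c_j.
  refine lt_of_le_of_ne (nonneg_of_mul_nonneg_left h1 h2) fun h3 => ?_
  have h4 := hf.quadP_sum_frame r j
  rw [← h3] at h4
  apply hf.ne_zero j
  refine hinj ?_
  rw [h4, map_zero]; simp

theorem HasDerivAt.quadP {u v : ℝ → V} {u' v' : V} {t : ℝ} (hu : HasDerivAt u u' t)
    (hv : HasDerivAt v v' t) :
    HasDerivAt (fun s => quadP (u s) (v s)) (quadP u' (v t) + quadP (u t) v') t := by
  have hL : ∀ {w : ℝ → V} {w' : V}, HasDerivAt w w' t →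
      HasDerivAt (fun s => jordanL (w s)) (jordanL w') t := fun hw =>
    ((jordanLm (V := V)).toContinuousLinearMap.hasFDerivAt.comp_hasDerivAt t hw)
  refine ((((hL hu).mul (hL hv)).add ((hL hv).mul (hL hu))).sub (hL (hu.jmul hv))).congr_deriv ?_
  simp only [_root_.quadP, jordanL_add]
  abel

theorem adjoint_jordanL (a : V) : ContinuousLinearMap.adjoint (jordanL a) = jordanL a :=
  ((ContinuousLinearMap.eq_adjoint_iff _ _).2 (inner_jmul_left a)).symm

theorem adjoint_innDer {D : V →L[ℝ] V} (hD : D ∈ innDer V) :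
    ContinuousLinearMap.adjoint D = -D :=
  ((ContinuousLinearMap.eq_adjoint_iff _ _).2 fun x y => by
    rw [clm_neg, inner_neg_left, skew_of_mem_innDer hD, neg_neg]).symm

variable (V) in
/-- The Lie algebra `L(V) + Der(V)` of the structure group. -/
def strLie : Submodule ℝ (V →L[ℝ] V) := LinearMap.range (jordanLm (V := V)) ⊔ innDer V

theorem mem_strLie {X : V →L[ℝ] V} :
    X ∈ strLie V ↔ ∃ a, ∃ D ∈ innDer V, X = jordanL a + D := by
  rw [strLie, Submodule.mem_sup]
  constructor
  · rintro ⟨_, ⟨a, rfl⟩, D, hD, rfl⟩; exact ⟨a, D, hD, rfl⟩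
  · rintro ⟨a, D, hD, rfl⟩; exact ⟨_, ⟨a, rfl⟩, D, hD, rfl⟩

theorem jordanL_mem_strLie (a : V) : jordanL a ∈ strLie V :=
  mem_strLie.2 ⟨a, 0, zero_mem _, by simp⟩

theorem innDer_le_strLie : innDer V ≤ strLie V := le_sup_right

theorem strLie_quadP {X : V →L[ℝ] V} (hX : X ∈ strLie V) (x y : V) :
    X * quadP x y + quadP x y * ContinuousLinearMap.adjoint X =
      quadP (X x) y + quadP x (X y) := by
  obtain ⟨a, D, hD, rfl⟩ := mem_strLie.1 hX
  rw [map_add, adjoint_jordanL, adjoint_innDer hD]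
  have h1 := jordanL_quadP a x y
  have h2 := (isDer_of_mem_innDer hD).quadP x y
  have e1 : quadP ((jordanL a + D) x) y = quadP (a * x) y + quadP (D x) y := by
    rw [clm_add, jordanL_apply, IsJordanFrame.quadP_add_left]
  have e2 : quadP x ((jordanL a + D) y) = quadP x (a * y) + quadP x (D y) := by
    rw [clm_add, jordanL_apply, quadP_comm, IsJordanFrame.quadP_add_left, quadP_comm x, quadP_comm x]
  rw [e1, e2, add_add_add_comm, ← h1, ← h2]
  noncomm_ring

theorem adjoint_exp (X : V →L[ℝ] V) :
    ContinuousLinearMap.adjoint (NormedSpace.exp X) =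
      NormedSpace.exp (ContinuousLinearMap.adjoint X) := by
  let _ : NormedAlgebra ℚ (V →L[ℝ] V) := NormedAlgebra.restrictScalars ℚ ℝ _
  exact NormedSpace.star_exp X

/-- Both sides, with X replaced by tX, solve T' = XT + TX*, by the infinitesimal identity
`strLie_quadP`. -/
theorem quadP_exp {X : V →L[ℝ] V} (hX : X ∈ strLie V) (x y : V) :
    quadP (NormedSpace.exp X x) (NormedSpace.exp X y) =
      NormedSpace.exp X * quadP x y * ContinuousLinearMap.adjoint (NormedSpace.exp X) := by
  let A : (V →L[ℝ] V) →L[ℝ] (V →L[ℝ] V) := ContinuousLinearMap.mul ℝ (V →L[ℝ] V) X +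
    (ContinuousLinearMap.mul ℝ (V →L[ℝ] V)).flip (ContinuousLinearMap.adjoint X)
  have h := linear_ode_unique (A := A)
    (w := fun t => quadP (NormedSpace.exp (t • X) x) (NormedSpace.exp (t • X) y))
    (u := fun t => NormedSpace.exp (t • X) * quadP x y *
      NormedSpace.exp (t • ContinuousLinearMap.adjoint X))
    (fun t => by
      refine ((hasDerivAt_exp_smul_apply X x t).quadP (hasDerivAt_exp_smul_apply X y t)).congr_deriv
        ?_
      exact (strLie_quadP hX _ _).symm)
    (fun t => by
      refine (((hasDerivAt_exp_smul X t).mul_const (quadP x y)).mul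
        (hasDerivAt_exp_smul (ContinuousLinearMap.adjoint X) t)).congr_deriv ?_
      have hcm : Commute (ContinuousLinearMap.adjoint X)
          (NormedSpace.exp (t • ContinuousLinearMap.adjoint X)) :=
        ((Commute.refl _).smul_right t).exp_right
      rw [hcm.eq]
      change _ = X * (_ * _ * _) + (_ * _ * _) * _
      simp only [mul_assoc]) (by simp) 1
  simp only [one_smul] at h
  rw [h, adjoint_exp]

theorem IsJordanFrame.quadP_injective_of_mem_cone (hc : IsJordanFrame c) {x : V}
    (hx : x ∈ symmetricCone V) : Function.Injective (quadP x x) := by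
  obtain ⟨k, -, r, hf, rfl⟩ := hc.exists_spectral x
  obtain ⟨B⟩ := hf.nonempty_peirceBasis
  have hpos := (hf.sum_mem_cone_iff r).1 hx
  rw [injective_iff_map_eq_zero]
  intro v hv
  have h1 : ∀ a, quadP (∑ j, r j • (k : V →L[ℝ] V) (c j)) (∑ j, r j • (k : V →L[ℝ] V) (c j))
      (B.b a) = (r (B.p a) * r (B.q a)) • B.b a := by
    intro a
    rw [quadP_apply, hf.sum_mul_sum, B.sum_mul, B.sum_mul, mul_smul_comm, B.sum_mul]
    simp only [smul_smul, ← sub_smul, ← add_smul]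
    congr 1; ring
  rw [← B.b.sum_repr' v, map_sum] at hv
  simp only [map_smul, h1] at hv
  have h2 : ∀ a, inner ℝ (B.b a) v = 0 := by
    intro a
    have h3 := congrArg (fun w => inner ℝ (B.b a) w) hv
    simp only [inner_sum, inner_smul_right, inner_zero_right,
      orthonormal_iff_ite.1 B.b.orthonormal, mul_ite, mul_one, mul_zero,
      Finset.sum_ite_eq, Finset.mem_univ, if_true] at h3
    rcases mul_eq_zero.1 h3 with h | h
    · exact h
    · exact absurd h (mul_pos (hpos _) (hpos _)).ne'
  rw [← B.b.sum_repr' v]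
  simp [h2]

theorem exp_injective (X : V →L[ℝ] V) : Function.Injective (NormedSpace.exp X : V →L[ℝ] V) := by
  intro u v h
  rw [← units_inv_apply (expUnit X) u, ← units_inv_apply (expUnit X) v]
  exact congrArg _ h

theorem IsJordanFrame.exp_mem_cone (hc : IsJordanFrame c) {X : V →L[ℝ] V} (hX : X ∈ strLie V)
    {x : V} (hx : x ∈ symmetricCone V) : NormedSpace.exp X x ∈ symmetricCone V := by
  have h := hc.path_mem_cone (γ := fun t => NormedSpace.exp (t • X) x)
    (continuous_iff_continuousAt.2 fun t => (hasDerivAt_exp_smul_apply X x t).continuousAt)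
    (by simpa using hx) (fun t => ?_) 1
  · simpa using h
  · rw [quadP_exp (Submodule.smul_mem _ t hX), adjoint_exp]
    exact ((exp_injective _).comp (hc.quadP_injective_of_mem_cone hx)).comp (exp_injective _)

end Cone
end

noncomputable section

/-! ### Derivatives of determinants -/

section DetDeriv

/-- In the Leibniz formula a permutation other than the identity moves at least two indices, so
after differentiating one factor another vanishing off-diagonal factor remains. -/
theorem hasDerivAt_matrix_det_of_eq_one {n : Type*} [Fintype n] [DecidableEq n]
    {M : ℝ → Matrix n n ℝ} {M' : Matrix n n ℝ} {t : ℝ}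
    (h : ∀ i j, HasDerivAt (fun s => M s i j) (M' i j) t) (h1 : M t = 1) :
    HasDerivAt (fun s => (M s).det) M'.trace t := by
  simp only [Matrix.det_apply]
  refine (HasDerivAt.fun_sum fun σ _ => (HasDerivAt.fun_finsetProd fun i _ =>
    h (σ i) i).const_smul (Equiv.Perm.sign σ)).congr_deriv ?_
  rw [Finset.sum_eq_single (1 : Equiv.Perm n)]
  · simp [h1, Matrix.trace]
  · intro σ _ hσ
    rw [Finset.sum_eq_zero, smul_zero]
    intro i _
    have : ∃ j ∈ Finset.univ.erase i, σ j ≠ j := by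
      by_contra hcon
      push Not at hcon
      apply hσ
      ext j
      by_cases hj : j = i
      · subst hj
        by_contra hne
        have h2 := hcon (σ j) (by simpa using hne)
        exact hne (σ.injective h2)
      · simpa using hcon j (by simpa using hj)
    obtain ⟨j, hj, hne⟩ := this
    rw [Finset.prod_eq_zero hj (by rw [h1, Matrix.one_apply_ne hne]), zero_smul]
  · simp

variable {V : Type*} [NormedAddCommGroup V] [InnerProductSpace ℝ V] [FiniteDimensional ℝ V]

theorem det_eq_of_onb {ι : Type*} [Fintype ι] [DecidableEq ι] (b : OrthonormalBasis ι ℝ V)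
    (S : V →L[ℝ] V) : S.det = (Matrix.of fun i j => inner ℝ (b i) (S (b j))).det := by
  refine (LinearMap.det_toMatrix b.toBasis (S : V →ₗ[ℝ] V)).symm.trans ?_
  congr 1
  ext i j
  simp [LinearMap.toMatrix_apply, OrthonormalBasis.repr_apply_apply]

theorem hasDerivAt_det_of_eq_one {T : ℝ → V →L[ℝ] V} {T' : V →L[ℝ] V} {t : ℝ}
    (h : HasDerivAt T T' t) (h1 : T t = 1) :
    HasDerivAt (fun s => (T s).det) (opTr T') t := by
  set b := (stdOrthonormalBasis ℝ V) with hb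
  have hd := det_eq_of_onb b
  simp only [hd]
  have h2 := hasDerivAt_matrix_det_of_eq_one
    (M := fun s => Matrix.of fun i j => inner ℝ (b i) (T s (b j)))
    (M' := Matrix.of fun i j => inner ℝ (b i) (T' (b j))) (t := t) (fun i j => by
      refine ((hasDerivAt_const t (b i)).inner ℝ (h.clm_apply (hasDerivAt_const t (b j)))).congr_deriv
        ?_
      simp) (by
      ext i j
      simp [h1, Matrix.one_apply, orthonormal_iff_ite.1 b.orthonormal])
  refine h2.congr_deriv ?_
  rw [opTr_eq_sum b]
  rfl

theorem det_clm_mul (S T : V →L[ℝ] V) : (S * T).det = S.det * T.det :=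
  LinearMap.det_comp (S : V →ₗ[ℝ] V) (T : V →ₗ[ℝ] V)

theorem det_clm_one : (1 : V →L[ℝ] V).det = 1 := LinearMap.det_id

/-- Jacobi's formula, reduced to the derivative at the identity by the factorization det T(s) = det
T(t) · det(S T(s)). -/
theorem hasDerivAt_det {T : ℝ → V →L[ℝ] V} {T' S : V →L[ℝ] V} {t : ℝ}
    (h : HasDerivAt T T' t) (hS : S * T t = 1) (hS' : T t * S = 1) :
    HasDerivAt (fun s => (T s).det) ((T t).det * opTr (S * T')) t := by
  have h1 := (hasDerivAt_det_of_eq_one (h.const_mul S) hS).const_mul (T t).det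
  refine h1.congr_of_eventuallyEq (Filter.Eventually.of_forall fun s => ?_)
  change (T s).det = (T t).det * (S * T s).det
  rw [← det_clm_mul, ← mul_assoc, hS', one_mul]

theorem det_exp_eq_one {X : V →L[ℝ] V} (hX : opTr X = 0) :
    (NormedSpace.exp X : V →L[ℝ] V).det = 1 := by
  have : CompleteSpace V := FiniteDimensional.complete ℝ V
  have h : ∀ t : ℝ, HasDerivAt (fun t : ℝ => (NormedSpace.exp (t • X) : V →L[ℝ] V).det) 0 t := by
    intro t
    refine (hasDerivAt_det (hasDerivAt_exp_smul X t) (exp_neg_mul_exp (t • X))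
      (exp_mul_exp_neg (t • X))).congr_deriv ?_
    rw [← mul_assoc, opTr_mul_comm, ← mul_assoc, exp_mul_exp_neg, one_mul, hX, mul_zero]
  have := is_const_of_deriv_eq_zero (fun s => (h s).differentiableAt) (fun s => (h s).deriv) 1 0
  simpa [det_clm_one] using this

theorem det_adjoint_clm (T : V →L[ℝ] V) : (ContinuousLinearMap.adjoint T).det = T.det := by
  set b := (stdOrthonormalBasis ℝ V) with hb
  have hd := det_eq_of_onb b
  rw [hd, hd T, ← Matrix.det_transpose]
  congr 1
  ext i j
  simp only [Matrix.transpose_apply, Matrix.of_apply]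
  rw [ContinuousLinearMap.adjoint_inner_right, real_inner_comm]

end DetDeriv

/-! ### The Lie algebras and groups attached to the cone -/

section LieAlgebra

variable {V : Type*} [NormedAddCommGroup V] [InnerProductSpace ℝ V] [EuclideanJordanAlgebra V]
  [FiniteDimensional ℝ V] {l : ℕ} {c : Fin l → V}

theorem IsJordanFrame.exp_mem_coneAut (hc : IsJordanFrame c) {X : V →L[ℝ] V} (hX : X ∈ strLie V) :
    expUnit X ∈ coneAut V := by
  intro x
  refine ⟨fun h => ?_, fun h => hc.exp_mem_cone hX h⟩
  have h2 := hc.exp_mem_cone (Submodule.neg_mem _ hX) h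
  rwa [show NormedSpace.exp (-X) (((expUnit X : (V →L[ℝ] V)ˣ) : V →L[ℝ] V) x) = x from
    units_inv_apply (expUnit X) x] at h2

theorem IsJordanFrame.strLie_subset_lieG (hc : IsJordanFrame c) {X : V →L[ℝ] V}
    (hX : X ∈ strLie V) : X ∈ lieG V := by
  intro t
  let γ : ℝ → coneAut V := fun s => ⟨expUnit (s • X), hc.exp_mem_coneAut (Submodule.smul_mem _ s hX)⟩
  have hcont : Continuous γ := by
    refine Continuous.subtype_mk (Units.continuous_iff.2 ⟨?_, ?_⟩) _
    · exact continuous_iff_continuousAt.2 fun s => (hasDerivAt_exp_smul X s).continuousAt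
    · have : Continuous fun s : ℝ => NormedSpace.exp (s • (-X)) :=
        continuous_iff_continuousAt.2 fun s => (hasDerivAt_exp_smul (-X) s).continuousAt
      refine this.congr fun s => ?_
      rw [smul_neg]; rfl
  have h1 : γ 0 = 1 := by
    apply Subtype.ext
    apply Units.ext
    change NormedSpace.exp ((0 : ℝ) • X) = 1
    simp
  have hmem : γ t ∈ Subgroup.connectedComponentOfOne (coneAut V) :=
    (isPreconnected_range hcont).subset_connectedComponent ⟨0, h1⟩ ⟨t, rfl⟩
  exact ⟨expUnit (t • X), ⟨γ t, hmem, rfl⟩, rfl⟩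

theorem mem_coneAut_of_groupG {g : (V →L[ℝ] V)ˣ} (hg : g ∈ groupG V) : g ∈ coneAut V := by
  obtain ⟨a, -, rfl⟩ := hg
  exact a.2

/-- Elements of `𝔤` preserve the orthogonality of elements of the closed cone infinitesimally. -/
theorem IsJordanFrame.inner_lieG_eq_zero (hc : IsJordanFrame c) {X : V →L[ℝ] V} (hX : X ∈ lieG V)
    (y z : V) (hyz : inner ℝ (y * y) (z * z) = 0) : inner ℝ (X (y * y)) (z * z) = 0 := by
  have hpos : ∀ t : ℝ, 0 ≤ inner ℝ (NormedSpace.exp (t • X) (y * y)) (z * z) := by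
    intro t
    obtain ⟨g, hg, hgX⟩ := hX t
    have hg2 := mem_coneAut_of_groupG hg
    have h1 : ∀ ε : ℝ, 0 < ε → 0 ≤ inner ℝ ((g : V →L[ℝ] V) (y * y)) (z * z) +
        ε * inner ℝ ((g : V →L[ℝ] V) 1) (z * z) := by
      intro ε hε
      -- Squares lie only in the closed cone. Adding ε e moves them into W, where membership of g in
      -- Aut(W) applies, and ε then tends to 0.
      have hm : y * y + ε • (1 : V) ∈ symmetricCone V := by
        refine hc.mem_cone_iff.2 ⟨ε, hε, fun u => ?_⟩
        rw [add_mul, smul_mul_assoc, jone_mul, inner_add_left, inner_smul_left,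
          real_inner_self_eq_norm_sq]
        have := inner_mul_self_nonneg hc y u
        simp only [RCLike.conj_to_real]
        linarith
      have h2 := hc.mem_squares_iff.1 (interior_subset ((hg2 _).2 hm)) z
      rw [mul_comm ((g : V →L[ℝ] V) _) z, inner_jmul_left, map_add, map_smul, inner_add_left,
        inner_smul_left] at h2
      simpa using h2
    rw [← hgX]
    have hlim : Tendsto (fun ε : ℝ => inner ℝ ((g : V →L[ℝ] V) (y * y)) (z * z) +
        ε * inner ℝ ((g : V →L[ℝ] V) 1) (z * z)) (𝓝[>] 0)
        (𝓝 (inner ℝ ((g : V →L[ℝ] V) (y * y)) (z * z))) := by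
      have : Tendsto (fun ε : ℝ => inner ℝ ((g : V →L[ℝ] V) (y * y)) (z * z) +
        ε * inner ℝ ((g : V →L[ℝ] V) 1) (z * z)) (𝓝 0) _ :=
        Continuous.tendsto (by fun_prop) 0
      simpa using this.mono_left nhdsWithin_le_nhds
    exact ge_of_tendsto hlim (eventually_mem_nhdsWithin.mono fun ε hε => h1 ε hε)
  have hloc : IsLocalMin (fun t : ℝ => inner ℝ (NormedSpace.exp (t • X) (y * y)) (z * z)) 0 := by
    refine Filter.Eventually.of_forall fun t => ?_
    simpa [hyz] using hpos t
  have h0 := hloc.hasDerivAt_eq_zero ((hasDerivAt_exp_smul_apply X (y * y) 0).inner ℝ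
    (hasDerivAt_const 0 (z * z)))
  simpa using h0

/-- An infinitesimal automorphism of the cone annihilating the unit maps an idempotent to its Peirce
`1/2`-space. -/
theorem mul_apply_idem_of_cross {Y : V →L[ℝ] V} (h1 : Y 1 = 0)
    (hY : ∀ y z : V, inner ℝ (y * y) (z * z) = 0 → inner ℝ (Y (y * y)) (z * z) = 0) {e : V}
    (he : e * e = e) : e * Y e = (1 / 2 : ℝ) • Y e := by
  have key : ∀ e w : V, e * e = e → e * w = 0 → inner ℝ (Y e) w = 0 := by
    intro e w he hw
    have hsq : ∀ u, e * u = 0 → inner ℝ (Y e) (u * u) = 0 := by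
      intro u hu
      have := hY e u (by rw [he, ← inner_jmul_left, mul_comm, hu, inner_zero_left])
      rwa [he] at this
    -- Ye is orthogonal to squares of elements of the Peirce 0-space. Expanding the square of (e' +
    -- w), where e' = 1 - e is the unit of this subalgebra, gives orthogonality to w itself.
    have hf : e * (1 - e) = 0 := by rw [mul_sub, jmul_one, he, sub_self]
    have a1 := hsq (1 - e) hf
    have a2 := hsq w hw
    have a3 := hsq (1 - e + w) (by rw [mul_add, hf, hw, add_zero])
    have e1 : (1 - e) * w = w := by rw [sub_mul, jone_mul, hw, sub_zero]
    rw [add_mul, mul_add, mul_add, mul_comm w (1 - e), e1, inner_add_right, inner_add_right,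
      inner_add_right, a1, a2] at a3
    linarith
  obtain ⟨y0, y1, y2, hy, h0, hh, h2⟩ := exists_even_odd he (Y e)
  have o01 : inner ℝ y1 y0 = 0 := by
    have := inner_jmul_left e y1 y0
    rw [hh, h0, zero_smul, inner_zero_right, inner_smul_left] at this
    simpa using this
  have o02 : inner ℝ y2 y0 = 0 := by
    have := inner_jmul_left e y2 y0
    rw [h2, h0, zero_smul, inner_zero_right, one_smul] at this
    exact this
  have o12 : inner ℝ y1 y2 = 0 := by
    have := inner_jmul_left e y1 y2
    rw [hh, h2, one_smul, inner_smul_left] at this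
    simp only [RCLike.conj_to_real] at this
    linarith
  have z0 : y0 = 0 := by
    have := key e y0 he (by rw [h0, zero_smul])
    rw [hy, inner_add_left, inner_add_left, o01, o02, add_zero, add_zero] at this
    exact inner_self_eq_zero.1 this
  -- The same argument applies to the idempotent 1 - e, for which Y(1 - e) = -Ye.
  have z2 : y2 = 0 := by
    have := key (1 - e) y2 (by rw [sub_mul, mul_sub, mul_sub, he, jone_mul, jone_mul, jmul_one]; abel)
      (by rw [sub_mul, h2, jone_mul, one_smul, sub_self])
    rw [map_sub, h1, zero_sub, inner_neg_left, neg_eq_zero, hy, inner_add_left, inner_add_left, z0,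
      o12, inner_zero_left, zero_add, zero_add] at this
    exact inner_self_eq_zero.1 this
  rw [hy, z0, z2, zero_add, add_zero, hh]

/-- The relation eYe = ½Ye for idempotents, applied also to sums of two orthogonal idempotents,
gives d_i Yd_j + d_j Yd_i = 0 for i ≠ j. By the spectral theorem Y(x²) = 2xYx, and polarization
gives the Leibniz rule. -/
theorem IsJordanFrame.isDer_of_cross (hc : IsJordanFrame c) {Y : V →L[ℝ] V} (h1 : Y 1 = 0)
    (hY : ∀ y z : V, inner ℝ (y * y) (z * z) = 0 → inner ℝ (Y (y * y)) (z * z) = 0) :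
    IsDer Y := by
  have hsq : ∀ x, Y (x * x) = (2 : ℝ) • (x * Y x) := by
    intro x
    obtain ⟨k, -, s, hf, rfl⟩ := hc.exists_spectral x
    set d : Fin l → V := fun i => (k : V →L[ℝ] V) (c i) with hd
    change Y ((∑ j, s j • d j) * ∑ j, s j • d j) = (2 : ℝ) • ((∑ j, s j • d j) * Y (∑ j, s j • d j))
    have hidem := fun e he => mul_apply_idem_of_cross h1 hY (e := e) he
    have hsym : ∀ i j, d i * Y (d j) + d j * Y (d i) = if i = j then Y (d j) else 0 := by
      intro i j
      split_ifs with hij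
      · subst hij
        rw [hidem _ (hf.idem i)]; module
      · have h2 := hidem (d i + d j) (by
          rw [add_mul, mul_add, mul_add]
          have a1 := hf.idem i
          have a2 := hf.idem j
          have a3 := hf.orth hij
          have a4 := hf.orth (Ne.symm hij)
          simp only [hd] at *
          rw [a1, a2, a3, a4]; abel)
        have b1 := hidem _ (hf.idem i)
        have b2 := hidem _ (hf.idem j)
        rw [map_add, add_mul, mul_add, mul_add] at h2
        linear_combination (norm := module) (1 : ℝ) • h2 - (1 : ℝ) • b1 - (1 : ℝ) • b2
    have e1 : (∑ j, s j • d j) * Y (∑ j, s j • d j) =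
        ∑ i, ∑ j, (s i * s j) • (d i * Y (d j)) := by
      simp only [map_sum, map_smul, Finset.sum_mul, Finset.mul_sum, smul_mul_assoc, mul_smul_comm,
        Finset.smul_sum, smul_smul]
      rw [Finset.sum_comm]
      exact Finset.sum_congr rfl fun i _ => Finset.sum_congr rfl fun j _ => by rw [mul_comm (s _)]
    have e2 : (∑ j, s j • d j) * Y (∑ j, s j • d j) =
        ∑ i, ∑ j, (s i * s j) • (d j * Y (d i)) := by
      rw [e1, Finset.sum_comm]
      exact Finset.sum_congr rfl fun i _ => Finset.sum_congr rfl fun j _ => by rw [mul_comm (s i)]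
    rw [two_smul]
    nth_rewrite 1 [e1]
    rw [e2, ← Finset.sum_add_distrib]
    simp only [← Finset.sum_add_distrib, ← smul_add, hsym, smul_ite, smul_zero, Finset.sum_ite_eq,
      Finset.mem_univ, if_true]
    have e3 := hf.sum_mul_sum s s
    change (∑ j, s j • d j) * (∑ j, s j • d j) = _ at e3
    rw [e3]
    simp [hd]
  intro x y
  have h2 := hsq (x + y)
  have h3 : (x + y) * (x + y) = x * x + y * y + (2 : ℝ) • (x * y) := by
    rw [add_mul, mul_add, mul_add, mul_comm y x]; module
  rw [h3, map_add, map_add, map_smul, hsq, hsq, map_add] at h2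
  refine smul_right_injective V (r := (2 : ℝ)) two_ne_zero ?_
  simp only [mul_add, add_mul, smul_add] at h2 ⊢
  rw [mul_comm (Y x) y]
  linear_combination (norm := module) (1 : ℝ) • h2

/-- Subtracting L(X1) from X leaves an operator that annihilates e and still preserves orthogonality
in the closed cone infinitesimally. Such an operator is a derivation, hence inner. -/
theorem IsJordanFrame.mem_lieG_iff (hc : IsJordanFrame c) {X : V →L[ℝ] V} :
    X ∈ lieG V ↔ X ∈ strLie V := by
  refine ⟨fun hX => ?_, hc.strLie_subset_lieG⟩
  have hd : IsDer (X - jordanL (X 1)) := by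
    refine hc.isDer_of_cross (by simp [jmul_one]) fun y z hyz => ?_
    rw [clm_sub, inner_sub_left, hc.inner_lieG_eq_zero hX y z hyz,
      hc.inner_lieG_eq_zero (hc.strLie_subset_lieG (jordanL_mem_strLie (X 1))) y z hyz, sub_zero]
  exact mem_strLie.2 ⟨X 1, X - jordanL (X 1), hd.mem_innDer, by abel⟩

theorem strLie_bracket {X Y : V →L[ℝ] V} (hX : X ∈ strLie V) (hY : Y ∈ strLie V) :
    X * Y - Y * X ∈ strLie V := by
  obtain ⟨a, D, hD, rfl⟩ := mem_strLie.1 hX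
  obtain ⟨b, D', hD', rfl⟩ := mem_strLie.1 hY
  have d1 := isDer_of_mem_innDer hD
  have d2 := isDer_of_mem_innDer hD'
  have d3 : IsDer (D * D' - D' * D) := by
    intro x y
    simp only [clm_sub, clm_mul, d1 _ _, d2 _ _, map_add, sub_mul, mul_sub]
    abel
  refine mem_strLie.2 ⟨D b - D' a, innerDer a b + (D * D' - D' * D),
    Submodule.add_mem _ (innerDer_mem a b) d3.mem_innDer, ?_⟩
  rw [jordanL_sub, ← d1.comm_jordanL b, ← d2.comm_jordanL a, innerDer]
  noncomm_ring

theorem IsJordanFrame.lieG1_le (hc : IsJordanFrame c) {X : V →L[ℝ] V} (hX : X ∈ lieG1 V) :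
    X ∈ strLie V ∧ opTr X = 0 := by
  induction hX using Submodule.span_induction with
  | mem z hz =>
    obtain ⟨S, hS, T, hT, rfl⟩ := hz
    exact ⟨strLie_bracket (hc.mem_lieG_iff.1 hS) (hc.mem_lieG_iff.1 hT), by
      rw [map_sub, opTr_mul_comm, sub_self]⟩
  | zero => exact ⟨zero_mem _, map_zero _⟩
  | add S T _ _ hS hT => exact ⟨add_mem hS.1 hT.1, by rw [map_add, hS.2, hT.2, add_zero]⟩
  | smul r S _ hS => exact ⟨Submodule.smul_mem _ r hS.1, by rw [map_smul, hS.2, smul_zero]⟩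

theorem IsJordanFrame.bracket_mem_lieG1 (hc : IsJordanFrame c) {X Y : V →L[ℝ] V}
    (hX : X ∈ strLie V) (hY : Y ∈ strLie V) : X * Y - Y * X ∈ lieG1 V :=
  Submodule.subset_span ⟨X, hc.mem_lieG_iff.2 hX, Y, hc.mem_lieG_iff.2 hY, rfl⟩

theorem IsJordanFrame.innDer_le_lieG1 (hc : IsJordanFrame c) : innDer V ≤ lieG1 V := by
  refine Submodule.span_le.2 ?_
  rintro _ ⟨a, b, rfl⟩
  exact hc.bracket_mem_lieG1 (jordanL_mem_strLie a) (jordanL_mem_strLie b)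

theorem IsJordanFrame.jordanL_mem_lieG1 (hc : IsJordanFrame c) (hV : IsSimpleJordan V) {a : V}
    (ha : inner ℝ a 1 = 0) : jordanL a ∈ lieG1 V := by
  have h := hV.mem_span_innerDer ha
  clear ha
  induction h using Submodule.span_induction with
  | mem z hz =>
    obtain ⟨x, y, b, rfl⟩ := hz
    rw [← (isDer_innerDer x y).comm_jordanL b]
    exact hc.bracket_mem_lieG1 (innDer_le_strLie (innerDer_mem x y)) (jordanL_mem_strLie b)
  | zero => rw [jordanL_zero]; exact zero_mem _
  | add x y _ _ hx hy => rw [jordanL_add]; exact add_mem hx hy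
  | smul r x _ hx => rw [jordanL_smul]; exact Submodule.smul_mem _ r hx

theorem expUnit_mem_groupG1 {X : V →L[ℝ] V} (hX : X ∈ lieG1 V) : expUnit X ∈ groupG1 V :=
  Subgroup.subset_closure ⟨X, hX, rfl⟩

theorem IsJordanFrame.innGroup_le_groupG1 (hc : IsJordanFrame c) : innGroup V ≤ groupG1 V := by
  refine Subgroup.closure_mono ?_
  rintro g ⟨D, hD, h⟩
  exact ⟨D, hc.innDer_le_lieG1 hD, h⟩

/-- The properties of elements of the structure group that are used below. -/
structure IsUnimodular (g : (V →L[ℝ] V)ˣ) : Prop where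
  quadP_map : ∀ x y, quadP ((g : V →L[ℝ] V) x) ((g : V →L[ℝ] V) y) =
    (g : V →L[ℝ] V) * quadP x y * ContinuousLinearMap.adjoint (g : V →L[ℝ] V)
  mem_cone : ∀ x, (g : V →L[ℝ] V) x ∈ symmetricCone V ↔ x ∈ symmetricCone V
  det_eq : (g : V →L[ℝ] V).det = 1

theorem IsJordanFrame.isUnimodular (hc : IsJordanFrame c) {g : (V →L[ℝ] V)ˣ}
    (hg : g ∈ groupG1 V) : IsUnimodular g := by
  induction hg using Subgroup.closure_induction with
  | mem x hx =>
    obtain ⟨X, hX, h⟩ := hx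
    obtain ⟨h1, h2⟩ := hc.lieG1_le hX
    have : x = expUnit X := Units.ext h
    subst this
    exact ⟨quadP_exp h1, hc.exp_mem_coneAut h1, det_exp_eq_one h2⟩
  | one =>
    refine ⟨fun x y => ?_, fun x => Iff.rfl, det_clm_one⟩
    have : ContinuousLinearMap.adjoint (1 : V →L[ℝ] V) = 1 := star_one _
    rw [Units.val_one, this, one_mul, mul_one]; rfl
  | mul x y _ _ hx hy =>
    refine ⟨fun u v => ?_, fun u => (hx.mem_cone _).trans (hy.mem_cone u), ?_⟩
    · have : ContinuousLinearMap.adjoint ((x : V →L[ℝ] V) * (y : V →L[ℝ] V)) =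
        ContinuousLinearMap.adjoint (y : V →L[ℝ] V) * ContinuousLinearMap.adjoint (x : V →L[ℝ] V) :=
        star_mul _ _
      rw [Units.val_mul, this, clm_mul, clm_mul, hx.quadP_map, hy.quadP_map]
      noncomm_ring
    · rw [Units.val_mul, det_clm_mul, hx.det_eq, hy.det_eq, one_mul]
  | inv x _ hx =>
    have hadj : ContinuousLinearMap.adjoint (x : V →L[ℝ] V) *
        ContinuousLinearMap.adjoint ((x⁻¹ : (V →L[ℝ] V)ˣ) : V →L[ℝ] V) = 1 := by
      have : star (((x⁻¹ : (V →L[ℝ] V)ˣ) : V →L[ℝ] V) * (x : V →L[ℝ] V)) = star 1 := by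
        rw [x.inv_mul]
      rwa [star_mul, star_one] at this
    refine ⟨fun u v => ?_, fun u => ?_, ?_⟩
    · have h1 := hx.quadP_map (((x⁻¹ : (V →L[ℝ] V)ˣ) : V →L[ℝ] V) u)
        (((x⁻¹ : (V →L[ℝ] V)ˣ) : V →L[ℝ] V) v)
      rw [units_apply_inv, units_apply_inv] at h1
      rw [h1]
      simp only [mul_assoc, hadj, mul_one]
      rw [← mul_assoc, x.inv_mul, one_mul]
    · rw [← hx.mem_cone, units_apply_inv]
    · have h1 := congrArg ContinuousLinearMap.det x.inv_mul
      rwa [det_clm_mul, hx.det_eq, mul_one, det_clm_one] at h1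

end LieAlgebra
end

noncomputable section

/-! ### Restricted roots -/

variable {V : Type*} [NormedAddCommGroup V] [InnerProductSpace ℝ V] [EuclideanJordanAlgebra V]
  [FiniteDimensional ℝ V] {l : ℕ} {c : Fin l → V}

theorem mem_cartanA_iff {X : V →L[ℝ] V} :
    X ∈ cartanA c ↔ ∃ x : Fin l → ℝ, X = jordanL (∑ j, x j • c j) := by
  rw [cartanA, Submodule.mem_span_range_iff_exists_fun]
  simp only [jordanL_sum, jordanL_smul, eq_comm]

theorem IsJordanFrame.mul_sum_frame (hc : IsJordanFrame c) (s : Fin l → ℝ) (j : Fin l) :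
    c j * (∑ i, s i • c i) = s j • c j := by
  simp [Finset.mul_sum, mul_smul_comm, hc.mul_eq]

/-- The brackets of a diagonal operator with the operators attached to an off-diagonal Peirce
space. -/
theorem IsJordanFrame.bracket_diag_offdiag (hc : IsJordanFrame c) {j k : Fin l} (hjk : j ≠ k)
    {b : V} (hb : b ∈ peirceSpace c j k) (x : Fin l → ℝ) :
    innerDer (∑ i, x i • c i) b = (x j - x k) • innerDer (c j) b ∧
    jordanL (∑ i, x i • c i) * innerDer (c j) b - innerDer (c j) b * jordanL (∑ i, x i • c i) =
      ((x j - x k) / 4) • jordanL b := by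
  have h0 : ∀ i, i ≠ j → i ≠ k → innerDer (c i) b = 0 := by
    intro i hi hk
    have h1 := jordanL_comm_cyclic (c i) (c i) b
    have h2 : c i * b = 0 := by rw [hb i, peirceCoeff_other hi hk, zero_smul]
    rw [mul_comm b, h2, hc.idem] at h1
    simp only [jordanL_zero, mul_zero, zero_mul, sub_zero, add_zero, zero_add] at h1
    rw [innerDer, ← neg_sub, h1, neg_zero]
  have hsum : ∀ t : Fin l → ℝ, innerDer (∑ i, t i • c i) b =
      t j • innerDer (c j) b + t k • innerDer (c k) b := by
    intro t
    have e : innerDer (∑ i, t i • c i) b = ∑ i, t i • innerDer (c i) b := by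
      ext z
      simp only [innerDer_apply, sum_apply, clm_smul, Finset.sum_mul,
        Finset.mul_sum, smul_mul_assoc, mul_smul_comm, smul_sub, Finset.sum_sub_distrib]
    rw [e, Finset.sum_eq_add j k hjk]
    · rintro i - ⟨hi, hk⟩
      rw [h0 i hi hk, smul_zero]
    · simp
    · simp
  have h1 : innerDer (c k) b = - innerDer (c j) b := by
    have := hsum fun _ => 1
    simp only [one_smul, hc.sum_eq] at this
    rw [innerDer, jordanL_one, one_mul, mul_one, sub_self] at this
    exact (neg_eq_of_add_eq_zero_right this.symm).symm
  constructor
  · rw [hsum, h1]; module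
  · have h2 := (isDer_innerDer (c j) b).comm_jordanL (∑ i, x i • c i)
    have h3 : innerDer (c j) b (∑ i, x i • c i) = -((x j - x k) / 4) • b := by
      rw [innerDer_apply, mul_comm b, frame_sum_mul x hb, mul_smul_comm, hb j,
        peirceCoeff_left hjk, hc.mul_sum_frame, mul_smul_comm, mul_comm b, hb j,
        peirceCoeff_left hjk]
      module
    rw [← neg_sub, h2, h3, jordanL_smul]; module

/-- For nonzero b in V_jk the root vector is L(b) + 2[L(c_j), L(b)]. The factor 2 balances the two
brackets in `bracket_diag_offdiag`, whose coefficients are x_j - x_k and (x_j - x_k)/4. -/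
theorem IsJordanFrame.exists_root (hc : IsJordanFrame c) (hV : IsSimpleJordan V) {j k : Fin l}
    (hjk : j ≠ k) : ∃ α : cartanA c →ₗ[ℝ] ℝ, IsRestrictedRoot c α ∧
      ∀ (x : Fin l → ℝ) (h : jordanL (∑ i, x i • c i) ∈ cartanA c),
        α ⟨_, h⟩ = (x j - x k) / 2 := by
  obtain ⟨b, hb, hb0⟩ := hc.exists_peirce_ne_zero hV hjk
  let ev : Fin l → (V →L[ℝ] V) →ₗ[ℝ] ℝ := fun i =>
    { toFun := fun X => inner ℝ (X 1) (c i) / ‖c i‖ ^ 2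
      map_add' := fun X Y => by rw [clm_add, inner_add_left, add_div]
      map_smul' := fun a X => by
        rw [clm_smul, inner_smul_left, RCLike.conj_to_real, smul_eq_mul, RingHom.id_apply,
          mul_div_assoc] }
  have hev : ∀ (x : Fin l → ℝ) i, ev i (jordanL (∑ i, x i • c i)) = x i := by
    intro x i
    change inner ℝ ((∑ i, x i • c i) * 1) (c i) / ‖c i‖ ^ 2 = _
    have h := norm_ne_zero_iff.2 (hc.ne_zero i)
    rw [jmul_one, sum_inner, Finset.sum_eq_single i, inner_smul_left, real_inner_self_eq_norm_sq]
    · simp only [RCLike.conj_to_real]; field_simp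
    · intro m _ hm
      rw [inner_smul_left, hc.inner_frame hm, mul_zero]
    · simp
  refine ⟨((1 / 2 : ℝ) • (ev j - ev k)).comp (cartanA c).subtype, ⟨?_, ?_⟩, ?_⟩
  · intro h0
    have hm : jordanL (∑ i, (if i = j then (1 : ℝ) else 0) • c i) ∈ cartanA c :=
      mem_cartanA_iff.2 ⟨_, rfl⟩
    have h1 := DFunLike.congr_fun h0 ⟨_, hm⟩
    change (1 / 2 : ℝ) * (ev j (jordanL _) - ev k (jordanL _)) = 0 at h1
    rw [hev, hev, if_pos rfl, if_neg (Ne.symm hjk)] at h1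
    norm_num at h1
  · refine ⟨jordanL b + (2 : ℝ) • innerDer (c j) b, hc.mem_lieG_iff.2 (mem_strLie.2
      ⟨b, _, Submodule.smul_mem _ _ (innerDer_mem _ _), rfl⟩), fun h0 => hb0 ?_, ?_⟩
    · have := DFunLike.congr_fun h0 (1 : V)
      rw [clm_add, clm_smul, (isDer_innerDer _ _).map_one, jordanL_apply, jmul_one, smul_zero,
        add_zero] at this
      exact this
    · rintro ⟨H, hH⟩
      obtain ⟨x, rfl⟩ := mem_cartanA_iff.1 hH
      change jordanL _ * _ - _ * jordanL _ =
        ((1 / 2 : ℝ) * (ev j (jordanL _) - ev k (jordanL _))) • _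
      rw [hev, hev]
      obtain ⟨e1, e2⟩ := hc.bracket_diag_offdiag hjk hb x
      rw [innerDer] at e1
      simp only [mul_add, add_mul, mul_smul_comm, smul_mul_assoc]
      linear_combination (norm := module) (1 : ℝ) • e1 + (2 : ℝ) • e2
  · intro x h
    change (1 / 2 : ℝ) * (ev j (jordanL _) - ev k (jordanL _)) = _
    rw [hev, hev]; ring

/-- Two facts are combined: roots evaluate to differences (x_j - x_k)/2, which turns π/2 into π, and
membership in 𝔤¹ is a trace condition. The latter becomes ∑ x_j = 0 because all c_j have the same
norm. -/
theorem IsJordanFrame.mem_crownOmega1_iff (hc : IsJordanFrame c) (hV : IsSimpleJordan V)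
    {X : V →L[ℝ] V} : X ∈ crownOmega1 c ↔ ∃ x : Fin l → ℝ, X = jordanL (∑ j, x j • c j) ∧
      (∀ j k, |x j - x k| < Real.pi) ∧ ∑ j, x j = 0 := by
  obtain ⟨B⟩ := hc.nonempty_peirceBasis
  have hinner : ∀ (x : Fin l → ℝ), inner ℝ (∑ j, x j • c j) 1 = ∑ j, x j * ‖c j‖ ^ 2 := by
    intro x
    rw [sum_inner]
    exact Finset.sum_congr rfl fun j _ => by
      rw [inner_smul_left, hc.inner_frame_one]; rfl
  constructor
  · rintro ⟨⟨hX, hα⟩, h1⟩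
    obtain ⟨x, rfl⟩ := mem_cartanA_iff.1 hX
    refine ⟨x, rfl, fun j k => ?_, ?_⟩
    · by_cases hjk : j = k
      · subst hjk; simpa using Real.pi_pos
      · obtain ⟨α, hr, he⟩ := hc.exists_root hV hjk
        have := hα α hr
        rw [he, abs_div, abs_two] at this
        linarith
    · have h2 := (hc.lieG1_le h1).2
      have h3 := hV.opTr_jordanL (∑ j, x j • c j)
      rw [h2, zero_mul, hinner] at h3
      have := hV.1
      have hn : (Module.finrank ℝ V : ℝ) ≠ 0 := by exact_mod_cast Module.finrank_pos.ne'
      have h4 := (mul_eq_zero.1 h3.symm).resolve_left hn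
      rcases isEmpty_or_nonempty (Fin l) with hl | ⟨⟨i⟩⟩
      · simp
      · simp only [fun j => hc.norm_sq_eq hV j i, ← Finset.sum_mul] at h4
        exact (mul_eq_zero.1 h4).resolve_right (pow_ne_zero 2 (norm_ne_zero_iff.2 (hc.ne_zero i)))
  · rintro ⟨x, rfl, hx, hs⟩
    have hmem : jordanL (∑ j, x j • c j) ∈ cartanA c := mem_cartanA_iff.2 ⟨x, rfl⟩
    refine ⟨⟨hmem, fun α hr => ?_⟩, hc.jordanL_mem_lieG1 hV ?_⟩
    · obtain ⟨-, Y, hY, hY0, hYr⟩ := hr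
      have h1 := hYr ⟨_, hmem⟩
      obtain ⟨b, D, hD, rfl⟩ := mem_strLie.1 (hc.mem_lieG_iff.1 hY)
      set a := α ⟨_, hmem⟩
      set h := ∑ j, x j • c j with hh
      have hd := isDer_of_mem_innDer hD
      simp only at h1
      have hc1 := hd.comm_jordanL h
      -- For a root vector L(b) + D, evaluation at e separates the multiplication part from the
      -- derivation part: -Dh = ab and [L(h), L(b)] = aD.
      have h2 : innerDer h b - jordanL (D h) = a • jordanL b + a • D := by
        rw [← hc1, innerDer, ← smul_add, ← h1]; noncomm_ring
      have h3 : - D h = a • b := by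
        have := DFunLike.congr_fun h2 (1 : V)
        simp only [clm_sub, clm_add, clm_smul, innerDer_apply, jordanL_apply, jmul_one,
          hd.map_one, smul_zero, add_zero] at this
        rw [mul_comm b h, sub_self, zero_sub] at this
        exact this
      have h4 : innerDer h b = a • D := by
        have h5 : jordanL (D h) = -(a • jordanL b) := by
          rw [← jordanL_smul, ← h3, jordanL_neg, neg_neg]
        rw [h5] at h2
        linear_combination (norm := module) (1 : ℝ) • h2
      by_cases hb : b = 0
      · subst hb
        have : a = 0 := by
          by_contra ha
          apply hY0
          have e : innerDer h 0 = 0 := by ext z; simp [innerDer_apply]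
          rw [e] at h4
          rw [jordanL_zero, zero_add]
          exact (smul_eq_zero.1 h4.symm).resolve_left ha
        rw [this, abs_zero]
        positivity
      · obtain ⟨i, hi⟩ : ∃ i, inner ℝ (B.b i) b ≠ 0 := by
          by_contra! hcon
          exact hb (by rw [← B.b.sum_repr' b]; simp [hcon])
        -- Applying [L(h), L(b)] = aD to h eliminates D. On a Peirce component the left side is
        -- multiplication by -((x_p - x_q)/2)².
        have h5 : h * (h * b) - (h * h) * b = -(a ^ 2) • b := by
          have := DFunLike.congr_fun h4 h
          rw [innerDer_apply, clm_smul, mul_comm b h, mul_comm b] at this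
          rw [this, ← neg_neg (D h), h3]
          module
        have h6 := congrArg (fun v => inner ℝ (B.b i) v) h5
        simp only [inner_sub_right, inner_smul_right, ← inner_jmul_left] at h6
        rw [hh, hc.sum_mul_sum, B.sum_mul, B.sum_mul, mul_smul_comm, B.sum_mul] at h6
        simp only [inner_smul_left, RCLike.conj_to_real] at h6
        have h7 : a ^ 2 = ((x (B.p i) - x (B.q i)) / 2) ^ 2 := by
          refine mul_right_cancel₀ hi ?_
          linear_combination h6
        rw [← abs_of_pos (half_pos Real.pi_pos), ← sq_lt_sq, h7, sq_lt_sq, abs_div, abs_div,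
          abs_two]
        have := hx (B.p i) (B.q i)
        rw [abs_of_pos Real.pi_pos]
        linarith
    · rw [hinner]
      rcases isEmpty_or_nonempty (Fin l) with hl | ⟨⟨i⟩⟩
      · simp
      · simp only [fun j => hc.norm_sq_eq hV j i, ← Finset.sum_mul, hs, zero_mul]

end

noncomputable section

/-! ### The complexified algebra -/

namespace Cplx

section Linear

variable {V : Type*} [NormedAddCommGroup V] [InnerProductSpace ℝ V]

@[simp] theorem re_zero : (0 : Cplx V).re = 0 := rfl
@[simp] theorem im_zero : (0 : Cplx V).im = 0 := rfl
@[simp] theorem re_neg (z : Cplx V) : (-z).re = -z.re := rfl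
@[simp] theorem im_neg (z : Cplx V) : (-z).im = -z.im := rfl
@[simp] theorem re_sub (z w : Cplx V) : (z - w).re = z.re - w.re := rfl
@[simp] theorem im_sub (z w : Cplx V) : (z - w).im = z.im - w.im := rfl

theorem real_smul_def (r : ℝ) (z : Cplx V) : r • z = (r : ℂ) • z := rfl
@[simp] theorem re_real_smul (r : ℝ) (z : Cplx V) : (r • z).re = r • z.re := by
  rw [real_smul_def, re_smul]; simp
@[simp] theorem im_real_smul (r : ℝ) (z : Cplx V) : (r • z).im = r • z.im := by
  rw [real_smul_def, im_smul]; simp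

@[simp] theorem re_ofReal (x : V) : (ofReal x).re = x := rfl
@[simp] theorem im_ofReal (x : V) : (ofReal x).im = 0 := rfl
@[simp] theorem re_conj (z : Cplx V) : (conj z).re = z.re := rfl
@[simp] theorem im_conj (z : Cplx V) : (conj z).im = -z.im := rfl
@[simp] theorem re_extend (T : V →L[ℝ] V) (z : Cplx V) : (extend T z).re = T z.re := rfl
@[simp] theorem im_extend (T : V →L[ℝ] V) (z : Cplx V) : (extend T z).im = T z.im := rfl

/-- The real part as a continuous linear map. -/
def reL : Cplx V →L[ℝ] V where
  toFun := re
  map_add' := re_add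
  map_smul' := re_real_smul
  cont := continuous_fst.comp (WithLp.prod_continuous_ofLp 2 V V)

/-- The imaginary part as a continuous linear map. -/
def imL : Cplx V →L[ℝ] V where
  toFun := im
  map_add' := im_add
  map_smul' := im_real_smul
  cont := continuous_snd.comp (WithLp.prod_continuous_ofLp 2 V V)

/-- The inclusion of the real form as a continuous linear map. -/
def ofRealL : V →L[ℝ] Cplx V where
  toFun := ofReal
  map_add' x y := by ext <;> simp
  map_smul' r x := by ext <;> simp
  cont := (WithLp.prod_continuous_toLp 2 V V).comp (continuous_id.prodMk continuous_const)

@[simp] theorem reL_apply (z : Cplx V) : reL z = z.re := rfl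
@[simp] theorem imL_apply (z : Cplx V) : imL z = z.im := rfl
@[simp] theorem ofRealL_apply (x : V) : ofRealL x = ofReal x := rfl

@[fun_prop] theorem continuous_re : Continuous (re : Cplx V → V) := reL.continuous
@[fun_prop] theorem continuous_im : Continuous (im : Cplx V → V) := imL.continuous

theorem ofReal_sum {ι : Type*} (s : Finset ι) (f : ι → V) :
    ofReal (∑ i ∈ s, f i) = ∑ i ∈ s, ofReal (f i) := map_sum ofRealL f s
theorem re_sum {ι : Type*} (s : Finset ι) (f : ι → Cplx V) :
    re (∑ i ∈ s, f i) = ∑ i ∈ s, re (f i) := map_sum reL f s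
theorem im_sum {ι : Type*} (s : Finset ι) (f : ι → Cplx V) :
    im (∑ i ∈ s, f i) = ∑ i ∈ s, im (f i) := map_sum imL f s

theorem mk_eq (x y : V) : mk x y = ofReal x + Complex.I • ofReal y := by ext <;> simp

theorem ofReal_smul (r : ℝ) (x : V) : ofReal (r • x) = (r : ℂ) • ofReal x := by ext <;> simp

@[simp] theorem extend_ofReal (T : V →L[ℝ] V) (x : V) : extend T (ofReal x) = ofReal (T x) := by
  ext <;> simp

/-- A real basis of `V` as a complex basis of `V_ℂ`. -/
def basis {ι : Type*} [Fintype ι] (b : Module.Basis ι ℝ V) : Module.Basis ι ℂ (Cplx V) :=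
  Module.Basis.ofEquivFun
    { toFun := fun z i => (b.repr z.re i : ℂ) + Complex.I * (b.repr z.im i : ℂ)
      map_add' := fun z w => by ext i; simp; ring
      map_smul' := fun a z => by
        ext i
        apply Complex.ext <;> simp
      invFun := fun f => mk (∑ i, (f i).re • b i) (∑ i, (f i).im • b i)
      left_inv := fun z => by
        ext <;> simp [b.sum_repr]
      right_inv := fun f => by
        ext i
        apply Complex.ext <;> simp only [re_mk, im_mk, b.repr_sum_self, Complex.add_re,
          Complex.add_im, Complex.ofReal_re, Complex.ofReal_im, Complex.mul_re, Complex.mul_im,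
          Complex.I_re, Complex.I_im] <;> ring }

theorem basis_repr {ι : Type*} [Fintype ι] (b : Module.Basis ι ℝ V) (z : Cplx V) (i : ι) :
    (basis b).repr z i = (b.repr z.re i : ℂ) + Complex.I * (b.repr z.im i : ℂ) := rfl

theorem basis_apply {ι : Type*} [Fintype ι] [DecidableEq ι] (b : Module.Basis ι ℝ V) (i : ι) :
    basis b i = ofReal (b i) := by
  apply (basis b).repr.injective
  refine Finsupp.ext fun j => ?_
  rw [Module.Basis.repr_self, basis_repr, re_ofReal, im_ofReal, b.repr_self]
  simp only [Finsupp.single_apply, map_zero, Finsupp.coe_zero, Pi.zero_apply]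
  split_ifs <;> simp

instance [FiniteDimensional ℝ V] : FiniteDimensional ℂ (Cplx V) :=
  (basis (Module.finBasis ℝ V)).finiteDimensional_of_finite

instance [FiniteDimensional ℝ V] : CompleteSpace (Cplx V) :=
  FiniteDimensional.complete ℂ (Cplx V)

/-! ### Polynomial functions -/

variable [FiniteDimensional ℝ V]

variable (V) in
/-- The algebra of complex polynomial functions on `V_ℂ`. -/
def polyFun : Subalgebra ℂ (Cplx V → ℂ) :=
  (MvPolynomial.aeval (R := ℂ) fun (i : Fin (Module.finrank ℝ V)) (z : Cplx V) =>
    (basis (Module.finBasis ℝ V)).repr z i).range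

theorem mem_polyFun {f : Cplx V → ℂ} : f ∈ polyFun V ↔
    ∃ p : MvPolynomial (Fin (Module.finrank ℝ V)) ℂ, ∀ z,
      f z = MvPolynomial.eval (fun i => (basis (Module.finBasis ℝ V)).repr z i) p := by
  have key : ∀ (p : MvPolynomial (Fin (Module.finrank ℝ V)) ℂ) (z : Cplx V),
      MvPolynomial.aeval (R := ℂ) (fun (i : Fin (Module.finrank ℝ V)) (z : Cplx V) =>
        (basis (Module.finBasis ℝ V)).repr z i) p z =
      MvPolynomial.eval (fun i => (basis (Module.finBasis ℝ V)).repr z i) p := by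
    intro p z
    induction p using MvPolynomial.induction_on with
    | C a => simp
    | add p q hp hq => simp only [map_add, Pi.add_apply, hp, hq]
    | mul_X p i hp => simp only [map_mul, Pi.mul_apply, hp, MvPolynomial.aeval_X,
        MvPolynomial.eval_X]
  constructor
  · rintro ⟨p, rfl⟩
    exact ⟨p, fun z => key p z⟩
  · rintro ⟨p, hp⟩
    exact ⟨p, funext fun z => (key p z).trans (hp z).symm⟩

theorem linear_mem_polyFun (φ : Cplx V →ₗ[ℂ] ℂ) : (fun z => φ z) ∈ polyFun V := by
  refine mem_polyFun.2 ⟨∑ i, MvPolynomial.C (φ (basis (Module.finBasis ℝ V) i)) *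
    MvPolynomial.X i, fun z => ?_⟩
  conv_lhs => rw [← (basis (Module.finBasis ℝ V)).sum_repr z]
  rw [map_sum, map_sum]
  exact Finset.sum_congr rfl fun i _ => by
    rw [map_smul, map_mul, MvPolynomial.eval_C, MvPolynomial.eval_X, smul_eq_mul, mul_comm]

theorem contDiff_of_mem_polyFun {f : Cplx V → ℂ} (hf : f ∈ polyFun V) : ContDiff ℂ 1 f := by
  obtain ⟨p, hp⟩ := mem_polyFun.1 hf
  rw [funext hp]
  clear hp hf
  induction p using MvPolynomial.induction_on with
  | C a => simpa using contDiff_const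
  | add p q hp hq =>
    simp only [map_add]
    exact hp.add hq
  | mul_X p i hp =>
    simp only [map_mul, MvPolynomial.eval_X]
    refine hp.mul ?_
    exact (LinearMap.toContinuousLinearMap
      ((basis (Module.finBasis ℝ V)).coord i)).contDiff

theorem differentiable_of_mem_polyFun {f : Cplx V → ℂ} (hf : f ∈ polyFun V) :
    Differentiable ℂ f :=
  (contDiff_of_mem_polyFun hf).differentiable (by simp)

/-- A polynomial function that vanishes on a nonempty open set of real points vanishes. -/
theorem polyFun_eq_zero {f : Cplx V → ℂ} (hf : f ∈ polyFun V) {U : Set V} (hU : IsOpen U)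
    (hne : U.Nonempty) (h0 : ∀ x ∈ U, f (ofReal x) = 0) : f = 0 := by
  obtain ⟨p, hp⟩ := mem_polyFun.1 hf
  obtain ⟨x0, hx0⟩ := hne
  set b := Module.finBasis ℝ V with hb
  let m : (Fin (Module.finrank ℝ V) → ℝ) → V := fun t => ∑ i, t i • b i
  have hm : Continuous m := by fun_prop
  have hopen : m ⁻¹' U ∈ 𝓝 (fun i => b.repr x0 i) := by
    refine hm.continuousAt.preimage_mem_nhds (hU.mem_nhds ?_)
    simp only [m, b.sum_repr]
    exact hx0
  obtain ⟨ε, hε, hball⟩ := Metric.mem_nhds_iff.1 hopen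
  have hp0 : p = 0 := by
    -- The open set contains a box in real coordinates, whose sides are infinite subsets of ℂ; a
    -- complex polynomial vanishing on such a product is zero.
    refine MvPolynomial.funext_set (fun i => (fun r : ℝ => (r : ℂ)) '' Metric.ball (b.repr x0 i) ε)
      (fun i => ?_) fun t ht => ?_
    · refine Set.Infinite.image (Complex.ofReal_injective.injOn) ?_
      rw [Real.ball_eq_Ioo]
      exact Set.Ioo_infinite (by linarith)
    · have : ∀ i, ∃ r ∈ Metric.ball (b.repr x0 i) ε, (r : ℂ) = t i := fun i => ht i (mem_univ i)
      choose r hr hrt using this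
      have h1 : m r ∈ U := hball (by
        rw [Metric.mem_ball, dist_pi_lt_iff hε]; exact hr)
      have h2 := h0 _ h1
      rw [hp] at h2
      rw [map_zero, ← h2]
      congr 1
      congr 1
      ext i
      rw [basis_repr]
      simp [m, ← hrt, Finsupp.single_apply]
  ext z
  rw [hp, hp0]; simp

end Linear

end Cplx

end

noncomputable section

/-! ### Newton's recursion -/

/-- The elementary symmetric functions in terms of power sums, by Newton's recursion. -/
def newtonE (p : ℕ → ℂ) : ℕ → ℂ
  | 0 => 1
  | k + 1 => (-1) ^ k / (k + 1) * ∑ i : Fin (k + 1), (-1) ^ (i : ℕ) * newtonE p i * p (k + 1 - i)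
decreasing_by exact i.2

theorem newtonE_zero (p : ℕ → ℂ) : newtonE p 0 = 1 := by rw [newtonE]

theorem newtonE_succ (p : ℕ → ℂ) (k : ℕ) : newtonE p (k + 1) =
    (-1) ^ k / (k + 1) * ∑ i ∈ Finset.range (k + 1), (-1) ^ i * newtonE p i * p (k + 1 - i) := by
  rw [newtonE, Finset.sum_range]

theorem newtonE_pow_mul (a : ℂ) (p : ℕ → ℂ) (k : ℕ) :
    newtonE (fun m => a ^ m * p m) k = a ^ k * newtonE p k := by
  induction k using Nat.strong_induction_on with
  | _ k ih =>
    rcases k with _ | k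
    · simp [newtonE_zero]
    · rw [newtonE_succ, newtonE_succ, mul_left_comm, Finset.mul_sum _ _ (a ^ (k + 1))]
      congr 1
      refine Finset.sum_congr rfl fun i hi => ?_
      have hi' := Finset.mem_range.1 hi
      rw [ih i hi']
      have : a ^ (k + 1) = a ^ i * a ^ (k + 1 - i) := by rw [← pow_add]; congr 1; omega
      rw [this]; ring

/-- Newton's identities. With them the coefficients of the generic minimal polynomial can be defined
from traces of powers, visibly polynomial in z, and evaluated on diagonal elements. -/
theorem newtonE_psum {l : ℕ} (t : Fin l → ℂ) (k : ℕ) :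
    newtonE (fun m => ∑ j, t j ^ m) k = (Finset.univ.val.map t).esymm k := by
  induction k using Nat.strong_induction_on with
  | _ k ih =>
    rcases k with _ | k
    · simp [newtonE_zero, Multiset.esymm]
    · have h := congrArg (MvPolynomial.aeval t) (MvPolynomial.mul_esymm_eq_sum (Fin l) ℂ (k + 1))
      rw [Finset.sum_filter, Finset.Nat.sum_antidiagonal_eq_sum_range_succ_mk,
        Finset.sum_range_succ, if_neg (lt_irrefl _), add_zero] at h
      simp only [map_mul, map_pow, map_neg, map_one, map_natCast, map_sum, apply_ite,
        MvPolynomial.aeval_esymm_eq_multiset_esymm, MvPolynomial.psum, MvPolynomial.aeval_X,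
        map_zero] at h
      rw [newtonE_succ]
      have hk : ((k : ℂ) + 1) ≠ 0 := by exact_mod_cast Nat.succ_ne_zero k
      rw [div_mul_eq_mul_div, div_eq_iff hk]
      push_cast at h
      rw [mul_comm _ ((k : ℂ) + 1), h]
      have e : (-1 : ℂ) ^ (k + 1 + 1) = (-1) ^ k := by ring
      rw [e]
      congr 1
      refine Finset.sum_congr rfl fun i hi => ?_
      rw [if_pos (Finset.mem_range.1 hi), ih i (Finset.mem_range.1 hi)]

theorem esymm_card_eq_prod {l : ℕ} (t : Fin l → ℂ) :
    (Finset.univ.val.map t).esymm l = ∏ j, t j := by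
  rw [Finset.esymm_map_val]
  have h : Finset.powersetCard l (Finset.univ : Finset (Fin l)) = {Finset.univ} := by
    convert Finset.powersetCard_self (Finset.univ : Finset (Fin l))
    simp
  rw [h, Finset.sum_singleton]

/-! ### The generic minimal polynomial -/

namespace Cplx

variable {V : Type*} [NormedAddCommGroup V] [InnerProductSpace ℝ V] [EuclideanJordanAlgebra V]

instance toRing : NonUnitalNonAssocCommRing (Cplx V) :=
  { (inferInstance : AddCommGroup (Cplx V)) with
    mul := fun x y => x * y
    left_distrib := fun x y z => by ext <;> simp [mul_add] <;> abel
    right_distrib := fun x y z => by ext <;> simp [add_mul] <;> abel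
    zero_mul := fun x => by ext <;> simp
    mul_zero := fun x => by ext <;> simp
    mul_comm := fun x y => by
      ext
      · simp [mul_comm x.re, mul_comm x.im]
      · simp [mul_comm x.re, mul_comm x.im, add_comm] }

instance smulComm : SMulCommClass ℂ (Cplx V) (Cplx V) :=
  ⟨fun a x y => ((L x).map_smul a y).symm⟩

instance scalarTower : IsScalarTower ℂ (Cplx V) (Cplx V) :=
  ⟨fun a x y => by
    change (a • x) * y = a • (x * y)
    rw [mul_comm, mul_comm x y]
    exact (L y).map_smul a x⟩

theorem one_def : (1 : Cplx V) = ofReal 1 := rfl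
@[simp] theorem re_one : (1 : Cplx V).re = 1 := rfl
@[simp] theorem im_one : (1 : Cplx V).im = 0 := rfl

theorem ofReal_mul (x y : V) : ofReal (x * y) = ofReal x * ofReal y := by ext <;> simp

theorem jpow_zero (z : Cplx V) : jpow z 0 = 1 := rfl
theorem jpow_succ (z : Cplx V) (k : ℕ) : jpow z (k + 1) = z * jpow z k := rfl

theorem jpow_smul (a : ℂ) (z : Cplx V) (k : ℕ) : jpow (a • z) k = a ^ k • jpow z k := by
  induction k with
  | zero => simp [jpow_zero]
  | succ k ih => rw [jpow_succ, ih, jpow_succ, smul_mul_smul_comm, pow_succ']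

theorem extend_mul {g : V →L[ℝ] V} (hg : ∀ x y, g (x * y) = g x * g y) (z w : Cplx V) :
    extend g (z * w) = extend g z * extend g w := by
  ext <;> simp [hg]

theorem jpow_extend {g : V →L[ℝ] V} (hg : ∀ x y, g (x * y) = g x * g y) (h1 : g 1 = 1)
    (z : Cplx V) (k : ℕ) : jpow (extend g z) k = extend g (jpow z k) := by
  induction k with
  | zero => rw [jpow_zero, jpow_zero, one_def, extend_ofReal, h1]
  | succ k ih => rw [jpow_succ, ih, jpow_succ, extend_mul hg]

theorem frame_mul_frame [FiniteDimensional ℝ V] {l : ℕ} {c : Fin l → V} (hc : IsJordanFrame c) (s t : Fin l → ℂ) :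
    (∑ j, s j • ofReal (c j)) * (∑ j, t j • ofReal (c j)) = ∑ j, (s j * t j) • ofReal (c j) := by
  simp only [Finset.sum_mul, Finset.mul_sum, smul_mul_smul_comm, ← ofReal_mul, hc.mul_eq]
  refine Finset.sum_congr rfl fun i _ => ?_
  rw [Finset.sum_eq_single i]
  · rw [if_pos rfl]
  · intro j _ hj
    rw [if_neg hj]
    ext <;> simp
  · simp

theorem jpow_frame [FiniteDimensional ℝ V] {l : ℕ} {c : Fin l → V} (hc : IsJordanFrame c) (t : Fin l → ℂ) (k : ℕ) :
    jpow (∑ j, t j • ofReal (c j)) k = ∑ j, t j ^ k • ofReal (c j) := by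
  induction k with
  | zero => simp [jpow_zero, one_def, ← hc.sum_eq, ofReal_sum]
  | succ k ih => rw [jpow_succ, ih, frame_mul_frame hc]; simp only [pow_succ']

variable (V) in
/-- The complex linear extension of the trace form `x ↦ l ⟪x, e⟫ / ‖e‖²`. -/
def jtr (l : ℕ) : Cplx V →ₗ[ℂ] ℂ where
  toFun z := (l / ‖(1 : V)‖ ^ 2 : ℝ) * ((inner ℝ z.re 1 : ℝ) + Complex.I * (inner ℝ z.im 1 : ℝ))
  map_add' z w := by simp only [re_add, im_add, inner_add_left]; push_cast; ring
  map_smul' a z := by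
    simp only [re_smul, im_smul, inner_add_left, inner_sub_left, inner_smul_left, smul_eq_mul,
      RCLike.conj_to_real, RingHom.id_apply]
    apply Complex.ext <;> simp <;> ring

theorem jtr_ofReal (l : ℕ) (x : V) :
    jtr V l (ofReal x) = (l / ‖(1 : V)‖ ^ 2 * inner ℝ x 1 : ℝ) := by
  change ((l / ‖(1 : V)‖ ^ 2 : ℝ) : ℂ) * ((inner ℝ x 1 : ℝ) + Complex.I * (inner ℝ (0 : V) 1 : ℝ)) = _
  simp

/-- The coefficients of the generic minimal polynomial. -/
def jcoeff (l : ℕ) (z : Cplx V) (k : ℕ) : ℂ := newtonE (fun m => jtr V l (jpow z m)) k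

/-- The determinant of a Jordan algebra of rank `l`. -/
def jdet (l : ℕ) (z : Cplx V) : ℂ := jcoeff l z l

/-- The generic minimal polynomial. -/
def genPoly (l : ℕ) (z : Cplx V) : Polynomial ℂ :=
  ∑ k ∈ Finset.range (l + 1), Polynomial.monomial k ((-1) ^ (l - k) * jcoeff l z (l - k))

theorem genPoly_coeff (l : ℕ) (z : Cplx V) (k : ℕ) :
    (genPoly l z).coeff k = if k ≤ l then (-1) ^ (l - k) * jcoeff l z (l - k) else 0 := by
  rw [genPoly, Polynomial.finsetSum_coeff]
  simp [Polynomial.coeff_monomial]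

theorem jcoeff_zero (l : ℕ) (z : Cplx V) : jcoeff l z 0 = 1 := newtonE_zero _

theorem genPoly_natDegree (l : ℕ) (z : Cplx V) : (genPoly l z).natDegree = l := by
  refine Polynomial.natDegree_eq_of_le_of_coeff_ne_zero ?_ ?_
  · refine Polynomial.natDegree_le_iff_coeff_eq_zero.2 fun k hk => ?_
    rw [genPoly_coeff, if_neg (by omega)]
  · rw [genPoly_coeff, if_pos le_rfl]; simp [jcoeff_zero]

theorem genPoly_monic (l : ℕ) (z : Cplx V) : (genPoly l z).Monic := by
  rw [Polynomial.Monic, Polynomial.leadingCoeff, genPoly_natDegree, genPoly_coeff, if_pos le_rfl]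
  simp [jcoeff_zero]

theorem jdet_smul (l : ℕ) (a : ℂ) (z : Cplx V) : jdet l (a • z) = a ^ l * jdet l z := by
  rw [jdet, jdet, jcoeff, jcoeff, ← newtonE_pow_mul]
  simp only [jpow_smul, map_smul, smul_eq_mul]

/-- The determinant is built from powers and the trace form alone. This version serves the parity
symmetries, for which membership in G¹ is not needed. -/
theorem jdet_extend_of_isOrthAut [FiniteDimensional ℝ V] (l : ℕ) {g : V →L[ℝ] V}
    (hg : IsOrthAut g) (h1 : g 1 = 1) (z : Cplx V) : jdet l (extend g z) = jdet l z := by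
  have h : ∀ z : Cplx V, jtr V l (extend g z) = jtr V l z := by
    intro z
    have e : ∀ x : V, inner ℝ (g x) 1 = inner ℝ x 1 := fun x => by
      conv_lhs => rw [← h1]
      exact hg.2 x 1
    change ((l / ‖(1 : V)‖ ^ 2 : ℝ) : ℂ) * ((inner ℝ (g z.re) 1 : ℝ) +
      Complex.I * (inner ℝ (g z.im) 1 : ℝ)) = _
    rw [e, e]
    rfl
  rw [jdet, jdet, jcoeff, jcoeff]
  simp only [jpow_extend hg.1 h1, h]

variable [FiniteDimensional ℝ V] {l : ℕ} {c : Fin l → V}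

theorem jtr_frame (hV : IsSimpleJordan V) (hc : IsJordanFrame c) (j : Fin l) :
    jtr V l (ofReal (c j)) = 1 := by
  rw [jtr_ofReal]
  have h1 : ‖(1 : V)‖ ^ 2 = l * ‖c j‖ ^ 2 := by
    rw [← real_inner_self_eq_norm_sq]
    conv_lhs => rw [← hc.sum_eq]
    rw [sum_inner]
    simp only [hc.sum_eq, hc.inner_frame_one, fun i => hc.norm_sq_eq hV i j]
    simp
  have h2 : ‖(1 : V)‖ ^ 2 ≠ 0 := pow_ne_zero 2 (norm_ne_zero_iff.2 hV.one_ne_zero)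
  rw [hc.inner_frame_one, div_mul_eq_mul_div, ← h1, div_self h2, Complex.ofReal_one]

theorem jcoeff_frame (hV : IsSimpleJordan V) (hc : IsJordanFrame c) (t : Fin l → ℂ) (k : ℕ) :
    jcoeff l (∑ j, t j • ofReal (c j)) k = (Finset.univ.val.map t).esymm k := by
  rw [jcoeff, ← newtonE_psum]
  simp only [jpow_frame hc, map_sum, map_smul, jtr_frame hV hc, smul_eq_mul, mul_one]

theorem jdet_frame (hV : IsSimpleJordan V) (hc : IsJordanFrame c) (t : Fin l → ℂ) :
    jdet l (∑ j, t j • ofReal (c j)) = ∏ j, t j := by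
  rw [jdet, jcoeff_frame hV hc, esymm_card_eq_prod]

theorem genPoly_frame (hV : IsSimpleJordan V) (hc : IsJordanFrame c) (t : Fin l → ℂ) :
    genPoly l (∑ j, t j • ofReal (c j)) = ∏ j, (Polynomial.X - Polynomial.C (t j)) := by
  have hcard : Multiset.card (Finset.univ.val.map t) = l := by simp
  have h2 : ∏ j, (Polynomial.X - Polynomial.C (t j)) =
      ((Finset.univ.val.map t).map fun t => Polynomial.X - Polynomial.C t).prod := by
    rw [Multiset.map_map]; rfl
  ext k
  rw [genPoly_coeff, h2]
  split_ifs with hk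
  · rw [Multiset.prod_X_sub_C_coeff _ (by rw [hcard]; exact hk), hcard, jcoeff_frame hV hc]
  · rw [← h2, Polynomial.coeff_eq_zero_of_natDegree_lt]
    rw [Polynomial.natDegree_finsetProd_X_sub_C_eq_card]
    simpa using hk

theorem jeval_frame (hc : IsJordanFrame c) (p : Polynomial ℂ) (t : Fin l → ℂ) :
    jeval p (∑ j, t j • ofReal (c j)) = ∑ j, p.eval (t j) • ofReal (c j) := by
  simp only [jeval, jpow_frame hc, Finset.smul_sum, smul_smul, Polynomial.eval_eq_sum_range,
    Finset.sum_smul]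
  rw [Finset.sum_comm]

theorem ofReal_frame (t : Fin l → ℝ) :
    ofReal (∑ j, t j • c j) = ∑ j, (t j : ℂ) • ofReal (c j) := by
  simp only [ofReal_sum, ofReal_smul]

theorem jpow_mem_polyFun (φ : Cplx V →ₗ[ℂ] ℂ) (k : ℕ) : (fun z => φ (jpow z k)) ∈ polyFun V := by
  induction k generalizing φ with
  | zero => exact (polyFun V).algebraMap_mem (φ 1)
  | succ k ih =>
    have e : (fun z => φ (jpow z (k + 1))) = ∑ i, (fun z : Cplx V =>
        (basis (Module.finBasis ℝ V)).coord i z) * fun z =>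
          (φ ∘ₗ L (basis (Module.finBasis ℝ V) i)) (jpow z k) := by
      ext z
      rw [Finset.sum_apply, jpow_succ]
      conv_lhs => rw [← (basis (Module.finBasis ℝ V)).sum_repr z]
      rw [Finset.sum_mul, map_sum]
      refine Finset.sum_congr rfl fun i _ => ?_
      rw [smul_mul_assoc, map_smul, (basis (Module.finBasis ℝ V)).sum_repr z]
      rfl
    rw [e]
    exact Subalgebra.sum_mem _ fun i _ =>
      Subalgebra.mul_mem _ (linear_mem_polyFun _) (ih _)

theorem jcoeff_mem_polyFun (l k : ℕ) : (fun z : Cplx V => jcoeff l z k) ∈ polyFun V := by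
  induction k using Nat.strong_induction_on with
  | _ k ih =>
    rcases k with _ | k
    · simp only [jcoeff_zero]
      exact (polyFun V).one_mem
    · have e : (fun z : Cplx V => jcoeff l z (k + 1)) = ((-1 : ℂ) ^ k / (k + 1)) •
          ∑ i ∈ Finset.range (k + 1), ((-1 : ℂ) ^ i) • ((fun z : Cplx V => jcoeff l z i) *
            fun z => jtr V l (jpow z (k + 1 - i))) := by
        ext z
        simp only [jcoeff, newtonE_succ, Pi.smul_apply, Finset.sum_apply, Pi.mul_apply,
          smul_eq_mul, mul_assoc]
      rw [e]
      exact Subalgebra.smul_mem _ (Subalgebra.sum_mem _ fun i hi => Subalgebra.smul_mem _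
        (Subalgebra.mul_mem _ (ih i (Finset.mem_range.1 hi)) (jpow_mem_polyFun _ _)) _) _

theorem jdet_mem_polyFun (l : ℕ) : (jdet l : Cplx V → ℂ) ∈ polyFun V := jcoeff_mem_polyFun l l

theorem contDiff_jdet (l : ℕ) : ContDiff ℂ 1 (jdet l : Cplx V → ℂ) :=
  contDiff_of_mem_polyFun (jdet_mem_polyFun l)

theorem differentiable_jdet (l : ℕ) : Differentiable ℂ (jdet l : Cplx V → ℂ) :=
  differentiable_of_mem_polyFun (jdet_mem_polyFun l)

/-- The Cayley-Hamilton theorem for `V_ℂ`. -/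
theorem jeval_genPoly (hV : IsSimpleJordan V) (hc : IsJordanFrame c) (z : Cplx V) :
    jeval (genPoly l z) z = 0 := by
  have h : ∀ φ : Cplx V →ₗ[ℂ] ℂ, (fun z => φ (jeval (genPoly l z) z)) = 0 := by
    intro φ
    refine polyFun_eq_zero (U := univ) ?_ isOpen_univ ⟨0, trivial⟩ fun x _ => ?_
    · have e : (fun z => φ (jeval (genPoly l z) z)) = ∑ k ∈ Finset.range (l + 1),
          ((-1 : ℂ) ^ (l - k)) • ((fun z : Cplx V => jcoeff l z (l - k)) *
            fun z => φ (jpow z k)) := by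
        ext z
        rw [jeval, genPoly_natDegree, map_sum, Finset.sum_apply]
        refine Finset.sum_congr rfl fun k hk => ?_
        rw [map_smul, genPoly_coeff, if_pos (Nat.lt_succ_iff.1 (Finset.mem_range.1 hk))]
        simp only [Pi.smul_apply, Pi.mul_apply, smul_eq_mul, mul_assoc]
      rw [e]
      exact Subalgebra.sum_mem _ fun k _ => Subalgebra.smul_mem _
        (Subalgebra.mul_mem _ (jcoeff_mem_polyFun _ _) (jpow_mem_polyFun _ _)) _
    -- For a real element the generic polynomial is ∏(X - t_j), which annihilates each eigenvalue;
    -- polynomiality carries the identity over to V_ℂ.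
    · obtain ⟨k, -, t, hf, rfl⟩ := hc.exists_spectral x
      have e := ofReal_frame (c := fun i => (k : V →L[ℝ] V) (c i)) t
      rw [e, genPoly_frame hV hf, jeval_frame hf]
      have : ∀ j, Polynomial.eval (t j : ℂ) (∏ j, (Polynomial.X - Polynomial.C (t j : ℂ))) = 0 := by
        intro j
        rw [Polynomial.eval_prod]
        exact Finset.prod_eq_zero (Finset.mem_univ j) (by simp)
      simp [this]
  refine (basis (Module.finBasis ℝ V)).ext_elem fun i => ?_
  have := congrFun (h ((basis (Module.finBasis ℝ V)).coord i)) z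
  simpa using this

end Cplx

end

noncomputable section

/-! ### The determinant -/

variable {V : Type*} [NormedAddCommGroup V] [InnerProductSpace ℝ V] [EuclideanJordanAlgebra V]
  [FiniteDimensional ℝ V] {l : ℕ} {c : Fin l → V}

theorem IsJordanFrame.norm_one_sq (hV : IsSimpleJordan V) (hc : IsJordanFrame c) (j : Fin l) :
    ‖(1 : V)‖ ^ 2 = l * ‖c j‖ ^ 2 := by
  rw [← real_inner_self_eq_norm_sq]
  conv_lhs => rw [← hc.sum_eq]
  rw [sum_inner]
  simp only [hc.sum_eq, hc.inner_frame_one, fun i => hc.norm_sq_eq hV i j]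
  simp

theorem IsJordanFrame.rank_pos (hV : IsSimpleJordan V) (hc : IsJordanFrame c) : 0 < l := by
  rcases Nat.eq_zero_or_pos l with h | h
  · subst h
    exact absurd hc.sum_eq.symm (by simpa using hV.one_ne_zero)
  · exact h

/-- Each index occurs `2n / l` times among the Peirce indices of an adapted basis. -/
theorem PeirceBasis.card_index (hV : IsSimpleJordan V) (hc : IsJordanFrame c) (B : PeirceBasis c)
    (j : Fin l) : l * ∑ a, ((if B.p a = j then 1 else 0) + (if B.q a = j then 1 else 0)) =
      2 * Module.finrank ℝ V := by
  -- The trace of L(c_j) in the adapted basis counts half of the occurrences of j, while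
  -- `IsSimpleJordan.opTr_jordanL` evaluates it as n/l.
  have h1 : opTr (jordanL (c j)) =
      ∑ a, ((if B.p a = j then 1 else 0) + (if B.q a = j then 1 else 0) : ℝ) / 2 := by
    rw [opTr_eq_sum B.b]
    refine Finset.sum_congr rfl fun a _ => ?_
    rw [jordanL_apply, B.mem a j, inner_smul_right, real_inner_self_eq_norm_sq,
      B.b.orthonormal.1 a, peirceCoeff]
    simp only [eq_comm (a := j)]
    split_ifs <;> norm_num
  have h2 := hV.opTr_jordanL (c j)
  rw [hc.norm_one_sq hV j, hc.inner_frame_one, ← mul_assoc] at h2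
  have h3 := mul_right_cancel₀ (pow_ne_zero 2 (norm_ne_zero_iff.2 (hc.ne_zero j))) h2
  rw [h1, ← Finset.sum_div] at h3
  have h4 : (l : ℝ) * ∑ a, ((if B.p a = j then 1 else 0) + (if B.q a = j then 1 else 0) : ℝ) =
      2 * Module.finrank ℝ V := by linarith
  exact_mod_cast h4

theorem PeirceBasis.quadP_apply (hc : IsJordanFrame c) (B : PeirceBasis c) (s t : Fin l → ℝ) (a) :
    quadP (∑ j, s j • c j) (∑ j, t j • c j) (B.b a) =
      ((s (B.p a) * t (B.q a) + s (B.q a) * t (B.p a)) / 2) • B.b a := by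
  rw [_root_.quadP_apply, hc.sum_mul_sum, B.sum_mul, B.sum_mul, B.sum_mul, mul_smul_comm,
    mul_smul_comm, B.sum_mul, B.sum_mul]
  module

theorem det_eq_prod_of_onb {ι : Type*} [Fintype ι] (b : OrthonormalBasis ι ℝ V)
    {T : V →L[ℝ] V} {r : ι → ℝ} (h : ∀ a, T (b a) = r a • b a) : T.det = ∏ a, r a := by
  classical
  rw [det_eq_of_onb b, ← Matrix.det_diagonal]
  congr 1
  ext i j
  rw [Matrix.of_apply, h, inner_smul_right, orthonormal_iff_ite.1 b.orthonormal, Matrix.diagonal_apply]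
  split_ifs with hij
  · rw [hij, mul_one]
  · rw [mul_zero]

theorem PeirceBasis.det_quadP (hc : IsJordanFrame c) (B : PeirceBasis c) (t : Fin l → ℝ) :
    (quadP (∑ j, t j • c j) (∑ j, t j • c j)).det = ∏ a, t (B.p a) * t (B.q a) := by
  refine det_eq_prod_of_onb B.b fun a => ?_
  rw [B.quadP_apply hc]
  congr 1; ring

/-- Each t_j occurs 2n/l times among the eigenvalue factors of P(x). The power l avoids dividing the
exponent. -/
theorem IsJordanFrame.det_quadP_pow (hV : IsSimpleJordan V) (hc : IsJordanFrame c)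
    (t : Fin l → ℝ) : (quadP (∑ j, t j • c j) (∑ j, t j • c j)).det ^ l =
      (∏ j, t j) ^ (2 * Module.finrank ℝ V) := by
  obtain ⟨B⟩ := hc.nonempty_peirceBasis
  have h1 : ∀ a, t (B.p a) * t (B.q a) =
      ∏ j, t j ^ ((if B.p a = j then 1 else 0) + (if B.q a = j then 1 else 0)) := by
    intro a
    simp only [pow_add, Finset.prod_mul_distrib, Finset.prod_pow_boole, Finset.mem_univ, if_true]
  rw [B.det_quadP hc]
  simp only [h1]
  rw [Finset.prod_comm, ← Finset.prod_pow, ← Finset.prod_pow]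
  refine Finset.prod_congr rfl fun j _ => ?_
  rw [Finset.prod_pow_eq_pow_sum, ← pow_mul, mul_comm, B.card_index hV hc]

namespace Cplx

theorem exists_jdet_ofReal (hV : IsSimpleJordan V) (hc : IsJordanFrame c) (x : V) :
    ∃ r : ℝ, jdet l (ofReal x) = r ∧ (quadP x x).det ^ l = r ^ (2 * Module.finrank ℝ V) ∧
      (x ∈ symmetricCone V → 0 < r) := by
  obtain ⟨k, -, t, hf, rfl⟩ := hc.exists_spectral x
  refine ⟨∏ j, t j, ?_, hf.det_quadP_pow hV t, fun hx => ?_⟩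
  · have e := ofReal_frame (c := fun i => (k : V →L[ℝ] V) (c i)) t
    rw [e, jdet_frame hV hf, Complex.ofReal_prod]
  · exact Finset.prod_pos fun j _ => (hf.sum_mem_cone_iff t).1 hx j

/-- The determinant is invariant under the commutator group. -/
theorem jdet_extend (hV : IsSimpleJordan V) (hc : IsJordanFrame c) {g : (V →L[ℝ] V)ˣ}
    (hg : g ∈ groupG1 V) (z : Cplx V) : jdet l (extend (g : V →L[ℝ] V) z) = jdet l z := by
  have hu := hc.isUnimodular hg
  have hmem : (fun z => jdet l (extend (g : V →L[ℝ] V) z) - jdet l z) ∈ polyFun V := by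
    refine Subalgebra.sub_mem _ ?_ (jdet_mem_polyFun l)
    obtain ⟨p, hp⟩ := mem_polyFun.1 (jdet_mem_polyFun (V := V) l)
    simp only [hp]
    clear hp
    induction p using MvPolynomial.induction_on with
    | C a => simp only [MvPolynomial.eval_C]; exact (polyFun V).algebraMap_mem a
    | add p q hp hq =>
      simp only [map_add]
      exact Subalgebra.add_mem _ hp hq
    | mul_X p i hp =>
      simp only [map_mul, MvPolynomial.eval_X]
      exact Subalgebra.mul_mem _ hp (linear_mem_polyFun
        ((basis (Module.finBasis ℝ V)).coord i ∘ₗ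
          (extend (g : V →L[ℝ] V) : Cplx V →ₗ[ℂ] Cplx V)))
  -- On the cone det P(gx) = (det g)² det P(x) = det P(x), so the two Jordan determinants have equal
  -- 2n-th powers. Both are positive there, hence equal.
  have h0 := polyFun_eq_zero hmem (U := symmetricCone V) isOpen_interior ⟨1, hc.one_mem_cone⟩
    fun x hx => by
      obtain ⟨r, h1, h2, h3⟩ := exists_jdet_ofReal hV hc x
      obtain ⟨r', h1', h2', h3'⟩ := exists_jdet_ofReal hV hc ((g : V →L[ℝ] V) x)
      rw [hu.quadP_map, det_clm_mul, det_clm_mul, det_adjoint_clm, hu.det_eq, one_mul, mul_one,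
        h2] at h2'
      have hn : 2 * Module.finrank ℝ V ≠ 0 := by
        have := hV.1
        have := Module.finrank_pos (R := ℝ) (M := V)
        omega
      rw [extend_ofReal, h1, h1', (pow_left_inj₀ (h3 hx).le (h3' ((hu.mem_cone x).2 hx)).le hn).1 h2',
        sub_self]
  exact sub_eq_zero.1 (congrFun h0 z)

/-- Euler's identity for a homogeneous function of degree l; it makes dΔ nonzero wherever Δ = 1. -/
theorem fderiv_jdet_self (l : ℕ) (z : Cplx V) : fderiv ℂ (jdet l) z z = l * jdet l z := by
  have h1 := (differentiable_jdet (V := V) l z).hasFDerivAt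
  have h2 : HasDerivAt (fun a : ℂ => jdet l (a • z)) (fderiv ℂ (jdet l) z z) 1 := by
    have h3 : HasDerivAt (fun a : ℂ => a • z) z 1 := by
      simpa using (hasDerivAt_id (1 : ℂ)).smul_const z
    have h4 : HasFDerivAt (jdet l) (fderiv ℂ (jdet l) z) ((1 : ℂ) • z) := by rwa [one_smul]
    exact h4.comp_hasDerivAt 1 h3
  have h5 : HasDerivAt (fun a : ℂ => jdet l (a • z)) (l * jdet l z) 1 := by
    simp only [jdet_smul]
    simpa using (hasDerivAt_pow l (1 : ℂ)).mul_const (jdet l z)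
  exact h2.unique h5

theorem jpow_mem_span {z : Cplx V} {q : Polynomial ℂ} (hq : q.Monic) (h0 : jeval q z = 0) (k : ℕ) :
    jpow z k ∈ Submodule.span ℂ (range fun i : Fin q.natDegree => jpow z i) := by
  induction k using Nat.strong_induction_on with
  | _ k ih =>
    by_cases hk : k < q.natDegree
    · exact Submodule.subset_span ⟨⟨k, hk⟩, rfl⟩
    · obtain ⟨j, rfl⟩ := Nat.exists_eq_add_of_le (not_lt.1 hk)
      have h : ∀ j, ∑ i ∈ Finset.range (q.natDegree + 1), q.coeff i • jpow z (i + j) = 0 := by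
        intro j
        induction j with
        | zero => exact h0
        | succ j ihj =>
          have := congrArg (fun w => z * w) ihj
          simpa [Finset.mul_sum, mul_smul_comm, ← jpow_succ, add_assoc] using this
      have hj := h j
      rw [Finset.sum_range_succ, hq.coeff_natDegree, one_smul, add_comm] at hj
      rw [eq_neg_of_add_eq_zero_left hj]
      refine Submodule.neg_mem _ (Submodule.sum_mem _ fun i hi => Submodule.smul_mem _ _ (ih _ ?_))
      have := Finset.mem_range.1 hi
      omega

theorem span_jpow_eq {z : Cplx V} {q : Polynomial ℂ} (hq : q.Monic) (h0 : jeval q z = 0) :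
    Submodule.span ℂ (range (jpow z)) =
      Submodule.span ℂ (range fun i : Fin q.natDegree => jpow z i) := by
  refine le_antisymm (Submodule.span_le.2 ?_) (Submodule.span_mono ?_)
  · rintro _ ⟨k, rfl⟩
    exact jpow_mem_span hq h0 k
  · rintro _ ⟨i, rfl⟩
    exact ⟨i, rfl⟩

theorem linearIndependent_frame (hV : IsSimpleJordan V) (hc : IsJordanFrame c) :
    LinearIndependent ℂ fun j => ofReal (c j) := by
  refine Fintype.linearIndependent_iff.2 fun a ha i => ?_
  have h1 := frame_mul_frame hc (fun j => if j = i then 1 else 0) a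
  rw [ha, mul_zero] at h1
  have h2 := congrArg (jtr V l) h1
  simpa [map_sum, jtr_frame hV hc] using h2.symm

theorem degree_le (hV : IsSimpleJordan V) (hc : IsJordanFrame c) (z : Cplx V) : degree z ≤ l := by
  have h := span_jpow_eq (genPoly_monic l z) (jeval_genPoly hV hc z)
  rw [degree, h]
  refine (finrank_range_le_card (R := ℂ) fun i : Fin (genPoly l z).natDegree => jpow z i).trans ?_
  simp [genPoly_natDegree]

/-- The element with the distinct eigenvalues 0, …, l - 1 works, since Lagrange interpolation
expresses every c_j as a polynomial in it. -/
theorem exists_le_degree (hV : IsSimpleJordan V) (hc : IsJordanFrame c) :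
    ∃ w : Cplx V, l ≤ degree w := by
  refine ⟨∑ j : Fin l, ((j : ℕ) : ℂ) • ofReal (c j), ?_⟩
  set w := ∑ j : Fin l, ((j : ℕ) : ℂ) • ofReal (c j) with hw
  have h1 : Submodule.span ℂ (range fun j => ofReal (c j)) ≤ Submodule.span ℂ (range (jpow w)) := by
    refine Submodule.span_le.2 ?_
    rintro _ ⟨j, rfl⟩
    set p := Lagrange.basis Finset.univ (fun i : Fin l => ((i : ℕ) : ℂ)) j with hp
    have hinj : Set.InjOn (fun i : Fin l => ((i : ℕ) : ℂ)) (Finset.univ : Finset (Fin l)) := by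
      intro a _ b _ hab
      have hab' : ((a : ℕ) : ℂ) = (b : ℕ) := hab
      exact Fin.ext (by exact_mod_cast hab')
    have h2 : jeval p w = ofReal (c j) := by
      rw [hw, jeval_frame hc, Finset.sum_eq_single j, hp,
        Lagrange.eval_basis_self hinj (Finset.mem_univ j), one_smul]
      · intro i _ hij
        have := Lagrange.eval_basis_of_ne (v := fun i : Fin l => ((i : ℕ) : ℂ)) (s := Finset.univ)
          hij.symm (Finset.mem_univ i)
        rw [hp, this, zero_smul]
      · simp
    change ofReal (c j) ∈ _
    rw [← h2, jeval]
    exact Submodule.sum_mem _ fun k _ => Submodule.smul_mem _ _ (Submodule.subset_span ⟨k, rfl⟩)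
  have h3 := Submodule.finrank_mono h1
  rwa [finrank_span_eq_card (linearIndependent_frame hV hc), Fintype.card_fin] at h3

/-- At a regular element e, z, …, z^{l-1} are independent. So the monic annihilating polynomial of
degree l is unique and equals `genPoly`, whose constant coefficient is (-1)^l times `jdet`. -/
theorem isJordanDet_jdet (hV : IsSimpleJordan V) (hc : IsJordanFrame c) :
    IsJordanDet (jdet l : Cplx V → ℂ) := by
  refine ⟨?_, fun z hz p hp hdeg h0 => ?_⟩
  · obtain ⟨p, hp⟩ := mem_polyFun.1 (jdet_mem_polyFun (V := V) l)
    exact ⟨_, fun i => (basis (Module.finBasis ℝ V)).coord i, p, hp⟩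
  · obtain ⟨w, hw⟩ := exists_le_degree hV hc
    have hl : degree z = l := le_antisymm (degree_le hV hc z) (hw.trans (hz w))
    have hli : LinearIndependent ℂ fun i : Fin l => jpow z i := by
      rw [linearIndependent_iff_card_eq_finrank_span, Fintype.card_fin, Set.finrank]
      have h := span_jpow_eq (genPoly_monic l z) (jeval_genPoly hV hc z)
      rw [degree, h] at hl
      rw [genPoly_natDegree] at hl
      exact hl.symm
    rw [hl] at hdeg
    have h1 := jeval_genPoly hV hc z
    rw [jeval, genPoly_natDegree, Finset.sum_range_succ] at h1
    rw [jeval, hdeg, Finset.sum_range_succ, ← hdeg, hp.coeff_natDegree, hdeg, ← h1] at h0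
    have hm := (genPoly_monic l z).coeff_natDegree
    rw [genPoly_natDegree] at hm
    rw [hm, add_left_inj, Finset.sum_range, Finset.sum_range, ← sub_eq_zero,
      ← Finset.sum_sub_distrib] at h0
    simp only [← sub_smul] at h0
    have h2 := Fintype.linearIndependent_iff.1 hli _ h0 ⟨0, hc.rank_pos hV⟩
    rw [sub_eq_zero] at h2
    simp only at h2
    rw [hdeg, h2, genPoly_coeff, if_pos (Nat.zero_le _), Nat.sub_zero, ← mul_assoc, ← pow_add,
      ← two_mul, pow_mul]
    simp [jdet]

end Cplx

end

noncomputable section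

/-! ### Polar decomposition of the tube over the cone -/

variable {V : Type*} [NormedAddCommGroup V] [InnerProductSpace ℝ V] [EuclideanJordanAlgebra V]
  [FiniteDimensional ℝ V] {l : ℕ} {c : Fin l → V}

theorem IsJordanFrame.exp_frame (hc : IsJordanFrame c) (h : Fin l → ℝ) (j : Fin l) :
    NormedSpace.exp (jordanL (∑ i, h i • c i)) (c j) = Real.exp (h j) • c j := by
  rw [Real.exp_eq_exp_ℝ]
  refine exp_apply_of_eigen ?_
  rw [jordanL_apply, mul_comm, hc.mul_sum_frame]

/-- Splitting h into a part orthogonal to e and a multiple of e separates an element of G¹ from a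
positive scalar. -/
theorem IsJordanFrame.exists_exp_eq_smul (hV : IsSimpleJordan V) (hc : IsJordanFrame c) (h : V) :
    ∃ g ∈ groupG1 V, ∃ r : ℝ, 0 < r ∧ ∀ v, NormedSpace.exp (jordanL h) v = r • (g : V →L[ℝ] V) v := by
  set m : ℝ := inner ℝ h 1 / ‖(1 : V)‖ ^ 2 with hm
  have h1 : ‖(1 : V)‖ ^ 2 ≠ 0 := pow_ne_zero 2 (norm_ne_zero_iff.2 hV.one_ne_zero)
  have h0 : inner ℝ (h - m • (1 : V)) 1 = 0 := by
    rw [inner_sub_left, inner_smul_left, real_inner_self_eq_norm_sq, RCLike.conj_to_real, hm,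
      div_mul_cancel₀ _ h1, sub_self]
  refine ⟨_, expUnit_mem_groupG1 (hc.jordanL_mem_lieG1 hV h0), Real.exp m, Real.exp_pos m,
    fun v => ?_⟩
  have hadd : jordanL h = jordanL (h - m • (1 : V)) + m • (1 : V →L[ℝ] V) := by
    rw [← jordanL_one, ← jordanL_smul, ← jordanL_add, sub_add_cancel]
  have hcomm : Commute (jordanL (h - m • (1 : V))) (m • (1 : V →L[ℝ] V)) :=
    (Commute.one_right _).smul_right m
  let _ : NormedAlgebra ℚ (V →L[ℝ] V) := NormedAlgebra.restrictScalars ℚ ℝ _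
  have h2 : NormedSpace.exp (m • (1 : V →L[ℝ] V)) v = Real.exp m • v := by
    rw [Real.exp_eq_exp_ℝ]
    exact exp_apply_of_eigen (by rw [clm_smul, clm_one])
  rw [hadd, NormedSpace.exp_add_of_commute hcomm, clm_mul, h2, map_smul]
  rfl

theorem one_add_mul_I (a : ℝ) : (1 : ℂ) + a * Complex.I =
    (Real.sqrt (1 + a ^ 2) : ℝ) * Complex.exp ((Real.arctan a : ℝ) * Complex.I) := by
  have h : Real.sqrt (1 + a ^ 2) ≠ 0 := (Real.sqrt_pos.2 (by positivity)).ne'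
  rw [Complex.exp_mul_I, ← Complex.ofReal_cos, ← Complex.ofReal_sin, Real.cos_arctan,
    Real.sin_arctan]
  apply Complex.ext
  · simp [h]
  · simp; field_simp

theorem prod_one_add_mul_I (a : Fin l → ℝ) : ∃ R : ℝ, 0 < R ∧
    ∏ j, ((1 : ℂ) + a j * Complex.I) =
      R * Complex.exp ((∑ j, Real.arctan (a j) : ℝ) * Complex.I) := by
  refine ⟨∏ j, Real.sqrt (1 + a j ^ 2), Finset.prod_pos fun j _ => Real.sqrt_pos.2 (by positivity),
    ?_⟩
  simp only [one_add_mul_I, Finset.prod_mul_distrib, Complex.ofReal_prod, Complex.ofReal_sum,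
    Finset.sum_mul, Complex.exp_sum]

namespace Cplx

theorem extend_comp (S T : V →L[ℝ] V) (z : Cplx V) : extend (S * T) z = extend S (extend T z) := rfl

theorem extend_smul_op (r : ℝ) (T : V →L[ℝ] V) (z : Cplx V) :
    extend (r • T) z = (r : ℂ) • extend T z := by ext <;> simp

/-- Every point of the tube over the cone is equivalent to a diagonal one with real part a multiple
of the unit. -/
theorem exists_tube_eq (hV : IsSimpleJordan V) (hc : IsJordanFrame c) {z : Cplx V}
    (hz : z.re ∈ symmetricCone V) : ∃ g ∈ groupG1 V, ∃ r : ℝ, 0 < r ∧ ∃ t : Fin l → ℝ,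
      z = (r : ℂ) • extend (g : V →L[ℝ] V) (∑ j, ((1 : ℂ) + t j * Complex.I) • ofReal (c j)) := by
  obtain ⟨k, -, s, hd, hx⟩ := hc.exists_spectral z.re
  have hs : ∀ j, 0 < s j := (hd.sum_mem_cone_iff s).1 (hx ▸ hz)
  obtain ⟨g, hg, r, hr, hgr⟩ := hd.exists_exp_eq_smul hV
    (∑ j, Real.log (s j) • (k : V →L[ℝ] V) (c j))
  have h1 : r • (g : V →L[ℝ] V) 1 = z.re := by
    rw [← hgr, ← hd.sum_eq, map_sum, hx]
    refine Finset.sum_congr rfl fun j _ => ?_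
    rw [hd.exp_frame (fun j => Real.log (s j)), Real.exp_log (hs j)]
  -- After Re z has been moved to a multiple of e, the imaginary part is diagonalized by an inner
  -- automorphism, which fixes e and so does not disturb the real part.
  obtain ⟨k', hk', t, -, ht⟩ := hc.exists_spectral
    (r⁻¹ • ((g⁻¹ : (V →L[ℝ] V)ˣ) : V →L[ℝ] V) z.im)
  have h2 : r • (g : V →L[ℝ] V) (∑ j, t j • (k' : V →L[ℝ] V) (c j)) = z.im := by
    rw [← ht, map_smul, smul_smul, mul_inv_cancel₀ hr.ne', one_smul, units_apply_inv]
  refine ⟨g * k', mul_mem hg (hc.innGroup_le_groupG1 hk'), r, hr, t, ?_⟩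
  have h3 : (k' : V →L[ℝ] V) 1 = 1 := (isOrthAut_of_mem_innGroup hk').map_one
  rw [Units.val_mul, extend_comp]
  ext
  · rw [← h1]
    simp [re_sum, -map_sum, hc.sum_eq, h3]
  · rw [← h2]
    simp [im_sum]

/-- The moduli √(1 + t_j²) are the eigenvalues of exp L(∑ log √(1 + t_i²) c_i) on the frame; only
the phases exp(i arctan t_j) remain. -/
theorem exists_eq_polar (hV : IsSimpleJordan V) (hc : IsJordanFrame c) (t : Fin l → ℝ) :
    ∃ g ∈ groupG1 V, ∃ r : ℝ, 0 < r ∧ ∑ j, ((1 : ℂ) + t j * Complex.I) • ofReal (c j) =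
      (r : ℂ) • extend (g : V →L[ℝ] V)
        (∑ j, Complex.exp ((Real.arctan (t j) : ℝ) * Complex.I) • ofReal (c j)) := by
  obtain ⟨g, hg, r, hr, hgr⟩ := hc.exists_exp_eq_smul hV
    (∑ j, Real.log (Real.sqrt (1 + t j ^ 2)) • c j)
  refine ⟨g, hg, r, hr, ?_⟩
  rw [← extend_smul_op, map_sum]
  refine Finset.sum_congr rfl fun j _ => ?_
  rw [map_smul, extend_ofReal, clm_smul, ← hgr,
    hc.exp_frame (fun j => Real.log (Real.sqrt (1 + t j ^ 2))),
    Real.exp_log (Real.sqrt_pos.2 (by positivity)), ofReal_smul, smul_smul,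
    mul_comm (Complex.exp _), ← one_add_mul_I]

/-! ### The operator `P(z, z̄)` -/

/-- The real operator whose complex linear extension is `P(z, z̄)`. -/
def hermP (z : Cplx V) : V →L[ℝ] V := quadP z.re z.re + quadP z.im z.im

theorem P_conj_eq (z : Cplx V) : P z (conj z) = (extend (hermP z) : Cplx V →ₗ[ℂ] Cplx V) := by
  refine LinearMap.ext fun w => ?_
  change z * (conj z * w) + conj z * (z * w) - (z * conj z) * w = extend (hermP z) w
  ext
  · simp only [hermP, re_extend, re_sub, re_add, re_mul, im_mul, re_conj, im_conj,
      clm_add, quadP_apply, mul_add, add_mul, mul_sub, sub_mul, neg_mul, mul_neg, mul_comm z.im z.re]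
    abel
  · simp only [hermP, im_extend, im_sub, im_add, re_mul, im_mul, re_conj, im_conj,
      clm_add, quadP_apply, mul_add, add_mul, mul_sub, sub_mul, neg_mul, mul_neg, mul_comm z.im z.re]
    abel

theorem det_extend (T : V →L[ℝ] V) :
    LinearMap.det (extend T : Cplx V →ₗ[ℂ] Cplx V) = ((T.det : ℝ) : ℂ) := by
  classical
  set b := Module.finBasis ℝ V
  rw [ContinuousLinearMap.det, ← LinearMap.det_toMatrix b, ← LinearMap.det_toMatrix (basis b)]
  change _ = Complex.ofRealHom _
  rw [RingHom.map_det]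
  congr 1
  ext i j
  rw [LinearMap.toMatrix_apply, basis_apply, RingHom.mapMatrix_apply, Matrix.map_apply,
    LinearMap.toMatrix_apply]
  change (basis b).repr (extend T (ofReal (b j))) i = _
  rw [extend_ofReal, basis_repr]
  simp

theorem det_P_conj (z : Cplx V) : LinearMap.det (P z (conj z)) = (((hermP z).det : ℝ) : ℂ) := by
  rw [P_conj_eq, det_extend]

theorem potential_eq (z : Cplx V) : potential z = -Real.log (hermP z).det := by
  rw [potential, det_P_conj, Complex.ofReal_re, Real.log_inv]

theorem hermP_extend {g : (V →L[ℝ] V)ˣ} (hu : IsUnimodular g) (z : Cplx V) :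
    hermP (extend (g : V →L[ℝ] V) z) = (g : V →L[ℝ] V) * hermP z *
      ContinuousLinearMap.adjoint (g : V →L[ℝ] V) := by
  rw [hermP, hermP, re_extend, im_extend, hu.quadP_map, hu.quadP_map]
  noncomm_ring

theorem det_hermP_extend {g : (V →L[ℝ] V)ˣ} (hu : IsUnimodular g) (z : Cplx V) :
    (hermP (extend (g : V →L[ℝ] V) z)).det = (hermP z).det := by
  rw [hermP_extend hu, det_clm_mul, det_clm_mul, det_adjoint_clm, hu.det_eq, one_mul, mul_one]

theorem potential_extend {g : (V →L[ℝ] V)ˣ} (hu : IsUnimodular g) (z : Cplx V) :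
    potential (extend (g : V →L[ℝ] V) z) = potential z := by
  rw [potential_eq, potential_eq, det_hermP_extend hu]

variable (c) in
/-- The point `∑ exp(iθ_j) c_j` of the diagonal torus. -/
def torusPt (θ : Fin l → ℝ) : Cplx V := ∑ j, Complex.exp (θ j * Complex.I) • ofReal (c j)

theorem re_torusPt (θ : Fin l → ℝ) : (torusPt c θ).re = ∑ j, Real.cos (θ j) • c j := by
  simp only [torusPt, re_sum, re_smul, re_ofReal, im_ofReal, smul_zero, sub_zero,
    Complex.exp_ofReal_mul_I_re]

theorem im_torusPt (θ : Fin l → ℝ) : (torusPt c θ).im = ∑ j, Real.sin (θ j) • c j := by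
  simp only [torusPt, im_sum, im_smul, re_ofReal, im_ofReal, smul_zero, zero_add,
    Complex.exp_ofReal_mul_I_im]

/-- The eigenvalue is cos θ_j cos θ_k + sin θ_j sin θ_k. This is how the condition |θ_j - θ_k| < π/2
becomes positivity of P(z, z̄). -/
theorem hermP_torusPt (hc : IsJordanFrame c) (θ : Fin l → ℝ) {j k : Fin l} {b : V}
    (hb : b ∈ peirceSpace c j k) : hermP (torusPt c θ) b = Real.cos (θ j - θ k) • b := by
  have h : ∀ s : Fin l → ℝ, quadP (∑ j, s j • c j) (∑ j, s j • c j) b = (s j * s k) • b := by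
    intro s
    rw [quadP_apply, hc.sum_mul_sum, frame_sum_mul _ hb, frame_sum_mul _ hb, mul_smul_comm,
      frame_sum_mul _ hb]
    module
  rw [hermP, clm_add, re_torusPt, im_torusPt, h, h, Real.cos_sub]
  module

/-! ### The domain -/

/-- The set of admissible angles. -/
def IsAngle (θ : Fin l → ℝ) : Prop := (∀ j k, |θ j - θ k| < Real.pi / 2) ∧ ∑ j, θ j = 0

/-- As the angles sum to zero, θ_j is the average of the differences θ_j - θ_k. In particular cos
θ_j > 0, so the domain lies in the tube over the cone. -/
theorem IsAngle.abs_lt {θ : Fin l → ℝ} (h : IsAngle θ) (j : Fin l) : |θ j| < Real.pi / 2 := by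
  have hl : (0 : ℝ) < l := by exact_mod_cast j.pos
  have h1 : l * θ j = ∑ k, (θ j - θ k) := by
    rw [Finset.sum_sub_distrib, h.2]; simp
  have h2 : |l * θ j| < l * (Real.pi / 2) := by
    rw [h1]
    refine (Finset.abs_sum_le_sum_abs _ _).trans_lt ?_
    refine (Finset.sum_lt_sum_of_nonempty ⟨j, Finset.mem_univ j⟩ fun k _ => h.1 j k).trans_le ?_
    simp
  rw [abs_mul, abs_of_pos hl] at h2
  exact lt_of_mul_lt_mul_left h2 hl.le

theorem exp_extend_apply_one (hc : IsJordanFrame c) (x : Fin l → ℝ) :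
    NormedSpace.exp ((Complex.I / 2) • extend (jordanL (∑ j, x j • c j))) (1 : Cplx V) =
      torusPt c fun j => x j / 2 := by
  rw [one_def, ← hc.sum_eq, ofReal_sum, map_sum, torusPt]
  refine Finset.sum_congr rfl fun j _ => ?_
  rw [exp_apply_of_eigen (r := ((x j / 2 : ℝ) : ℂ) * Complex.I), Complex.exp_eq_exp_ℂ]
  change (Complex.I / 2) • extend (jordanL (∑ j, x j • c j)) (ofReal (c j)) = _
  rw [extend_ofReal, jordanL_apply, mul_comm, hc.mul_sum_frame, ofReal_smul, smul_smul]
  congr 1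
  push_cast; ring

theorem mem_Xi_iff (hV : IsSimpleJordan V) (hc : IsJordanFrame c) {z : Cplx V} :
    z ∈ Xi c ↔ ∃ g ∈ groupG1 V, ∃ θ : Fin l → ℝ, IsAngle θ ∧
      z = extend (g : V →L[ℝ] V) (torusPt c θ) := by
  constructor
  · rintro ⟨g, hg, X, hX, rfl⟩
    obtain ⟨x, rfl, h1, h2⟩ := (hc.mem_crownOmega1_iff hV).1 hX
    refine ⟨g, hg, _, ⟨fun j k => ?_, ?_⟩, by rw [exp_extend_apply_one hc]⟩
    · have := h1 j k
      rw [← sub_div, abs_div, abs_two]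
      linarith
    · rw [← Finset.sum_div, h2, zero_div]
  · rintro ⟨g, hg, θ, hθ, rfl⟩
    refine ⟨g, hg, _, (hc.mem_crownOmega1_iff hV).2 ⟨fun j => 2 * θ j, rfl, fun j k => ?_, ?_⟩, ?_⟩
    · have := hθ.1 j k
      rw [← mul_sub, abs_mul, abs_two]
      linarith
    · rw [← Finset.mul_sum, hθ.2, mul_zero]
    · rw [exp_extend_apply_one hc]
      congr 2
      ext j; ring

theorem extend_mem_Xi {g : (V →L[ℝ] V)ˣ} (hg : g ∈ groupG1 V) {z : Cplx V} (hz : z ∈ Xi c) :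
    extend (g : V →L[ℝ] V) z ∈ Xi c := by
  obtain ⟨g', hg', X, hX, rfl⟩ := hz
  exact ⟨g * g', mul_mem hg hg', X, hX, rfl⟩

theorem jdet_torusPt (hV : IsSimpleJordan V) (hc : IsJordanFrame c) (θ : Fin l → ℝ) :
    jdet l (torusPt c θ) = Complex.exp ((∑ j, θ j : ℝ) * Complex.I) := by
  rw [torusPt, jdet_frame hV hc, ← Complex.exp_sum, Complex.ofReal_sum, Finset.sum_mul]

theorem det_hermP_torusPt_pos (hc : IsJordanFrame c) {θ : Fin l → ℝ}
    (hθ : IsAngle θ) : 0 < (hermP (torusPt c θ)).det := by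
  obtain ⟨B⟩ := hc.nonempty_peirceBasis
  rw [det_eq_prod_of_onb B.b fun a => hermP_torusPt hc θ (B.mem a)]
  exact Finset.prod_pos fun a _ => Real.cos_pos_of_mem_Ioo (abs_lt.1 (hθ.1 _ _))

end Cplx

end

noncomputable section

/-! ### The domain is open in the hypersurface `det = 1` -/

theorem isOpen_forall_compact_pos {X Y : Type*} [TopologicalSpace X] [TopologicalSpace Y]
    {K : Set Y} (hK : IsCompact K) {F : X → Y → ℝ} (hF : Continuous fun p : X × Y => F p.1 p.2) :
    IsOpen {x | ∀ y ∈ K, 0 < F x y} := by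
  refine isOpen_iff_mem_nhds.2 fun x hx => ?_
  exact hK.eventually_forall_of_forall_eventually fun y hy =>
    (isOpen_lt continuous_const hF).mem_nhds (hx y hy)

/-- A continuous angle starting at 0 cannot reach ±π/2 while its cosine stays positive. This
converts the open condition in `Cplx.tubeNhd` into control of the branch of the argument. -/
theorem abs_lt_of_cos_pos {f : ℝ → ℝ} (hf : Continuous f) (h0 : f 0 = 0)
    (hc : ∀ s ∈ Icc (0 : ℝ) 1, 0 < Real.cos (f s)) : |f 1| < Real.pi / 2 := by
  by_contra! hcon
  have h1 : Real.pi / 2 ∈ Icc |f 0| |f 1| := ⟨by rw [h0, abs_zero]; positivity, hcon⟩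
  obtain ⟨s, hs, hs'⟩ := intermediate_value_Icc zero_le_one hf.abs.continuousOn h1
  have h2 := hc s hs
  simp only at hs'
  rw [← Real.cos_abs, hs', Real.cos_pi_div_two] at h2
  exact lt_irrefl _ h2

variable {V : Type*} [NormedAddCommGroup V] [InnerProductSpace ℝ V] [EuclideanJordanAlgebra V]
  [FiniteDimensional ℝ V] {l : ℕ} {c : Fin l → V}

variable (V) in
/-- `L` as a continuous linear map. -/
def jordanLC : V →L[ℝ] V →L[ℝ] V := LinearMap.toContinuousLinearMap (jordanLm (V := V))

theorem contDiff_jordanL {n : WithTop ℕ∞} : ContDiff ℝ n (jordanL : V → V →L[ℝ] V) :=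
  (jordanLC V).contDiff

theorem ContDiff.jmul {F : Type*} [NormedAddCommGroup F] [NormedSpace ℝ F] {n : WithTop ℕ∞}
    {f g : F → V} (hf : ContDiff ℝ n f) (hg : ContDiff ℝ n g) : ContDiff ℝ n fun x => f x * g x :=
  (contDiff_jordanL.comp hf).clm_apply hg

theorem ContDiff.quadP {F : Type*} [NormedAddCommGroup F] [NormedSpace ℝ F] {n : WithTop ℕ∞}
    {f g : F → V} (hf : ContDiff ℝ n f) (hg : ContDiff ℝ n g) :
    ContDiff ℝ n fun x => _root_.quadP (f x) (g x) := by
  have h1 := contDiff_jordanL.comp hf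
  have h2 := contDiff_jordanL.comp hg
  exact ((h1.clm_comp h2).add (h2.clm_comp h1)).sub (contDiff_jordanL.comp (hf.jmul hg))

theorem contDiff_det_clm {n : WithTop ℕ∞} : ContDiff ℝ n fun T : V →L[ℝ] V => T.det := by
  have h : (fun T : V →L[ℝ] V => T.det) = fun T => ∑ σ : Equiv.Perm (Fin (Module.finrank ℝ V)),
      (Equiv.Perm.sign σ : ℝ) * ∏ i, inner ℝ (stdOrthonormalBasis ℝ V (σ i))
        (T (stdOrthonormalBasis ℝ V i)) := by
    ext T
    rw [det_eq_of_onb (stdOrthonormalBasis ℝ V), Matrix.det_apply']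
    simp
  rw [h]
  refine ContDiff.sum fun σ _ => contDiff_const.mul (contDiff_prod fun i _ => ?_)
  exact contDiff_const.inner ℝ (contDiff_id.clm_apply contDiff_const)

theorem units_adjoint_apply (g : (V →L[ℝ] V)ˣ) (x : V) :
    ContinuousLinearMap.adjoint (g : V →L[ℝ] V)
      (ContinuousLinearMap.adjoint ((g⁻¹ : (V →L[ℝ] V)ˣ) : V →L[ℝ] V) x) = x := by
  refine ext_inner_left ℝ fun y => ?_
  rw [ContinuousLinearMap.adjoint_inner_right, ContinuousLinearMap.adjoint_inner_right,
    units_inv_apply]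

namespace Cplx

theorem contDiff_hermP {n : WithTop ℕ∞} : ContDiff ℝ n (hermP : Cplx V → V →L[ℝ] V) :=
  ((reL (V := V)).contDiff.quadP reL.contDiff).add (imL.contDiff.quadP imL.contDiff)

theorem continuous_hermP : Continuous (hermP : Cplx V → V →L[ℝ] V) :=
  (contDiff_hermP (n := 0)).continuous

theorem isOpen_hermP_pos : IsOpen {z : Cplx V | ∀ u, u ≠ 0 → 0 < inner ℝ (hermP z u) u} := by
  have h : {z : Cplx V | ∀ u, u ≠ 0 → 0 < inner ℝ (hermP z u) u} =
      {z : Cplx V | ∀ u ∈ Metric.sphere (0 : V) 1, 0 < inner ℝ (hermP z u) u} := by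
    ext z
    refine ⟨fun h u hu => h u (ne_zero_of_mem_unit_sphere ⟨u, hu⟩), fun h u hu => ?_⟩
    have hn := norm_pos_iff.2 hu
    have h1 := h (‖u‖⁻¹ • u) (by
      rw [mem_sphere_zero_iff_norm, norm_smul, norm_inv, norm_norm, inv_mul_cancel₀ hn.ne'])
    rw [map_smul, inner_smul_left, inner_smul_right, ← mul_assoc] at h1
    simp only [RCLike.conj_to_real] at h1
    exact pos_of_mul_pos_right h1 (by positivity)
  rw [h]
  refine isOpen_forall_compact_pos (isCompact_sphere _ _) ?_
  exact ((continuous_hermP.comp continuous_fst).clm_apply continuous_snd).inner continuous_snd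

theorem hermP_extend_inner {g : (V →L[ℝ] V)ˣ} (hu : IsUnimodular g) (z : Cplx V) (u v : V) :
    inner ℝ (hermP (extend (g : V →L[ℝ] V) z) u) v =
      inner ℝ (hermP z (ContinuousLinearMap.adjoint (g : V →L[ℝ] V) u))
        (ContinuousLinearMap.adjoint (g : V →L[ℝ] V) v) := by
  rw [hermP_extend hu, clm_mul, clm_mul, ContinuousLinearMap.adjoint_inner_right]

/-- The segment from `Re z` to `z`. -/
def tubePath (z : Cplx V) (s : ℝ) : Cplx V := mk z.re (s • z.im)

theorem continuous_tubePath : Continuous fun p : Cplx V × ℝ => tubePath p.1 p.2 := by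
  simp only [tubePath, mk_eq]
  have h : Continuous (ofReal : V → Cplx V) := ofRealL.continuous
  have h2 : Continuous fun p : Cplx V × ℝ => ofReal (p.2 • p.1.im) :=
    h.comp (continuous_snd.smul (continuous_im.comp continuous_fst))
  exact (h.comp (continuous_re.comp continuous_fst)).add (h2.const_smul Complex.I)

theorem tubePath_extend (g : V →L[ℝ] V) (r : ℝ) (a t : Fin l → ℝ) (s : ℝ) :
    tubePath ((r : ℂ) • extend g (∑ j, ((a j : ℂ) * (1 + t j * Complex.I)) • ofReal (c j))) s =
      (r : ℂ) • extend g (∑ j, ((a j : ℂ) * (1 + (s * t j : ℝ) * Complex.I)) • ofReal (c j)) := by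
  ext
  · simp [tubePath, re_sum]
  · simp [tubePath, im_sum, Finset.smul_sum, smul_smul]
    refine Finset.sum_congr rfl fun j _ => ?_
    congr 1; ring

theorem jdet_tubePath (hV : IsSimpleJordan V) (hc : IsJordanFrame c) {g : (V →L[ℝ] V)ˣ}
    (hg : g ∈ groupG1 V) {r : ℝ} (hr : 0 < r) {a : Fin l → ℝ} (ha : ∀ j, 0 < a j)
    (t : Fin l → ℝ) (s : ℝ) : ∃ R : ℝ, 0 < R ∧ jdet l (tubePath ((r : ℂ) • extend (g : V →L[ℝ] V)
      (∑ j, ((a j : ℂ) * (1 + t j * Complex.I)) • ofReal (c j))) s) =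
        R * Complex.exp ((∑ j, Real.arctan (s * t j) : ℝ) * Complex.I) := by
  obtain ⟨R, hR, h⟩ := prod_one_add_mul_I fun j => s * t j
  have hp : 0 < ∏ j, a j := Finset.prod_pos fun j _ => ha j
  refine ⟨r ^ l * (∏ j, a j) * R, by positivity, ?_⟩
  rw [tubePath_extend, jdet_smul, jdet_extend hV hc hg, jdet_frame hV hc, Finset.prod_mul_distrib, h]
  push_cast; ring

/-- A neighbourhood of the domain in `V_ℂ` cutting it out of the hypersurface `det = 1`. -/
def tubeNhd (c : Fin l → V) : Set (Cplx V) :=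
  {z | z.re ∈ symmetricCone V ∧ (∀ u, u ≠ 0 → 0 < inner ℝ (hermP z u) u) ∧
    ∃ z₀ ∈ Xi c, ∀ s ∈ Icc (0 : ℝ) 1,
      0 < (jdet l (tubePath z s) * (starRingEnd ℂ) (jdet l (tubePath z₀ s))).re}

theorem isOpen_tubeNhd (c : Fin l → V) : IsOpen (tubeNhd c) := by
  have h1 : IsOpen {z : Cplx V | z.re ∈ symmetricCone V} :=
    isOpen_interior.preimage continuous_re
  refine h1.inter (isOpen_hermP_pos.inter ?_)
  have : {z : Cplx V | ∃ z₀ ∈ Xi c, ∀ s ∈ Icc (0 : ℝ) 1,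
      0 < (jdet l (tubePath z s) * (starRingEnd ℂ) (jdet l (tubePath z₀ s))).re} =
      ⋃ z₀ ∈ Xi c, {z | ∀ s ∈ Icc (0 : ℝ) 1,
        0 < (jdet l (tubePath z s) * (starRingEnd ℂ) (jdet l (tubePath z₀ s))).re} := by
    ext z; simp
  change IsOpen {z : Cplx V | ∃ z₀ ∈ Xi c, ∀ s ∈ Icc (0 : ℝ) 1,
      0 < (jdet l (tubePath z s) * (starRingEnd ℂ) (jdet l (tubePath z₀ s))).re}
  rw [this]
  refine isOpen_biUnion fun z₀ _ => isOpen_forall_compact_pos isCompact_Icc ?_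
  have hd := (differentiable_jdet (V := V) l).continuous
  refine Complex.continuous_re.comp ((hd.comp continuous_tubePath).mul
    (Complex.continuous_conj.comp (hd.comp ?_)))
  exact continuous_tubePath.comp (continuous_const.prodMk continuous_snd)

theorem hermP_torusPt_pos (hc : IsJordanFrame c) {θ : Fin l → ℝ} (hθ : IsAngle θ) {u : V}
    (hu : u ≠ 0) : 0 < inner ℝ (hermP (torusPt c θ) u) u := by
  obtain ⟨B⟩ := hc.nonempty_peirceBasis
  have h : inner ℝ (hermP (torusPt c θ) u) u =
      ∑ a, Real.cos (θ (B.p a) - θ (B.q a)) * inner ℝ (B.b a) u ^ 2 := by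
    conv_lhs => enter [2, 2]; rw [← B.b.sum_repr' u]
    rw [map_sum, sum_inner]
    refine Finset.sum_congr rfl fun a _ => ?_
    rw [map_smul, hermP_torusPt hc θ (B.mem a), inner_smul_left, inner_smul_left]
    simp only [RCLike.conj_to_real]
    ring
  rw [h]
  obtain ⟨a, ha⟩ : ∃ a, inner ℝ (B.b a) u ≠ 0 := by
    by_contra! hcon
    exact hu (by rw [← B.b.sum_repr' u]; simp [hcon])
  have hpos : ∀ a, 0 < Real.cos (θ (B.p a) - θ (B.q a)) := fun a =>
    Real.cos_pos_of_mem_Ioo (abs_lt.1 (hθ.1 _ _))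
  exact Finset.sum_pos' (fun a _ => mul_nonneg (hpos a).le (sq_nonneg _))
    ⟨a, Finset.mem_univ a, mul_pos (hpos a) (by positivity)⟩

theorem torusPt_eq_tan {θ : Fin l → ℝ} (hθ : ∀ j, |θ j| < Real.pi / 2) : torusPt c θ =
    ∑ j, ((Real.cos (θ j) : ℂ) * (1 + Real.tan (θ j) * Complex.I)) • ofReal (c j) := by
  refine Finset.sum_congr rfl fun j _ => ?_
  have h := (Real.cos_pos_of_mem_Ioo (abs_lt.1 (hθ j))).ne'
  have h' : (Real.cos (θ j) : ℂ) ≠ 0 := by exact_mod_cast h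
  rw [Complex.exp_mul_I, Real.tan_eq_sin_div_cos, ← Complex.ofReal_cos, ← Complex.ofReal_sin]
  congr 1
  push_cast at h' ⊢
  field_simp

theorem Xi_subset_tubeNhd (hV : IsSimpleJordan V) (hc : IsJordanFrame c) : Xi c ⊆ tubeNhd c := by
  intro z hz
  obtain ⟨g, hg, θ, hθ, rfl⟩ := (mem_Xi_iff hV hc).1 hz
  have hu := hc.isUnimodular hg
  have hcos : ∀ j, 0 < Real.cos (θ j) := fun j =>
    Real.cos_pos_of_mem_Ioo (abs_lt.1 (hθ.abs_lt j))
  refine ⟨?_, fun u hu0 => ?_, _, hz, fun s _ => ?_⟩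
  · rw [re_extend, hu.mem_cone, re_torusPt, hc.sum_mem_cone_iff]
    exact hcos
  · rw [hermP_extend_inner hu]
    refine hermP_torusPt_pos hc hθ fun h0 => hu0 ?_
    have := units_adjoint_apply g⁻¹ u
    rw [inv_inv, h0, map_zero] at this
    exact this.symm
  -- With z itself as reference point the quantity is |det|², and det has no zero on the segment.
  · obtain ⟨R, hR, h⟩ := jdet_tubePath hV hc hg one_pos hcos (fun j => Real.tan (θ j)) s
    rw [Complex.ofReal_one, one_smul, ← torusPt_eq_tan hθ.abs_lt] at h
    rw [Complex.mul_conj, Complex.ofReal_re, Complex.normSq_pos, h]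
    exact mul_ne_zero (by exact_mod_cast hR.ne') (Complex.exp_ne_zero _)

theorem jdet_of_mem_Xi (hV : IsSimpleJordan V) (hc : IsJordanFrame c) {z : Cplx V}
    (hz : z ∈ Xi c) : jdet l z = 1 := by
  obtain ⟨g, hg, θ, hθ, rfl⟩ := (mem_Xi_iff hV hc).1 hz
  rw [jdet_extend hV hc hg, jdet_torusPt hV hc, hθ.2]
  simp

/-- In polar form z = r g·∑ exp(i arctan t_j) c_j, the equation det z = 1 alone fixes ∑ arctan t_j
only modulo 2π. Comparison of arguments along the segments from the real parts removes this
ambiguity. -/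
theorem mem_Xi_of_mem_tubeNhd (hV : IsSimpleJordan V) (hc : IsJordanFrame c) {z : Cplx V}
    (hz : z ∈ tubeNhd c) (h1 : jdet l z = 1) : z ∈ Xi c := by
  obtain ⟨hW, hP, z₀, hz₀, hs⟩ := hz
  obtain ⟨g, hg, r, hr, t, hzt⟩ := exists_tube_eq hV hc hW
  obtain ⟨g₀, hg₀, θ, hθ, rfl⟩ := (mem_Xi_iff hV hc).1 hz₀
  have hcos : ∀ j, 0 < Real.cos (θ j) := fun j =>
    Real.cos_pos_of_mem_Ioo (abs_lt.1 (hθ.abs_lt j))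
  have hz1 : z = (r : ℂ) • extend (g : V →L[ℝ] V)
      (∑ j, (((1 : ℝ) : ℂ) * (1 + t j * Complex.I)) • ofReal (c j)) := by
    simpa using hzt
  have hz2 : extend (g₀ : V →L[ℝ] V) (torusPt c θ) = ((1 : ℝ) : ℂ) • extend (g₀ : V →L[ℝ] V)
      (∑ j, ((Real.cos (θ j) : ℂ) * (1 + Real.tan (θ j) * Complex.I)) • ofReal (c j)) := by
    rw [← torusPt_eq_tan hθ.abs_lt, Complex.ofReal_one, one_smul]
  -- The difference of the continuous arguments of det along the two segments; at s = 1 the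
  -- reference contributes ∑ θ_j = 0.
  set A : ℝ → ℝ := fun s => ∑ j, Real.arctan (s * t j) - ∑ j, Real.arctan (s * Real.tan (θ j))
    with hA
  have hAs : |A 1| < Real.pi / 2 := by
    refine abs_lt_of_cos_pos ?_ (by simp [hA]) fun s hs' => ?_
    · have : Continuous Real.arctan := Real.continuous_arctan
      fun_prop
    · have := hs s hs'
      obtain ⟨R, hR, e1⟩ := jdet_tubePath hV hc hg hr (a := fun _ => 1) (fun _ => one_pos) t s
      obtain ⟨R', hR', e2⟩ := jdet_tubePath hV hc hg₀ one_pos hcos (fun j => Real.tan (θ j)) s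
      rw [hz2, e2, hz1, e1, map_mul, Complex.conj_ofReal, ← Complex.exp_conj, map_mul,
        Complex.conj_ofReal, Complex.conj_I, mul_mul_mul_comm, ← Complex.exp_add] at this
      have e3 : ((∑ j, Real.arctan (s * t j) : ℝ) : ℂ) * Complex.I +
          ((∑ j, Real.arctan (s * Real.tan (θ j)) : ℝ) : ℂ) * -Complex.I = (A s : ℝ) * Complex.I := by
        rw [hA]; push_cast; ring
      rw [e3, ← Complex.ofReal_mul, Complex.re_ofReal_mul, Complex.exp_ofReal_mul_I_re] at this
      exact pos_of_mul_pos_right this (by positivity)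
  have hA1 : A 1 = ∑ j, Real.arctan (t j) := by
    have e : ∀ j, Real.arctan (Real.tan (θ j)) = θ j := fun j =>
      Real.arctan_tan (abs_lt.1 (hθ.abs_lt j)).1 (abs_lt.1 (hθ.abs_lt j)).2
    simp only [hA, one_mul, e, hθ.2, sub_zero]
  obtain ⟨g', hg', r', hr', ht⟩ := exists_eq_polar hV hc t
  have hz3 : z = ((r * r' : ℝ) : ℂ) • extend ((g * g' : (V →L[ℝ] V)ˣ) : V →L[ℝ] V)
      (torusPt c fun j => Real.arctan (t j)) := by
    rw [hzt, ht, map_smul, smul_smul, Units.val_mul, extend_comp, Complex.ofReal_mul]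
    rfl
  have hgg := mul_mem hg hg'
  have hrr : 0 < r * r' := mul_pos hr hr'
  rw [hz3, jdet_smul, jdet_extend hV hc hgg, jdet_torusPt hV hc, ← hA1, ← Complex.ofReal_pow] at h1
  have him := congrArg Complex.im h1
  rw [Complex.im_ofReal_mul, Complex.exp_ofReal_mul_I_im, Complex.one_im] at him
  have hsin := (mul_eq_zero.1 him).resolve_left (pow_pos hrr l).ne'
  have hpi := abs_lt.1 hAs
  have hA0 : A 1 = 0 := (Real.sin_eq_zero_iff_of_lt_of_lt (by linarith [Real.pi_pos])
    (by linarith [Real.pi_pos])).1 hsin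
  have hr1 : r * r' = 1 := by
    rw [hA0] at h1
    have h2 : (r * r') ^ l = 1 := by
      simp only [Complex.ofReal_zero, zero_mul, Complex.exp_zero, _root_.mul_one] at h1
      exact_mod_cast h1
    exact (pow_eq_one_iff_of_nonneg hrr.le (hc.rank_pos hV).ne').1 h2
  rw [hr1, Complex.ofReal_one, one_smul] at hz3
  refine (mem_Xi_iff hV hc).2 ⟨_, hgg, _, ⟨fun j k => ?_, hA1 ▸ hA0⟩, hz3⟩
  by_cases hjk : j = k
  · subst hjk; simpa using Real.pi_pos
  obtain ⟨b, hb, hb0⟩ := hc.exists_peirce_ne_zero hV hjk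
  set u := ContinuousLinearMap.adjoint (((g * g')⁻¹ : (V →L[ℝ] V)ˣ) : V →L[ℝ] V) b with hu
  have hub := units_adjoint_apply (g * g') b
  rw [← hu] at hub
  have hu0 : u ≠ 0 := fun h0 => hb0 (by rw [← hub, h0, map_zero])
  have hpos := hP u hu0
  rw [hz3, hermP_extend_inner (hc.isUnimodular hgg), hub, hermP_torusPt hc _ hb, inner_smul_left,
    real_inner_self_eq_norm_sq, RCLike.conj_to_real] at hpos
  have hcosp := pos_of_mul_pos_left hpos (by positivity)
  have b1 := Real.arctan_lt_pi_div_two (t j)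
  have b2 := Real.neg_pi_div_two_lt_arctan (t j)
  -- Values of arctan differ by less than π, and on that range a positive cosine means a difference
  -- below π/2.
  have b3 := Real.arctan_lt_pi_div_two (t k)
  have b4 := Real.neg_pi_div_two_lt_arctan (t k)
  by_contra! hcon
  rw [← Real.cos_abs] at hcosp
  have := Real.cos_nonpos_of_pi_div_two_le_of_le hcon (by
    have : |Real.arctan (t j) - Real.arctan (t k)| ≤ Real.pi := abs_le.2 ⟨by linarith, by linarith⟩
    linarith [Real.pi_pos])
  linarith

theorem isOpenInHypersurface_Xi (hV : IsSimpleJordan V) (hc : IsJordanFrame c) :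
    IsOpenInHypersurface (Xi c) (jdet l) := by
  refine ⟨differentiable_jdet l, ⟨tubeNhd c, isOpen_tubeNhd c, ?_⟩, fun z hz h0 => ?_⟩
  · exact Subset.antisymm
      (fun z hz => ⟨Xi_subset_tubeNhd hV hc hz, jdet_of_mem_Xi hV hc hz⟩)
      fun z hz => mem_Xi_of_mem_tubeNhd hV hc hz.1 hz.2
  · have h := fderiv_jdet_self l z
    rw [h0, jdet_of_mem_Xi hV hc hz, _root_.mul_one] at h
    change (0 : ℂ) = l at h
    exact (hc.rank_pos hV).ne' (by exact_mod_cast h.symm)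

end Cplx

end

noncomputable section

/-! ### The Levi form -/

section Levi

variable {E : Type*} [NormedAddCommGroup E] [NormedSpace ℂ E]

theorem two_le_infty : (2 : WithTop ℕ∞) ≤ ((⊤ : ℕ∞) : WithTop ℕ∞) := by
  have : ((2 : ℕ∞) : WithTop ℕ∞) ≤ ((⊤ : ℕ∞) : WithTop ℕ∞) := WithTop.coe_le_coe.2 le_top
  exact this

/-- The second derivative as a real bilinear form. -/
def hessian (f : E → ℝ) (z : E) : E →L[ℝ] E →L[ℝ] ℝ := fderiv ℝ (fderiv ℝ f) z

theorem hasDerivAt_line (z Z : E) : HasDerivAt (fun t : ℝ => z + (t : ℂ) • Z) Z 0 := by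
  have h : HasDerivAt (fun t : ℝ => (t : ℂ)) 1 0 := Complex.ofRealCLM.hasDerivAt (x := (0 : ℝ))
  simpa using (h.smul_const Z).const_add z

theorem dirDeriv_ofReal {f : E → ℝ} {z : E} (hf : DifferentiableAt ℝ f z) (Z : E) :
    dirDeriv Z (fun w => (f w : ℂ)) z = (fderiv ℝ f z Z : ℝ) := by
  have h1 : HasFDerivAt f (fderiv ℝ f z) (z + ((0 : ℝ) : ℂ) • Z) := by
    simpa using hf.hasFDerivAt
  exact (h1.comp_hasDerivAt (0 : ℝ) (hasDerivAt_line z Z)).ofReal_comp.deriv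

theorem dirDeriv_congr {f g : E → ℂ} {z : E} (h : f =ᶠ[𝓝 z] g) (Z : E) :
    dirDeriv Z f z = dirDeriv Z g z := by
  refine Filter.EventuallyEq.deriv_eq ?_
  have hc : Tendsto (fun t : ℝ => z + (t : ℂ) • Z) (𝓝 0) (𝓝 z) := by
    simpa using (hasDerivAt_line z Z).continuousAt.tendsto
  exact hc.eventually h

theorem delbarZ_ofReal {f : E → ℝ} {z : E} (hf : DifferentiableAt ℝ f z) (Z : E) :
    delbarZ Z (fun w => (f w : ℂ)) z =
      (1 / 2 : ℂ) * ((fderiv ℝ f z Z : ℝ) + Complex.I * (fderiv ℝ f z (Complex.I • Z) : ℝ)) := by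
  rw [delbarZ, dirDeriv_ofReal hf, dirDeriv_ofReal hf]

/-- Expressing the Wirtinger derivatives through the real Hessian makes sesquilinearity and
Hermitian symmetry algebraic consequences of the symmetry of second derivatives. -/
theorem leviForm_eq {f : E → ℝ} {z : E} (hf : ContDiffAt ℝ 2 f z) (u v : E) :
    leviForm f z u v = (1 / 4 : ℂ) * ((hessian f z u v + hessian f z (Complex.I • u) (Complex.I • v) : ℝ) +
      Complex.I * (hessian f z u (Complex.I • v) - hessian f z (Complex.I • u) v : ℝ)) := by
  have hev : ∀ᶠ w in 𝓝 z, DifferentiableAt ℝ f w :=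
    (hf.eventually (by simp)).mono fun w hw => hw.differentiableAt (by simp)
  have h1 : delbarZ v (fun w => (f w : ℂ)) =ᶠ[𝓝 z] fun w =>
      (1 / 2 : ℂ) * ((fderiv ℝ f w v : ℝ) + Complex.I * (fderiv ℝ f w (Complex.I • v) : ℝ)) :=
    hev.mono fun w hw => delbarZ_ofReal hw v
  have hd : DifferentiableAt ℝ (fderiv ℝ f) z :=
    (hf.fderiv_right (m := 1) (by norm_num)).differentiableAt (by simp)
  have h2 : ∀ Z, dirDeriv Z (delbarZ v fun w => (f w : ℂ)) z =
      (1 / 2 : ℂ) * ((hessian f z Z v : ℝ) + Complex.I * (hessian f z Z (Complex.I • v) : ℝ)) := by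
    intro Z
    rw [dirDeriv_congr h1]
    have h3 : ∀ x, HasDerivAt (fun t : ℝ => ((fderiv ℝ f (z + (t : ℂ) • Z) x : ℝ) : ℂ))
        (hessian f z Z x : ℝ) 0 := by
      intro x
      have h5 : HasFDerivAt (fderiv ℝ f) (hessian f z) z := hd.hasFDerivAt
      have h4 : HasFDerivAt (fderiv ℝ f) (hessian f z) (z + ((0 : ℝ) : ℂ) • Z) := by
        simpa using h5
      have h6 := (ContinuousLinearMap.apply ℝ ℝ x).hasFDerivAt.comp_hasDerivAt (0 : ℝ)
        (h4.comp_hasDerivAt (0 : ℝ) (hasDerivAt_line z Z))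
      exact h6.ofReal_comp
    exact (((h3 v).add ((h3 (Complex.I • v)).const_mul Complex.I)).const_mul (1 / 2 : ℂ)).deriv
  rw [leviForm, delZ, h2, h2]
  push_cast
  linear_combination (-1 / 4 : ℂ) * (hessian f z (Complex.I • u) (Complex.I • v) : ℂ) * Complex.I_sq

theorem hessian_symm {f : E → ℝ} {z : E} (hf : ContDiffAt ℝ 2 f z) (u v : E) :
    hessian f z u v = hessian f z v u :=
  (hf.isSymmSndFDerivAt (by simp)).eq u v

theorem I_smul_I_smul (u : E) : Complex.I • Complex.I • u = -u := by
  rw [smul_smul, Complex.I_mul_I, neg_one_smul]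

theorem leviForm_add_left {f : E → ℝ} {z : E} (hf : ContDiffAt ℝ 2 f z) (u v w : E) :
    leviForm f z (u + v) w = leviForm f z u w + leviForm f z v w := by
  simp only [leviForm_eq hf, smul_add, map_add, add_apply]
  push_cast; ring

theorem leviForm_smul_left {f : E → ℝ} {z : E} (hf : ContDiffAt ℝ 2 f z) (a : ℂ) (u w : E) :
    leviForm f z (a • u) w = a * leviForm f z u w := by
  have h1 : a • u = a.re • u + a.im • (Complex.I • u) := by
    conv_lhs => rw [← Complex.re_add_im a, add_smul, mul_smul]
    rfl
  have h2 : Complex.I • a • u = a.re • (Complex.I • u) + (-a.im) • u := by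
    rw [h1, smul_add, smul_comm, smul_comm Complex.I a.im, I_smul_I_smul, smul_neg, neg_smul]
  simp only [leviForm_eq hf, h2]
  simp only [h1, map_add, map_smul, add_apply, smul_eq_mul,
    smul_apply]
  conv_rhs => rw [← Complex.re_add_im a]
  push_cast
  linear_combination (-1 / 4 : ℂ) * (a.im : ℂ) * ((hessian f z u (Complex.I • w) : ℂ) -
    hessian f z (Complex.I • u) w) * Complex.I_sq

theorem leviForm_conj {f : E → ℝ} {z : E} (hf : ContDiffAt ℝ 2 f z) (u v : E) :
    leviForm f z v u = (starRingEnd ℂ) (leviForm f z u v) := by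
  simp only [leviForm_eq hf, map_mul, map_add, Complex.conj_ofReal, Complex.conj_I, map_div₀,
    map_one, map_ofNat]
  rw [hessian_symm hf v u, hessian_symm hf (Complex.I • v), hessian_symm hf v,
    hessian_symm hf (Complex.I • v)]
  push_cast; ring

theorem leviForm_self {f : E → ℝ} {z : E} (hf : ContDiffAt ℝ 2 f z) (u : E) :
    leviForm f z u u =
      ((hessian f z u u + hessian f z (Complex.I • u) (Complex.I • u)) / 4 : ℝ) := by
  rw [leviForm_eq hf, hessian_symm hf (Complex.I • u) u]
  push_cast; ring

theorem leviForm_map {F : Type*} [NormedAddCommGroup F] [NormedSpace ℂ F] (f : F → ℝ)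
    (A : E →L[ℂ] F) (z u v : E) :
    leviForm f (A z) (A u) (A v) = leviForm (f ∘ A) z u v := by
  simp only [leviForm, delZ, delbarZ, dirDeriv, ← map_smul, ← map_add, Function.comp_apply]

variable (E) in
/-- Multiplication by `i` as a real operator. -/
def mulI : E →L[ℝ] E := (Complex.I • ContinuousLinearMap.id ℂ E).restrictScalars ℝ

theorem mulI_apply (u : E) : mulI E u = Complex.I • u := rfl

variable (E) in
/-- The operator sending a real form `λ` to `¼ λ(i ·)`, as a `1`-form. -/
def twistForm : (E →L[ℝ] ℝ) →L[ℝ] E [⋀^Fin 1]→L[ℝ] ℝ :=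
  ((ContinuousAlternatingMap.ofSubsingletonLIE (𝕜 := ℝ) (E := E) (F := ℝ) (0 : Fin 1)).toContinuousLinearEquiv :
    (E →L[ℝ] ℝ) →L[ℝ] E [⋀^Fin 1]→L[ℝ] ℝ).comp
      ((1 / 4 : ℝ) • (ContinuousLinearMap.compL ℝ E E ℝ).flip (mulI E))

theorem twistForm_apply (φ : E →L[ℝ] ℝ) (v : Fin 1 → E) :
    twistForm E φ v = 1 / 4 * φ (Complex.I • v 0) := by
  simp [twistForm, ContinuousAlternatingMap.ofSubsingletonLIE, mulI_apply]

/-- Only positivity is a real hypothesis on f. The fundamental form Im h is exact, equal to dβ with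
β = ¼ df(i·), so closedness is d² = 0. -/
theorem isKahlerStructure_leviForm {S O : Set E} {T : E → Submodule ℂ E} {f : E → ℝ}
    (hO : IsOpen O) (hSO : S ⊆ O) (hf : ContDiffOn ℝ ∞ f O)
    (hpos : ∀ z ∈ S, ∀ u ∈ T z, u ≠ 0 → 0 < (leviForm f z u u).re) :
    IsKahlerStructure S T (leviForm f) := by
  have hfa : ∀ z ∈ O, ContDiffAt ℝ ∞ f z := fun z hz => hf.contDiffAt (hO.mem_nhds hz)
  have hf2 : ∀ z ∈ O, ContDiffAt ℝ 2 f z := fun z hz => (hfa z hz).of_le two_le_infty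
  refine ⟨fun z hz u _ v _ w _ => leviForm_add_left (hf2 z (hSO hz)) u v w,
    fun z hz a u _ w _ => leviForm_smul_left (hf2 z (hSO hz)) a u w,
    fun z hz u _ v _ => leviForm_conj (hf2 z (hSO hz)) u v, hpos, ?_⟩
  set β : E → E [⋀^Fin 1]→L[ℝ] ℝ := fun z => twistForm E (fderiv ℝ f z) with hβ
  have hdf : ∀ z ∈ O, ContDiffAt ℝ ∞ (fderiv ℝ f) z := fun z hz =>
    (hfa z hz).fderiv_right (by simp)
  have hβs : ∀ z ∈ O, ContDiffAt ℝ ∞ β z := fun z hz =>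
    (twistForm E).contDiff.contDiffAt.comp z (hdf z hz)
  refine ⟨O, extDeriv β, hO, hSO, fun z hz => ?_, fun z hz => ?_, fun z hz u _ v _ => ?_⟩
  · refine ContDiffAt.contDiffWithinAt ?_
    exact (ContinuousAlternatingMap.alternatizeUncurryFinCLM ℝ E ℝ).contDiff.contDiffAt.comp z
      ((hβs z hz).fderiv_right (by simp))
  · exact extDeriv_extDeriv_apply (hβs z hz) (by simpa using two_le_infty)
  · have hz' := hSO hz
    have h1 : fderiv ℝ β z = (twistForm E).comp (hessian f z) := by
      have hd : DifferentiableAt ℝ (fderiv ℝ f) z := (hdf z hz').differentiableAt (by simp)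
      exact ((twistForm E).hasFDerivAt.comp z hd.hasFDerivAt).fderiv
    rw [extDeriv, h1, ContinuousAlternatingMap.alternatizeUncurryFin_apply, Fin.sum_univ_two,
      leviForm_eq (hf2 z hz')]
    simp only [ContinuousLinearMap.comp_apply, twistForm_apply]
    rw [hessian_symm (hf2 z hz') (Complex.I • u) v]
    simp [Fin.removeNth]
    ring

end Levi

end

noncomputable section

/-! ### The Levi form of the potential -/

variable {V : Type*} [NormedAddCommGroup V] [InnerProductSpace ℝ V] [EuclideanJordanAlgebra V]
  [FiniteDimensional ℝ V] {l : ℕ} {c : Fin l → V}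

theorem exists_units_of_det_ne_zero {T : V →L[ℝ] V} (h : T.det ≠ 0) :
    ∃ u : (V →L[ℝ] V)ˣ, (u : V →L[ℝ] V) = T :=
  ⟨(ContinuousLinearEquiv.unitsEquiv ℝ V).symm (T.toContinuousLinearEquivOfDetNeZero h), by
    ext x; rfl⟩

namespace Cplx

/-- Half of the derivative of `hermP` at `z` in the direction `Z`. -/
def hermA (z Z : Cplx V) : V →L[ℝ] V := quadP z.re Z.re + quadP z.im Z.im

theorem hermA_self (z : Cplx V) : hermA z z = hermP z := rfl

theorem quadP_neg_neg (x y : V) : quadP (-x) (-y) = quadP x y := by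
  unfold quadP; simp only [jordanL_neg, neg_mul_neg]

theorem hermP_I_smul (Z : Cplx V) : hermP (Complex.I • Z) = hermP Z := by
  unfold hermP
  simp only [re_smul, im_smul, Complex.I_re, Complex.I_im, zero_smul, one_smul, zero_sub, zero_add,
    quadP_neg_neg]
  exact add_comm _ _

theorem hermA_I_smul (z Z : Cplx V) : hermA z (Complex.I • Z) = quadP z.im Z.re - quadP z.re Z.im := by
  unfold hermA quadP
  simp only [re_smul, im_smul, Complex.I_re, Complex.I_im, zero_smul, one_smul, zero_sub, zero_add,
    jordanL_neg, mul_neg, neg_mul]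
  abel

theorem hasDerivAt_line_re (z Z : Cplx V) (t : ℝ) :
    HasDerivAt (fun t : ℝ => (z + (t : ℂ) • Z).re) Z.re t := by
  have h : (fun t : ℝ => (z + (t : ℂ) • Z).re) = fun t : ℝ => z.re + t • Z.re := by
    ext t; simp
  rw [h]
  simpa using ((hasDerivAt_id t).smul_const Z.re).const_add z.re

theorem hasDerivAt_line_im (z Z : Cplx V) (t : ℝ) :
    HasDerivAt (fun t : ℝ => (z + (t : ℂ) • Z).im) Z.im t := by
  have h : (fun t : ℝ => (z + (t : ℂ) • Z).im) = fun t : ℝ => z.im + t • Z.im := by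
    ext t; simp
  rw [h]
  simpa using ((hasDerivAt_id t).smul_const Z.im).const_add z.im

theorem quadP_zero_right (x : V) : quadP x 0 = 0 := by
  unfold quadP; simp

theorem hasDerivAt_hermP (z Z : Cplx V) (t : ℝ) :
    HasDerivAt (fun t : ℝ => hermP (z + (t : ℂ) • Z)) ((2 : ℝ) • hermA (z + (t : ℂ) • Z) Z) t := by
  have h1 := hasDerivAt_line_re z Z t
  have h2 := hasDerivAt_line_im z Z t
  refine ((h1.quadP h1).add (h2.quadP h2)).congr_deriv ?_
  rw [quadP_comm Z.re, quadP_comm Z.im, hermA]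
  module

theorem hasDerivAt_hermA (z Z : Cplx V) (t : ℝ) :
    HasDerivAt (fun t : ℝ => hermA (z + (t : ℂ) • Z) Z) (hermP Z) t := by
  have h1 := hasDerivAt_line_re z Z t
  have h2 := hasDerivAt_line_im z Z t
  refine ((h1.quadP (hasDerivAt_const t Z.re)).add (h2.quadP (hasDerivAt_const t Z.im))).congr_deriv ?_
  rw [quadP_zero_right, quadP_zero_right, add_zero, add_zero, hermP]

theorem contDiffAt_potential {n : WithTop ℕ∞} {z : Cplx V} (hz : 0 < (hermP z).det) :
    ContDiffAt ℝ n potential z := by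
  rw [funext (potential_eq (V := V))]
  exact ((contDiff_det_clm.comp contDiff_hermP).contDiffAt.log hz.ne').neg

theorem fderiv_potential {z : Cplx V} (hz : 0 < (hermP z).det) {S : V →L[ℝ] V}
    (h1 : S * hermP z = 1) (h2 : hermP z * S = 1) (Z : Cplx V) :
    fderiv ℝ potential z Z = -2 * opTr (S * hermA z Z) := by
  have hz0 : z + ((0 : ℝ) : ℂ) • Z = z := by simp
  have hd : HasFDerivAt potential (fderiv ℝ potential z) (z + ((0 : ℝ) : ℂ) • Z) := by
    rw [hz0]
    exact ((contDiffAt_potential (n := 1) hz).differentiableAt (by simp)).hasFDerivAt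
  have h3 := hd.comp_hasDerivAt (0 : ℝ) (hasDerivAt_line z Z)
  have h4 := hasDerivAt_det (hasDerivAt_hermP z Z 0) (S := S) (by rw [hz0, h1]) (by rw [hz0, h2])
  have h5 := (h4.log (by rw [hz0]; exact hz.ne')).neg
  have h6 : potential ∘ (fun t : ℝ => z + (t : ℂ) • Z) =
      -fun t : ℝ => Real.log (hermP (z + (t : ℂ) • Z)).det := by
    ext t
    exact potential_eq _
  rw [h6] at h3
  rw [h3.unique h5, hz0, mul_smul_comm, map_smul, mul_div_cancel_left₀ _ hz.ne',
    smul_eq_mul]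
  ring

/-- The first derivative -2 tr(P⁻¹A) is differentiated along the same real line, with P' = 2A and A'
= P(Z, Z̄), using (P⁻¹)' = -P⁻¹P'P⁻¹. -/
theorem hessian_potential {z : Cplx V} (hz : 0 < (hermP z).det) {S : V →L[ℝ] V}
    (h1 : S * hermP z = 1) (h2 : hermP z * S = 1) (Z : Cplx V) :
    hessian potential z Z Z = 4 * opTr (S * hermA z Z * (S * hermA z Z)) -
      2 * opTr (S * hermP Z) := by
  have hz0 : z + ((0 : ℝ) : ℂ) • Z = z := by simp
  have hpos : ∀ᶠ t : ℝ in 𝓝 0, 0 < (hermP (z + (t : ℂ) • Z)).det := by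
    have hc : ContinuousAt (fun t : ℝ => (hermP (z + (t : ℂ) • Z)).det) 0 :=
      (contDiff_det_clm (n := 0)).continuous.continuousAt.comp (hasDerivAt_hermP z Z 0).continuousAt
    exact hc.eventually_const_lt (by simpa using hz)
  have hC := contDiffAt_potential (n := 2) hz
  have h3 : HasDerivAt (fun t : ℝ => fderiv ℝ potential (z + (t : ℂ) • Z) Z)
      (hessian potential z Z Z) 0 := by
    have hd : DifferentiableAt ℝ (fderiv ℝ (potential (V := V))) z :=
      (hC.fderiv_right (m := 1) (by norm_num)).differentiableAt (by simp)
    have h5 : HasFDerivAt (fderiv ℝ (potential (V := V))) (hessian potential z) z := hd.hasFDerivAt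
    have h4 : HasFDerivAt (fderiv ℝ potential) (hessian potential z) (z + ((0 : ℝ) : ℂ) • Z) := by
      rw [hz0]; exact h5
    exact (ContinuousLinearMap.apply ℝ ℝ Z).hasFDerivAt.comp_hasDerivAt (0 : ℝ)
      (h4.comp_hasDerivAt (0 : ℝ) (hasDerivAt_line z Z))
  have hinv : HasDerivAt (fun t : ℝ => Ring.inverse (hermP (z + (t : ℂ) • Z)))
      (-(S * ((2 : ℝ) • hermA z Z) * S)) 0 := by
    let u : (V →L[ℝ] V)ˣ := ⟨hermP z, S, h2, h1⟩
    have h4 : HasFDerivAt Ring.inverse (-ContinuousLinearMap.mulLeftRight ℝ (V →L[ℝ] V) S S)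
        (hermP (z + ((0 : ℝ) : ℂ) • Z)) := by
      rw [hz0]
      exact hasFDerivAt_ringInverse (𝕜 := ℝ) u
    refine (h4.comp_hasDerivAt (0 : ℝ) (hasDerivAt_hermP z Z 0)).congr_deriv ?_
    rw [hz0]
    rfl
  have h6 : (fun t : ℝ => fderiv ℝ potential (z + (t : ℂ) • Z) Z) =ᶠ[𝓝 0] fun t : ℝ =>
      -2 * opTr (Ring.inverse (hermP (z + (t : ℂ) • Z)) * hermA (z + (t : ℂ) • Z) Z) := by
    refine hpos.mono fun t ht => ?_
    obtain ⟨u, hu⟩ := exists_units_of_det_ne_zero ht.ne'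
    have hIU : IsUnit (hermP (z + (t : ℂ) • Z)) := ⟨u, hu⟩
    exact fderiv_potential ht (Ring.inverse_mul_cancel _ hIU) (Ring.mul_inverse_cancel _ hIU) Z
  have hS : Ring.inverse (hermP z) = S := by
    let u : (V →L[ℝ] V)ˣ := ⟨hermP z, S, h2, h1⟩
    exact Ring.inverse_unit u
  have h7 : HasDerivAt (fun t : ℝ =>
      -2 * opTr (Ring.inverse (hermP (z + (t : ℂ) • Z)) * hermA (z + (t : ℂ) • Z) Z))
      (-2 * opTr (-(S * ((2 : ℝ) • hermA z Z) * S) * hermA z Z + S * hermP Z)) 0 := by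
    have h8 := hinv.mul (hasDerivAt_hermA z Z 0)
    rw [hz0, hS] at h8
    exact ((LinearMap.toContinuousLinearMap (opTr (V := V))).hasFDerivAt.comp_hasDerivAt (0 : ℝ)
      h8).const_mul (-2)
  have h9 := h3.unique (h7.congr_of_eventuallyEq h6)
  rw [h9]
  simp only [mul_smul_comm, smul_mul_assoc, neg_mul, map_add, map_neg, map_smul, smul_eq_mul,
    mul_assoc]
  ring

theorem leviForm_potential {z : Cplx V} (hz : 0 < (hermP z).det) {S : V →L[ℝ] V}
    (h1 : S * hermP z = 1) (h2 : hermP z * S = 1) (Z : Cplx V) :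
    (leviForm potential z Z Z).re = opTr (S * hermA z Z * (S * hermA z Z)) +
      opTr (S * hermA z (Complex.I • Z) * (S * hermA z (Complex.I • Z))) - opTr (S * hermP Z) := by
  rw [leviForm_self (contDiffAt_potential hz), Complex.ofReal_re, hessian_potential hz h1 h2,
    hessian_potential hz h1 h2, hermP_I_smul]
  ring

end Cplx

end

noncomputable section

/-! ### The Levi form on the diagonal torus -/

variable {V : Type*} [NormedAddCommGroup V] [InnerProductSpace ℝ V] [EuclideanJordanAlgebra V]
  [FiniteDimensional ℝ V] {l : ℕ} {c : Fin l → V}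

theorem quadP_inner (x y u v : V) : inner ℝ (quadP x y u) v = inner ℝ u (quadP x y v) := by
  simp only [quadP_apply, inner_sub_left, inner_add_left, inner_sub_right, inner_add_right,
    inner_jmul_left]
  ring

theorem sum_sq_inner_eq {ι : Type*} [Fintype ι] (b : OrthonormalBasis ι ℝ V) (v : V) :
    ∑ a, inner ℝ (b a) v ^ 2 = ‖v‖ ^ 2 := by
  have h := b.sum_inner_mul_inner v v
  rw [real_inner_self_eq_norm_sq] at h
  rw [← h]
  exact Finset.sum_congr rfl fun a _ => by rw [real_inner_comm v, sq]

theorem opTr_sq_eq {ι : Type*} [Fintype ι] (b : OrthonormalBasis ι ℝ V) {S A : V →L[ℝ] V}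
    {m : ι → ℝ} (hS : ∀ a, S (b a) = (m a)⁻¹ • b a)
    (hA : ∀ u v, inner ℝ (A u) v = inner ℝ u (A v)) :
    opTr (S * A * (S * A)) = ∑ k, ∑ a, inner ℝ (b a) (A (b k)) ^ 2 / (m a * m k) := by
  have hin : ∀ a v, inner ℝ (b a) (S v) = (m a)⁻¹ * inner ℝ (b a) v := by
    intro a v
    have e : S v = ∑ i, (m i)⁻¹ • inner ℝ (b i) v • b i := by
      conv_lhs => rw [← b.sum_repr' v]
      simp only [map_sum, map_smul, hS]
      exact Finset.sum_congr rfl fun i _ => smul_comm _ _ _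
    rw [e, inner_sum, Finset.sum_eq_single a]
    · rw [inner_smul_right, inner_smul_right, real_inner_self_eq_norm_sq, b.orthonormal.1]; ring
    · intro i _ hi
      rw [inner_smul_right, inner_smul_right, b.orthonormal.2 hi.symm]; ring
    · simp
  rw [opTr_eq_sum b]
  refine Finset.sum_congr rfl fun k _ => ?_
  rw [clm_mul, clm_mul, clm_mul, hin, ← hA, ← b.sum_inner_mul_inner, Finset.mul_sum]
  refine Finset.sum_congr rfl fun a _ => ?_
  rw [hin, real_inner_comm]
  rw [div_eq_mul_inv, mul_inv]; ring

namespace Cplx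

theorem hermA_inner (z Z : Cplx V) (u v : V) :
    inner ℝ (hermA z Z u) v = inner ℝ u (hermA z Z v) := by
  simp only [hermA, clm_add, inner_add_left, inner_add_right, quadP_inner]

/-- The Levi form at a point of the torus, in an adapted basis. -/
theorem leviForm_torusPt (hc : IsJordanFrame c) (B : PeirceBasis c) {θ : Fin l → ℝ}
    (hθ : IsAngle θ) (Z : Cplx V) : (leviForm potential (torusPt c θ) Z Z).re =
      ∑ k, ∑ a, (inner ℝ (B.b a) (hermA (torusPt c θ) Z (B.b k)) ^ 2 +
        inner ℝ (B.b a) (hermA (torusPt c θ) (Complex.I • Z) (B.b k)) ^ 2) /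
          (Real.cos (θ (B.p a) - θ (B.q a)) * Real.cos (θ (B.p k) - θ (B.q k))) -
      ∑ a, inner ℝ (B.b a) (hermP Z (B.b a)) / Real.cos (θ (B.p a) - θ (B.q a)) ∧
    fderiv ℝ potential (torusPt c θ) Z =
      -2 * ∑ a, inner ℝ (B.b a) (hermA (torusPt c θ) Z (B.b a)) /
        Real.cos (θ (B.p a) - θ (B.q a)) := by
  have hz := det_hermP_torusPt_pos hc hθ
  have hm : ∀ a, Real.cos (θ (B.p a) - θ (B.q a)) ≠ 0 := fun a =>
    (Real.cos_pos_of_mem_Ioo (abs_lt.1 (hθ.1 _ _))).ne'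
  obtain ⟨u, hu⟩ := exists_units_of_det_ne_zero hz.ne'
  set S : V →L[ℝ] V := ((u⁻¹ : (V →L[ℝ] V)ˣ) : V →L[ℝ] V) with hSdef
  have h1 : S * hermP (torusPt c θ) = 1 := by rw [hSdef, ← hu, Units.inv_mul]
  have h2 : hermP (torusPt c θ) * S = 1 := by rw [hSdef, ← hu, Units.mul_inv]
  have hS : ∀ a, S (B.b a) = (Real.cos (θ (B.p a) - θ (B.q a)))⁻¹ • B.b a := by
    intro a
    have h3 := congrArg S (hermP_torusPt hc θ (B.mem a))
    rw [← clm_mul, h1, clm_one, map_smul] at h3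
    rw [eq_inv_smul_iff₀ (hm a)]
    exact h3.symm
  have hin : ∀ (T : V →L[ℝ] V), opTr (S * T) =
      ∑ a, inner ℝ (B.b a) (T (B.b a)) / Real.cos (θ (B.p a) - θ (B.q a)) := by
    intro T
    rw [opTr_mul_comm, opTr_eq_sum B.b]
    refine Finset.sum_congr rfl fun a _ => ?_
    rw [clm_mul, hS, map_smul, inner_smul_right, inv_mul_eq_div]
  constructor
  · rw [leviForm_potential hz h1 h2, opTr_sq_eq B.b hS (hermA_inner _ _),
      opTr_sq_eq B.b hS (hermA_inner _ _), hin, ← Finset.sum_add_distrib]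
    simp only [← Finset.sum_add_distrib, ← add_div]
  · rw [fderiv_potential hz h1 h2, hin]

theorem quadP_frame_offdiag (hc : IsJordanFrame c) {j k : Fin l} (hjk : j ≠ k) {X b : V}
    (hX : X ∈ peirceSpace c j k) (hb : b ∈ peirceSpace c j k) (s : Fin l → ℝ) :
    quadP (∑ i, s i • c i) X b = (s j * inner ℝ X b / (2 * ‖c j‖ ^ 2)) • c j +
      (s k * inner ℝ X b / (2 * ‖c k‖ ^ 2)) • c k := by
  rw [quadP_apply, frame_sum_mul s hb, frame_sum_mul s hX, mul_smul_comm, smul_mul_assoc,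
    add_sub_cancel_right, hc.mul_mem_offdiag hjk hX hb, mul_add, mul_smul_comm, mul_smul_comm,
    mul_comm _ (c j), mul_comm _ (c k), hc.mul_sum_frame, hc.mul_sum_frame]
  module

/-- Taking the inner product with b in the identity for L(c_i)P(X, X) + P(X, X)L(c_i) gives a
difference of Peirce eigenvalues times this number. So only basis vectors of V_jk contribute to the
trace of P(X, X). -/
theorem quadP_inner_self_of_coeff {j k p q : Fin l} {X b : V} (hX : X ∈ peirceSpace c j k)
    (hb : b ∈ peirceSpace c p q) {i : Fin l} (h : peirceCoeff p q i ≠ peirceCoeff j k i) :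
    inner ℝ b (quadP X X b) = 0 := by
  have h1 := DFunLike.congr_fun (jordanL_quadP (c i) X X) b
  rw [hX i, clm_add, clm_add, clm_mul, clm_mul, jordanL_apply, jordanL_apply, hb i, map_smul] at h1
  have h2 : ∀ r : ℝ, quadP (r • X) X = r • quadP X X := fun r => by
    unfold quadP
    simp only [jordanL_smul, smul_mul_assoc, mul_smul_comm]
    module
  rw [quadP_comm X (peirceCoeff j k i • X), h2, clm_smul] at h1
  have h3 := congrArg (fun v => inner ℝ b v) h1
  simp only [inner_add_right, inner_smul_right, ← inner_jmul_left, hb i, inner_smul_left,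
    RCLike.conj_to_real] at h3
  have h4 : (peirceCoeff p q i - peirceCoeff j k i) * inner ℝ b (quadP X X b) = 0 := by linarith
  exact (mul_eq_zero.1 h4).resolve_left (sub_ne_zero.2 h)

theorem quadP_inner_self_offdiag (hc : IsJordanFrame c) {j k : Fin l} (hjk : j ≠ k) {X b : V}
    (hX : X ∈ peirceSpace c j k) (hb : b ∈ peirceSpace c j k) (hN : ‖c k‖ ^ 2 = ‖c j‖ ^ 2)
    (hb1 : ‖b‖ = 1) : inner ℝ b (quadP X X b) =
      inner ℝ X b ^ 2 / ‖c j‖ ^ 2 - ‖X‖ ^ 2 / (2 * ‖c j‖ ^ 2) := by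
  have hN0 : ‖c j‖ ^ 2 ≠ 0 := pow_ne_zero 2 (norm_ne_zero_iff.2 (hc.ne_zero j))
  have h1 : X * b = (inner ℝ X b / (2 * ‖c j‖ ^ 2)) • (c j + c k) := by
    rw [hc.mul_mem_offdiag hjk hX hb, hN, smul_add]
  have h2 : X * X = (‖X‖ ^ 2 / (2 * ‖c j‖ ^ 2)) • (c j + c k) := by
    rw [hc.mul_mem_offdiag hjk hX hX, hN, smul_add, real_inner_self_eq_norm_sq]
  have h3 : (c j + c k) * b = b := by
    rw [add_mul, hb j, hb k, IsJordanFrame.peirceCoeff_left hjk,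
      IsJordanFrame.peirceCoeff_right hjk]
    module
  have h4 : ‖c j + c k‖ ^ 2 = 2 * ‖c j‖ ^ 2 := by
    rw [norm_add_sq_real, hc.inner_frame hjk, hN]; ring
  rw [quadP_apply, inner_sub_right, inner_add_right, ← inner_jmul_left, h2, smul_mul_assoc, h3,
    inner_smul_right, real_inner_self_eq_norm_sq, real_inner_self_eq_norm_sq, hb1, h1, norm_smul,
    mul_pow, h4, Real.norm_eq_abs, sq_abs]
  field_simp
  ring

/-- The lower bound for the Levi form on an off-diagonal Peirce space. -/
theorem leviForm_offdiag_ge (hV : IsSimpleJordan V) (hc : IsJordanFrame c) {θ : Fin l → ℝ}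
    (hθ : IsAngle θ) {j k : Fin l} (hjk : j ≠ k) {Z : Cplx V} (hX : Z.re ∈ peirceSpace c j k)
    (hY : Z.im ∈ peirceSpace c j k) : ∃ r : ℝ, 0 < r ∧
      r * ‖Z‖ ^ 2 ≤ (leviForm potential (torusPt c θ) Z Z).re := by
  classical
  obtain ⟨B⟩ := hc.nonempty_peirceBasis
  set C := Real.cos (θ j - θ k) with hC
  set m : Fin (Module.finrank ℝ V) → ℝ := fun a => Real.cos (θ (B.p a) - θ (B.q a)) with hm
  set N := ‖c j‖ ^ 2 with hNdef
  have hN : ‖c k‖ ^ 2 = N := hc.norm_sq_eq hV k j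
  have hN0 : 0 < N := pow_pos (norm_pos_iff.2 (hc.ne_zero j)) 2
  have hC0 : 0 < C := Real.cos_pos_of_mem_Ioo (abs_lt.1 (hθ.1 _ _))
  have hm0 : ∀ a, 0 < m a := fun a => Real.cos_pos_of_mem_Ioo (abs_lt.1 (hθ.1 _ _))
  set J : Finset (Fin (Module.finrank ℝ V)) :=
    Finset.univ.filter fun a => B.b a ∈ peirceSpace c j k with hJ
  have hdich : ∀ a, a ∉ J → ∃ i, peirceCoeff (B.p a) (B.q a) i ≠ peirceCoeff j k i := by
    intro a ha
    by_contra! hcon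
    refine ha (Finset.mem_filter.2 ⟨Finset.mem_univ a, fun i => ?_⟩)
    rw [B.mem a i, hcon i]
  have hmJ : ∀ a ∈ J, m a = C := by
    intro a ha
    have h1 := hermP_torusPt hc θ (B.mem a)
    rw [hermP_torusPt hc θ (Finset.mem_filter.1 ha).2] at h1
    have h0 : B.b a ≠ 0 := B.b.orthonormal.ne_zero a
    exact (smul_left_injective ℝ h0 h1).symm
  have hJne : 0 < J.card := by
    refine Finset.card_pos.2 ?_
    obtain ⟨x, hx, hx0⟩ := hc.exists_peirce_ne_zero hV hjk
    by_contra! hcon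
    refine hx0 ?_
    rw [← B.b.sum_repr' x]
    refine Finset.sum_eq_zero fun a _ => ?_
    obtain ⟨i, hi⟩ := hdich a (by rw [hcon]; simp)
    rw [hc.inner_eq_zero_of_coeff (B.mem a) hx hi, zero_smul]
  -- A basis vector that is not orthogonal to some c_i has cosine 1, because P(z, z̄) is symmetric
  -- and fixes c_i. So one of the two denominators disappears below.
  have hfix : ∀ a i, m a * inner ℝ (B.b a) (c i) = inner ℝ (B.b a) (c i) := by
    intro a i
    have h1 := hermA_inner (torusPt c θ) (torusPt c θ) (B.b a) (c i)
    rw [hermA_self, hermP_torusPt hc θ (B.mem a), hermP_torusPt hc θ (hc.self_mem i), sub_self,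
      Real.cos_zero, one_smul, inner_smul_left, RCLike.conj_to_real] at h1
    exact h1
  have horth : ∀ a ∈ J, inner ℝ (B.b a) (c j) = 0 ∧ inner ℝ (B.b a) (c k) = 0 := by
    intro a ha
    have hb := (Finset.mem_filter.1 ha).2
    constructor
    · refine hc.inner_eq_zero_of_coeff hb (hc.self_mem j) (r := j) ?_
      rw [IsJordanFrame.peirceCoeff_left hjk, IsJordanFrame.peirceCoeff_diag]; norm_num
    · refine hc.inner_eq_zero_of_coeff hb (hc.self_mem k) (r := k) ?_
      rw [IsJordanFrame.peirceCoeff_right hjk, IsJordanFrame.peirceCoeff_diag]; norm_num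
  set A := hermA (torusPt c θ) Z with hA
  set A' := hermA (torusPt c θ) (Complex.I • Z) with hA'
  have hAb : ∀ a ∈ J, A (B.b a) =
      ((Real.cos (θ j) * inner ℝ Z.re (B.b a) + Real.sin (θ j) * inner ℝ Z.im (B.b a)) / (2 * N)) • c j +
      ((Real.cos (θ k) * inner ℝ Z.re (B.b a) + Real.sin (θ k) * inner ℝ Z.im (B.b a)) / (2 * N)) • c k := by
    intro a ha
    have hb := (Finset.mem_filter.1 ha).2
    rw [hA, hermA, re_torusPt, im_torusPt, clm_add,
      quadP_frame_offdiag hc hjk hX hb fun i => Real.cos (θ i),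
      quadP_frame_offdiag hc hjk hY hb fun i => Real.sin (θ i), hN]
    module
  have hAb' : ∀ a ∈ J, A' (B.b a) =
      ((Real.sin (θ j) * inner ℝ Z.re (B.b a) - Real.cos (θ j) * inner ℝ Z.im (B.b a)) / (2 * N)) • c j +
      ((Real.sin (θ k) * inner ℝ Z.re (B.b a) - Real.cos (θ k) * inner ℝ Z.im (B.b a)) / (2 * N)) • c k := by
    intro a ha
    have hb := (Finset.mem_filter.1 ha).2
    rw [hA', hermA_I_smul, re_torusPt, im_torusPt, clm_sub,
      quadP_frame_offdiag hc hjk hX hb fun i => Real.sin (θ i),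
      quadP_frame_offdiag hc hjk hY hb fun i => Real.cos (θ i), hN]
    module
  set Q : Fin (Module.finrank ℝ V) → ℝ := fun a => inner ℝ Z.re (B.b a) ^ 2 + inner ℝ Z.im (B.b a) ^ 2
    with hQ
  set T : Fin (Module.finrank ℝ V) → Fin (Module.finrank ℝ V) → ℝ := fun a b =>
    (inner ℝ (B.b a) (A (B.b b)) ^ 2 + inner ℝ (B.b a) (A' (B.b b)) ^ 2) / (m a * m b) with hT
  have hnorm : ∀ s t : ℝ, ‖s • c j + t • c k‖ ^ 2 = N * (s ^ 2 + t ^ 2) := by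
    intro s t
    rw [norm_add_sq_real, inner_smul_left, inner_smul_right, hc.inner_frame hjk, norm_smul,
      norm_smul, mul_pow, mul_pow, hN, Real.norm_eq_abs, Real.norm_eq_abs, sq_abs, sq_abs]
    ring
  have hsumJ : ∀ b ∈ J, ∑ a, T a b = Q b / (2 * N * C) := by
    intro b hb
    have h1 : ∀ a, T a b = (inner ℝ (B.b a) (A (B.b b)) ^ 2 + inner ℝ (B.b a) (A' (B.b b)) ^ 2) / C := by
      intro a
      have e : ∀ s t : ℝ, m a * inner ℝ (B.b a) (s • c j + t • c k) =
          inner ℝ (B.b a) (s • c j + t • c k) := by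
        intro s t
        rw [inner_add_right, inner_smul_right, inner_smul_right, mul_add, mul_left_comm, hfix,
          mul_left_comm, hfix]
      have e1 : m a * inner ℝ (B.b a) (A (B.b b)) = inner ℝ (B.b a) (A (B.b b)) := by
        rw [hAb b hb]; exact e _ _
      have e2 : m a * inner ℝ (B.b a) (A' (B.b b)) = inner ℝ (B.b a) (A' (B.b b)) := by
        rw [hAb' b hb]; exact e _ _
      have := (hm0 a).ne'
      rw [hT]
      simp only
      rw [hmJ b hb, div_mul_eq_div_div]
      congr 1
      rw [div_eq_iff this]
      linear_combination (-inner ℝ (B.b a) (A (B.b b))) * e1 - inner ℝ (B.b a) (A' (B.b b)) * e2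
    simp only [h1]
    rw [← Finset.sum_div, Finset.sum_add_distrib, sum_sq_inner_eq, sum_sq_inner_eq, hAb b hb,
      hAb' b hb, hnorm, hnorm]
    have s1 := Real.sin_sq_add_cos_sq (θ j)
    have s2 := Real.sin_sq_add_cos_sq (θ k)
    rw [hQ]
    field_simp
    linear_combination (inner ℝ Z.re (B.b b) ^ 2 + inner ℝ Z.im (B.b b) ^ 2) * (s1 + s2)
  have hTsymm : ∀ a b, T a b = T b a := by
    intro a b
    simp only [hT]
    rw [← hermA_inner, ← hermA_inner, real_inner_comm, real_inner_comm (B.b b), mul_comm (m a)]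
  have hT0 : ∀ a b, 0 ≤ T a b := fun a b =>
    div_nonneg (by positivity) (mul_pos (hm0 a) (hm0 b)).le
  have hTJ : ∀ a ∈ J, ∀ b ∈ J, T a b = 0 := by
    intro a ha b hb
    simp only [hT]
    rw [hAb b hb, hAb' b hb]
    simp only [inner_add_right, inner_smul_right, (horth a ha).1, (horth a ha).2]
    simp
  -- A and A' map V_jk into the span of c_j and c_k. The rows and columns indexed by `J` are
  -- therefore disjoint as far as nonzero entries go and contribute equally by symmetry, whence the
  -- factor 2. The remaining entries are nonnegative.
  have hfirst : 2 * ∑ b ∈ J, Q b / (2 * N * C) ≤ ∑ b, ∑ a, T a b := by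
    have h1 : ∀ b a, (if b ∈ J then T a b else 0) + (if a ∈ J then T a b else 0) ≤ T a b := by
      intro b a
      have := hT0 a b
      split_ifs with h h'
      · rw [hTJ a h' b h]; simp
      · simp
      · simp
      · simpa
    have h2 : ∑ b, ∑ a, (if b ∈ J then T a b else 0) = ∑ b ∈ J, Q b / (2 * N * C) := by
      rw [← Finset.sum_filter_add_sum_filter_not Finset.univ (· ∈ J)]
      have z : ∑ b with b ∉ J, ∑ a, (if b ∈ J then T a b else 0) = 0 := by
        refine Finset.sum_eq_zero fun b hb => Finset.sum_eq_zero fun a _ => ?_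
        rw [if_neg (Finset.mem_filter.1 hb).2]
      rw [z, add_zero]
      have : Finset.univ.filter (· ∈ J) = J := by ext; simp
      rw [this]
      refine Finset.sum_congr rfl fun b hb => ?_
      simp only [if_pos hb]
      exact hsumJ b hb
    have h3 : ∑ b, ∑ a, (if a ∈ J then T a b else 0) = ∑ b, ∑ a, (if b ∈ J then T a b else 0) := by
      rw [Finset.sum_comm]
      exact Finset.sum_congr rfl fun b _ => Finset.sum_congr rfl fun a _ => by rw [hTsymm]
    calc 2 * ∑ b ∈ J, Q b / (2 * N * C) =
        ∑ b, ∑ a, ((if b ∈ J then T a b else 0) + (if a ∈ J then T a b else 0)) := by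
          simp only [Finset.sum_add_distrib]
          rw [h3, h2]; ring
      _ ≤ _ := Finset.sum_le_sum fun b _ => Finset.sum_le_sum fun a _ => h1 b a
  have hsecond : ∑ a, inner ℝ (B.b a) (hermP Z (B.b a)) / m a =
      ∑ b ∈ J, (Q b / N - ‖Z‖ ^ 2 / (2 * N)) / C := by
    rw [← Finset.sum_subset (Finset.subset_univ J)]
    · refine Finset.sum_congr rfl fun b hb => ?_
      have hb' := (Finset.mem_filter.1 hb).2
      have hb1 := B.b.orthonormal.1 b
      rw [hmJ b hb, hermP, clm_add, inner_add_right, quadP_inner_self_offdiag hc hjk hX hb' hN hb1,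
        quadP_inner_self_offdiag hc hjk hY hb' hN hb1, norm_sq]
      simp only [hQ, hNdef]
      ring
    · intro b _ hb
      obtain ⟨i, hi⟩ := hdich b hb
      rw [hermP, clm_add, inner_add_right, quadP_inner_self_of_coeff hX (B.mem b) hi,
        quadP_inner_self_of_coeff hY (B.mem b) hi]
      simp
  -- The terms Q cancel between the two sums, and each basis vector of V_jk leaves ‖Z‖²/(2NC).
  refine ⟨J.card / (2 * N * C), by positivity, ?_⟩
  rw [(leviForm_torusPt hc B hθ Z).1]
  change _ ≤ ∑ b, ∑ a, T a b - ∑ a, inner ℝ (B.b a) (hermP Z (B.b a)) / m a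
  rw [hsecond]
  refine le_trans (le_of_eq ?_) (sub_le_sub_right hfirst _)
  rw [Finset.mul_sum, ← Finset.sum_sub_distrib]
  have : ∀ b ∈ J, 2 * (Q b / (2 * N * C)) - (Q b / N - ‖Z‖ ^ 2 / (2 * N)) / C =
      ‖Z‖ ^ 2 / (2 * N * C) := by
    intro b _
    field_simp
    ring
  rw [Finset.sum_congr rfl this, Finset.sum_const, nsmul_eq_mul]
  ring

end Cplx

end

/-! ### Diagonal tangent vectors and parity -/

noncomputable section

variable {V : Type*} [NormedAddCommGroup V] [InnerProductSpace ℝ V] [EuclideanJordanAlgebra V]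
  [FiniteDimensional ℝ V] {l : ℕ} {c : Fin l → V}

namespace Cplx

/-- The diagonal tangent vector `∑ (a_j + i b_j) exp(iθ_j) c_j`. -/
def diagVec (c : Fin l → V) (θ a b : Fin l → ℝ) : Cplx V :=
  mk (∑ j, (a j * Real.cos (θ j) - b j * Real.sin (θ j)) • c j)
    (∑ j, (a j * Real.sin (θ j) + b j * Real.cos (θ j)) • c j)

/-- All operators involved are diagonal in the adapted basis, and sin² + cos² = 1 completes the
squares. The formulas depend on a and b through differences, apart from the term in a_p + a_q, which
sums to zero on tangent vectors. -/
theorem leviForm_diagVec (hc : IsJordanFrame c) (B : PeirceBasis c) {θ : Fin l → ℝ}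
    (hθ : IsAngle θ) (a b : Fin l → ℝ) :
    (leviForm potential (torusPt c θ) (diagVec c θ a b) (diagVec c θ a b)).re =
      ∑ k, ((a (B.p k) - a (B.q k)) ^ 2 + (b (B.p k) - b (B.q k)) ^ 2) /
        (4 * Real.cos (θ (B.p k) - θ (B.q k)) ^ 2) ∧
    fderiv ℝ potential (torusPt c θ) (diagVec c θ a b) =
      -∑ k, ((a (B.p k) + a (B.q k)) + (b (B.q k) - b (B.p k)) *
        (Real.sin (θ (B.p k) - θ (B.q k)) / Real.cos (θ (B.p k) - θ (B.q k)))) := by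
  obtain ⟨e1, e2⟩ := leviForm_torusPt hc B hθ (diagVec c θ a b)
  have hm : ∀ k, Real.cos (θ (B.p k) - θ (B.q k)) ≠ 0 := fun a =>
    (Real.cos_pos_of_mem_Ioo (abs_lt.1 (hθ.1 _ _))).ne'
  have hA : ∀ k, hermA (torusPt c θ) (diagVec c θ a b) (B.b k) =
      (((a (B.p k) + a (B.q k)) * Real.cos (θ (B.p k) - θ (B.q k)) +
        (b (B.q k) - b (B.p k)) * Real.sin (θ (B.p k) - θ (B.q k))) / 2) • B.b k := by
    intro k
    rw [hermA, re_torusPt, im_torusPt, diagVec, re_mk, im_mk, clm_add, B.quadP_apply hc,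
      B.quadP_apply hc, ← add_smul, Real.cos_sub, Real.sin_sub]
    congr 1; ring
  have hA' : ∀ k, hermA (torusPt c θ) (Complex.I • diagVec c θ a b) (B.b k) =
      (((a (B.q k) - a (B.p k)) * Real.sin (θ (B.p k) - θ (B.q k)) -
        (b (B.p k) + b (B.q k)) * Real.cos (θ (B.p k) - θ (B.q k))) / 2) • B.b k := by
    intro k
    rw [hermA_I_smul, re_torusPt, im_torusPt, diagVec, re_mk, im_mk, clm_sub, B.quadP_apply hc,
      B.quadP_apply hc, ← sub_smul, Real.cos_sub, Real.sin_sub]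
    congr 1; ring
  have hP : ∀ k, hermP (diagVec c θ a b) (B.b k) =
      ((a (B.p k) * a (B.q k) + b (B.p k) * b (B.q k)) * Real.cos (θ (B.p k) - θ (B.q k)) -
        (b (B.p k) * a (B.q k) - a (B.p k) * b (B.q k)) *
          Real.sin (θ (B.p k) - θ (B.q k))) • B.b k := by
    intro k
    rw [hermP, diagVec, re_mk, im_mk, clm_add, B.quadP_apply hc, B.quadP_apply hc, ← add_smul,
      Real.cos_sub, Real.sin_sub]
    congr 1; ring
  have hin : ∀ i k, inner ℝ (B.b i) (B.b k) = if i = k then (1 : ℝ) else 0 :=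
    orthonormal_iff_ite.1 B.b.orthonormal
  constructor
  · rw [e1, ← Finset.sum_sub_distrib]
    refine Finset.sum_congr rfl fun k _ => ?_
    rw [Finset.sum_eq_single k]
    · rw [hA, hA', hP]
      simp only [inner_smul_right, hin, if_true, mul_one]
      have hs := Real.sin_sq_add_cos_sq (θ (B.p k) - θ (B.q k))
      have hmk := hm k
      set C := Real.cos (θ (B.p k) - θ (B.q k))
      set s := Real.sin (θ (B.p k) - θ (B.q k))
      field_simp
      linear_combination 4 * ((a (B.p k) - a (B.q k)) ^ 2 + (b (B.p k) - b (B.q k)) ^ 2) * hs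
    · intro i _ hi
      rw [hA, hA']
      simp [inner_smul_right, hin, hi]
    · simp
  · rw [e2, Finset.mul_sum, ← Finset.sum_neg_distrib]
    refine Finset.sum_congr rfl fun k _ => ?_
    rw [hA, inner_smul_right, hin, if_pos rfl]
    have hmk := hm k
    field_simp

/-! ### Parity symmetries -/

theorem paritySymm_inner (e x y : V) : inner ℝ (paritySymm e x) y = inner ℝ x (paritySymm e y) := by
  simp only [paritySymm_apply, inner_add_left, inner_sub_left, inner_add_right, inner_sub_right,
    inner_smul_left, inner_smul_right, inner_jmul_left, RCLike.conj_to_real]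

theorem isOrthAut_paritySymm {e : V} (he : e * e = e) : IsOrthAut (paritySymm e) :=
  ⟨paritySymm_mul he, fun x y => by rw [paritySymm_inner, paritySymm_self he]⟩

theorem paritySymm_one {e : V} (he : e * e = e) : paritySymm e (1 : V) = 1 :=
  paritySymm_of_zero (by rw [jmul_one, he])

theorem paritySymm_sum_frame (hc : IsJordanFrame c) (i : Fin l) (s : Fin l → ℝ) :
    paritySymm (c i) (∑ j, s j • c j) = ∑ j, s j • c j :=
  paritySymm_of_zero (by rw [hc.mul_sum_frame, mul_smul_comm, hc.idem])

theorem paritySymm_offdiag_neg {j k i : Fin l} {x : V} (hx : x ∈ peirceSpace c j k)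
    (h : peirceCoeff j k i = 1 / 2) : paritySymm (c i) x = -x :=
  paritySymm_of_half (by rw [hx i, h])

theorem paritySymm_offdiag_pos {j k i : Fin l} {x : V} (hx : x ∈ peirceSpace c j k)
    (h : peirceCoeff j k i = 0) : paritySymm (c i) x = x :=
  paritySymm_of_zero (by rw [hx i, h, zero_smul, mul_zero])

/-- An involutive automorphism conjugates P(z, z̄), and its determinant squares to one. -/
theorem potential_paritySymm {e : V} (he : e * e = e) (z : Cplx V) :
    potential (extend (paritySymm e) z) = potential z := by
  have hq : ∀ x y : V, quadP (paritySymm e x) (paritySymm e y) =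
      paritySymm e * quadP x y * paritySymm e := by
    intro x y
    ext v
    conv_lhs => rw [← paritySymm_self he v]
    simp only [quadP_apply, clm_mul, ← paritySymm_mul he, map_add, map_sub]
  have h1 : hermP (extend (paritySymm e) z) = paritySymm e * hermP z * paritySymm e := by
    rw [hermP, re_extend, im_extend, hq, hq, hermP]
    noncomm_ring
  have h2 : (paritySymm e : V →L[ℝ] V).det * (paritySymm e).det = 1 := by
    rw [← det_clm_mul, ← det_clm_one (V := V)]
    congr 1
    ext v
    exact paritySymm_self he v
  rw [potential_eq, potential_eq, h1, det_clm_mul, det_clm_mul]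
  congr 2
  linear_combination (hermP z).det * h2

theorem extend_paritySymm_torusPt (hc : IsJordanFrame c) (i : Fin l) (θ : Fin l → ℝ) :
    extend (paritySymm (c i)) (torusPt c θ) = torusPt c θ := by
  ext
  · rw [re_extend, re_torusPt, paritySymm_sum_frame hc]
  · rw [im_extend, im_torusPt, paritySymm_sum_frame hc]

theorem leviForm_paritySymm (hc : IsJordanFrame c) (i : Fin l) (θ : Fin l → ℝ) (u v : Cplx V) :
    leviForm potential (torusPt c θ) (extend (paritySymm (c i)) u) (extend (paritySymm (c i)) v) =
      leviForm potential (torusPt c θ) u v := by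
  have h := leviForm_map potential (extend (paritySymm (c i))) (torusPt c θ) u v
  rw [extend_paritySymm_torusPt hc] at h
  rw [h]
  congr 1
  ext z
  exact potential_paritySymm (hc.idem i) z

/-- Vectors of opposite parity are orthogonal for the Levi form. -/
theorem leviForm_eq_zero_of_parity (hc : IsJordanFrame c) {θ : Fin l → ℝ} (hθ : IsAngle θ)
    (i : Fin l) {u v : Cplx V} (hu : extend (paritySymm (c i)) u = u)
    (hv : extend (paritySymm (c i)) v = -v) :
    leviForm potential (torusPt c θ) u v = 0 ∧ leviForm potential (torusPt c θ) v u = 0 := by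
  have hC := contDiffAt_potential (n := 2) (det_hermP_torusPt_pos hc hθ)
  have h1 := leviForm_paritySymm hc i θ v u
  rw [hu, hv, ← neg_one_smul ℂ v, leviForm_smul_left hC] at h1
  have h2 : leviForm potential (torusPt c θ) v u = 0 := by
    linear_combination (-1 / 2 : ℂ) * h1
  exact ⟨by rw [leviForm_conj hC v u, h2, map_zero], h2⟩

theorem fderiv_potential_eq_zero_of_parity (hc : IsJordanFrame c) {θ : Fin l → ℝ} (hθ : IsAngle θ)
    (i : Fin l) {v : Cplx V} (hv : extend (paritySymm (c i)) v = -v) :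
    fderiv ℝ potential (torusPt c θ) v = 0 := by
  have hd : HasFDerivAt potential (fderiv ℝ potential (torusPt c θ)) (torusPt c θ) :=
    ((contDiffAt_potential (n := 1) (det_hermP_torusPt_pos hc hθ)).differentiableAt
      (by simp)).hasFDerivAt
  have hd' : HasFDerivAt potential (fderiv ℝ potential (torusPt c θ))
      (extend (paritySymm (c i)) (torusPt c θ)) := by
    rw [extend_paritySymm_torusPt hc]; exact hd
  have h1 := hd'.comp (torusPt c θ)
    ((extend (paritySymm (c i))).restrictScalars ℝ : Cplx V →L[ℝ] Cplx V).hasFDerivAt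
  have h2 : potential ∘ ⇑(extend (paritySymm (c i))) = potential := funext fun z => potential_paritySymm (hc.idem i) z
  rw [h2] at h1
  have h3 := DFunLike.congr_fun (hd.unique h1) v
  change _ = fderiv ℝ potential (torusPt c θ) (extend (paritySymm (c i)) v) at h3
  rw [hv, map_neg] at h3
  linarith

theorem fderiv_jdet_eq_zero_of_parity (hc : IsJordanFrame c) (θ : Fin l → ℝ)
    (i : Fin l) {v : Cplx V} (hv : extend (paritySymm (c i)) v = -v) :
    fderiv ℂ (jdet l) (torusPt c θ) v = 0 := by
  have hd := (differentiable_jdet (V := V) l (torusPt c θ)).hasFDerivAt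
  have hd' : HasFDerivAt (jdet l) (fderiv ℂ (jdet l) (torusPt c θ))
      (extend (paritySymm (c i)) (torusPt c θ)) := by
    rw [extend_paritySymm_torusPt hc]; exact hd
  have h1 := hd'.comp (torusPt c θ) (extend (paritySymm (c i))).hasFDerivAt
  have h2 : jdet l ∘ extend (paritySymm (c i)) = jdet l := funext fun z =>
    jdet_extend_of_isOrthAut l (isOrthAut_paritySymm (hc.idem i)) (paritySymm_one (hc.idem i)) z
  rw [h2] at h1
  have h3 := DFunLike.congr_fun (hd.unique h1) v
  rw [ContinuousLinearMap.comp_apply, hv, map_neg] at h3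
  linear_combination (1 / 2 : ℂ) * h3

theorem diagVec_eq (θ a b : Fin l → ℝ) : diagVec c θ a b =
    ∑ j, (((a j : ℂ) + b j * Complex.I) * Complex.exp (θ j * Complex.I)) • ofReal (c j) := by
  ext
  · rw [diagVec, re_mk, re_sum]
    refine Finset.sum_congr rfl fun j _ => ?_
    simp [Complex.exp_ofReal_mul_I_re, Complex.exp_ofReal_mul_I_im]
  · rw [diagVec, im_mk, im_sum]
    refine Finset.sum_congr rfl fun j _ => ?_
    simp [Complex.exp_ofReal_mul_I_re, Complex.exp_ofReal_mul_I_im]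

/-- Along s ↦ z + sZ the determinant is ∏(1 + s(a_j + i b_j)), since ∑ θ_j = 0. Tangency of a
diagonal vector thus means ∑ a_j = ∑ b_j = 0. -/
theorem fderiv_jdet_diagVec (hV : IsSimpleJordan V) (hc : IsJordanFrame c) {θ : Fin l → ℝ}
    (hθ : ∑ j, θ j = 0) (a b : Fin l → ℝ) :
    fderiv ℂ (jdet l) (torusPt c θ) (diagVec c θ a b) =
      ((∑ j, a j : ℝ) : ℂ) + (∑ j, b j : ℝ) * Complex.I := by
  have hd : HasFDerivAt (jdet l) (fderiv ℂ (jdet l) (torusPt c θ))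
      (torusPt c θ + (0 : ℂ) • diagVec c θ a b) := by
    rw [zero_smul, add_zero]
    exact (differentiable_jdet (V := V) l (torusPt c θ)).hasFDerivAt
  have h1 := hd.comp_hasDerivAt (0 : ℂ)
    (((hasDerivAt_id (0 : ℂ)).smul_const (diagVec c θ a b)).const_add (torusPt c θ))
  rw [one_smul] at h1
  have h2 : (jdet l ∘ fun s : ℂ => torusPt c θ + id s • diagVec c θ a b) =
      fun s : ℂ => ∏ j, (1 + s * ((a j : ℂ) + b j * Complex.I)) := by
    ext s
    have e : torusPt c θ + s • diagVec c θ a b = ∑ j, (Complex.exp (θ j * Complex.I) *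
        (1 + s * ((a j : ℂ) + b j * Complex.I))) • ofReal (c j) := by
      rw [torusPt, diagVec_eq, Finset.smul_sum, ← Finset.sum_add_distrib]
      refine Finset.sum_congr rfl fun j _ => ?_
      rw [smul_smul, ← add_smul]
      congr 1; ring
    rw [Function.comp_apply, id, e, jdet_frame hV hc, Finset.prod_mul_distrib, ← Complex.exp_sum,
      ← Finset.sum_mul, ← Complex.ofReal_sum, hθ]
    simp
  rw [h2] at h1
  have h3 : HasDerivAt (fun s : ℂ => ∏ j, (1 + s * ((a j : ℂ) + b j * Complex.I)))
      (∑ j, ((a j : ℂ) + b j * Complex.I)) 0 := by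
    refine (HasDerivAt.fun_finsetProd (u := Finset.univ) fun j _ =>
      ((hasDerivAt_id (0 : ℂ)).mul_const ((a j : ℂ) + b j * Complex.I)).const_add 1).congr_deriv ?_
    simp
  rw [h1.unique h3, Finset.sum_add_distrib, ← Finset.sum_mul]
  push_cast; rfl

end Cplx

end

noncomputable section

/-! ### Tangent vectors of the hypersurface at points of the torus -/

variable {V : Type*} [NormedAddCommGroup V] [InnerProductSpace ℝ V] [EuclideanJordanAlgebra V]
  [FiniteDimensional ℝ V] {l : ℕ} {c : Fin l → V}

/-- The pairs `i < j`. -/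
def ltPairs (l : ℕ) : Finset (Fin l × Fin l) := Finset.univ.filter fun p => p.1 < p.2

theorem sum_sum_eq_diag_add {M : Type*} [AddCommGroup M] [Module ℝ M] (f : Fin l → Fin l → M)
    (hf : ∀ i j, f i j = f j i) :
    ∑ i, ∑ j, f i j = ∑ i, f i i + ∑ p ∈ ltPairs l, (2 : ℝ) • f p.1 p.2 := by
  have h1 : ∀ i j, f i j = (if i = j then f i j else 0) + ((if i < j then f i j else 0) +
      (if j < i then f j i else 0)) := by
    intro i j
    rcases lt_trichotomy i j with h | h | h
    · simp [h, h.ne, h.not_gt]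
    · simp [h]
    · simp [h, h.ne', h.not_gt, hf i j]
  have h2 : ∑ p ∈ ltPairs l, (2 : ℝ) • f p.1 p.2 =
      ∑ i, ∑ j, (2 : ℝ) • (if i < j then f i j else 0) := by
    rw [ltPairs, Finset.sum_filter, Fintype.sum_prod_type]
    exact Finset.sum_congr rfl fun i _ => Finset.sum_congr rfl fun j _ => by split_ifs <;> simp
  rw [h2, Finset.sum_congr rfl fun i _ => Finset.sum_congr rfl fun j _ => h1 i j]
  simp only [Finset.sum_add_distrib]
  rw [Finset.sum_comm (f := fun i j => if j < i then f j i else 0)]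
  simp only [two_smul, Finset.sum_add_distrib]
  simp

theorem mem_ltPairs {p : Fin l × Fin l} : p ∈ ltPairs l ↔ p.1 < p.2 := by simp [ltPairs]

namespace Cplx

/-- The component of `Z` in the complexified Peirce space `V_ij`, `i ≠ j`. -/
def offVec (c : Fin l → V) (Z : Cplx V) (p : Fin l × Fin l) : Cplx V :=
  mk ((2 : ℝ) • quadP (c p.1) (c p.2) Z.re) ((2 : ℝ) • quadP (c p.1) (c p.2) Z.im)

theorem exists_eq_diagVec_add (hc : IsJordanFrame c) (θ : Fin l → ℝ) (Z : Cplx V) :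
    ∃ a b : Fin l → ℝ, Z = diagVec c θ a b + ∑ p ∈ ltPairs l, offVec c Z p := by
  have hd : ∀ x : V, ∃ s : Fin l → ℝ, x = ∑ i, s i • c i +
      ∑ p ∈ ltPairs l, (2 : ℝ) • quadP (c p.1) (c p.2) x := by
    intro x
    choose s hs using fun i => hc.eq_smul_of_mem_diag (hc.quadP_mem i i x)
    refine ⟨s, ?_⟩
    conv_lhs => rw [← hc.sum_quadP x]
    rw [sum_sum_eq_diag_add _ fun i j => by rw [quadP_comm]]
    simp only [hs]
  obtain ⟨s, hs⟩ := hd Z.re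
  obtain ⟨t, ht⟩ := hd Z.im
  -- The diagonal coefficient s + it is multiplied by exp(-iθ), because `diagVec` measures
  -- coefficients relative to exp(iθ_j) c_j.
  refine ⟨fun i => s i * Real.cos (θ i) + t i * Real.sin (θ i),
    fun i => t i * Real.cos (θ i) - s i * Real.sin (θ i), ?_⟩
  ext
  · conv_lhs => rw [hs]
    rw [re_add, re_sum, diagVec, re_mk]
    simp only [offVec, re_mk]
    congr 1
    refine Finset.sum_congr rfl fun i _ => ?_
    congr 1
    linear_combination (-s i) * Real.sin_sq_add_cos_sq (θ i)
  · conv_lhs => rw [ht]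
    rw [im_add, im_sum, diagVec, im_mk]
    simp only [offVec, im_mk]
    congr 1
    refine Finset.sum_congr rfl fun i _ => ?_
    congr 1
    linear_combination (-t i) * Real.sin_sq_add_cos_sq (θ i)

theorem extend_paritySymm_diagVec (hc : IsJordanFrame c) (r : Fin l) (θ a b : Fin l → ℝ) :
    extend (paritySymm (c r)) (diagVec c θ a b) = diagVec c θ a b := by
  ext
  · rw [re_extend, diagVec, re_mk, paritySymm_sum_frame hc]
  · rw [im_extend, diagVec, im_mk, paritySymm_sum_frame hc]

theorem extend_paritySymm_offVec_neg (hc : IsJordanFrame c) (Z : Cplx V) {p : Fin l × Fin l}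
    (hp : p.1 < p.2) {r : Fin l} (hr : r = p.1 ∨ r = p.2) :
    extend (paritySymm (c r)) (offVec c Z p) = -offVec c Z p := by
  have h : peirceCoeff p.1 p.2 r = 1 / 2 := by
    rcases hr with rfl | rfl
    · exact IsJordanFrame.peirceCoeff_left hp.ne
    · exact IsJordanFrame.peirceCoeff_right hp.ne
  ext
  · rw [re_extend, offVec, re_mk, map_smul, paritySymm_offdiag_neg (hc.quadP_mem _ _ _) h]
    simp
  · rw [im_extend, offVec, im_mk, map_smul, paritySymm_offdiag_neg (hc.quadP_mem _ _ _) h]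
    simp

theorem extend_paritySymm_offVec_pos (hc : IsJordanFrame c) (Z : Cplx V) {p : Fin l × Fin l}
    {r : Fin l} (h1 : r ≠ p.1) (h2 : r ≠ p.2) :
    extend (paritySymm (c r)) (offVec c Z p) = offVec c Z p := by
  have h := IsJordanFrame.peirceCoeff_other h1 h2
  ext
  · rw [re_extend, offVec, re_mk, map_smul, paritySymm_offdiag_pos (hc.quadP_mem _ _ _) h]
  · rw [im_extend, offVec, im_mk, map_smul, paritySymm_offdiag_pos (hc.quadP_mem _ _ _) h]

/-- Distinct pairs differ in some index of p that does not occur in q. The parity symmetry at this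
index changes the sign of one component only. -/
theorem leviForm_offVec_offVec (hc : IsJordanFrame c) {θ : Fin l → ℝ} (hθ : IsAngle θ)
    (Z : Cplx V) {p q : Fin l × Fin l} (hp : p.1 < p.2) (hq : q.1 < q.2) (hpq : p ≠ q) :
    leviForm potential (torusPt c θ) (offVec c Z p) (offVec c Z q) = 0 := by
  by_cases h1 : p.1 ≠ q.1 ∧ p.1 ≠ q.2
  · exact (leviForm_eq_zero_of_parity hc hθ p.1 (extend_paritySymm_offVec_pos hc Z h1.1 h1.2)
      (extend_paritySymm_offVec_neg hc Z hp (Or.inl rfl))).2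
  · have h2 : p.2 ≠ q.1 ∧ p.2 ≠ q.2 := by
      refine ⟨fun h => ?_, fun h => ?_⟩
      · have : p.1 = q.2 := by
          by_contra h'
          exact h1 ⟨fun h'' => hp.ne (h''.trans h.symm), h'⟩
        rw [h, this] at hp
        exact lt_asymm hp hq
      · refine h1 ⟨fun h' => hpq (Prod.ext h' h), fun h' => hp.ne (h'.trans h.symm)⟩
    exact (leviForm_eq_zero_of_parity hc hθ p.2 (extend_paritySymm_offVec_pos hc Z h2.1 h2.2)
      (extend_paritySymm_offVec_neg hc Z hp (Or.inr rfl))).2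

/-- The form and the differentials in the Peirce decomposition of a tangent vector. -/
theorem leviForm_decomposition (hc : IsJordanFrame c) {θ : Fin l → ℝ} (hθ : IsAngle θ)
    (Z : Cplx V) : ∃ a b : Fin l → ℝ, Z = diagVec c θ a b + ∑ p ∈ ltPairs l, offVec c Z p ∧
      leviForm potential (torusPt c θ) Z Z =
        leviForm potential (torusPt c θ) (diagVec c θ a b) (diagVec c θ a b) +
        ∑ p ∈ ltPairs l, leviForm potential (torusPt c θ) (offVec c Z p) (offVec c Z p) ∧
      fderiv ℝ potential (torusPt c θ) Z = fderiv ℝ potential (torusPt c θ) (diagVec c θ a b) ∧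
      fderiv ℂ (jdet l) (torusPt c θ) Z = fderiv ℂ (jdet l) (torusPt c θ) (diagVec c θ a b) := by
  obtain ⟨a, b, h⟩ := exists_eq_diagVec_add hc θ Z
  have hC := contDiffAt_potential (n := 2) (det_hermP_torusPt_pos hc hθ)
  set w := torusPt c θ
  set D := diagVec c θ a b with hD
  set H : Cplx V → Cplx V →+ ℂ := fun v =>
    AddMonoidHom.mk' (fun u => leviForm potential w u v) fun u u' => leviForm_add_left hC u u' v
    with hH
  have hHa : ∀ u v, H v u = leviForm potential w u v := fun _ _ => rfl
  have hDW : ∀ p ∈ ltPairs l, leviForm potential w D (offVec c Z p) = 0 ∧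
      leviForm potential w (offVec c Z p) D = 0 := fun p hp =>
    leviForm_eq_zero_of_parity hc hθ p.1 (extend_paritySymm_diagVec hc _ _ _ _)
      (extend_paritySymm_offVec_neg hc Z (mem_ltPairs.1 hp) (Or.inl rfl))
  set W := ∑ p ∈ ltPairs l, offVec c Z p with hW
  have hsumL : ∀ v, leviForm potential w W v =
      ∑ p ∈ ltPairs l, leviForm potential w (offVec c Z p) v := fun v => by
    rw [← hHa, hW, map_sum]; rfl
  have hZD : leviForm potential w W D = 0 := by
    rw [hsumL]; exact Finset.sum_eq_zero fun p hp => (hDW p hp).2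
  have hpW : ∀ p ∈ ltPairs l, leviForm potential w (offVec c Z p) W =
      leviForm potential w (offVec c Z p) (offVec c Z p) := by
    intro p hp
    rw [leviForm_conj hC, hsumL, Finset.sum_eq_single p, ← leviForm_conj hC]
    · intro q hq hqp
      exact leviForm_offVec_offVec hc hθ Z (mem_ltPairs.1 hq) (mem_ltPairs.1 hp) hqp
    · exact fun h => absurd hp h
  refine ⟨a, b, h, ?_, ?_, ?_⟩
  · have e1 : leviForm potential w D W = 0 := by rw [leviForm_conj hC, hZD, map_zero]
    conv_lhs => rw [h]
    rw [leviForm_add_left hC, leviForm_conj hC (D + W) D, leviForm_conj hC (D + W) W,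
      leviForm_add_left hC, leviForm_add_left hC, hZD, e1, add_zero, zero_add,
      ← leviForm_conj hC, ← leviForm_conj hC, hsumL W]
    congr 1
    exact Finset.sum_congr rfl hpW
  · conv_lhs => rw [h]
    rw [map_add, hW, map_sum, Finset.sum_eq_zero, add_zero]
    exact fun p hp => fderiv_potential_eq_zero_of_parity hc hθ p.1
      (extend_paritySymm_offVec_neg hc Z (mem_ltPairs.1 hp) (Or.inl rfl))
  · conv_lhs => rw [h]
    rw [map_add, hW, map_sum, Finset.sum_eq_zero, add_zero]
    exact fun p hp => fderiv_jdet_eq_zero_of_parity hc θ p.1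
      (extend_paritySymm_offVec_neg hc Z (mem_ltPairs.1 hp) (Or.inl rfl))

theorem leviForm_offVec (hV : IsSimpleJordan V) (hc : IsJordanFrame c) {θ : Fin l → ℝ}
    (hθ : IsAngle θ) (Z : Cplx V) {p : Fin l × Fin l} (hp : p.1 < p.2) :
    ∃ r > 0, r * ‖offVec c Z p‖ ^ 2 ≤
      (leviForm potential (torusPt c θ) (offVec c Z p) (offVec c Z p)).re :=
  leviForm_offdiag_ge hV hc hθ hp.ne
    (by rw [offVec, re_mk]; exact Submodule.smul_mem _ _ (hc.quadP_mem _ _ _))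
    (by rw [offVec, im_mk]; exact Submodule.smul_mem _ _ (hc.quadP_mem _ _ _))

end Cplx

/-- Every pair of indices occurs in an adapted basis. -/
theorem PeirceBasis.exists_index (hV : IsSimpleJordan V) (hc : IsJordanFrame c) (B : PeirceBasis c)
    {i j : Fin l} (hij : i ≠ j) :
    ∃ k, (B.p k = i ∧ B.q k = j) ∨ (B.p k = j ∧ B.q k = i) := by
  obtain ⟨x, hx, hx0⟩ := hc.exists_peirce_ne_zero hV hij
  obtain ⟨k, hk⟩ : ∃ k, inner ℝ (B.b k) x ≠ 0 := by
    by_contra! h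
    apply hx0
    rw [← B.b.sum_repr' x]
    simp [h]
  refine ⟨k, ?_⟩
  have h : ∀ r, peirceCoeff (B.p k) (B.q k) r = peirceCoeff i j r := by
    intro r
    by_contra h
    exact hk (hc.inner_eq_zero_of_coeff (B.mem k) hx h)
  have h1 := h i
  have h2 := h j
  rw [IsJordanFrame.peirceCoeff_left hij] at h1
  rw [IsJordanFrame.peirceCoeff_right hij] at h2
  unfold peirceCoeff at h1 h2
  by_cases a1 : i = B.p k <;> by_cases a2 : i = B.q k <;> by_cases a3 : j = B.p k <;>
    by_cases a4 : j = B.q k <;> simp [a1, a2, a3, a4] at h1 h2 ⊢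
  all_goals first
    | exact absurd (a1.trans a3.symm) hij
    | exact absurd (a2.trans a4.symm) hij

theorem PeirceBasis.eq_const (hV : IsSimpleJordan V) (hc : IsJordanFrame c) (B : PeirceBasis c)
    {a : Fin l → ℝ} (h : ∀ k, a (B.p k) = a (B.q k)) (ha : ∑ i, a i = 0) (i : Fin l) : a i = 0 := by
  have h1 : ∀ j, a j = a i := by
    intro j
    by_cases hij : i = j
    · rw [hij]
    · obtain ⟨k, ⟨h1, h2⟩ | ⟨h1, h2⟩⟩ := B.exists_index hV hc hij
      · rw [← h1, ← h2, h]
      · rw [← h1, ← h2, h]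
  rw [Finset.sum_congr rfl fun j _ => h1 j, Finset.sum_const, nsmul_eq_mul, Finset.card_univ,
    Fintype.card_fin] at ha
  refine (mul_eq_zero.1 ha).resolve_left ?_
  have := i.pos
  positivity

/-- Every index occurs equally often among the labels of an adapted basis, so the sum is a multiple
of ∑ a_i. It removes the part of dφ that the Levi form could not bound. -/
theorem PeirceBasis.sum_index_eq_zero (hV : IsSimpleJordan V) (hc : IsJordanFrame c)
    (B : PeirceBasis c) {a : Fin l → ℝ} (ha : ∑ i, a i = 0) :
    ∑ k, (a (B.p k) + a (B.q k)) = 0 := by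
  have hl : (l : ℝ) ≠ 0 := by
    have := hc.rank_pos hV
    positivity
  have h1 : ∀ k, a (B.p k) + a (B.q k) =
      ∑ j, ((if B.p k = j then 1 else 0) + (if B.q k = j then 1 else 0)) * a j := by
    intro k
    simp [add_mul, Finset.sum_add_distrib]
  have h2 : ∀ j, (l : ℝ) * ∑ k, ((if B.p k = j then 1 else 0) + (if B.q k = j then 1 else 0)) =
      2 * Module.finrank ℝ V := fun j => by exact_mod_cast B.card_index hV hc j
  refine (mul_eq_zero.1 (?_ : (l : ℝ) * _ = 0)).resolve_left hl
  rw [Finset.sum_congr rfl fun k _ => h1 k, Finset.sum_comm, Finset.mul_sum,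
    Finset.sum_congr rfl fun j _ => (by rw [← Finset.sum_mul, ← mul_assoc, h2] :
      (l : ℝ) * ∑ k, ((if B.p k = j then 1 else 0) + (if B.q k = j then 1 else 0)) * a j =
        2 * Module.finrank ℝ V * a j), ← Finset.mul_sum, ha, mul_zero]

/-! ### Positivity and the gradient bound on the torus -/

namespace Cplx

theorem sum_eq_zero_of_fderiv_jdet (hV : IsSimpleJordan V) (hc : IsJordanFrame c) {θ : Fin l → ℝ}
    (hθ : IsAngle θ) {a b : Fin l → ℝ}
    (h : fderiv ℂ (jdet l) (torusPt c θ) (diagVec c θ a b) = 0) :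
    ∑ j, a j = 0 ∧ ∑ j, b j = 0 := by
  rw [fderiv_jdet_diagVec hV hc hθ.2] at h
  constructor
  · simpa using congrArg Complex.re h
  · simpa using congrArg Complex.im h

theorem leviForm_offVec_nonneg (hV : IsSimpleJordan V) (hc : IsJordanFrame c) {θ : Fin l → ℝ}
    (hθ : IsAngle θ) (Z : Cplx V) {p : Fin l × Fin l} (hp : p.1 < p.2) :
    0 ≤ (leviForm potential (torusPt c θ) (offVec c Z p) (offVec c Z p)).re := by
  obtain ⟨r, hr, h⟩ := leviForm_offVec hV hc hθ Z hp
  exact le_trans (by positivity) h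

/-- The Levi form is positive definite on the tangent space of the hypersurface. -/
theorem leviForm_torusPt_pos (hV : IsSimpleJordan V) (hc : IsJordanFrame c) {θ : Fin l → ℝ}
    (hθ : IsAngle θ) {Z : Cplx V} (hZ : fderiv ℂ (jdet l) (torusPt c θ) Z = 0) (hZ0 : Z ≠ 0) :
    0 < (leviForm potential (torusPt c θ) Z Z).re := by
  obtain ⟨B⟩ := hc.nonempty_peirceBasis
  obtain ⟨a, b, h, hL, -, hJ⟩ := leviForm_decomposition hc hθ Z
  rw [hJ] at hZ
  obtain ⟨ha, hb⟩ := sum_eq_zero_of_fderiv_jdet hV hc hθ hZ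
  have hC : ∀ k, 0 < Real.cos (θ (B.p k) - θ (B.q k)) := fun k =>
    Real.cos_pos_of_mem_Ioo (abs_lt.1 (hθ.1 _ _))
  have hD := (leviForm_diagVec hc B hθ a b).1
  have hterm : ∀ k, 0 ≤ ((a (B.p k) - a (B.q k)) ^ 2 + (b (B.p k) - b (B.q k)) ^ 2) /
      (4 * Real.cos (θ (B.p k) - θ (B.q k)) ^ 2) := fun k => by positivity
  have hW := fun p (hp : p ∈ ltPairs l) => leviForm_offVec_nonneg hV hc hθ Z (mem_ltPairs.1 hp)
  have hD0 := Finset.sum_nonneg fun k (_ : k ∈ Finset.univ) => hterm k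
  have hW0 := Finset.sum_nonneg hW
  rw [hL, Complex.add_re, Complex.re_sum, hD]
  by_contra hcon
  apply hZ0
  have z1 := (Finset.sum_eq_zero_iff_of_nonneg fun k _ => hterm k).1
    (le_antisymm (by linarith) hD0)
  have z2 := (Finset.sum_eq_zero_iff_of_nonneg hW).1 (le_antisymm (by linarith) hW0)
  have z3 : ∀ k, a (B.p k) = a (B.q k) ∧ b (B.p k) = b (B.q k) := by
    intro k
    have h1 := z1 k (Finset.mem_univ k)
    rw [div_eq_zero_iff, or_iff_left (by have := hC k; positivity)] at h1
    constructor
    · nlinarith [sq_nonneg (a (B.p k) - a (B.q k)), sq_nonneg (b (B.p k) - b (B.q k))]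
    · nlinarith [sq_nonneg (a (B.p k) - a (B.q k)), sq_nonneg (b (B.p k) - b (B.q k))]
  have a0 := B.eq_const hV hc (fun k => (z3 k).1) ha
  have b0 := B.eq_const hV hc (fun k => (z3 k).2) hb
  have w0 : ∑ p ∈ ltPairs l, offVec c Z p = 0 := by
    refine Finset.sum_eq_zero fun p hp => ?_
    obtain ⟨r, hr, hle⟩ := leviForm_offVec hV hc hθ Z (mem_ltPairs.1 hp)
    rw [z2 p hp] at hle
    rw [← norm_eq_zero, ← sq_eq_zero_iff]
    exact le_antisymm (le_of_mul_le_mul_left (by simpa using hle) hr) (sq_nonneg _)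
  rw [h, w0, add_zero, diagVec]
  ext <;> simp [a0, b0]

/-- The gradient of the potential is bounded. -/
theorem fderiv_potential_torusPt_sq_le (hV : IsSimpleJordan V) (hc : IsJordanFrame c)
    {θ : Fin l → ℝ} (hθ : IsAngle θ) {Z : Cplx V}
    (hZ : fderiv ℂ (jdet l) (torusPt c θ) Z = 0) :
    fderiv ℝ potential (torusPt c θ) Z ^ 2 ≤
      4 * Module.finrank ℝ V * (leviForm potential (torusPt c θ) Z Z).re := by
  obtain ⟨B⟩ := hc.nonempty_peirceBasis
  obtain ⟨a, b, h, hL, hP, hJ⟩ := leviForm_decomposition hc hθ Z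
  rw [hJ] at hZ
  obtain ⟨ha, hb⟩ := sum_eq_zero_of_fderiv_jdet hV hc hθ hZ
  have hC : ∀ k, 0 < Real.cos (θ (B.p k) - θ (B.q k)) := fun k =>
    Real.cos_pos_of_mem_Ioo (abs_lt.1 (hθ.1 _ _))
  obtain ⟨hD, hF⟩ := leviForm_diagVec hc B hθ a b
  rw [hP, hL, Complex.add_re, Complex.re_sum, hF, Finset.sum_add_distrib,
    B.sum_index_eq_zero hV hc ha, zero_add, neg_sq]
  refine le_trans ?_ (mul_le_mul_of_nonneg_left (le_add_of_nonneg_right (Finset.sum_nonneg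
    fun p hp => leviForm_offVec_nonneg hV hc hθ Z (mem_ltPairs.1 hp))) (by positivity))
  -- Cauchy–Schwarz over the n basis vectors; each term (b_p - b_q)² tan² is then at most four times
  -- the corresponding term of the Levi form.
  refine (sq_sum_le_card_mul_sum_sq).trans ?_
  rw [Finset.card_univ, Fintype.card_fin, mul_comm (4 : ℝ), mul_assoc, hD]
  refine mul_le_mul_of_nonneg_left ?_ (Nat.cast_nonneg _)
  rw [Finset.mul_sum]
  refine Finset.sum_le_sum fun k _ => ?_
  have := hC k
  have hs := Real.sin_sq_add_cos_sq (θ (B.p k) - θ (B.q k))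
  rw [mul_pow, div_pow, ← mul_div_assoc, ← mul_div_assoc, mul_div_mul_left _ _ (by norm_num)]
  refine div_le_div_of_nonneg_right ?_ (by positivity)
  nlinarith [sq_nonneg (a (B.p k) - a (B.q k)), sq_nonneg (b (B.p k) - b (B.q k)),
    mul_nonneg (sq_nonneg (b (B.p k) - b (B.q k))) (sq_nonneg (Real.cos (θ (B.p k) - θ (B.q k))))]

end Cplx

end

noncomputable section

/-! ### Invariance, positivity and the gradient bound on the whole domain -/

variable {V : Type*} [NormedAddCommGroup V] [InnerProductSpace ℝ V] [EuclideanJordanAlgebra V]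
  [FiniteDimensional ℝ V] {l : ℕ} {c : Fin l → V}

namespace Cplx

theorem fderiv_potential_extend {g : (V →L[ℝ] V)ˣ} (hu : IsUnimodular g) {z : Cplx V}
    (hz : 0 < (hermP z).det) (Z : Cplx V) :
    fderiv ℝ potential (extend (g : V →L[ℝ] V) z) (extend (g : V →L[ℝ] V) Z) =
      fderiv ℝ potential z Z := by
  have h0 : ∀ {w : Cplx V}, 0 < (hermP w).det → HasFDerivAt potential (fderiv ℝ potential w) w :=
    fun hw => ((contDiffAt_potential (n := 1) hw).differentiableAt (by simp)).hasFDerivAt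
  have h1 := (h0 (by rwa [det_hermP_extend hu] : 0 < (hermP (extend (g : V →L[ℝ] V) z)).det)).comp z
    ((extend (g : V →L[ℝ] V)).restrictScalars ℝ : Cplx V →L[ℝ] Cplx V).hasFDerivAt
  have h2 : potential ∘ ⇑(extend (g : V →L[ℝ] V)) = potential :=
    funext fun z => potential_extend hu z
  rw [h2] at h1
  exact (DFunLike.congr_fun (h1.unique (h0 hz)) Z)

theorem fderiv_jdet_extend (hV : IsSimpleJordan V) (hc : IsJordanFrame c) {g : (V →L[ℝ] V)ˣ}
    (hg : g ∈ groupG1 V) (z Z : Cplx V) :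
    fderiv ℂ (jdet l) (extend (g : V →L[ℝ] V) z) (extend (g : V →L[ℝ] V) Z) =
      fderiv ℂ (jdet l) z Z := by
  have h1 := (differentiable_jdet (V := V) l (extend (g : V →L[ℝ] V) z)).hasFDerivAt.comp z
    (extend (g : V →L[ℝ] V)).hasFDerivAt
  have h2 : jdet l ∘ extend (g : V →L[ℝ] V) = jdet l := funext fun z => jdet_extend hV hc hg z
  rw [h2] at h1
  exact DFunLike.congr_fun (h1.unique (differentiable_jdet (V := V) l z).hasFDerivAt) Z

theorem leviForm_potential_extend {g : (V →L[ℝ] V)ˣ} (hu : IsUnimodular g) (z u v : Cplx V) :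
    leviForm potential (extend (g : V →L[ℝ] V) z) (extend (g : V →L[ℝ] V) u)
      (extend (g : V →L[ℝ] V) v) = leviForm potential z u v := by
  rw [leviForm_map]
  congr 1
  exact funext fun z => potential_extend hu z

theorem mem_levelTangent {Δ : Cplx V → ℂ} {z Z : Cplx V} :
    Z ∈ levelTangent Δ z ↔ fderiv ℂ Δ z Z = 0 := Iff.rfl

theorem extend_mem_levelTangent (hV : IsSimpleJordan V) (hc : IsJordanFrame c) {g : (V →L[ℝ] V)ˣ}
    (hg : g ∈ groupG1 V) {z Z : Cplx V} : extend (g : V →L[ℝ] V) Z ∈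
      levelTangent (jdet l) (extend (g : V →L[ℝ] V) z) ↔ Z ∈ levelTangent (jdet l) z := by
  rw [mem_levelTangent, mem_levelTangent, fderiv_jdet_extend hV hc hg]

theorem extend_inv_extend (g : (V →L[ℝ] V)ˣ) (z : Cplx V) :
    extend ((g⁻¹ : (V →L[ℝ] V)ˣ) : V →L[ℝ] V) (extend (g : V →L[ℝ] V) z) = z := by
  ext
  · rw [re_extend, re_extend, units_inv_apply]
  · rw [im_extend, im_extend, units_inv_apply]

theorem extend_extend_inv (g : (V →L[ℝ] V)ˣ) (z : Cplx V) :
    extend (g : V →L[ℝ] V) (extend ((g⁻¹ : (V →L[ℝ] V)ˣ) : V →L[ℝ] V) z) = z := by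
  ext
  · rw [re_extend, re_extend, units_apply_inv]
  · rw [im_extend, im_extend, units_apply_inv]

theorem det_hermP_pos (hV : IsSimpleJordan V) (hc : IsJordanFrame c) {z : Cplx V} (hz : z ∈ Xi c) :
    0 < (hermP z).det := by
  obtain ⟨g, hg, θ, hθ, rfl⟩ := (mem_Xi_iff hV hc).1 hz
  rw [det_hermP_extend (hc.isUnimodular hg)]
  exact det_hermP_torusPt_pos hc hθ

theorem leviForm_pos (hV : IsSimpleJordan V) (hc : IsJordanFrame c) {z Z : Cplx V} (hz : z ∈ Xi c)
    (hZ : Z ∈ levelTangent (jdet l) z) (hZ0 : Z ≠ 0) : 0 < (leviForm potential z Z Z).re := by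
  obtain ⟨g, hg, θ, hθ, rfl⟩ := (mem_Xi_iff hV hc).1 hz
  rw [← extend_extend_inv g Z] at hZ ⊢
  rw [leviForm_potential_extend (hc.isUnimodular hg)]
  refine leviForm_torusPt_pos hV hc hθ ((extend_mem_levelTangent hV hc hg).1 hZ) fun h => hZ0 ?_
  rw [← extend_extend_inv g Z, h, map_zero]

theorem fderiv_potential_sq_le (hV : IsSimpleJordan V) (hc : IsJordanFrame c) {z Z : Cplx V}
    (hz : z ∈ Xi c) (hZ : Z ∈ levelTangent (jdet l) z) :
    fderiv ℝ potential z Z ^ 2 ≤ 4 * Module.finrank ℝ V * (leviForm potential z Z Z).re := by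
  obtain ⟨g, hg, θ, hθ, rfl⟩ := (mem_Xi_iff hV hc).1 hz
  have hu := hc.isUnimodular hg
  rw [← extend_extend_inv g Z] at hZ ⊢
  rw [leviForm_potential_extend hu, fderiv_potential_extend hu (det_hermP_torusPt_pos hc hθ)]
  exact fderiv_potential_torusPt_sq_le hV hc hθ ((extend_mem_levelTangent hV hc hg).1 hZ)

theorem contDiffOn_potential {n : WithTop ℕ∞} :
    ContDiffOn ℝ n (potential (V := V)) {z | 0 < (hermP z).det} :=
  fun _ hz => (contDiffAt_potential hz).contDiffWithinAt

theorem isOpen_det_hermP_pos : IsOpen {z : Cplx V | 0 < (hermP z).det} :=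
  isOpen_lt continuous_const
    ((contDiff_det_clm.comp contDiff_hermP : ContDiff ℝ 1 _).continuous)

theorem isStrictlyPlurisubharmonicOn_potential (hV : IsSimpleJordan V) (hc : IsJordanFrame c) :
    IsStrictlyPlurisubharmonicOn (Xi c) (levelTangent (jdet l)) potential := by
  refine ⟨⟨_, isOpen_det_hermP_pos, fun z hz => det_hermP_pos hV hc hz, contDiffOn_potential⟩,
    fun z hz Z hZ hZ0 => ⟨?_, leviForm_pos hV hc hz hZ hZ0⟩⟩
  rw [leviForm_self (contDiffAt_potential (det_hermP_pos hV hc hz)), Complex.ofReal_im]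

theorem isKahlerStructure_potential (hV : IsSimpleJordan V) (hc : IsJordanFrame c) :
    IsKahlerStructure (Xi c) (levelTangent (jdet l)) (leviForm potential) :=
  isKahlerStructure_leviForm isOpen_det_hermP_pos (fun _ hz => det_hermP_pos hV hc hz)
    contDiffOn_potential fun _ hz _ hu hu0 => leviForm_pos hV hc hz hu hu0

end Cplx

end

noncomputable section

/-! ### Lengths of curves in level sets -/

open MeasureTheory

section Curves

variable {E : Type*} [NormedAddCommGroup E] [NormedSpace ℂ E] {S : Set E} {Δ : E → ℂ}
  {h : E → E → E → ℂ} {f : E → ℝ} {γ : ℝ → E} {p q : E}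

/-- `γ` is a `C¹` curve in `S` from `p` to `q`. -/
def IsCurveIn (S : Set E) (γ : ℝ → E) (p q : E) : Prop :=
  ContDiffOn ℝ 1 γ (Icc 0 1) ∧ (∀ t ∈ Icc (0 : ℝ) 1, γ t ∈ S) ∧ γ 0 = p ∧ γ 1 = q

theorem IsCurveIn.riemannDist_le (hγ : IsCurveIn S γ p q) : riemannDist S h p q ≤ curveLength h γ :=
  sInf_le ⟨γ, hγ.1, hγ.2.1, hγ.2.2.1, hγ.2.2.2, rfl⟩

theorem exists_curve_of_riemannDist_lt {r : ℝ≥0∞} (hr : riemannDist S h p q < r) :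
    ∃ γ, IsCurveIn S γ p q ∧ curveLength h γ < r := by
  obtain ⟨_, ⟨γ, h1, h2, h3, h4, rfl⟩, hlt⟩ := sInf_lt_iff.1 hr
  exact ⟨γ, ⟨h1, h2, h3, h4⟩, hlt⟩

theorem IsCurveIn.hasDerivAt (hγ : IsCurveIn S γ p q) {t : ℝ} (ht : t ∈ Ioo (0 : ℝ) 1) :
    HasDerivAt γ (deriv γ t) t :=
  ((hγ.1.contDiffAt (Icc_mem_nhds ht.1 ht.2)).differentiableAt (by simp)).hasDerivAt

theorem IsCurveIn.deriv_mem (hγ : IsCurveIn S γ p q) (hΔ : Differentiable ℂ Δ)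
    (hS : ∀ z ∈ S, Δ z = 1) {t : ℝ} (ht : t ∈ Ioo (0 : ℝ) 1) :
    deriv γ t ∈ levelTangent Δ (γ t) := by
  have h1 : HasDerivAt (fun s => Δ (γ s)) (fderiv ℂ Δ (γ t) (deriv γ t)) t :=
    ((hΔ (γ t)).hasFDerivAt.restrictScalars ℝ).comp_hasDerivAt t (hγ.hasDerivAt ht)
  have h2 : HasDerivAt (fun s => Δ (γ s)) 0 t := by
    refine (hasDerivAt_const t (1 : ℂ)).congr_of_eventuallyEq ?_
    filter_upwards [Icc_mem_nhds ht.1 ht.2] with s hs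
    exact hS _ (hγ.2.1 s hs)
  exact h1.unique h2

/-- Functions whose derivative along a curve is bounded by the speed are Lipschitz. -/
theorem enorm_sub_le_curveLength {F : Type*} [NormedAddCommGroup F] [NormedSpace ℝ F] {u : ℝ → F}
    {s C : ℝ} (hs0 : 0 ≤ s) (hs1 : s ≤ 1) (hu : ContDiffOn ℝ 1 u (Icc 0 s))
    (hC : 0 ≤ C) (hb : ∀ t ∈ Ioo 0 s, ‖deriv u t‖ ≤ C * Real.sqrt (h (γ t) (deriv γ t) (deriv γ t)).re) :
    ‖u s - u 0‖ₑ ≤ ENNReal.ofReal C * curveLength h γ := by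
  refine (enorm_sub_le_lintegral_deriv_of_contDiffOn_Icc hu hs0).trans ?_
  -- The endpoints are discarded: a curve that is C¹ only on the closed interval has no controlled
  -- two-sided derivative there.
  rw [curveLength, ← lintegral_const_mul' _ _ ENNReal.ofReal_ne_top, ← restrict_Ioo_eq_restrict_Icc]
  refine (setLIntegral_mono' measurableSet_Ioo fun t ht => ?_).trans
    (lintegral_mono_set (Ioo_subset_Icc_self.trans (Icc_subset_Icc_right hs1)))
  rw [← ENNReal.ofReal_mul hC, ← ofReal_norm]
  exact ENNReal.ofReal_le_ofReal (hb t ht)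

/-- Integration of the gradient bound along curves, whose velocities are tangent to the level set.
It keeps the potential bounded along Cauchy sequences. -/
theorem ofReal_abs_sub_le_of_riemannDist_lt {O : Set E} (hO : IsOpen O) (hSO : S ⊆ O)
    (hf : ContDiffOn ℝ 1 f O) (hΔ : Differentiable ℂ Δ) (hS : ∀ z ∈ S, Δ z = 1) {C : ℝ} (hC : 0 ≤ C)
    (hb : ∀ z ∈ S, ∀ Z ∈ levelTangent Δ z, |fderiv ℝ f z Z| ≤ C * Real.sqrt (h z Z Z).re)
    {r : ℝ≥0∞} (hr : riemannDist S h p q < r) :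
    ENNReal.ofReal |f q - f p| ≤ ENNReal.ofReal C * r := by
  obtain ⟨γ, hγ, hlt⟩ := exists_curve_of_riemannDist_lt hr
  have h1 := enorm_sub_le_curveLength (h := h) (γ := γ) (u := fun t => f (γ t)) zero_le_one le_rfl
    (hf.comp hγ.1 fun t ht => hSO (hγ.2.1 t ht)) hC fun t ht => by
      have hz := hγ.2.1 t (Ioo_subset_Icc_self ht)
      have h2 : HasDerivAt (fun s => f (γ s)) (fderiv ℝ f (γ t) (deriv γ t)) t :=
        (((hf.contDiffAt (hO.mem_nhds (hSO hz))).differentiableAt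
          (by simp)).hasFDerivAt).comp_hasDerivAt t (hγ.hasDerivAt ht)
      rw [h2.deriv]
      exact hb _ hz _ (hγ.deriv_mem hΔ hS ht)
  rw [hγ.2.2.1, hγ.2.2.2, ← ofReal_norm, Real.norm_eq_abs] at h1
  exact h1.trans (mul_le_mul_right hlt.le _)

theorem riemannDist_map_le (A : E →L[ℂ] E) (hA : ∀ z ∈ S, A z ∈ S)
    (hh : ∀ z u v, h (A z) (A u) (A v) = h z u v) (p q : E) :
    riemannDist S h (A p) (A q) ≤ riemannDist S h p q := by
  refine le_of_forall_gt fun r hr => ?_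
  obtain ⟨γ, hγ, hlt⟩ := exists_curve_of_riemannDist_lt hr
  have h1 : IsCurveIn S (fun t => A (γ t)) (A p) (A q) :=
    ⟨(A.restrictScalars ℝ).contDiff.comp_contDiffOn hγ.1, fun t ht => hA _ (hγ.2.1 t ht),
      congrArg A hγ.2.2.1, congrArg A hγ.2.2.2⟩
  refine h1.riemannDist_le.trans_lt (lt_of_eq_of_lt ?_ hlt)
  rw [curveLength, curveLength, ← restrict_Ioo_eq_restrict_Icc]
  refine setLIntegral_congr_fun measurableSet_Ioo fun t ht => ?_
  have h2 : HasDerivAt (fun s => A (γ s)) (A (deriv γ t)) t :=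
    (A.restrictScalars ℝ).hasFDerivAt.comp_hasDerivAt t (hγ.hasDerivAt ht)
  simp only [h2.deriv, hh]

/-- A curve runs inside a closed ball until it has covered the radius or ended. -/
theorem exists_exit_time (hγ : ContinuousOn γ (Icc 0 1)) (ρ : ℝ) :
    ∃ s ∈ Icc (0 : ℝ) 1, (∀ t ∈ Ioo 0 s, ‖γ t - γ 0‖ ≤ ρ) ∧ min ‖γ 1 - γ 0‖ ρ ≤ ‖γ s - γ 0‖ := by
  set A := {t ∈ Icc (0 : ℝ) 1 | ρ ≤ ‖γ t - γ 0‖} with hA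
  have hAc : IsCompact A := by
    have : IsClosed A :=
      isClosed_Icc.isClosed_le continuousOn_const ((hγ.sub continuousOn_const).norm)
    exact isCompact_Icc.of_isClosed_subset this fun t ht => ht.1
  by_cases hne : A.Nonempty
  · obtain ⟨s, hs, hmin⟩ := hAc.exists_isLeast hne
    refine ⟨s, hs.1, fun t ht => ?_, (min_le_right _ _).trans hs.2⟩
    by_contra! hcon
    exact absurd (hmin ⟨⟨ht.1.le, ht.2.le.trans hs.1.2⟩, hcon.le⟩) (not_le.2 ht.2)
  · refine ⟨1, right_mem_Icc.2 zero_le_one, fun t ht => ?_, min_le_left _ _⟩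
    by_contra! hcon
    exact hne ⟨t, Ioo_subset_Icc_self ht, hcon.le⟩

/-- The real part of the Levi form on the diagonal. -/
def leviQuad (f : E → ℝ) (z Z : E) : ℝ :=
  (hessian f z Z Z + hessian f z (Complex.I • Z) (Complex.I • Z)) / 4

theorem leviForm_self_re (hf : ContDiffAt ℝ 2 f p) (Z : E) :
    (leviForm f p Z Z).re = leviQuad f p Z := by
  rw [leviForm_self hf, Complex.ofReal_re, leviQuad]

theorem leviQuad_smul (z Z : E) (a : ℝ) : leviQuad f z (a • Z) = a ^ 2 * leviQuad f z Z := by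
  simp only [leviQuad, smul_comm Complex.I a, map_smul, smul_apply, smul_eq_mul]
  ring

theorem leviQuad_le (z Z : E) : leviQuad f z Z ≤ ‖hessian f z‖ * ‖Z‖ ^ 2 := by
  have h1 : ∀ v : E, hessian f z v v ≤ ‖hessian f z‖ * ‖v‖ ^ 2 := fun v => by
    refine (le_abs_self _).trans (((hessian f z).le_opNorm₂ v v).trans_eq ?_)
    ring
  have h2 := h1 (Complex.I • Z)
  rw [norm_smul, Complex.norm_I, one_mul] at h2
  have h3 : 0 ≤ ‖hessian f z‖ * ‖Z‖ ^ 2 := by positivity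
  rw [leviQuad]
  linarith [h1 Z]

theorem continuousOn_hessian {O : Set E} (hO : IsOpen O) (hf : ContDiffOn ℝ 2 f O) :
    ContinuousOn (hessian f) O := fun z hz =>
  (((hf.contDiffAt (hO.mem_nhds hz)).fderiv_right (m := 1) (by norm_num)).fderiv_right (m := 0)
    (by norm_num)).continuousAt.continuousWithinAt

theorem continuousOn_leviQuad {O : Set E} (hO : IsOpen O) (hf : ContDiffOn ℝ 2 f O) :
    ContinuousOn (fun w : E × E => leviQuad f w.1 w.2) (O ×ˢ univ) := by
  have h1 : ContinuousOn (fun w : E × E => hessian f w.1) (O ×ˢ univ) :=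
    (continuousOn_hessian hO hf).comp continuousOn_fst fun w hw => hw.1
  have h2 : ∀ g : E × E → E, Continuous g →
      ContinuousOn (fun w : E × E => hessian f w.1 (g w) (g w)) (O ×ˢ univ) := fun g hg =>
    (h1.clm_apply hg.continuousOn).clm_apply hg.continuousOn
  exact ((h2 _ continuous_snd).add (h2 _ (continuous_snd.const_smul Complex.I))).div_const 4

/-- On a compact set the metric dominates the Euclidean metric, on tangent vectors. -/
theorem exists_norm_le_sqrt_leviQuad [FiniteDimensional ℂ E] {O K : Set E} (hO : IsOpen O)
    (hf : ContDiffOn ℝ 2 f O) (hKO : K ⊆ O) (hK : IsCompact K) (hΔ : ContDiff ℂ 1 Δ)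
    (hpos : ∀ z ∈ K, ∀ Z ∈ levelTangent Δ z, Z ≠ 0 → 0 < leviQuad f z Z) :
    ∃ C : ℝ, 0 ≤ C ∧ ∀ z ∈ K, ∀ Z ∈ levelTangent Δ z, ‖Z‖ ≤ C * Real.sqrt (leviQuad f z Z) := by
  have : ProperSpace E := FiniteDimensional.proper ℂ E
  -- The unit tangent vectors over K form a compact set, on which the positive quadratic form has a
  -- positive lower bound.
  set D : Set (E × E) := (K ×ˢ Metric.sphere 0 1) ∩ {w | fderiv ℂ Δ w.1 w.2 = 0} with hD
  have hDc : IsCompact D := by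
    refine (hK.prod (isCompact_sphere 0 1)).inter_right (isClosed_eq ?_ continuous_const)
    exact ((hΔ.continuous_fderiv (by simp)).comp continuous_fst).clm_apply continuous_snd
  obtain ⟨m, hm, hmD⟩ := hDc.exists_forall_le' (f := fun w : E × E => leviQuad f w.1 w.2) (a := 0)
    ((continuousOn_leviQuad hO hf).mono fun w hw => ⟨hKO hw.1.1, mem_univ _⟩)
    fun w hw => hpos w.1 hw.1.1 w.2 hw.2 (ne_zero_of_mem_unit_sphere ⟨w.2, hw.1.2⟩)
  refine ⟨(Real.sqrt m)⁻¹, by positivity, fun z hz Z hZ => ?_⟩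
  rw [← div_eq_inv_mul, le_div_iff₀ (Real.sqrt_pos.2 hm)]
  by_cases hZ0 : Z = 0
  · rw [hZ0, norm_zero, zero_mul]; exact Real.sqrt_nonneg _
  have hn := norm_pos_iff.2 hZ0
  have hu : ‖Z‖⁻¹ • Z ∈ levelTangent Δ z := by
    have := (levelTangent Δ z).smul_mem ((‖Z‖⁻¹ : ℝ) : ℂ) hZ
    rwa [Complex.coe_smul] at this
  have h1 := hmD (z, ‖Z‖⁻¹ • Z) ⟨⟨hz, by
    rw [mem_sphere_zero_iff_norm, norm_smul, norm_inv, norm_norm, inv_mul_cancel₀ hn.ne']⟩, hu⟩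
  simp only [leviQuad_smul] at h1
  refine Real.le_sqrt_of_sq_le ?_
  rw [mul_pow, Real.sq_sqrt hm.le]
  calc ‖Z‖ ^ 2 * m ≤ ‖Z‖ ^ 2 * (‖Z‖⁻¹ ^ 2 * leviQuad f z Z) :=
        mul_le_mul_of_nonneg_left h1 (by positivity)
    _ = leviQuad f z Z := by field_simp

/-- Local comparison with the Euclidean metric from below, uniform on compact sets. -/
theorem exists_min_norm_le_riemannDist [FiniteDimensional ℂ E] {O U K : Set E} (hO : IsOpen O)
    (hSO : S ⊆ O) (hf : ContDiffOn ℝ 2 f O) (hΔ : ContDiff ℂ 1 Δ) (hU : IsOpen U)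
    (hSU : S = U ∩ {z | Δ z = 1})
    (hpos : ∀ z ∈ S, ∀ Z ∈ levelTangent Δ z, Z ≠ 0 → 0 < (leviForm f z Z Z).re)
    (hK : IsCompact K) (hKS : K ⊆ S) :
    ∃ K' ⊆ S, IsCompact K' ∧ ∃ ρ C : ℝ, 0 < ρ ∧ 0 ≤ C ∧
      (∀ p ∈ K, ∀ z, Δ z = 1 → ‖z - p‖ ≤ ρ → z ∈ K') ∧
      ∀ p ∈ K, ∀ q ∈ S, ∀ r, riemannDist S (leviForm f) p q < r →
        ENNReal.ofReal (min ‖q - p‖ ρ) ≤ ENNReal.ofReal C * r := by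
  have : ProperSpace E := FiniteDimensional.proper ℂ E
  -- The ρ-neighbourhood of K is closed up inside the ambient open set, so its intersection with Δ =
  -- 1 is still a compact subset of S.
  obtain ⟨ρ, hρ, hρU⟩ := hK.exists_cthickening_subset_open hU
    (hKS.trans (hSU.subset.trans inter_subset_left))
  have hlev : ∀ z ∈ S, Δ z = 1 := fun z hz => (hSU.subset hz).2
  set K' : Set E := Metric.cthickening ρ K ∩ {z | Δ z = 1} with hK'
  have hK'S : K' ⊆ S := fun z hz => hSU.superset ⟨hρU hz.1, hz.2⟩
  have hK'c : IsCompact K' :=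
    hK.cthickening.inter_right (isClosed_eq hΔ.continuous continuous_const)
  have hquad : ∀ z ∈ S, ∀ Z, (leviForm f z Z Z).re = leviQuad f z Z := fun z hz Z =>
    leviForm_self_re (hf.contDiffAt (hO.mem_nhds (hSO hz))) Z
  obtain ⟨C, hC, hCK⟩ := exists_norm_le_sqrt_leviQuad hO hf (hK'S.trans hSO) hK'c hΔ
    fun z hz Z hZ hZ0 => by rw [← hquad z (hK'S hz)]; exact hpos z (hK'S hz) Z hZ hZ0
  have hball : ∀ p ∈ K, ∀ z, Δ z = 1 → ‖z - p‖ ≤ ρ → z ∈ K' := fun p hp z hz hzp =>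
    ⟨Metric.mem_cthickening_of_dist_le z p ρ K hp (by rwa [dist_eq_norm]), hz⟩
  refine ⟨K', hK'S, hK'c, ρ, C, hρ, hC, hball, fun p hp q _ r hr => ?_⟩
  obtain ⟨γ, hγ, hlt⟩ := exists_curve_of_riemannDist_lt hr
  -- Only the part of the curve within distance ρ of p is measured, since the comparison of metrics
  -- is available on `K'` alone. This accounts for the minimum with ρ in the conclusion.
  obtain ⟨s, hs, hin, hout⟩ := exists_exit_time hγ.1.continuousOn ρ
  rw [hγ.2.2.1, hγ.2.2.2] at hout
  rw [hγ.2.2.1] at hin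
  have hsub : Icc 0 s ⊆ Icc (0 : ℝ) 1 := Icc_subset_Icc_right hs.2
  have h1 := enorm_sub_le_curveLength (h := leviForm f) (γ := γ) (u := γ) hs.1 hs.2
    (hγ.1.mono hsub) hC fun t ht => by
      have ht1 : t ∈ Ioo (0 : ℝ) 1 := ⟨ht.1, ht.2.trans_le hs.2⟩
      have hz := hγ.2.1 t (Ioo_subset_Icc_self ht1)
      rw [hquad _ hz]
      exact hCK _ (hball p hp _ (hlev _ hz) (hin t ht)) _
        (hγ.deriv_mem (hΔ.differentiable (by simp)) hlev ht1)
  rw [hγ.2.2.1, ← ofReal_norm] at h1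
  exact (ENNReal.ofReal_le_ofReal hout).trans (h1.trans (mul_le_mul_right hlt.le _))

/-- Local comparison with the Euclidean metric from above, at a point where `S` has a local
retraction. -/
theorem exists_riemannDist_le {O : Set E} (hO : IsOpen O) (hSO : S ⊆ O) (hf : ContDiffOn ℝ 2 f O)
    {y : E} (hy : y ∈ S) {N : E → E} (hN : ContDiffAt ℝ 1 N y) (hNS : ∀ z ∈ S, N z = z)
    (hNy : ∀ᶠ z in 𝓝 y, N z ∈ S) :
    ∃ C : ℝ, 0 ≤ C ∧ ∀ᶠ p in 𝓝[S] y,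
      riemannDist S (leviForm f) p y ≤ ENNReal.ofReal (C * ‖p - y‖) := by
  have e1 : ∀ᶠ z in 𝓝 y, ContDiffAt ℝ 1 N z := hN.eventually (by simp)
  have e2 : ∀ᶠ z in 𝓝 y, ‖fderiv ℝ N z‖ < ‖fderiv ℝ N y‖ + 1 :=
    (((hN.fderiv_right (m := 0) (by norm_num)).continuousAt).norm.tendsto).eventually_lt_const
      (lt_add_one _)
  have e3 : ∀ᶠ z in 𝓝 y, ‖hessian f (N z)‖ < ‖hessian f (N y)‖ + 1 := by
    have h1 : ContinuousAt (hessian f) (N y) := by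
      rw [hNS y hy]
      exact (continuousOn_hessian hO hf).continuousAt (hO.mem_nhds (hSO hy))
    exact (ContinuousAt.comp' h1 hN.continuousAt).norm.tendsto.eventually_lt_const (lt_add_one _)
  set M := ‖fderiv ℝ N y‖ + 1 with hM
  set H := ‖hessian f (N y)‖ + 1 with hH
  have hM0 : 0 ≤ M := by positivity
  have hH0 : 0 ≤ H := by positivity
  obtain ⟨r, hr, hball⟩ := Metric.eventually_nhds_iff_ball.1 (((hNy.and e1).and e2).and e3)
  refine ⟨Real.sqrt H * M, by positivity, ?_⟩
  filter_upwards [self_mem_nhdsWithin, mem_nhdsWithin_of_mem_nhds (Metric.ball_mem_nhds y hr)]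
    with p hpS hp
  -- The straight segment leaves S; its image under the retraction N is a curve in S with speed at
  -- most √H · M · ‖p - y‖.
  set line : ℝ → E := fun t => p + t • (y - p) with hline
  have hl : ∀ t ∈ Icc (0 : ℝ) 1, line t ∈ Metric.ball y r := fun t ht => by
    have := (convex_ball y r).add_smul_sub_mem hp (Metric.mem_ball_self hr) ht
    exact this
  have hld : ∀ t, HasDerivAt line (y - p) t := fun t => by
    have h1 := ((hasDerivAt_id t).smul_const (y - p)).const_add p
    rwa [one_smul] at h1
  have hlc : ContDiff ℝ 1 line := contDiff_const.add (contDiff_id.smul contDiff_const)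
  have hγ : IsCurveIn S (fun t => N (line t)) p y := by
    refine ⟨fun t ht => ?_, fun t ht => (hball _ (hl t ht)).1.1.1, ?_, ?_⟩
    · exact ((hball _ (hl t ht)).1.1.2.comp t hlc.contDiffAt).contDiffWithinAt
    · simp [hline, hNS p hpS]
    · simp [hline, hNS y hy]
  refine hγ.riemannDist_le.trans ?_
  rw [curveLength]
  calc _ ≤ ∫⁻ t in Icc (0 : ℝ) 1, ENNReal.ofReal (Real.sqrt H * M * ‖p - y‖) := by
        refine setLIntegral_mono' measurableSet_Icc fun t ht => ENNReal.ofReal_le_ofReal ?_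
        obtain ⟨⟨⟨b1, b2⟩, b3⟩, b4⟩ := hball _ (hl t ht)
        have hd : HasDerivAt (fun t => N (line t)) (fderiv ℝ N (line t) (y - p)) t :=
          ((b2.differentiableAt (by simp)).hasFDerivAt).comp_hasDerivAt t (hld t)
        rw [hd.deriv, leviForm_self_re (hf.contDiffAt (hO.mem_nhds (hSO b1)))]
        refine Real.sqrt_le_iff.2 ⟨by positivity, (leviQuad_le _ _).trans ?_⟩
        rw [mul_pow, mul_pow, Real.sq_sqrt hH0, mul_assoc, ← mul_pow, norm_sub_rev p y]
        refine mul_le_mul b4.le ?_ (by positivity) hH0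
        refine pow_le_pow_left₀ (norm_nonneg _) ?_ 2
        exact ((fderiv ℝ N (line t)).le_opNorm _).trans
          (mul_le_mul_of_nonneg_right b3.le (norm_nonneg _))
    _ = _ := by simp

end Curves

end

noncomputable section

/-! ### Completeness -/

variable {V : Type*} [NormedAddCommGroup V] [InnerProductSpace ℝ V] [EuclideanJordanAlgebra V]
  [FiniteDimensional ℝ V] {l : ℕ} {c : Fin l → V}

namespace Cplx

/-- The local retraction `z ↦ Δ(z)^{-1/l} z` onto the hypersurface `Δ = 1`. -/
def unitRetract (l : ℕ) (z : Cplx V) : Cplx V := Complex.exp (-Complex.log (jdet l z) / l) • z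

theorem unitRetract_eq_self {z : Cplx V} (hz : jdet l z = 1) : unitRetract l z = z := by
  simp [unitRetract, hz]

theorem jdet_unitRetract (hl : 0 < l) {z : Cplx V} (hz : jdet l z ≠ 0) :
    jdet l (unitRetract l z) = 1 := by
  have hl' : (l : ℂ) ≠ 0 := by exact_mod_cast hl.ne'
  rw [unitRetract, jdet_smul, ← Complex.exp_nat_mul, mul_div_cancel₀ _ hl', Complex.exp_neg,
    Complex.exp_log hz, inv_mul_cancel₀ hz]

theorem contDiffAt_unitRetract {z : Cplx V} (hz : jdet l z = 1) :
    ContDiffAt ℝ 1 (unitRetract l) z := by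
  have h1 : ContDiffAt ℂ 1 Complex.log (jdet l z) := by
    rw [hz]
    exact Complex.contDiffAt_log Complex.one_mem_slitPlane
  have h2 : ContDiffAt ℂ 1 (fun w : Cplx V => Complex.log (jdet l w)) z :=
    h1.comp z (contDiff_jdet l).contDiffAt
  have h3 : ContDiffAt ℂ 1 (unitRetract (V := V) l) z :=
    ((h2.neg.div_const (l : ℂ)).cexp).smul contDiffAt_id
  exact h3.restrict_scalars ℝ

theorem eventually_unitRetract_mem (hV : IsSimpleJordan V) (hc : IsJordanFrame c) {z : Cplx V}
    (hz : z ∈ Xi c) : ∀ᶠ w in 𝓝 z, unitRetract l w ∈ Xi c := by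
  have h1 := jdet_of_mem_Xi hV hc hz
  have e1 : ∀ᶠ w in 𝓝 z, unitRetract l w ∈ tubeNhd c := by
    refine (contDiffAt_unitRetract h1).continuousAt.eventually_mem ?_
    rw [unitRetract_eq_self h1]
    exact (isOpen_tubeNhd c).mem_nhds (Xi_subset_tubeNhd hV hc hz)
  have e2 : ∀ᶠ w in 𝓝 z, jdet l w ≠ 0 :=
    (contDiff_jdet l).continuous.continuousAt.eventually_ne (by rw [h1]; exact one_ne_zero)
  filter_upwards [e1, e2] with w hw1 hw2
  exact mem_Xi_of_mem_tubeNhd hV hc hw1 (jdet_unitRetract (hc.rank_pos hV) hw2)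

theorem torusPt_mem_Xi (hV : IsSimpleJordan V) (hc : IsJordanFrame c) {θ : Fin l → ℝ}
    (hθ : IsAngle θ) : torusPt c θ ∈ Xi c :=
  (mem_Xi_iff hV hc).2 ⟨1, one_mem _, θ, hθ, by ext <;> simp⟩

theorem continuous_torusPt (c : Fin l → V) : Continuous (torusPt c) := by
  unfold torusPt
  fun_prop

/-- The potential is an exhaustion function modulo the action of `G¹`. -/
theorem isCompact_torusPt_potential_le (hV : IsSimpleJordan V) (hc : IsJordanFrame c) (b : ℝ) :
    IsCompact (torusPt c '' {θ | IsAngle θ ∧ potential (torusPt c θ) ≤ b}) := by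
  refine IsCompact.image ?_ (continuous_torusPt c)
  have hdet : Continuous fun θ : Fin l → ℝ => (hermP (torusPt c θ)).det :=
    ((contDiff_det_clm.comp contDiff_hermP : ContDiff ℝ 1 _).continuous).comp (continuous_torusPt c)
  have hset : {θ : Fin l → ℝ | IsAngle θ ∧ potential (torusPt c θ) ≤ b} =
      {θ | ∀ j k, |θ j - θ k| ≤ Real.pi / 2} ∩ {θ | ∑ j, θ j = 0} ∩
        {θ | Real.exp (-b) ≤ (hermP (torusPt c θ)).det} := by
    ext θ
    constructor
    · rintro ⟨hθ, hb⟩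
      refine ⟨⟨fun j k => (hθ.1 j k).le, hθ.2⟩, ?_⟩
      rw [potential_eq] at hb
      exact (Real.le_log_iff_exp_le (det_hermP_torusPt_pos hc hθ)).1 (by linarith)
    · rintro ⟨⟨h1, h2⟩, h3⟩
      have hpos : 0 < (hermP (torusPt c θ)).det := (Real.exp_pos _).trans_le h3
      -- At a boundary angle |θ_j - θ_k| = π/2 the operator kills V_jk, which is nonzero,
      -- contradicting the lower bound on the determinant. Hence the sublevel set is cut out by
      -- closed conditions.
      have hθ : IsAngle θ := by
        refine ⟨fun j k => lt_of_le_of_ne (h1 j k) fun heq => hpos.ne' ?_, h2⟩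
        have hjk : j ≠ k := by
          rintro rfl
          simp only [sub_self, abs_zero] at heq
          linarith [Real.pi_pos]
        obtain ⟨x, hx, hx0⟩ := hc.exists_peirce_ne_zero hV hjk
        by_contra hne
        obtain ⟨u, hu⟩ := exists_units_of_det_ne_zero hne
        have h4 := hermP_torusPt hc θ hx
        rw [← Real.cos_abs, heq, Real.cos_pi_div_two, zero_smul, ← hu] at h4
        have h5 := units_inv_apply u x
        rw [h4, map_zero] at h5
        exact hx0 h5.symm
      refine ⟨hθ, ?_⟩
      rw [potential_eq]
      linarith [(Real.le_log_iff_exp_le hpos).2 h3]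
  rw [hset]
  refine Metric.isCompact_of_isClosed_isBounded ?_ ?_
  · refine (IsClosed.inter ?_ (isClosed_eq (by fun_prop) continuous_const)).inter
      (isClosed_le continuous_const hdet)
    simp only [ofPred_forall]
    exact isClosed_iInter fun j => isClosed_iInter fun k =>
      isClosed_le (by fun_prop) continuous_const
  · rw [← hset]
    refine (Metric.isBounded_closedBall (x := (0 : Fin l → ℝ)) (r := Real.pi / 2)).subset ?_
    rintro θ ⟨hθ, -⟩
    rw [mem_closedBall_zero_iff, pi_norm_le_iff_of_nonneg (by positivity)]
    exact fun j => (hθ.abs_lt j).le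

theorem abs_fderiv_potential_le (hV : IsSimpleJordan V) (hc : IsJordanFrame c) {z Z : Cplx V}
    (hz : z ∈ Xi c) (hZ : Z ∈ levelTangent (jdet l) z) :
    |fderiv ℝ potential z Z| ≤
      Real.sqrt (4 * Module.finrank ℝ V) * Real.sqrt (leviForm potential z Z Z).re := by
  rw [← Real.sqrt_mul (by positivity)]
  exact Real.abs_le_sqrt (fderiv_potential_sq_le hV hc hz hZ)

theorem riemannDist_extend_le (hc : IsJordanFrame c) {g : (V →L[ℝ] V)ˣ} (hg : g ∈ groupG1 V)
    (p q : Cplx V) : riemannDist (Xi c) (leviForm potential) (extend (g : V →L[ℝ] V) p)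
      (extend (g : V →L[ℝ] V) q) ≤ riemannDist (Xi c) (leviForm potential) p q :=
  riemannDist_map_le _ (fun _ hz => extend_mem_Xi hg hz)
    (leviForm_potential_extend (hc.isUnimodular hg)) p q

theorem lt_of_ofReal_le_mul {a C e : ℝ} (hC : 0 ≤ C) (he : 0 < e)
    (h : ENNReal.ofReal a ≤ ENNReal.ofReal C * ENNReal.ofReal (e / (C + 1))) : a < e := by
  rw [← ENNReal.ofReal_mul hC, ENNReal.ofReal_le_ofReal_iff (by positivity)] at h
  refine h.trans_lt ?_
  rw [← mul_div_assoc, div_lt_iff₀ (by positivity)]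
  nlinarith

/-- Bounded potential confines the torus representatives of the tail to a compact slice. Translating
the whole sequence by the group element of one late term puts its tail near that slice, where local
comparison produces a Euclidean limit. -/
theorem isCompleteRiemannian_Xi (hV : IsSimpleJordan V) (hc : IsJordanFrame c) :
    IsCompleteRiemannian (Xi c) (leviForm potential) := by
  intro x hx hC
  set d := riemannDist (Xi c) (leviForm (potential (V := V))) with hd
  choose g hg θ hθ hxg using fun n => (mem_Xi_iff hV hc).1 (hx n)
  have hSO : Xi c ⊆ {z | 0 < (hermP z).det} := fun z hz => det_hermP_pos hV hc hz
  have hlev : ∀ z ∈ Xi c, jdet l z = 1 := fun z hz => jdet_of_mem_Xi hV hc hz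
  have hSU : Xi c = tubeNhd c ∩ {z | jdet l z = 1} := Subset.antisymm
    (fun z hz => ⟨Xi_subset_tubeNhd hV hc hz, hlev z hz⟩)
    fun z hz => mem_Xi_of_mem_tubeNhd hV hc hz.1 hz.2
  have hlow := fun K => exists_min_norm_le_riemannDist (S := Xi c) (K := K) isOpen_det_hermP_pos hSO
    contDiffOn_potential (contDiff_jdet l) (isOpen_tubeNhd c) hSU
    fun z hz Z hZ hZ0 => leviForm_pos hV hc hz hZ hZ0
  obtain ⟨N₁, hN₁⟩ := hC 1 one_pos
  set b := potential (x N₁) + Real.sqrt (4 * Module.finrank ℝ V) with hb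
  have hbound : ∀ n ≥ N₁, potential (x n) ≤ b := by
    intro n hn
    have h1 := ofReal_abs_sub_le_of_riemannDist_lt isOpen_det_hermP_pos hSO contDiffOn_potential
      (differentiable_jdet l) hlev (Real.sqrt_nonneg _)
      (fun z hz Z hZ => abs_fderiv_potential_le hV hc hz hZ) (hN₁ N₁ le_rfl n hn)
    rw [_root_.mul_one, ENNReal.ofReal_le_ofReal_iff (Real.sqrt_nonneg _)] at h1
    linarith [le_abs_self (potential (x n) - potential (x N₁))]
  set K := torusPt c '' {θ | IsAngle θ ∧ potential (torusPt c θ) ≤ b} with hK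
  have hKS : K ⊆ Xi c := by
    rintro _ ⟨θ, hθ, rfl⟩
    exact torusPt_mem_Xi hV hc hθ.1
  obtain ⟨K', hK'S, hK'c, ρ, C, hρ, hC0, hball, hKlow⟩ :=
    hlow K (isCompact_torusPt_potential_le hV hc b) hKS
  -- Since C · ρ/(C + 1) < ρ, the minimum of ‖y_n - y_N‖ and ρ falls below ρ, so the tail stays in
  -- the ρ-ball around y_N.
  obtain ⟨N₂, hN₂⟩ := hC (ENNReal.ofReal (ρ / (C + 1))) (ENNReal.ofReal_pos.2 (by positivity))
  set N := max N₁ N₂ with hN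
  have hgi : (g N)⁻¹ ∈ groupG1 V := inv_mem (hg N)
  set y : ℕ → Cplx V := fun n => extend (((g N)⁻¹ : (V →L[ℝ] V)ˣ) : V →L[ℝ] V) (x n) with hy
  have hyS : ∀ n, y n ∈ Xi c := fun n => extend_mem_Xi hgi (hx n)
  have hyx : ∀ n, extend (g N : V →L[ℝ] V) (y n) = x n := fun n => extend_extend_inv _ _
  have hyd : ∀ m n, d (y m) (y n) ≤ d (x m) (x n) := fun m n => riemannDist_extend_le hc hgi _ _
  have hyN : y N ∈ K := by
    refine ⟨θ N, ⟨hθ N, ?_⟩, ?_⟩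
    · rw [← potential_extend (hc.isUnimodular (hg N)), ← hxg]
      exact hbound N (le_max_left _ _)
    · simp only [hy]
      rw [hxg N, extend_inv_extend]
  have hyK : ∀ n ≥ N, y n ∈ K' := by
    intro n hn
    have h1 := hKlow (y N) hyN (y n) (hyS n) _ ((hyd N n).trans_lt
      (hN₂ N (le_max_right _ _) n ((le_max_right _ _).trans hn)))
    have h2 := lt_of_ofReal_le_mul hC0 hρ h1
    refine hball (y N) hyN (y n) (hlev _ (hyS n)) ?_
    exact ((min_lt_iff.1 h2).resolve_right (lt_irrefl _)).le
  -- The comparison is applied again, now around every point of `K'`, so that all tail terms may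
  -- serve as base points in the Cauchy estimate.
  obtain ⟨-, -, -, ρ', C', hρ', hC'0, -, hK'low⟩ := hlow K' hK'c hK'S
  have hcauchy : CauchySeq y := by
    rw [Metric.cauchySeq_iff]
    intro ε hε
    have he : 0 < min ε ρ' := lt_min hε hρ'
    obtain ⟨M, hM⟩ := hC (ENNReal.ofReal (min ε ρ' / (C' + 1)))
      (ENNReal.ofReal_pos.2 (by positivity))
    refine ⟨max M N, fun m hm n hn => ?_⟩
    have h1 := lt_of_ofReal_le_mul hC'0 he (hK'low (y n) (hyK n ((le_max_right _ _).trans hn)) (y m)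
      (hyS m) _ ((hyd n m).trans_lt (hM n ((le_max_left _ _).trans hn) m
        ((le_max_left _ _).trans hm))))
    rw [dist_eq_norm]
    rcases min_lt_iff.1 h1 with h2 | h2
    · exact h2.trans_le (min_le_left _ _)
    · exact absurd (h2.trans_le (min_le_right _ _)) (lt_irrefl _)
  obtain ⟨y₀, hy₀⟩ := cauchySeq_tendsto_of_complete hcauchy
  have hy₀S : y₀ ∈ Xi c := hK'S (hK'c.isClosed.mem_of_tendsto hy₀ (eventually_atTop.2 ⟨N, hyK⟩))
  -- Euclidean convergence is turned back into Riemannian convergence through the local retraction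
  -- obtained by scaling the determinant to 1.
  obtain ⟨C₀, hC₀, hup⟩ := exists_riemannDist_le isOpen_det_hermP_pos hSO contDiffOn_potential hy₀S
    (contDiffAt_unitRetract (hlev _ hy₀S)) (fun z hz => unitRetract_eq_self (hlev z hz))
    (eventually_unitRetract_mem hV hc hy₀S)
  refine ⟨extend (g N : V →L[ℝ] V) y₀, extend_mem_Xi (hg N) hy₀S, ?_⟩
  have hlim : Tendsto (fun n => ENNReal.ofReal (C₀ * ‖y n - y₀‖)) atTop (𝓝 0) := by
    have h1 : Tendsto (fun n => C₀ * ‖y n - y₀‖) atTop (𝓝 0) := by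
      have := (tendsto_iff_norm_sub_tendsto_zero.1 hy₀).const_mul C₀
      rwa [mul_zero] at this
    have h2 := ENNReal.tendsto_ofReal h1
    rwa [ENNReal.ofReal_zero] at h2
  refine tendsto_of_tendsto_of_tendsto_of_le_of_le' tendsto_const_nhds hlim
    (Eventually.of_forall fun n => zero_le) ?_
  filter_upwards [(tendsto_nhdsWithin_iff.2 ⟨hy₀, Eventually.of_forall hyS⟩).eventually hup] with n hn
  refine le_trans ?_ hn
  rw [← hyx n]
  exact riemannDist_extend_le hc (hg N) _ _

end Cplx

end

/-! ### The theorem -/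

theorem theorem8p11 {V : Type*} [NormedAddCommGroup V] [InnerProductSpace ℝ V]
    [FiniteDimensional ℝ V] [EuclideanJordanAlgebra V] (hV : IsSimpleJordan V)
    {l : ℕ} (c : Fin l → V) (hc : IsJordanFrame c) :
    ∃ Δ : Cplx V → ℂ, Cplx.IsJordanDet Δ ∧
      IsOpenInHypersurface (Cplx.Xi c) Δ ∧
      (∀ z ∈ Cplx.Xi c, (LinearMap.det (Cplx.P z (Cplx.conj z))).im = 0 ∧
        0 < (LinearMap.det (Cplx.P z (Cplx.conj z))).re) ∧
      IsStrictlyPlurisubharmonicOn (Cplx.Xi c) (levelTangent Δ) Cplx.potential ∧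
      IsKahlerStructure (Cplx.Xi c) (levelTangent Δ) (leviForm Cplx.potential) ∧
      (∀ g ∈ groupG1 V, ∀ z ∈ Cplx.Xi c,
        Cplx.extend (g : V →L[ℝ] V) z ∈ Cplx.Xi c ∧
        ∀ Z₁ ∈ levelTangent Δ z, ∀ Z₂ ∈ levelTangent Δ z,
          Cplx.extend (g : V →L[ℝ] V) Z₁ ∈ levelTangent Δ (Cplx.extend (g : V →L[ℝ] V) z) ∧
          leviForm Cplx.potential (Cplx.extend (g : V →L[ℝ] V) z)
            (Cplx.extend (g : V →L[ℝ] V) Z₁) (Cplx.extend (g : V →L[ℝ] V) Z₂) =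
              leviForm Cplx.potential z Z₁ Z₂) ∧
      IsCompleteRiemannian (Cplx.Xi c) (leviForm Cplx.potential) := by
  refine ⟨Cplx.jdet l, Cplx.isJordanDet_jdet hV hc, Cplx.isOpenInHypersurface_Xi hV hc,
    fun z hz => ?_, Cplx.isStrictlyPlurisubharmonicOn_potential hV hc,
    Cplx.isKahlerStructure_potential hV hc, fun g hg z hz => ⟨Cplx.extend_mem_Xi hg hz,
      fun Z₁ h₁ Z₂ _ => ⟨(Cplx.extend_mem_levelTangent hV hc hg).2 h₁,
        Cplx.leviForm_potential_extend (hc.isUnimodular hg) z Z₁ Z₂⟩⟩,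
    Cplx.isCompleteRiemannian_Xi hV hc⟩
  rw [Cplx.det_P_conj, Complex.ofReal_im, Complex.ofReal_re]
  exact ⟨rfl, Cplx.det_hermP_pos hV hc hz⟩
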